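/- Let $\Gamma$ be a group. A \emph{classifying CW complex} $B\Gamma$ is a path-connected CW complex $X$ with $\pi_1(X)\cong\Gamma$ and $\pi_n(X)=0$ for all $n\ge 2$. Call $\Gamma$ \emph{geometrically finite} if it has a classifying CW complex with finitely many cells. Say that $\Gamma$ has property $(*)_s$ if $B\Gamma$ has the stable homotopy type of a wedge of spheres, that is, if the suspension spectrum of $B\Gamma$ (based at a vertex) is isomorphic in the stable homotopy category to a wedge of sphere spectra, i.e. to the suspension spectrum of $\bigvee_{j\in J}S^{n_j}$ for some family $(n_j)_{j\in J}$ of non-negative integers; this does not depend on the choice of $B\Gamma$ or of the vertex. A \emph{generalized homology theory} $h_*$ is a sequence $(h_k)_{k\in\mathbb Z}$ of functors from pairs of topological spaces to abelian groups, with natural boundary maps $h_{k+1}(X,A)\to h_k(A)$, satisfying the homotopy, exactness and excision axioms of Eilenberg and Steenrod (but not necessarily the dimension axiom). \textbf{Proposition.} Let $\Gamma$ be a geometrically finite group with property $(*)_s$. Then $\Gamma$ has the 1-Step Stabilization property for every generalized homology theory $h_*$: for every classifying CW complex $X$ of $\Gamma$, every $m\ge 0$ and every $k\in\mathbb Z$,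 $$\ker\bigl(h_k(X^{(m)})\to h_k(X^{(m+1)})\bigr)=\ker\bigl(h_k(X^{(m)})\to h_k(X)\bigr),$$ where $X^{(m)}$ is the $m$-skeleton of $X$ and the homomorphisms are induced by the inclusions. -/

import Mathlib

open CategoryTheory Topology
open scoped unitInterval Topology.Homotopy

universe u v w

noncomputable section

namespace OneStep

/-! ### Pointed spaces, reduced suspensions, wedges of spheres -/

/-- A topological space with a base point. -/
structure PtdSpace : Type (u + 1) where
  /-- the underlying set -/
  carrier : Type u
  /-- the topology -/
  [top : TopologicalSpace carrier]
  /-- the base point -/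
  pt : carrier

instance : CoeSort PtdSpace.{u} (Type u) := ⟨PtdSpace.carrier⟩

instance (X : PtdSpace.{u}) : TopologicalSpace X := X.top

/-- A base point preserving continuous map. -/
structure PtdMap (X : PtdSpace.{u}) (Y : PtdSpace.{v}) where
  /-- the continuous map -/
  toMap : C(X, Y)
  map_pt : toMap X.pt = Y.pt

/-- The equivalence relation that identifies all points of `S` with each other. -/
def collapse {Y : Type u} (S : Set Y) : Setoid Y where
  r a b := a = b ∨ (a ∈ S ∧ b ∈ S)
  iseqv :=
    { refl := fun _ => Or.inl rfl
      symm := by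
        rintro a b (h | ⟨ha, hb⟩)
        · exact Or.inl h.symm
        · exact Or.inr ⟨hb, ha⟩
      trans := by
        rintro a b c (rfl | ⟨ha, hb⟩) (rfl | ⟨hb', hc⟩)
        · exact Or.inl rfl
        · exact Or.inr ⟨hb', hc⟩
        · exact Or.inr ⟨ha, hb⟩
        · exact Or.inr ⟨ha, hc⟩ }

/-- The part `X × {0, 1} ∪ {pt} × I` of the cylinder `X × I`. -/
def suspBase (X : PtdSpace.{u}) : Set (X × I) := {p | p.2 = 0 ∨ p.2 = 1 ∨ p.1 = X.pt}

/-- The reduced suspension `X × I / (X × {0, 1} ∪ {pt} × I)` with the quotient topology. -/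
def susp (X : PtdSpace.{u}) : PtdSpace.{u} where
  carrier := Quotient (collapse (suspBase X))
  pt := Quotient.mk _ (X.pt, 0)

/-- The quotient map from the cylinder to the reduced suspension. -/
def suspMk (X : PtdSpace.{u}) : C(X × I, susp X) :=
  ⟨Quotient.mk (collapse (suspBase X)), continuous_quotient_mk'⟩

lemma suspMk_eq_pt (X : PtdSpace.{u}) {p : X × I} (hp : p ∈ suspBase X) :
    suspMk X p = (susp X).pt :=
  Quotient.sound (s := collapse (suspBase X)) (Or.inr ⟨hp, Or.inl rfl⟩)

/-- The iterated reduced suspension. -/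
def iterSusp (X : PtdSpace.{u}) : ℕ → PtdSpace.{u}
  | 0 => X
  | n + 1 => susp (iterSusp X n)

/-- The wedge of a family of pointed spaces: the disjoint union of the spaces and of one further
point, with all base points and the further point identified. The wedge of the empty family is a
point. -/
def wedge {J : Type u} (X : J → PtdSpace.{v}) : PtdSpace.{max u v} where
  carrier := Quotient (collapse
    ({z | z = Sum.inl PUnit.unit ∨ ∃ j, z = Sum.inr ⟨j, (X j).pt⟩} :
      Set (PUnit.{1} ⊕ (Σ j, X j))))
  pt := Quotient.mk _ (Sum.inl PUnit.unit)

/-- The `n`-sphere, as the unit sphere of `(n + 1)`-dimensional Euclidean space. -/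
def sphere (n : ℕ) : PtdSpace.{0} where
  carrier := Metric.sphere (0 : EuclideanSpace ℝ (Fin (n + 1))) 1
  pt := ⟨EuclideanSpace.single 0 1, by simp⟩

/-! ### Spectra and stable homotopy type -/

/-- A (sequential pre)spectrum: pointed spaces `E 0, E 1, …` with structure maps from the reduced
suspension of `E n` to `E (n + 1)`. -/
structure Spectrum : Type (u + 1) where
  /-- the spaces of the spectrum -/
  space : ℕ → PtdSpace.{u}
  /-- the structure maps -/
  str : ∀ n, PtdMap (susp (space n)) (space (n + 1))

/-- A map of spectra: pointed maps in each level that commute with the structure maps, i.e.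
`f (n + 1) ∘ σ n = σ n ∘ Σ (f n)`. -/
structure Spectrum.Hom (E F : Spectrum.{u}) where
  /-- the map in level `n` -/
  app : ∀ n, PtdMap (E.space n) (F.space n)
  comm : ∀ n (x : E.space n) (t : I),
    (app (n + 1)).toMap ((E.str n).toMap (suspMk _ (x, t))) =
      (F.str n).toMap (suspMk _ ((app n).toMap x, t))

/-- The map on `d`-dimensional loops (maps of the cube that send the boundary to the base point)
induced by a pointed map. -/
def pushLoop {X : PtdSpace.{u}} {Y : PtdSpace.{v}} (f : PtdMap X Y) {d : ℕ}
    (p : GenLoop (Fin d) X X.pt) : GenLoop (Fin d) Y Y.pt :=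
  ⟨f.toMap.comp p.1, fun t ht => by
    have h : p.1 t = X.pt := p.2 t ht
    simp [h, f.map_pt]⟩

/-- The stabilization of a loop `p : S^d → E n` to the loop `S^(d+1) = Σ S^d → Σ E n → E (n+1)`. -/
def Spectrum.stab (E : Spectrum.{u}) {n d : ℕ} (p : GenLoop (Fin d) (E.space n) (E.space n).pt) :
    GenLoop (Fin (d + 1)) (E.space (n + 1)) (E.space (n + 1)).pt :=
  ⟨(E.str n).toMap.comp ((suspMk (E.space n)).comp
      ⟨fun t => (p.1 (fun i => t i.succ), t 0), by fun_prop⟩), by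
    rintro t ⟨i, hi⟩
    have key : ((p.1 (fun i => t i.succ), t 0) : E.space n × I) ∈ suspBase (E.space n) := by
      refine Fin.cases (fun h => ?_) (fun j h => ?_) i hi
      · rcases h with h | h
        · exact Or.inl h
        · exact Or.inr (Or.inl h)
      · exact Or.inr (Or.inr (p.2 _ ⟨j, h⟩))
    exact (congrArg (E.str n).toMap (suspMk_eq_pt _ key)).trans (E.str n).map_pt⟩

/-- A representative of an element of the `k`-th homotopy group of a spectrum. -/
structure Spectrum.Rep (E : Spectrum.{u}) (k : ℤ) where
  /-- the level in the spectrum -/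
  n : ℕ
  /-- the dimension of the sphere -/
  d : ℕ
  deg : (d : ℤ) - n = k
  /-- the map of the sphere -/
  loop : GenLoop (Fin d) (E.space n) (E.space n).pt

/-- The identifications in the colimit over `n` of the groups `π_(k+n) (E n)`. -/
inductive Spectrum.Rel (E : Spectrum.{u}) (k : ℤ) : E.Rep k → E.Rep k → Prop
  | homotopic (n d : ℕ) (h : (d : ℤ) - n = k) (p q : GenLoop (Fin d) (E.space n) (E.space n).pt)
      (hpq : GenLoop.Homotopic p q) : Spectrum.Rel E k ⟨n, d, h, p⟩ ⟨n, d, h, q⟩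
  | stab (n d : ℕ) (h : (d : ℤ) - n = k) (h' : ((d + 1 : ℕ) : ℤ) - (n + 1 : ℕ) = k)
      (p : GenLoop (Fin d) (E.space n) (E.space n).pt) :
      Spectrum.Rel E k ⟨n, d, h, p⟩ ⟨n + 1, d + 1, h', E.stab p⟩

/-- The (underlying set of the) `k`-th homotopy group `π_k E = colim_n π_(k+n) (E n)`. -/
def Spectrum.Pi (E : Spectrum.{u}) (k : ℤ) : Type u := Quot (Spectrum.Rel E k)

/-- The map on homotopy groups induced by a map of spectra. -/
def Spectrum.Hom.mapPi {E F : Spectrum.{u}} (f : Spectrum.Hom E F) (k : ℤ) : E.Pi k → F.Pi k :=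
  Quot.map (fun a => ⟨a.n, a.d, a.deg, pushLoop (f.app a.n) a.loop⟩) <| by
    rintro _ _ (⟨n, d, h, p, q, hpq⟩ | ⟨n, d, h, h', p⟩)
    · refine Spectrum.Rel.homotopic n d h _ _ ?_
      exact ContinuousMap.HomotopicRel.comp_continuousMap hpq (f.app n).toMap
    · have e : pushLoop (f.app (n + 1)) (E.stab p) = F.stab (pushLoop (f.app n) p) := by
        apply GenLoop.ext
        intro t
        exact f.comm n _ _
      show Spectrum.Rel F k _ ⟨n + 1, d + 1, h', pushLoop (f.app (n + 1)) (E.stab p)⟩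
      rw [e]
      exact Spectrum.Rel.stab n d h h' _

/-- A stable equivalence of spectra: a map inducing bijections on all homotopy groups. -/
def Spectrum.Hom.IsStableEquiv {E F : Spectrum.{u}} (f : Spectrum.Hom E F) : Prop :=
  ∀ k : ℤ, Function.Bijective (f.mapPi k)

/-- Two spectra are equivalent, i.e. isomorphic in the stable homotopy category, if they are
connected by a zigzag of stable equivalences. -/
def Spectrum.Equivalent (E F : Spectrum.{u}) : Prop :=
  Relation.EqvGen (fun E F : Spectrum.{u} => ∃ f : Spectrum.Hom E F, f.IsStableEquiv) E F

/-- The suspension spectrum of a pointed space. -/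
def suspensionSpectrum (X : PtdSpace.{u}) : Spectrum.{u} where
  space := iterSusp X
  str _ := ⟨ContinuousMap.id _, rfl⟩

/-- A pointed space has the stable homotopy type of a wedge of spheres: its suspension spectrum is
equivalent to the suspension spectrum of some wedge of spheres, that is to a wedge of sphere
spectra. -/
def HasStableTypeOfWedgeOfSpheres (X : PtdSpace.{u}) : Prop :=
  ∃ (J : Type u) (n : J → ℕ),
    (suspensionSpectrum X).Equivalent (suspensionSpectrum (wedge fun j => sphere (n j)))

/-! ### Generalized homology theories -/

/-- The inclusion of pairs `(X ∖ U, A ∖ U) → (X, A)`. -/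
def excisionMap (X : TopCat.{u}) (A U : Set X) :
    TopPair.ofSubset (X := TopCat.of ↥(Uᶜ)) (Subtype.val ⁻¹' A) ⟶ TopPair.ofSubset (X := X) A :=
  TopPair.ofHom (TopCat.ofHom ⟨Subtype.val, continuous_subtype_val⟩)
    (TopCat.ofHom ⟨fun x => ⟨x.1.1, x.2⟩, by fun_prop⟩)

/-- A generalized homology theory: a sequence of functors on pairs of spaces, indexed by the
integers and with values in abelian groups, with natural boundary maps, which is homotopy
invariant and satisfies the exactness and the excision axiom. There is no dimension axiom. -/
structure IsGeneralizedHomologyTheory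
    (h : TopPair.HomologyPretheory.{u} AddCommGrpCat.{w} (ComplexShape.down ℤ)) : Prop where
  homotopy : h.IsHomotopyInvariant
  /-- exactness of `h_k A → h_k X → h_k (X, A)` -/
  exact_fst (P : TopPair.{u}) (k : ℤ) :
    Function.Exact ((h.H k).map P.map)
      ((h.iso k).hom.app P.fst ≫ (h.Hₚ k).map (TopPair.j P))
  /-- exactness of `h_(k+1) X → h_(k+1) (X, A) → h_k A` -/
  exact_pair (P : TopPair.{u}) (k : ℤ) :
    Function.Exact ((h.iso (k + 1)).hom.app P.fst ≫ (h.Hₚ (k + 1)).map (TopPair.j P))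
      ((h.δ (k + 1) k).app P)
  /-- exactness of `h_(k+1) (X, A) → h_k A → h_k X` -/
  exact_snd (P : TopPair.{u}) (k : ℤ) :
    Function.Exact ((h.δ (k + 1) k).app P) ((h.H k).map P.map)
  excision (X : TopCat.{u}) (A U : Set X) (hU : closure U ⊆ interior A) (k : ℤ) :
    IsIso ((h.Hₚ k).map (excisionMap X A U))

/-! ### The 1-Step Stabilization property -/

/-- The `m`-skeleton of a CW complex, as a space. -/
def skel (X : Type u) [TopologicalSpace X] [T2Space X] [CWComplex (Set.univ : Set X)] (m : ℕ) :
    TopCat.{u} :=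
  TopCat.of ↥(CWComplex.skeleton (Set.univ : Set X) m : Set X)

/-- The inclusion of the `m`-skeleton in the whole complex. -/
def skelIncl (X : Type u) [TopologicalSpace X] [T2Space X] [CWComplex (Set.univ : Set X)] (m : ℕ) :
    skel X m ⟶ TopCat.of X :=
  TopCat.ofHom ⟨Subtype.val, continuous_subtype_val⟩

/-- The inclusion of the `m`-skeleton in the `(m + 1)`-skeleton. -/
def skelStep (X : Type u) [TopologicalSpace X] [T2Space X] [CWComplex (Set.univ : Set X)] (m : ℕ) :
    skel X m ⟶ skel X (m + 1) :=
  TopCat.ofHom ⟨Set.inclusion (CWComplex.skeleton_mono (by norm_cast; omega)),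
    continuous_inclusion _⟩

/-- The 1-Step Stabilization property of a CW complex `X` for `h`: for all `m` and `k` the kernels
of `h_k (X^(m)) → h_k (X^(m+1))` and of `h_k (X^(m)) → h_k X` agree. -/
def OneStepStabilization
    (h : TopPair.HomologyPretheory.{u} AddCommGrpCat.{w} (ComplexShape.down ℤ))
    (X : Type u) [TopologicalSpace X] [T2Space X] [CWComplex (Set.univ : Set X)] : Prop :=
  ∀ (m : ℕ) (k : ℤ),
    ((h.H k).map (skelStep X m)).hom.ker = ((h.H k).map (skelIncl X m)).hom.ker

/-! ### Classifying spaces of groups -/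

/-- `X` is an Eilenberg-MacLane space `K(Γ, 1)`. -/
structure IsClassifyingSpace (Γ : Type v) [Group Γ] (X : Type u) [TopologicalSpace X] : Prop where
  pathConnected : PathConnectedSpace X
  fundamentalGroup : ∀ x : X, Nonempty (FundamentalGroup X x ≃* Γ)
  aspherical : ∀ n : ℕ, 2 ≤ n → ∀ x : X, Subsingleton (HomotopyGroup.Pi n X x)

/-- A group is geometrically finite if it has a classifying space that is a finite CW complex. -/
def GeometricallyFinite (Γ : Type v) [Group Γ] : Prop :=
  ∃ (X : Type u) (_ : TopologicalSpace X) (_ : T2Space X) (_ : CWComplex (Set.univ : Set X)),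
    RelCWComplex.Finite (Set.univ : Set X) ∧ IsClassifyingSpace Γ X

/-- The property `(*)_s` of a group: its classifying CW complex has the stable homotopy type of a
wedge of spheres (with a vertex as base point, as usual). Neither the choice of the complex nor that
of the vertex matters, so it suffices that one choice has the property. -/
def StableWedgeProperty (Γ : Type v) [Group Γ] : Prop :=
  ∃ (X : Type u) (_ : TopologicalSpace X) (_ : T2Space X) (_ : CWComplex (Set.univ : Set X)) (x : X),
    IsClassifyingSpace Γ X ∧ x ∈ (CWComplex.skeleton (Set.univ : Set X) 0 : Set X) ∧
      HasStableTypeOfWedgeOfSpheres ⟨X, x⟩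

/-- The 1-Step Stabilization property of a group for `h`, asked of all its classifying CW
complexes. -/
def GroupOneStepStabilization
    (h : TopPair.HomologyPretheory.{u} AddCommGrpCat.{w} (ComplexShape.down ℤ))
    (Γ : Type v) [Group Γ] : Prop :=
  ∀ (X : Type u) [TopologicalSpace X] [T2Space X] [CWComplex (Set.univ : Set X)],
    IsClassifyingSpace Γ X → OneStepStabilization h X

end OneStep

end

/-!
# One-step stabilization for groups whose classifying space is stably a wedge of spheres

In a wedge of spheres every skeleton is a retract, since the spheres of larger dimension can be
collapsed (`exists_retraction_skPt`). The kernels in question therefore vanish there, and the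
proof transfers this to a complex `X` that is stably a homotopy retract of a wedge of spheres.

*Stabilization.* Let `Σ^l X` be a homotopy retract of `Σ^l W` for a wedge of spheres `W`. Cellular
approximation in suspensions (`exists_htpy_skPtIncl_comp`, `htpy_skPtStep_comp`) transports the
retraction of `W` onto its `m`-skeleton to a map `r : Σ^l X → Σ^l X^(m)` such that the composition
of `Σ^l X^(m) → Σ^l X` with `r` and with the inclusion in `Σ^l X^(m + 1)` is homotopic to this
inclusion (`exists_iterSuspMap_skPtStep_factorization`). The approximation only uses that a map
from a compact subset of a Euclidean space can be pushed off cells of larger dimension, because a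
smooth map between Euclidean spaces misses points if the dimension of the target is larger
(`compressible_cell`, `compressible_cyl`).

*Homology.* A class `a` of `X^(m)` that dies in `X` is reduced, so that it has suspensions, which
vanish as soon as `a` does, and for well-pointed spaces only then (`exists_iterSusp_class`). By
the above, the `l`-fold suspension of `a` dies in `Σ^l X^(m + 1)`, since it already does in `Σ^l
X`. As skeleta are well-pointed (`isWellPointed_skPt`), `a` dies in `X^(m + 1)`
(`ker_skelStep_eq_ker_skelIncl`). The suspension is used as a relation between homology classes
(`SuspRel`), which avoids the construction of an isomorphism.

*Uniqueness of classifying complexes.* Let `X0` be a finite classifying complex and `X1` one that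
is stably a wedge of spheres. There are maps `X → X0 → X1` and back whose compositions are
homotopic to identities (`IsClassifyingSpace.exists_htpy_id`). They are constructed by obstruction
theory: the holonomy of a path with values in the group decides whether maps and homotopies extend
over cells of low dimension, and in higher dimensions there is no obstruction. On the 1-skeleton,
holonomies are determined up to conjugation by their values on the edges (`exists_conj_of_edges`).

*Stable maps.* The definition of the stable homotopy type consists in a zigzag of stable
equivalences of spectra. A stable equivalence induces bijections of the stable maps of finite
complexes, which is proved over one cell after the other (`exists_ball_lift`,
`exists_finite_lift`). A zigzag thus gives a natural correspondence of stable maps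
(`Equivalent.nonempty_correspondence`). For the map `X0 → X1`, it yields a stable map to a wedge
of spheres. By compactness this map has values in a finite wedge (`exists_factor_finite_wedge`),
whose inclusion corresponds to a stable map to `X1`. Hence some suspension of `X0 → X1` factors
through the suspension of a finite wedge of spheres (`exists_stable_factorization`), and `Σ^l X`
is a homotopy retract of this suspension.
-/

noncomputable section

namespace OneStep

open Set Metric

/-! ### Maps out of a CW complex -/

section CW

variable {X : Type u} [TopologicalSpace X] [T2Space X] [CWComplex (Set.univ : Set X)]

/-- The `n`-cells of a CW complex. -/
abbrev Cell (X : Type u) [TopologicalSpace X] [T2Space X] [CWComplex (Set.univ : Set X)] (n : ℕ) :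
    Type u :=
  RelCWComplex.cell (Set.univ : Set X) n

/-- The characteristic map of a cell, defined on the whole of `ℝⁿ` but only meaningful on the closed
unit ball. -/
abbrev chi (n : ℕ) (e : Cell X n) : (Fin n → ℝ) → X :=
  RelCWComplex.map n e

/-- The union of the cells of dimension less than `n`. -/
abbrev skLT (X : Type u) [TopologicalSpace X] [T2Space X] [CWComplex (Set.univ : Set X)] (n : ℕ∞) :
    Set X :=
  (CWComplex.skeletonLT (Set.univ : Set X) n : Set X)

lemma chi_mem_skLT {n : ℕ} (e : Cell X n) {y : Fin n → ℝ}
    (hy : y ∈ closedBall (0 : Fin n → ℝ) 1) : chi n e y ∈ skLT X (n + 1) :=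
  CWComplex.closedCell_subset_skeletonLT n e (mem_image_of_mem _ hy)

lemma chi_mem_skLT_of_lt {n : ℕ} {N : ℕ∞} (h : (n : ℕ∞) < N)
    (e : Cell X n) {y : Fin n → ℝ}
    (hy : y ∈ closedBall (0 : Fin n → ℝ) 1) : chi n e y ∈ skLT X N :=
  CWComplex.skeletonLT_mono (Order.add_one_le_of_lt h) (chi_mem_skLT e hy)

lemma chi_sphere_mem {n : ℕ} (e : Cell X n) {y : Fin n → ℝ}
    (hy : y ∈ Metric.sphere (0 : Fin n → ℝ) 1) : chi n e y ∈ skLT X n :=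
  CWComplex.cellFrontier_subset_skeletonLT n e (mem_image_of_mem _ hy)

lemma chi_ball_notMem {n : ℕ} (e : Cell X n) {y : Fin n → ℝ}
    (hy : y ∈ ball (0 : Fin n → ℝ) 1) : chi n e y ∉ skLT X n := fun h =>
  (RelCWComplex.disjoint_skeletonLT_openCell (C := (Set.univ : Set X)) (j := e) le_rfl).le_bot
    ⟨h, mem_image_of_mem _ hy⟩

lemma chi_symm_apply {n : ℕ} (e : Cell X n) {y : Fin n → ℝ}
    (hy : y ∈ ball (0 : Fin n → ℝ) 1) : (RelCWComplex.map n e).symm (chi n e y) = y :=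
  (RelCWComplex.map n e).left_inv (by rw [RelCWComplex.source_eq]; exact hy)

lemma chi_injOn {n : ℕ} (e : Cell X n) :
    InjOn (chi n e) (ball 0 1) := fun a ha b hb h => by
  rw [← chi_symm_apply e ha, ← chi_symm_apply e hb, h]

lemma chi_ball_inj {n m : ℕ} {e : Cell X n}
    {e' : Cell X m}
    {y : Fin n → ℝ} {y' : Fin m → ℝ} (hy : y ∈ ball (0 : Fin n → ℝ) 1)
    (hy' : y' ∈ ball (0 : Fin m → ℝ) 1) (h : chi n e y = chi m e' y') :
    (⟨n, e⟩ : Σ n, Cell X n) = ⟨m, e'⟩ := by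
  by_contra hne
  exact (CWComplex.disjoint_openCell_of_ne hne).le_bot
    ⟨mem_image_of_mem (chi n e) hy, by rw [h]; exact mem_image_of_mem (chi m e') hy'⟩

lemma exists_chi_of_mem_skLT {N : ℕ∞} {x : X} (hx : x ∈ skLT X N) :
    ∃ n : ℕ, (n : ℕ∞) < N ∧ ∃ e : Cell X n,
      ∃ y ∈ ball (0 : Fin n → ℝ) 1, chi n e y = x := by
  obtain ⟨n, hn, e, y, hy, h⟩ := CWComplex.mem_skeletonLT_iff.1 hx
  exact ⟨n, hn, e, y, hy, h⟩

lemma exists_chi (x : X) : ∃ n : ℕ, ∃ e : Cell X n,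
    ∃ y ∈ ball (0 : Fin n → ℝ) 1, chi n e y = x := by
  obtain ⟨n, -, h⟩ := exists_chi_of_mem_skLT (X := X) (N := ⊤) (x := x) (by simp)
  exact ⟨n, h⟩

lemma isClosed_skLT (N : ℕ∞) : IsClosed (skLT X N) :=
  RelCWComplex.Subcomplex.closed _

lemma continuousOn_chi {n : ℕ} (e : Cell X n) :
    ContinuousOn (chi n e) (closedBall 0 1) := RelCWComplex.continuousOn n e

/-- A map out of a skeleton is continuous as soon as it is continuous on every closed cell. -/
lemma continuousOn_skLT_of_cells {T : Type*} [TopologicalSpace T] (f : X → T) (N : ℕ∞)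
    (h : ∀ n : ℕ, (n : ℕ∞) < N → ∀ e, ContinuousOn (f ∘ chi n e) (closedBall 0 1)) :
    ContinuousOn f (skLT X N) := by
  rw [continuousOn_iff_isClosed]
  intro F hF
  refine ⟨f ⁻¹' F ∩ skLT X N, ?_, by rw [inter_assoc, inter_self]⟩
  refine (CWComplex.closed (Set.univ : Set X) _ (subset_univ _)).2 fun n => ?_
  induction n using Nat.strong_induction_on with
  | _ n ih =>
  intro e
  -- On cells outside the skeleton the preimage only meets the boundary, where lower cells decide.
  by_cases hn : (n : ℕ∞) < N
  · have : f ⁻¹' F ∩ skLT X N ∩ CWComplex.closedCell n e =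
        chi n e '' (closedBall 0 1 ∩ (f ∘ chi n e) ⁻¹' F) := by
      ext x
      constructor
      · rintro ⟨⟨h1, -⟩, y, hy, rfl⟩
        exact ⟨y, ⟨hy, h1⟩, rfl⟩
      · rintro ⟨y, ⟨hy, h1⟩, rfl⟩
        exact ⟨⟨h1, chi_mem_skLT_of_lt hn e hy⟩, y, hy, rfl⟩
    rw [this]
    have hc : IsClosed (closedBall 0 1 ∩ (f ∘ chi n e) ⁻¹' F) :=
      (h n hn e).preimage_isClosed_of_isClosed isClosed_closedBall hF
    exact (((isCompact_closedBall (0 : Fin n → ℝ) 1).of_isClosed_subset hc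
      inter_subset_left).image_of_continuousOn
      ((continuousOn_chi e).mono inter_subset_left)).isClosed
  · have hd : Disjoint (skLT X N) (CWComplex.openCell n e) :=
      RelCWComplex.disjoint_skeletonLT_openCell (not_lt.1 hn)
    rw [← CWComplex.cellFrontier_union_openCell_eq_closedCell, inter_union_distrib_left]
    rw [(hd.mono_left inter_subset_right).inter_eq, union_empty]
    cases n with
    | zero => simp [RelCWComplex.cellFrontier_zero_eq_empty]
    | succ n =>
      exact CWComplex.isClosed_inter_cellFrontier_succ_of_le_isClosed_inter_closedCell
        (fun m hm j => ih m (Nat.lt_succ_of_le hm) j) e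

/-- The parametrized form of `continuousOn_skLT_of_cells`. -/
lemma continuousOn_skLT_prod {P Z : Type*} [TopologicalSpace P] [LocallyCompactSpace P]
    [TopologicalSpace Z] (f : X → P → Z) (N : ℕ∞)
    (h : ∀ n : ℕ, (n : ℕ∞) < N → ∀ e, ContinuousOn
      (fun q : (Fin n → ℝ) × P => f (chi n e q.1) q.2) (closedBall 0 1 ×ˢ univ)) :
    ContinuousOn (fun q : X × P => f q.1 q.2) (skLT X N ×ˢ univ) := by
  rcases (skLT X N).eq_empty_or_nonempty with h0 | ⟨x0, hx0⟩
  · rw [h0]; simp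
  have hfx : ∀ x ∈ skLT X N, Continuous (f x) := by
    intro x hx
    obtain ⟨n, hn, e, y, hy, rfl⟩ := exists_chi_of_mem_skLT hx
    have := (h n hn e).comp_continuous (f := fun p : P => (y, p)) (by fun_prop)
      (fun p => ⟨ball_subset_closedBall hy, mem_univ _⟩)
    exact this
  -- As `P` is locally compact, the statement is about a map from the skeleton to `C(P, Z)`.
  let F : X → C(P, Z) := fun x => ContinuousMap.mkD (f x) ⟨f x0, hfx x0 hx0⟩
  have hF : ∀ x ∈ skLT X N, ∀ p, F x p = f x p := fun x hx p => by
    simp only [F]; rw [ContinuousMap.mkD_of_continuous (hfx x hx)]; rfl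
  have hFc : ContinuousOn F (skLT X N) := by
    refine continuousOn_skLT_of_cells F N fun n hn e => ?_
    rw [continuousOn_iff_continuous_domRestrict]
    refine ContinuousMap.continuous_of_continuous_uncurry _ ?_
    have := (h n hn e).comp_continuous (f := fun q : closedBall (0 : Fin n → ℝ) 1 × P =>
      ((q.1 : Fin n → ℝ), q.2)) (by fun_prop) (fun q => ⟨q.1.2, mem_univ _⟩)
    refine this.congr fun q => ?_
    exact (hF _ (chi_mem_skLT_of_lt hn e q.1.2) q.2).symm
  have : ContinuousOn (fun q : X × P => F q.1 q.2) (skLT X N ×ˢ univ) := by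
    have h1 : ContinuousOn (fun q : X × P => (F q.1, q.2)) (skLT X N ×ˢ univ) :=
      (hFc.comp continuousOn_fst (fun q hq => hq.1)).prodMk continuousOn_snd
    exact (continuous_eval (F := C(P, Z))).comp_continuousOn h1
  exact this.congr fun q hq => (hF _ hq.1 _).symm

/-- A parametrized map on the union of the cells of dimension less than `n` extends over the
`n`-cells once it does so on each of them. -/
lemma exists_extension_step {P Z : Type*} [TopologicalSpace P] [LocallyCompactSpace P]
    [TopologicalSpace Z] (n : ℕ) (g : X → P → Z)
    (hg : ContinuousOn (fun q : X × P => g q.1 q.2) (skLT X n ×ˢ univ))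
    (G : Cell X n → (Fin n → ℝ) → P → Z)
    (hG : ∀ e, ContinuousOn (fun q : (Fin n → ℝ) × P => G e q.1 q.2) (closedBall 0 1 ×ˢ univ))
    (hGg : ∀ e, ∀ y ∈ Metric.sphere (0 : Fin n → ℝ) 1, G e y = g (chi n e y)) :
    ∃ g' : X → P → Z, ContinuousOn (fun q : X × P => g' q.1 q.2) (skLT X (n + 1) ×ˢ univ) ∧
      (∀ x ∈ skLT X n, g' x = g x) ∧
      ∀ e, ∀ y ∈ closedBall (0 : Fin n → ℝ) 1, g' (chi n e y) = G e y := by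
  classical
  let g' : X → P → Z := fun x =>
    if h : ∃ e : Cell X n, ∃ y ∈ ball (0 : Fin n → ℝ) 1, chi n e y = x
    then G h.choose h.choose_spec.choose else g x
  have h1 : ∀ x ∈ skLT X n, g' x = g x := fun x hx => by
    refine dif_neg ?_
    rintro ⟨e, y, hy, rfl⟩
    exact chi_ball_notMem e hy hx
  have h2 : ∀ e, ∀ y ∈ closedBall (0 : Fin n → ℝ) 1, g' (chi n e y) = G e y := by
    intro e y hy
    rw [← sphere_union_ball] at hy
    rcases hy with hy | hy
    · rw [h1 _ (chi_sphere_mem e hy), hGg e y hy]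
    · have h : ∃ e' : Cell X n, ∃ y' ∈ ball (0 : Fin n → ℝ) 1,
          chi n e' y' = chi n e y := ⟨e, y, hy, rfl⟩
      have e1 : g' (chi n e y) = G h.choose h.choose_spec.choose := dif_pos h
      have e2 := h.choose_spec.choose_spec
      rw [e1]
      generalize h.choose = e', h.choose_spec.choose = y' at e2 ⊢
      have e3 := chi_ball_inj e2.1 hy e2.2
      simp only [Sigma.mk.injEq, heq_eq_eq, true_and] at e3
      subst e3
      rw [chi_injOn _ e2.1 hy e2.2]
  refine ⟨g', continuousOn_skLT_prod g' _ fun m hm e => ?_, h1, h2⟩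
  have hm' : m ≤ n := by
    have : (m : ℕ∞) < ((n + 1 : ℕ) : ℕ∞) := by simpa using hm
    have := Nat.cast_lt.1 this
    omega
  rcases hm'.eq_or_lt with rfl | hlt
  · exact (hG e).congr fun q hq => congrFun (h2 e q.1 hq.1) q.2
  · have hms : ∀ y ∈ closedBall (0 : Fin m → ℝ) 1, chi m e y ∈ skLT X n := fun y hy =>
      chi_mem_skLT_of_lt (by exact_mod_cast hlt) e hy
    have : ContinuousOn (fun q : (Fin m → ℝ) × P => g (chi m e q.1) q.2)
        (closedBall 0 1 ×ˢ univ) := by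
      refine hg.comp (f := fun q : (Fin m → ℝ) × P => (chi m e q.1, q.2))
        (((continuousOn_chi e).comp continuousOn_fst fun q hq => hq.1).prodMk continuousOn_snd)
        fun q hq => ⟨hms _ hq.1, mem_univ _⟩
    exact this.congr fun q hq => congrFun (h1 _ (hms _ hq.1)) q.2

/-- Construction of a parametrized map on a skeleton, subject to a pointwise constraint `R`, by
extending it over one cell after the other. -/
theorem exists_extension {P Z : Type*} [TopologicalSpace P] [LocallyCompactSpace P]
    [TopologicalSpace Z] (N : ℕ∞) (R : X → (P → Z) → Prop) (n0 : ℕ) (hn0 : (n0 : ℕ∞) ≤ N)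
    (g0 : X → P → Z) (hg0 : ContinuousOn (fun q : X × P => g0 q.1 q.2) (skLT X n0 ×ˢ univ))
    (hR0 : ∀ x ∈ skLT X n0, R x (g0 x))
    (hcell : ∀ n : ℕ, n0 ≤ n → (n : ℕ∞) < N → ∀ e : Cell X n,
      ∀ b : (Fin n → ℝ) → P → Z,
      ContinuousOn (fun q : (Fin n → ℝ) × P => b q.1 q.2) (Metric.sphere 0 1 ×ˢ univ) →
      (∀ y ∈ Metric.sphere (0 : Fin n → ℝ) 1, R (chi n e y) (b y)) →
      ∃ G : (Fin n → ℝ) → P → Z,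
        ContinuousOn (fun q : (Fin n → ℝ) × P => G q.1 q.2) (closedBall 0 1 ×ˢ univ) ∧
        (∀ y ∈ Metric.sphere (0 : Fin n → ℝ) 1, G y = b y) ∧
        ∀ y ∈ closedBall (0 : Fin n → ℝ) 1, R (chi n e y) (G y)) :
    ∃ g : X → P → Z, ContinuousOn (fun q : X × P => g q.1 q.2) (skLT X N ×ˢ univ) ∧
      (∀ x ∈ skLT X n0, g x = g0 x) ∧ ∀ x ∈ skLT X N, R x (g x) := by
  classical
  let S : ℕ → Set X := fun k => skLT X (min ((n0 + k : ℕ) : ℕ∞) N)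
  have hSmono : ∀ {k l}, k ≤ l → S k ⊆ S l := fun {k l} h =>
    CWComplex.skeletonLT_mono (min_le_min_right _ (by exact_mod_cast Nat.add_le_add_left h n0))
  let Good : ℕ → (X → P → Z) → Prop := fun k g =>
    ContinuousOn (fun q : X × P => g q.1 q.2) (S k ×ˢ univ) ∧ ∀ x ∈ S k, R x (g x)
  have step : ∀ k, ∀ g, Good k g → ∃ g', Good (k + 1) g' ∧ ∀ x ∈ S k, g' x = g x := by
    rintro k g ⟨hc, hR⟩
    by_cases hk : ((n0 + k : ℕ) : ℕ∞) < N
    · have hSk : S k = skLT X ((n0 + k : ℕ) : ℕ∞) := by simp only [S, min_eq_left hk.le]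
      have hSk1 : S (k + 1) = skLT X (((n0 + k : ℕ) : ℕ∞) + 1) := by
        simp only [S]
        rw [min_eq_left]
        · norm_cast
        · have := Order.add_one_le_of_lt hk
          exact_mod_cast this
      rw [hSk] at hc hR
      have := fun e => hcell (n0 + k) (by omega) hk e (fun y => g (chi _ e y))
        (hc.comp (f := fun q : (Fin (n0 + k) → ℝ) × P => (chi _ e q.1, q.2))
        ((((continuousOn_chi e).mono sphere_subset_closedBall).comp continuousOn_fst
          fun q hq => hq.1).prodMk continuousOn_snd)
        fun q hq => ⟨chi_sphere_mem e hq.1, mem_univ _⟩)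
        (fun y hy => hR _ (chi_sphere_mem e hy))
      choose G hG1 hG2 hG3 using this
      obtain ⟨g', h1, h2, h3⟩ := exists_extension_step (n0 + k) g hc G hG1 hG2
      refine ⟨g', ⟨by rw [hSk1]; exact h1, fun x hx => ?_⟩, by rw [hSk]; exact h2⟩
      rw [hSk1] at hx
      obtain ⟨m, hm, e, y, hy, rfl⟩ := exists_chi_of_mem_skLT hx
      have hm' : m ≤ n0 + k := by
        have : (m : ℕ∞) < ((n0 + k + 1 : ℕ) : ℕ∞) := by simpa using hm
        have := Nat.cast_lt.1 this
        omega
      rcases hm'.eq_or_lt with rfl | hlt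
      · rw [h3 e y (ball_subset_closedBall hy)]
        exact hG3 e y (ball_subset_closedBall hy)
      · have := chi_mem_skLT_of_lt (X := X) (N := ((n0 + k : ℕ) : ℕ∞)) (by exact_mod_cast hlt) e
          (ball_subset_closedBall hy)
        rw [h2 _ this]
        exact hR _ this
    · have hSk : S (k + 1) = S k := by
        simp only [S]
        rw [min_eq_right (not_lt.1 hk), min_eq_right ((not_lt.1 hk).trans _)]
        exact_mod_cast (by omega : n0 + k ≤ n0 + (k + 1))
      exact ⟨g, by simp only [Good, hSk]; exact ⟨hc, hR⟩, fun _ _ => rfl⟩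
  choose! next hnext1 hnext2 using step
  let s : ℕ → X → P → Z := fun k => Nat.rec g0 (fun k g => next k g) k
  have hs : ∀ k, Good k (s k) := by
    intro k
    induction k with
    | zero =>
      have : S 0 = skLT X n0 := by simp only [S, add_zero, min_eq_left hn0]
      simp only [Good, this]
      exact ⟨hg0, hR0⟩
    | succ k ih => exact hnext1 k _ ih
  have hagree : ∀ k l, k ≤ l → ∀ x ∈ S k, s l x = s k x := by
    intro k l hkl
    induction l, hkl using Nat.le_induction with
    | base => exact fun _ _ => rfl
    | succ l hkl ih =>
      exact fun x hx => (hnext2 l _ (hs l) x (hSmono hkl hx)).trans (ih x hx)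
  -- The successive extensions `s k` agree wherever they are constrained, and the result is their
  -- common value.
  let g : X → P → Z := fun x => if h : ∃ k, x ∈ S k then s (Nat.find h) x else g0 x
  have hg : ∀ k, ∀ x ∈ S k, g x = s k x := by
    intro k x hx
    have h : ∃ k, x ∈ S k := ⟨k, hx⟩
    have : g x = s (Nat.find h) x := dif_pos h
    rw [this, hagree _ k (Nat.find_min' h hx) x (Nat.find_spec h)]
  have hcov : ∀ n : ℕ, (n : ℕ∞) < N → ∀ e : Cell X n,
      ∀ y ∈ closedBall (0 : Fin n → ℝ) 1, chi n e y ∈ S (n + 1) := fun n hn e y hy =>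
    chi_mem_skLT_of_lt (lt_min (by norm_cast; omega) hn) e hy
  refine ⟨g, continuousOn_skLT_prod g N fun n hn e => ?_, fun x hx => ?_, fun x hx => ?_⟩
  · have h1 : ContinuousOn (fun q : (Fin n → ℝ) × P => s (n + 1) (chi n e q.1) q.2)
        (closedBall 0 1 ×ˢ univ) :=
      (hs (n + 1)).1.comp (f := fun q : (Fin n → ℝ) × P => (chi n e q.1, q.2))
        (((continuousOn_chi e).comp continuousOn_fst fun q hq => hq.1).prodMk continuousOn_snd)
        fun q hq => ⟨hcov n hn e _ hq.1, mem_univ _⟩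
    exact h1.congr fun q hq => congrFun (hg _ _ (hcov n hn e _ hq.1)) q.2
  · refine hg 0 x ?_
    simpa only [S, add_zero, min_eq_left hn0] using hx
  · obtain ⟨n, hn, e, y, hy, rfl⟩ := exists_chi_of_mem_skLT hx
    have h1 := hcov n hn e y (ball_subset_closedBall hy)
    rw [hg _ _ h1]
    exact (hs _).2 _ h1

end CW

/-! ### Balls: homotopy extension and related deformations -/

/-- An identification of `B` with the closed unit ball of the normed space `V`, given by the
embedding `emb` of `B` in `V` and by the radial retraction `ret` of `V` onto `B`. -/
structure BallChart (V : Type*) (B : Type*) [NormedAddCommGroup V] [NormedSpace ℝ V]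
    [TopologicalSpace B] where
  /-- the embedding in the normed space -/
  emb : C(B, V)
  /-- the radial retraction -/
  ret : C(V, B)
  ret_emb : ∀ b, ret (emb b) = b
  emb_ret : ∀ v, emb (ret v) = (max 1 ‖v‖)⁻¹ • v

namespace BallChart

variable {V W B S Z : Type*} [NormedAddCommGroup V] [NormedSpace ℝ V] [NormedAddCommGroup W]
  [NormedSpace ℝ W] [TopologicalSpace B] [TopologicalSpace S] [TopologicalSpace Z]

lemma norm_clamp (v : V) : ‖(max 1 ‖v‖)⁻¹ • v‖ = min 1 ‖v‖ := by
  have h : 0 < max 1 ‖v‖ := lt_max_of_lt_left one_pos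
  rw [norm_smul, norm_inv, Real.norm_of_nonneg h.le]
  rcases le_total ‖v‖ 1 with h1 | h1
  · simp [max_eq_left h1, min_eq_right h1]
  · rw [max_eq_right h1, min_eq_left h1, inv_mul_cancel₀ (by linarith)]

lemma norm_clamp_le (v : V) : ‖(max 1 ‖v‖)⁻¹ • v‖ ≤ 1 := by
  rw [norm_clamp]; exact min_le_left _ _

lemma clamp_eq_self {v : V} (h : ‖v‖ ≤ 1) : (max 1 ‖v‖)⁻¹ • v = v := by
  rw [max_eq_left h, inv_one, one_smul]

lemma continuous_clamp : Continuous fun v : V => (max 1 ‖v‖)⁻¹ • v :=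
  ((continuous_const.max continuous_norm).inv₀ fun v => by
    simpa using (lt_max_of_lt_left one_pos : (0 : ℝ) < max 1 ‖v‖).ne').smul continuous_id

/-- The closed unit ball itself. -/
def ball (V : Type*) [NormedAddCommGroup V] [NormedSpace ℝ V] :
    BallChart V (closedBall (0 : V) 1) where
  emb := ⟨Subtype.val, continuous_subtype_val⟩
  ret := ⟨fun v => ⟨(max 1 ‖v‖)⁻¹ • v, by simpa using norm_clamp_le v⟩,
    continuous_clamp.subtype_mk _⟩
  ret_emb b := Subtype.ext (clamp_eq_self (mem_closedBall_zero_iff.1 b.2))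
  emb_ret _ := rfl

lemma abs_clamp_apply_le {N : Type*} [Fintype N] (v : N → ℝ) (i : N) :
    |((max 1 ‖v‖)⁻¹ • v) i| ≤ 1 :=
  (norm_le_pi_norm ((max 1 ‖v‖)⁻¹ • v) i).trans (norm_clamp_le v)

/-- The cube `I^N` as a ball for the maximum norm. -/
def cube (N : Type*) [Fintype N] : BallChart (N → ℝ) (N → I) where
  emb := ⟨fun t i => 2 * (t i : ℝ) - 1, by fun_prop⟩
  ret := ⟨fun v i => Set.projIcc (0 : ℝ) 1 zero_le_one ((((max 1 ‖v‖)⁻¹ • v) i + 1) / 2), by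
    refine continuous_pi fun i => continuous_projIcc.comp ?_
    have := (continuous_apply i).comp (continuous_clamp (V := N → ℝ))
    exact (this.add continuous_const).div_const _⟩
  ret_emb t := by
    have h : ‖(fun i => 2 * (t i : ℝ) - 1 : N → ℝ)‖ ≤ 1 := by
      refine (pi_norm_le_iff_of_nonneg zero_le_one).2 fun i => ?_
      rw [Real.norm_eq_abs, abs_le]
      constructor <;> linarith [(t i).2.1, (t i).2.2]
    ext i
    simp only [ContinuousMap.coe_mk, clamp_eq_self h]
    rw [show (2 * (t i : ℝ) - 1 + 1) / 2 = t i by ring, projIcc_val]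
  emb_ret v := by
    ext i
    have h := abs_le.1 (abs_clamp_apply_le v i)
    simp only [ContinuousMap.coe_mk]
    rw [projIcc_of_mem zero_le_one ⟨by linarith, by linarith⟩]
    ring

/-- The unit interval as a ball of the real line. -/
def interval : BallChart ℝ I where
  emb := ⟨fun t => 2 * (t : ℝ) - 1, by fun_prop⟩
  ret := ⟨fun v => Set.projIcc (0 : ℝ) 1 zero_le_one (((max 1 ‖v‖)⁻¹ • v + 1) / 2),
    continuous_projIcc.comp ((continuous_clamp.add continuous_const).div_const _)⟩
  ret_emb t := by
    have h : ‖2 * (t : ℝ) - 1‖ ≤ 1 := by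
      rw [Real.norm_eq_abs, abs_le]
      constructor <;> linarith [t.2.1, t.2.2]
    simp only [ContinuousMap.coe_mk, clamp_eq_self h]
    rw [show (2 * (t : ℝ) - 1 + 1) / 2 = t by ring, projIcc_val]
  emb_ret v := by
    have h := abs_le.1 (show |(max 1 ‖v‖)⁻¹ • v| ≤ 1 from norm_clamp_le v)
    simp only [ContinuousMap.coe_mk]
    rw [projIcc_of_mem zero_le_one ⟨by linarith, by linarith⟩]
    ring

lemma norm_emb_le (c : BallChart V B) (b : B) : ‖c.emb b‖ ≤ 1 := by
  rw [← c.ret_emb b, c.emb_ret]; exact norm_clamp_le _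

/-- The product of two balls is a ball for the maximum norm. -/
def prod (c : BallChart V B) (d : BallChart W S) : BallChart (V × W) (B × S) where
  emb := ⟨fun b => (c.emb b.1, d.emb b.2), by fun_prop⟩
  ret := ⟨fun v => (c.ret ((max 1 ‖v‖)⁻¹ • v).1, d.ret ((max 1 ‖v‖)⁻¹ • v).2), by
    have := continuous_clamp (V := V × W)
    exact (c.ret.continuous.comp this.fst).prodMk (d.ret.continuous.comp this.snd)⟩
  ret_emb b := by
    have h : ‖((c.emb b.1, d.emb b.2) : V × W)‖ ≤ 1 := by
      rw [Prod.norm_def]; exact max_le (c.norm_emb_le _) (d.norm_emb_le _)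
    simp only [ContinuousMap.coe_mk, clamp_eq_self h, ret_emb]
  emb_ret v := by
    have h := norm_clamp_le v
    have h1 : ‖((max 1 ‖v‖)⁻¹ • v).1‖ ≤ 1 := (norm_fst_le _).trans h
    have h2 : ‖((max 1 ‖v‖)⁻¹ • v).2‖ ≤ 1 := (norm_snd_le _).trans h
    simp only [ContinuousMap.coe_mk, emb_ret]
    rw [clamp_eq_self h1, clamp_eq_self h2]

/-- The boundary sphere of a ball. -/
def bd (c : BallChart V B) : Set B := {b | ‖c.emb b‖ = 1}

lemma isClosed_bd (c : BallChart V B) : IsClosed c.bd :=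
  isClosed_eq (by fun_prop) continuous_const

lemma mem_bd_prod {c : BallChart V B} {d : BallChart W S} {b : B × S} :
    b ∈ (c.prod d).bd ↔ b.1 ∈ c.bd ∨ b.2 ∈ d.bd := by
  show max ‖c.emb b.1‖ ‖d.emb b.2‖ = 1 ↔ _
  have h1 := c.norm_emb_le b.1
  have h2 := d.norm_emb_le b.2
  constructor
  · intro h
    rcases max_choice ‖c.emb b.1‖ ‖d.emb b.2‖ with h' | h'
    · exact Or.inl (h'.symm.trans h)
    · exact Or.inr (h'.symm.trans h)
  · rintro (h | h)
    · rw [show ‖c.emb b.1‖ = 1 from h, max_eq_left h2]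
    · rw [show ‖d.emb b.2‖ = 1 from h, max_eq_right h1]

lemma mem_bd_interval {t : I} : t ∈ interval.bd ↔ t = 0 ∨ t = 1 := by
  show |2 * (t : ℝ) - 1| = 1 ↔ _
  constructor
  · intro h
    rcases (abs_eq zero_le_one).1 h with h | h
    · exact Or.inr (Subtype.ext (by rw [Set.Icc.coe_one]; linarith))
    · exact Or.inl (Subtype.ext (by rw [Set.Icc.coe_zero]; linarith))
  · rintro (rfl | rfl) <;> norm_num

lemma mem_bd_cube {N : Type*} [Fintype N] {t : N → I} :
    t ∈ (cube N).bd ↔ t ∈ Cube.boundary N := by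
  have key : ∀ i, ‖(cube N).emb t i‖ = 1 ↔ t i = 0 ∨ t i = 1 := fun i => mem_bd_interval
  constructor
  · intro h
    by_contra hb
    have : ∀ i, ‖(cube N).emb t i‖ < 1 := fun i =>
      lt_of_le_of_ne ((norm_le_pi_norm _ i).trans (norm_emb_le _ _))
        fun h' => hb ⟨i, (key i).1 h'⟩
    exact absurd h ((pi_norm_lt_iff one_pos).2 this).ne
  · rintro ⟨i, hi⟩
    refine le_antisymm (norm_emb_le _ _) ?_
    rw [← (key i).2 hi]
    exact norm_le_pi_norm _ i

lemma mem_bd_ball {y : closedBall (0 : V) 1} :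
    y ∈ (ball V).bd ↔ (y : V) ∈ Metric.sphere (0 : V) 1 := by
  simp [bd, ball]

/-- Radial scaling, followed by the radial retraction. -/
def scl (c : BallChart V B) : C(ℝ × B, B) := ⟨fun q => c.ret (q.1 • c.emb q.2), by fun_prop⟩

lemma emb_scl (c : BallChart V B) (s : ℝ) (b : B) :
    c.emb (c.scl (s, b)) = (max 1 ‖s • c.emb b‖)⁻¹ • s • c.emb b := c.emb_ret _

lemma scl_one (c : BallChart V B) (b : B) : c.scl (1, b) = b := by
  simp [scl, c.ret_emb]

lemma scl_mem_bd (c : BallChart V B) {s : ℝ} {b : B} (hs : 0 ≤ s) (h : 1 ≤ s * ‖c.emb b‖) :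
    c.scl (s, b) ∈ c.bd := by
  show ‖c.emb (c.scl (s, b))‖ = 1
  rw [emb_scl, norm_clamp, norm_smul, Real.norm_of_nonneg hs, min_eq_left h]

lemma scl_of_mem_bd (c : BallChart V B) {s : ℝ} {b : B} (hs : 1 ≤ s) (h : b ∈ c.bd) :
    c.scl (s, b) = b := by
  have hb : ‖c.emb b‖ = 1 := h
  have h1 : c.emb (c.scl (s, b)) = c.emb b := by
    rw [emb_scl, norm_smul, hb, Real.norm_of_nonneg (by linarith), mul_one, max_eq_right hs,
      smul_smul, inv_mul_cancel₀ (by linarith), one_smul]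
  rw [← c.ret_emb (c.scl (s, b)), h1, c.ret_emb]

/-- Projection of the cylinder over a ball onto the union of its bottom and its sides, from the
point above the centre of the ball at height 2. -/
def boxRet (c : BallChart V B) : C(I × B, I × B) where
  toFun q := (Set.projIcc (0 : ℝ) 1 zero_le_one (2 - (2 - (q.1 : ℝ)) / max ‖c.emb q.2‖ (1 / 2)),
    c.scl ((1 - (q.1 : ℝ) / 2)⁻¹, q.2))
  continuous_toFun := by
    refine (continuous_projIcc.comp ?_).prodMk (c.scl.continuous.comp (.prodMk ?_ continuous_snd))
    · refine continuous_const.sub (.div (by fun_prop) (by fun_prop) fun q => ?_)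
      exact (lt_max_of_lt_right (by norm_num)).ne'
    · refine .inv₀ (by fun_prop) fun q => ?_
      have := q.1.2.2
      intro h; linarith

lemma boxRet_mem (c : BallChart V B) (q : I × B) :
    (c.boxRet q).1 = 0 ∨ (c.boxRet q).2 ∈ c.bd := by
  have h0 := q.1.2.1
  have h1 := q.1.2.2
  have hp : (0 : ℝ) < 1 - (q.1 : ℝ) / 2 := by linarith
  rcases le_total ‖c.emb q.2‖ (1 - (q.1 : ℝ) / 2) with h | h
  · left
    refine projIcc_of_le_left zero_le_one ?_
    have hm : 0 < max ‖c.emb q.2‖ (1 / 2) := lt_max_of_lt_right (by norm_num)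
    have : 2 ≤ (2 - (q.1 : ℝ)) / max ‖c.emb q.2‖ (1 / 2) := by
      rw [le_div_iff₀ hm]
      have := max_le h (show (1 / 2 : ℝ) ≤ 1 - (q.1 : ℝ) / 2 by linarith)
      linarith
    linarith
  · right
    refine c.scl_mem_bd (inv_nonneg.2 hp.le) ?_
    rw [inv_mul_eq_div, le_div_iff₀ hp]
    linarith

lemma boxRet_of_mem (c : BallChart V B) {q : I × B} (h : q.1 = 0 ∨ q.2 ∈ c.bd) :
    c.boxRet q = q := by
  have h0 := q.1.2.1
  have h1 := q.1.2.2
  rcases h with h | h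
  · have h' : (q.1 : ℝ) = 0 := by rw [h]; rfl
    refine Prod.ext ?_ ?_
    · show Set.projIcc (0 : ℝ) 1 zero_le_one _ = _
      rw [h]
      refine projIcc_of_le_left zero_le_one ?_
      have hm : 0 < max ‖c.emb q.2‖ (1 / 2) := lt_max_of_lt_right (by norm_num)
      have : 2 ≤ (2 - ((0 : I) : ℝ)) / max ‖c.emb q.2‖ (1 / 2) := by
        rw [le_div_iff₀ hm]
        have := max_le (c.norm_emb_le q.2) (show (1 / 2 : ℝ) ≤ 1 by norm_num)
        simp only [Set.Icc.coe_zero]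
        linarith
      linarith
    · show c.scl _ = _
      rw [h', zero_div, sub_zero, inv_one, scl_one]
  · have hb : ‖c.emb q.2‖ = 1 := h
    refine Prod.ext ?_ ?_
    · show Set.projIcc (0 : ℝ) 1 zero_le_one (2 - (2 - (q.1 : ℝ)) / max ‖c.emb q.2‖ (1 / 2)) = _
      rw [hb, max_eq_left (by norm_num), div_one, sub_sub_cancel, projIcc_val]
    · exact c.scl_of_mem_bd (by rw [one_le_inv₀ (by linarith)]; linarith) h

/-- The homotopy extension property of a ball relative to its boundary sphere. -/
lemma exists_homotopy_extension (c : BallChart V B) (f : I × B → Z)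
    (hf : ContinuousOn f {q | q.1 = 0 ∨ q.2 ∈ c.bd}) :
    ∃ K : C(I × B, Z), ∀ q, q.1 = 0 ∨ q.2 ∈ c.bd → K q = f q :=
  ⟨⟨f ∘ c.boxRet, hf.comp_continuous c.boxRet.continuous c.boxRet_mem⟩, fun q hq => by
    simp [c.boxRet_of_mem hq]⟩

/-- A map on the bottom and a map on the sides of a cylinder that fit together form a continuous
map. -/
lemma exists_homotopy_extension' (c : BallChart V B) (u : C(B, Z)) (k : I × B → Z)
    (hk : ContinuousOn k (univ ×ˢ c.bd)) (huk : ∀ y ∈ c.bd, k (0, y) = u y) :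
    ∃ K : C(I × B, Z), (∀ y, K (0, y) = u y) ∧ ∀ t, ∀ y ∈ c.bd, K (t, y) = k (t, y) := by
  classical
  let f : I × B → Z := fun q => if q.2 ∈ c.bd then k q else u q.2
  have h1 : ∀ q : I × B, q.2 ∈ c.bd → f q = k q := fun q hq => if_pos hq
  have h2 : ∀ q : I × B, q.1 = 0 → f q = u q.2 := fun q hq => by
    by_cases h : q.2 ∈ c.bd
    · rw [h1 q h, ← huk _ h, ← hq]
    · exact if_neg h
  have hf : ContinuousOn f ({q | q.1 = 0} ∪ {q | q.2 ∈ c.bd}) := by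
    refine ContinuousOn.union_of_isClosed ?_ ?_ (isClosed_eq continuous_fst continuous_const)
      (c.isClosed_bd.preimage continuous_snd)
    · exact (by fun_prop : Continuous fun q : I × B => u q.2).continuousOn.congr h2
    · refine ContinuousOn.congr (hk.mono ?_) h1
      exact fun q hq => ⟨mem_univ _, hq⟩
  obtain ⟨K, hK⟩ := c.exists_homotopy_extension f hf
  exact ⟨K, fun y => (hK (0, y) (Or.inl rfl)).trans (h2 _ rfl),
    fun t y hy => (hK (t, y) (Or.inr hy)).trans (h1 _ hy)⟩

/-- The concatenation of two homotopies, parametrized by `[0, 2]`. -/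
lemma exists_concat (K L : C(I × B, Z)) (h : ∀ y, L (0, y) = K (1, y)) :
    ∃ M : C(ℝ × B, Z), (∀ t : I, ∀ y, M (t, y) = K (t, y)) ∧
      ∀ t : I, ∀ y, M (1 + t, y) = L (t, y) := by
  let M : ℝ × B → Z := fun q => if q.1 ≤ 1 then K (projIcc (0 : ℝ) 1 zero_le_one q.1, q.2)
    else L (projIcc (0 : ℝ) 1 zero_le_one (q.1 - 1), q.2)
  have hM : Continuous M := by
    refine Continuous.if_le ?_ ?_ continuous_fst continuous_const ?_
    · exact K.continuous.comp ((continuous_projIcc.comp continuous_fst).prodMk continuous_snd)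
    · exact L.continuous.comp ((continuous_projIcc.comp (continuous_fst.sub
        continuous_const)).prodMk continuous_snd)
    · intro q hq
      rw [hq, sub_self, projIcc_left, projIcc_right]
      exact (h _).symm
  refine ⟨⟨M, hM⟩, fun t y => ?_, fun t y => ?_⟩
  · show M (t, y) = _
    simp only [M]
    rw [if_pos t.2.2, projIcc_val]
  · show M (1 + t, y) = _
    by_cases ht : (t : ℝ) = 0
    · simp only [M]
      have ht' : t = 0 := Subtype.ext ht
      rw [if_pos (by rw [ht, add_zero]), ht', h]
      congr 2
      refine projIcc_of_right_le _ (by simp)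
    · have : 0 < (t : ℝ) := lt_of_le_of_ne t.2.1 (Ne.symm ht)
      simp only [M]
      rw [if_neg (by linarith), add_sub_cancel_left, projIcc_val]

/-- A homotopy followed by a homotopy relative to the boundary sphere can be replaced by a homotopy
that has the same track on the boundary as the first one. -/
lemma exists_concat_rel (c : BallChart V B) (K L : C(I × B, Z)) (h : ∀ y, L (0, y) = K (1, y))
    (hL : ∀ t, ∀ y ∈ c.bd, L (t, y) = K (1, y)) :
    ∃ G : C(I × B, Z), (∀ y, G (0, y) = K (0, y)) ∧ (∀ t, ∀ y ∈ c.bd, G (t, y) = K (t, y)) ∧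
      ∀ y, G (1, y) = L (1, c.scl (2, y)) := by
  obtain ⟨M, hMK, hML⟩ := exists_concat K L h
  -- The ball of radius `1 / 2` is expanded to the whole ball and runs through both homotopies.
  -- The collar around it finally lands on the boundary, where `L` is constant, so that it may run
  -- through less and less of `L`, and through none of it on the boundary sphere.
  refine ⟨⟨fun q => M ((q.1 : ℝ) * (1 + min 1 (2 - 2 * ‖c.emb q.2‖)),
    c.scl (1 + (q.1 : ℝ), q.2)), by fun_prop⟩, fun y => ?_, fun t y hy => ?_, fun y => ?_⟩
  · simp only [ContinuousMap.coe_mk, Set.Icc.coe_zero, zero_mul, add_zero, scl_one]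
    exact hMK 0 y
  · have hy' : ‖c.emb y‖ = 1 := hy
    simp only [ContinuousMap.coe_mk, hy']
    rw [c.scl_of_mem_bd (by linarith [t.2.1]) hy, ← hMK]
    norm_num
  · simp only [ContinuousMap.coe_mk, Set.Icc.coe_one, one_mul]
    rw [show (1 : ℝ) + 1 = 2 by norm_num]
    have h0 := norm_nonneg (c.emb y)
    have h1 := c.norm_emb_le y
    rcases le_total (2 * ‖c.emb y‖) 1 with h2 | h2
    · rw [min_eq_left (by linarith)]
      exact hML 1 _
    · rw [min_eq_right (by linarith)]
      have h3 := c.scl_mem_bd (s := 2) (by norm_num) h2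
      have h4 := hML ⟨2 - 2 * ‖c.emb y‖, by constructor <;> linarith⟩ (c.scl (2, y))
      rw [h4, hL _ _ h3, hL _ _ h3]

/-- If maps on the ball that send the boundary to `A` can be deformed into `A` relative to the
boundary, then a homotopy on the boundary that ends in `A` extends to a homotopy on the ball with
given start that ends in `A`. -/
lemma exists_extension_of_compression (c : BallChart V B) (A : Set Z) (u : C(B, Z))
    (k : I × B → Z) (hk : ContinuousOn k (univ ×ˢ c.bd)) (huk : ∀ y ∈ c.bd, k (0, y) = u y)
    (hkA : ∀ y ∈ c.bd, k (1, y) ∈ A)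
    (hA : ∀ w : C(B, Z), (∀ y ∈ c.bd, w y ∈ A) → ∃ L : C(I × B, Z), (∀ y, L (0, y) = w y) ∧
      (∀ t, ∀ y ∈ c.bd, L (t, y) = w y) ∧ ∀ y, L (1, y) ∈ A) :
    ∃ G : C(I × B, Z), (∀ y, G (0, y) = u y) ∧ (∀ t, ∀ y ∈ c.bd, G (t, y) = k (t, y)) ∧
      ∀ y, G (1, y) ∈ A := by
  obtain ⟨K, hK0, hK1⟩ := c.exists_homotopy_extension' u k hk huk
  obtain ⟨L, hL0, hL1, hL2⟩ := hA (K.comp ⟨fun y => (1, y), by fun_prop⟩) fun y hy => by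
    simpa [hK1 1 y hy] using hkA y hy
  obtain ⟨G, hG0, hG1, hG2⟩ := c.exists_concat_rel K L hL0 hL1
  exact ⟨G, fun y => (hG0 y).trans (hK0 y), fun t y hy => (hG1 t y hy).trans (hK1 t y hy),
    fun y => hG2 y ▸ hL2 _⟩

/-- A lift `v'` of `u` along `φ` up to a homotopy that moves on the boundary along the image of
a homotopy `v` can be replaced by a lift up to a homotopy relative to the boundary. -/
lemma exists_lift_rel {E F : Type*} [TopologicalSpace E] [TopologicalSpace F]
    (c : BallChart V B) (φ : C(E, F)) (u : C(B, F)) (v : I × B → E)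
    (hv : ContinuousOn v (univ ×ˢ c.bd)) (v' : C(B, E)) (hvv' : ∀ y ∈ c.bd, v' y = v (1, y))
    (L : C(I × B, F)) (hL0 : ∀ y, L (0, y) = u y)
    (hLb : ∀ t, ∀ y ∈ c.bd, L (t, y) = φ (v (t, y))) (hL1 : ∀ y, L (1, y) = φ (v' y)) :
    ∃ v'' : C(B, E), (∀ y ∈ c.bd, v'' y = v (0, y)) ∧ ∃ L' : C(I × B, F),
      (∀ y, L' (0, y) = u y) ∧ (∀ t, ∀ y ∈ c.bd, L' (t, y) = u y) ∧
      ∀ y, L' (1, y) = φ (v'' y) := by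
  classical
  -- The new lift is `v'`, rescaled to the ball of radius `1 / 2`, and runs back along `v` on the
  -- collar around this ball.
  let p : B → I := fun y => projIcc (0 : ℝ) 1 zero_le_one (2 - 2 * ‖c.emb y‖)
  have hp : Continuous p := continuous_projIcc.comp (by fun_prop)
  have hs : ∀ y, 1 ≤ 2 * ‖c.emb y‖ → c.scl (2, y) ∈ c.bd := fun y h =>
    c.scl_mem_bd (by norm_num) h
  let v'' : B → E := fun y => if 2 * ‖c.emb y‖ ≤ 1 then v' (c.scl (2, y))
    else v (p y, c.scl (2, y))
  have hp1 : ∀ y, 2 * ‖c.emb y‖ ≤ 1 → p y = 1 := fun y h =>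
    projIcc_of_right_le _ (by linarith)
  have e2 : ∀ y, 1 ≤ 2 * ‖c.emb y‖ → v'' y = v (p y, c.scl (2, y)) := by
    intro y h
    by_cases h' : 2 * ‖c.emb y‖ ≤ 1
    · simp only [v'', if_pos h']
      rw [hvv' _ (hs y h), hp1 y h']
    · exact if_neg h'
  have hv'' : Continuous v'' := by
    refine continuous_if_le (by fun_prop) continuous_const (by fun_prop) ?_ ?_
    · refine hv.comp (f := fun y : B => (p y, c.scl (2, y))) (by fun_prop) ?_
      exact fun y hy => ⟨mem_univ _, hs y hy⟩
    · intro y hy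
      rw [hvv' _ (hs y hy.ge), hp1 y hy.le]
  refine ⟨⟨v'', hv''⟩, fun y hy => ?_, ⟨fun q => L (min q.1 (p q.2),
    c.scl (1 + (q.1 : ℝ), q.2)), by fun_prop⟩, fun y => ?_, fun t y hy => ?_, fun y => ?_⟩
  · have hy' : ‖c.emb y‖ = 1 := hy
    refine (e2 y (by rw [hy']; norm_num)).trans ?_
    rw [c.scl_of_mem_bd (by norm_num) hy]
    congr 2
    exact projIcc_of_le_left _ (by rw [hy']; norm_num)
  · simp only [ContinuousMap.coe_mk, Set.Icc.coe_zero, add_zero, scl_one]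
    rw [min_eq_left (unitInterval.nonneg' : 0 ≤ p y)]
    exact hL0 y
  · have hy' : ‖c.emb y‖ = 1 := hy
    have : p y = 0 := projIcc_of_le_left _ (by rw [hy']; norm_num)
    simp only [ContinuousMap.coe_mk, this]
    rw [c.scl_of_mem_bd (by linarith [t.2.1]) hy, min_eq_right (unitInterval.nonneg' : 0 ≤ t), hL0]
  · simp only [ContinuousMap.coe_mk, Set.Icc.coe_one]
    rw [show (1 : ℝ) + 1 = 2 by norm_num, min_eq_right (unitInterval.le_one' : p y ≤ 1)]
    rcases le_total (2 * ‖c.emb y‖) 1 with h | h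
    · rw [hp1 y h, hL1]
      simp only [v'', if_pos h]
    · rw [e2 y h, hLb _ _ (hs y h)]

/-- A homotopy of the cylinder `I × S` over a ball that preserves its boundary, starts with the
identity, and finally maps everything on the boundary but the open top to the bottom. -/
def squeeze (c : BallChart V S) : C(I × (I × S), I × S) where
  toFun q := (Set.projIcc (0 : ℝ) 1 zero_le_one
      (min (q.2.1 : ℝ) (1 - max (2 * (q.1 : ℝ) - 1) 0 +
        max (2 * (q.1 : ℝ) - 1) 0 * (2 - 2 * ‖c.emb q.2.2‖))),
    c.scl (1 + min (2 * (q.1 : ℝ)) 1, q.2.2))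
  continuous_toFun := by
    refine (continuous_projIcc.comp ?_).prodMk ?_ <;> fun_prop

lemma squeeze_zero (c : BallChart V S) (x : I × S) : c.squeeze (0, x) = x := by
  refine Prod.ext ?_ ?_
  · show Set.projIcc (0 : ℝ) 1 zero_le_one _ = _
    have h : max (2 * ((0 : I) : ℝ) - 1) 0 = 0 := by norm_num
    simp only [h, zero_mul, add_zero, sub_zero]
    rw [min_eq_left x.1.2.2, projIcc_val]
  · show c.scl (1 + min (2 * ((0 : I) : ℝ)) 1, x.2) = x.2
    have h : min (2 * ((0 : I) : ℝ)) 1 = 0 := by norm_num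
    rw [h, add_zero, scl_one]

/-- During the expansion of `S`, in the first half of the time, the top stays at height one. In the
second half the points of the top outside the ball of radius `1 / 2`, which have been moved to the
sides, slide down. -/
lemma squeeze_mem_bd (c : BallChart V S) {t : I} {x : I × S} (hx : x ∈ (interval.prod c).bd) :
    c.squeeze (t, x) ∈ (interval.prod c).bd := by
  rw [mem_bd_prod, mem_bd_interval] at hx ⊢
  have hn := c.norm_emb_le x.2
  have hn0 := norm_nonneg (c.emb x.2)
  have h1 : (1 : ℝ) ≤ 1 + min (2 * (t : ℝ)) 1 := by
    have : 0 ≤ min (2 * (t : ℝ)) 1 := le_min (by linarith [t.2.1]) zero_le_one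
    linarith
  rcases hx with (hx | hx) | hx
  · left; left
    show Set.projIcc (0 : ℝ) 1 zero_le_one _ = _
    refine projIcc_of_le_left _ ((min_le_left _ _).trans ?_)
    simp [hx]
  · rcases le_total (2 * ‖c.emb x.2‖) 1 with h | h
    · left; right
      show Set.projIcc (0 : ℝ) 1 zero_le_one _ = _
      refine projIcc_of_right_le _ (le_min (by simp [hx]) ?_)
      have : 0 ≤ max (2 * (t : ℝ) - 1) 0 := le_max_right _ _
      simp only
      nlinarith
    · rcases le_total (2 * (t : ℝ)) 1 with ht | ht
      · left; right
        show Set.projIcc (0 : ℝ) 1 zero_le_one _ = _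
        refine projIcc_of_right_le _ (le_min (by simp [hx]) ?_)
        simp only
        rw [max_eq_right (by linarith)]
        norm_num
      · right
        refine c.scl_mem_bd (by linarith) ?_
        simp only
        rw [min_eq_right ht]
        linarith
  · right
    show c.scl _ ∈ c.bd
    rwa [c.scl_of_mem_bd h1 hx]

lemma squeeze_one (c : BallChart V S) {x : I × S} (hx : x.1 = 0 ∨ x.2 ∈ c.bd) :
    (c.squeeze (1, x)).1 = 0 := by
  show Set.projIcc (0 : ℝ) 1 zero_le_one _ = _
  refine projIcc_of_le_left zero_le_one ?_
  rcases hx with hx | hx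
  · exact (min_le_left _ _).trans (by simp [hx])
  · refine (min_le_right _ _).trans ?_
    have hx' : ‖c.emb x.2‖ = 1 := hx
    simp only [hx']
    norm_num

/-- A homotopy of the cylinder `I × S` over a ball that preserves its boundary, starts with the
identity, and contracts the bottom to a point. -/
def contractBottom (c : BallChart V S) : C(I × (I × S), I × S) where
  toFun q := (Set.projIcc (0 : ℝ) 1 zero_le_one ((1 + (q.1 : ℝ)) * q.2.1 - q.1),
    c.scl (min 1 (1 + ((1 + (q.1 : ℝ)) * q.2.1 - q.1)), q.2.2))
  continuous_toFun := by
    refine (continuous_projIcc.comp ?_).prodMk ?_ <;> fun_prop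

lemma contractBottom_zero (c : BallChart V S) (x : I × S) : c.contractBottom (0, x) = x := by
  refine Prod.ext ?_ ?_
  · show Set.projIcc (0 : ℝ) 1 zero_le_one ((1 + ((0 : I) : ℝ)) * x.1 - ((0 : I) : ℝ)) = _
    simp [projIcc_val]
  · show c.scl (min 1 (1 + ((1 + ((0 : I) : ℝ)) * x.1 - ((0 : I) : ℝ))), x.2) = x.2
    rw [min_eq_left (by simpa using x.1.2.1), scl_one]

lemma contractBottom_mem_bd (c : BallChart V S) {t : I} {x : I × S}
    (hx : x ∈ (interval.prod c).bd) : c.contractBottom (t, x) ∈ (interval.prod c).bd := by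
  rw [mem_bd_prod, mem_bd_interval] at hx ⊢
  rcases hx with (hx | hx) | hx
  · left; left
    refine projIcc_of_le_left zero_le_one ?_
    simpa [hx] using t.2.1
  · left; right
    refine projIcc_of_right_le zero_le_one ?_
    simp [hx]
  · rcases le_total ((1 + (t : ℝ)) * x.1 - t) 0 with h | h
    · left; left
      exact projIcc_of_le_left zero_le_one h
    · right
      show c.scl (min 1 (1 + ((1 + (t : ℝ)) * x.1 - t)), x.2) ∈ c.bd
      rwa [min_eq_left (by linarith), scl_one]

lemma contractBottom_one (c : BallChart V S) {x : I × S} (hx : x.1 = 0) :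
    c.contractBottom (1, x) = (0, c.ret 0) := by
  refine Prod.ext ?_ ?_
  · refine projIcc_of_le_left zero_le_one ?_
    simp [hx]
  · show c.ret _ = c.ret 0
    simp [hx]

/-- A map `v` from the boundary of the ball `I × S` to `Y` extends over the ball provided that, for
all maps `r` from `S` to the boundary of `I × S` that are constant on the boundary of `S`, the
composition with `v` is null-homotopic relative to the boundary. -/
lemma exists_extension_of_null {Y : Type*} [TopologicalSpace Y] (c : BallChart V S)
    (v : I × S → Y) (hv : ContinuousOn v (interval.prod c).bd)
    (hnull : ∀ (r : C(S, I × S)) (x0 : I × S), x0 ∈ (interval.prod c).bd →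
      (∀ s, r s ∈ (interval.prod c).bd) → (∀ s ∈ c.bd, r s = x0) →
      ∃ N : C(I × S, Y), (∀ s, N (0, s) = v x0) ∧ (∀ s, N (1, s) = v (r s)) ∧
        ∀ t, ∀ s ∈ c.bd, N (t, s) = v x0) :
    ∃ v' : C(I × S, Y), ∀ x ∈ (interval.prod c).bd, v' x = v x := by
  -- deform `v` to a map that is constant outside the top
  let h : C(I × (I × S), I × S) :=
    ⟨fun q => c.contractBottom (q.1, c.squeeze q), by fun_prop⟩
  have hbd : ∀ t x, x ∈ (interval.prod c).bd → h (t, x) ∈ (interval.prod c).bd :=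
    fun t x hx => c.contractBottom_mem_bd (c.squeeze_mem_bd hx)
  have h0 : ∀ x, h (0, x) = x := fun x => by
    show c.contractBottom (0, c.squeeze (0, x)) = x
    rw [squeeze_zero, contractBottom_zero]
  have h1 : ∀ x : I × S, x.1 = 0 ∨ x.2 ∈ c.bd → h (1, x) = (0, c.ret 0) := fun x hx =>
    c.contractBottom_one (c.squeeze_one hx)
  have htop : ∀ s : S, ((1 : I), s) ∈ (interval.prod c).bd := fun s =>
    mem_bd_prod.2 (Or.inl (mem_bd_interval.2 (Or.inr rfl)))
  obtain ⟨N, hN0, hN1, hNb⟩ := hnull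
    ⟨fun s => h (1, (1, s)), by fun_prop⟩ (0, c.ret 0)
    (mem_bd_prod.2 (Or.inl (mem_bd_interval.2 (Or.inl rfl)))) (fun s => hbd _ _ (htop s))
    (fun s hs => h1 (1, s) (Or.inr hs))
  have hN : ∀ x ∈ (interval.prod c).bd, N x = v (h (1, x)) := by
    rintro ⟨t, s⟩ hx
    rcases mem_bd_prod.1 hx with hx' | hx'
    · rcases mem_bd_interval.1 hx' with rfl | rfl
      · rw [hN0, h1 _ (Or.inl rfl)]
      · exact hN1 s
    · rw [hNb t s hx', h1 _ (Or.inr hx')]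
  -- The deformed map extends, so the original one does by the homotopy extension property, used
  -- along the reversed deformation.
  obtain ⟨K, -, hK⟩ := (interval.prod c).exists_homotopy_extension' N
    (fun q => v (h (σ q.1, q.2)))
    (hv.comp (f := fun q : I × (I × S) => h (σ q.1, q.2)) (by fun_prop)
      fun q hq => hbd _ _ hq.2) (fun x hx => by simp [hN x hx])
  exact ⟨K.comp ⟨fun x => (1, x), by fun_prop⟩, fun x hx => by simp [hK 1 x hx, h0]⟩

end BallChart

/-! ### Pushing maps off cells of higher dimension -/

section Compression

variable {Z : Type*} [TopologicalSpace Z]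

/-- Every map to `S` from a compact subset of a Euclidean space of dimension at most `d` can be
deformed into `A` relative to the points that are already mapped to `A`. -/
def Compressible (A S : Set Z) (d : ℕ) : Prop :=
  ∀ (K : Type) [TopologicalSpace K] [CompactSpace K] (k : ℕ), k ≤ d →
    ∀ j : C(K, Fin k → ℝ), Function.Injective j → ∀ u : C(K, Z), (∀ s, u s ∈ S) →
      ∃ H : C(I × K, Z), (∀ s, H (0, s) = u s) ∧ (∀ s, H (1, s) ∈ A) ∧
        ∀ s, u s ∈ A → ∀ t, H (t, s) = u s

lemma Compressible.refl (A : Set Z) (d : ℕ) : Compressible A A d :=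
  fun K _ _ _ _ _ _ u hu => ⟨⟨fun q => u q.2, by fun_prop⟩, fun _ => rfl, hu, fun _ _ _ => rfl⟩

lemma exists_homotopy_trans {K : Type*} [TopologicalSpace K] (H H' : C(I × K, Z))
    (h : ∀ s, H' (0, s) = H (1, s)) : ∃ G : C(I × K, Z), (∀ s, G (0, s) = H (0, s)) ∧
      (∀ s, G (1, s) = H' (1, s)) ∧
      ∀ s z, (∀ t, H (t, s) = z) → (∀ t, H' (t, s) = z) → ∀ t, G (t, s) = z := by
  obtain ⟨M, hM1, hM2⟩ := BallChart.exists_concat H H' h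
  refine ⟨⟨fun q => M (2 * (q.1 : ℝ), q.2), by fun_prop⟩, fun s => ?_, fun s => ?_,
    fun s z h1 h2 t => ?_⟩
  · rw [← hM1]; simp
  · rw [← hM2]
    simp only [ContinuousMap.coe_mk, Set.Icc.coe_one]
    norm_num
  · simp only [ContinuousMap.coe_mk]
    rcases le_total (2 * (t : ℝ)) 1 with ht | ht
    · rw [← h1 ⟨2 * (t : ℝ), by linarith [t.2.1], ht⟩, ← hM1]
    · rw [← h2 ⟨2 * (t : ℝ) - 1, by linarith, by linarith [t.2.2]⟩, ← hM2]
      simp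

lemma Compressible.trans {A S T : Set Z} {d : ℕ} (hAS : A ⊆ S) (h1 : Compressible A S d)
    (h2 : Compressible S T d) : Compressible A T d := by
  intro K _ _ k hk j hj u hu
  obtain ⟨H, hH0, hH1, hH⟩ := h2 K k hk j hj u hu
  obtain ⟨H', hH0', hH1', hH'⟩ := h1 K k hk j hj (H.comp ⟨fun s => (1, s), by fun_prop⟩) hH1
  obtain ⟨G, hG0, hG1, hG⟩ := exists_homotopy_trans H H' hH0'
  refine ⟨G, fun s => (hG0 s).trans (hH0 s), fun s => hG1 s ▸ hH1' s, fun s hs t => ?_⟩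
  have e1 := hH s (hAS hs)
  refine hG s _ e1 (fun t => ?_) t
  have e2 : H (1, s) = u s := e1 1
  exact (hH' s (show H (1, s) ∈ A by rwa [e2]) t).trans e2

/-- A continuous map on a compact subset of a Euclidean space with values in a space of higher
dimension can be approximated by the restriction of a map that omits the origin. -/
lemma exists_approx_ne_zero {K : Type*} [TopologicalSpace K] [CompactSpace K] {V : Type*}
    [NormedAddCommGroup V] [NormedSpace ℝ V] [FiniteDimensional ℝ V] {k : ℕ}
    (hk : k < Module.finrank ℝ V) (j : C(K, Fin k → ℝ)) (hj : Function.Injective j)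
    (F : C(K, V)) {ε : ℝ} (hε : 0 < ε) :
    ∃ P : C(K, V), (∀ s, P s ≠ 0) ∧ ∀ s, ‖P s - F s‖ < ε := by
  have hemb : IsClosedEmbedding j := j.continuous.isClosedEmbedding hj
  obtain ⟨F', hF'⟩ := ContinuousMap.exists_extension (Y := V) hemb F
  have hF's : ∀ s, F' (j s) = F s := fun s => DFunLike.congr_fun hF' s
  obtain ⟨g, hg⟩ := exists_contMDiffMap_forall_mem_convex_of_local_const
    (modelWithCornersSelf ℝ (Fin k → ℝ)) (n := (⊤ : ℕ∞)) (F := V)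
    (t := fun x => Metric.ball (F' x) (ε / 2))
    (fun x => convex_ball _ _) (fun x => ⟨F' x, by
      have : ∀ᶠ y in 𝓝 x, dist (F' y) (F' x) < ε / 2 :=
        (F'.continuous.tendsto x).eventually (Metric.ball_mem_nhds _ (by positivity))
      filter_upwards [this] with y hy
      rw [Metric.mem_ball, dist_comm]; exact hy⟩)
  have hgc : ContDiff ℝ 1 g := (g.contMDiff.contDiff).of_le (by exact_mod_cast le_top)
  have hd := hgc.dense_compl_range_of_finrank_lt_finrank (by simpa using hk)
  obtain ⟨v, hv, hv'⟩ := hd.exists_dist_lt 0 (show 0 < ε / 2 by positivity)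
  refine ⟨⟨fun s => g (j s) - v, by fun_prop⟩, fun s hs => hv ⟨j s, sub_eq_zero.1 hs⟩, fun s => ?_⟩
  have h1 : ‖g (j s) - F s‖ < ε / 2 := by
    have := hg (j s)
    rwa [Metric.mem_ball, dist_eq_norm, hF's] at this
  have h2 : ‖v‖ < ε / 2 := by simpa [dist_eq_norm] using hv'
  have h3 : g (j s) - v - F s = (g (j s) - F s) - v := by abel
  simp only [ContinuousMap.coe_mk]
  rw [h3]
  exact (norm_sub_le _ _).trans_lt (by linarith)

variable {V D : Type*} [NormedAddCommGroup V] [NormedSpace ℝ V] [TopologicalSpace D]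
  [CompactSpace D] [T2Space Z]

/-- A space obtained from the closed set `A` by attaching a cell: maps out of the parametrized
space are given by compatible maps on `A` and on the cell. -/
lemma exists_glue_cell {P T : Type*} [TopologicalSpace P] [TopologicalSpace T]
    (c : BallChart V D) {A : Set Z} (hA : IsClosed A) (Q : C(D, Z))
    (hQb : ∀ y ∈ c.bd, Q y ∈ A) (hQi : ∀ y, y ∉ c.bd → Q y ∉ A)
    (hinj : ∀ y y', y ∉ c.bd → y' ∉ c.bd → Q y = Q y' → y = y')
    (a : Z × P → T) (ha : ContinuousOn a (A ×ˢ univ)) (Ψ : C(D × P, T))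
    (haΨ : ∀ y ∈ c.bd, ∀ p, Ψ (y, p) = a (Q y, p)) :
    ∃ g : Z × P → T, ContinuousOn g ((A ∪ range Q) ×ˢ univ) ∧ (∀ z ∈ A, ∀ p, g (z, p) = a (z, p)) ∧
      ∀ y p, g (Q y, p) = Ψ (y, p) := by
  classical
  let g : Z × P → T := fun q => if h : ∃ y, y ∉ c.bd ∧ Q y = q.1 then Ψ (h.choose, q.2) else a q
  have h1 : ∀ z ∈ A, ∀ p, g (z, p) = a (z, p) := fun z hz p => by
    refine dif_neg ?_
    rintro ⟨y, hy, rfl⟩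
    exact hQi y hy hz
  have h2 : ∀ y p, g (Q y, p) = Ψ (y, p) := by
    intro y p
    by_cases hy : y ∈ c.bd
    · rw [h1 _ (hQb y hy), haΨ y hy]
    · have h : ∃ y', y' ∉ c.bd ∧ Q y' = Q y := ⟨y, hy, rfl⟩
      have e : g (Q y, p) = Ψ (h.choose, p) := dif_pos h
      rw [e, hinj _ y h.choose_spec.1 hy h.choose_spec.2]
  refine ⟨g, ?_, h1, h2⟩
  rw [union_prod]
  have hQ : IsProperMap Q := Q.continuous.isProperMap
  refine ContinuousOn.union_of_isClosed ?_ ?_ (hA.prod isClosed_univ)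
    ((isCompact_range Q.continuous).isClosed.prod isClosed_univ)
  · exact ha.congr fun q hq => h1 q.1 hq.1 q.2
  · rw [continuousOn_iff_isClosed]
    intro C hC
    refine ⟨Prod.map Q id '' (Ψ ⁻¹' C), (hQ.prodMap isProperMap_id).isClosedMap _
      (hC.preimage Ψ.continuous), ?_⟩
    ext ⟨z, p⟩
    constructor
    · rintro ⟨hz, ⟨y, rfl⟩, -⟩
      exact ⟨⟨(y, p), by simpa [h2] using hz, rfl⟩, ⟨y, rfl⟩, trivial⟩
    · rintro ⟨⟨⟨y, p'⟩, hy, he⟩, hz⟩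
      simp only [Prod.map_apply, id_eq, Prod.mk.injEq] at he
      obtain ⟨rfl, rfl⟩ := he
      exact ⟨by simpa [h2] using hy, hz⟩

/-- A map from a compact subset of a Euclidean space of dimension less than that of an attached cell
can be pushed off the cell: approximate it near the centre of the cell by a smooth map, which
misses the centre up to a translation, and project radially. -/
theorem compressible_cell [FiniteDimensional ℝ V] (c : BallChart V D) {A : Set Z}
    (hA : IsClosed A) (Q : C(D, Z))
    (hQb : ∀ y ∈ c.bd, Q y ∈ A) (hQi : ∀ y, y ∉ c.bd → Q y ∉ A)
    (hinj : ∀ y y', y ∉ c.bd → y' ∉ c.bd → Q y = Q y' → y = y') {d : ℕ}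
    (hd : d < Module.finrank ℝ V) : Compressible A (A ∪ range Q) d := by
  intro K _ _ k hk j hj u hu
  have hsplit : ∀ s, u s ∈ A ∨ ∃ y, u s = Q y := fun s => by
    rcases hu s with h | ⟨y, hy⟩
    exacts [Or.inl h, Or.inr ⟨y, hy.symm⟩]
  -- a coordinate function of the cell, damped near the boundary
  obtain ⟨F₀, hF₀c, hF₀A, hF₀Q⟩ := exists_glue_cell (P := Unit) c hA Q hQb hQi hinj
    (fun _ => (0 : V)) continuousOn_const
    ⟨fun q => (min 1 (2 * (1 - ‖c.emb q.1‖))) • c.emb q.1, by fun_prop⟩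
    (fun y hy p => by
      have hy' : ‖c.emb y‖ = 1 := hy
      simp [hy'])
  let F : C(K, V) := ⟨fun s => F₀ (u s, ()), hF₀c.comp_continuous (by fun_prop)
    fun s => ⟨hu s, trivial⟩⟩
  obtain ⟨P, hP0, hPF⟩ := exists_approx_ne_zero (hk.trans_lt hd) j hj F (show (0 : ℝ) < 1 / 8 by
    norm_num)
  -- First homotopy: replace the coordinate function `F` by the approximation `P` near the centre
  -- of the cell. The cutoff `lam` is 1 up to radius `1 / 4` and 0 from radius `1 / 2` on; between
  -- these radii the correction, of norm less than `1 / 8`, is too small to reach the centre.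
  let lam : ℝ → ℝ := fun r => max 0 (min 1 (2 - 4 * r))
  have hlam : Continuous lam := by fun_prop
  have hlam1 : ∀ r, |lam r| ≤ 1 := fun r => by
    rw [abs_of_nonneg (le_max_left _ _)]
    exact max_le zero_le_one (min_le_left _ _)
  let G₁ : C(D × (I × K), D) := ⟨fun q => c.ret (c.emb q.1 +
    ((q.2.1 : ℝ) * lam ‖c.emb q.1‖) • (P q.2.2 - F q.2.2)), by fun_prop⟩
  have hG₁b : ∀ y ∈ c.bd, ∀ p, G₁ (y, p) = y := fun y hy p => by
    have hy' : ‖c.emb y‖ = 1 := hy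
    simp only [G₁, ContinuousMap.coe_mk, hy', lam]
    norm_num
    exact c.ret_emb y
  obtain ⟨g₁, hg₁c, hg₁A, hg₁Q⟩ := exists_glue_cell c hA Q hQb hQi hinj
    (fun q : Z × (I × K) => q.1) continuousOn_fst (Q.comp G₁)
    (fun y hy p => by simp [hG₁b y hy p])
  let H₁ : C(I × K, Z) := ⟨fun q => g₁ (u q.2, q), hg₁c.comp_continuous (by fun_prop)
    fun q => ⟨hu q.2, trivial⟩⟩
  have hne : ∀ y s, u s = Q y → c.emb (G₁ (y, (1, s))) ≠ 0 := by
    intro y s hus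
    have hFs : F s = (min 1 (2 * (1 - ‖c.emb y‖))) • c.emb y := by
      show F₀ (u s, ()) = _
      rw [hus, hF₀Q]; rfl
    have h0 : c.emb y + lam ‖c.emb y‖ • (P s - F s) ≠ 0 := by
      rcases le_total ‖c.emb y‖ (1 / 4) with h | h
      · rw [min_eq_left (by linarith), one_smul] at hFs
        have : lam ‖c.emb y‖ = 1 := by
          simp only [lam]
          rw [min_eq_left (by linarith), max_eq_right zero_le_one]
        rw [this, one_smul, hFs, add_sub_cancel]
        exact hP0 s
      · intro h0
        have h1 : c.emb y = -(lam ‖c.emb y‖ • (P s - F s)) := eq_neg_of_add_eq_zero_left h0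
        have h2 : ‖c.emb y‖ ≤ ‖P s - F s‖ := by
          calc ‖c.emb y‖ = |lam ‖c.emb y‖| * ‖P s - F s‖ := by
                conv_lhs => rw [h1, norm_neg, norm_smul, Real.norm_eq_abs]
            _ ≤ 1 * ‖P s - F s‖ := by gcongr; exact hlam1 _
            _ = _ := one_mul _
        linarith [hPF s]
    simp only [G₁, ContinuousMap.coe_mk, c.emb_ret, Set.Icc.coe_one, one_mul]
    refine smul_ne_zero (inv_ne_zero ?_) h0
    exact (lt_max_of_lt_left one_pos).ne'
  -- by compactness the new map avoids a neighbourhood of the centre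
  obtain ⟨δ, hδ0, hδ1, hδ⟩ : ∃ δ : ℝ, 0 < δ ∧ δ ≤ 1 ∧
      ∀ y s, u s = Q y → δ ≤ ‖c.emb (G₁ (y, (1, s)))‖ := by
    let M : Set (D × K) := {q | u q.2 = Q q.1}
    have hM : IsCompact M := (isClosed_eq (by fun_prop) (by fun_prop)).isCompact
    rcases M.eq_empty_or_nonempty with h | h
    · refine ⟨1, one_pos, le_rfl, fun y s hys => ?_⟩
      have : (y, s) ∈ M := hys
      rw [h] at this
      exact this.elim
    · obtain ⟨q, hq, hmin⟩ := hM.exists_isMinOn h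
        (f := fun q : D × K => ‖c.emb (G₁ (q.1, (1, q.2)))‖) (by fun_prop)
      exact ⟨_, norm_pos_iff.2 (hne q.1 q.2 hq), c.norm_emb_le _, fun y s hys =>
        hmin (show (y, s) ∈ M from hys)⟩
  -- Second homotopy: push radially outwards, until all points at distance at least `δ` from the
  -- centre have reached the boundary.
  let G₂ : C(D × I, D) := ⟨fun q => c.ret (((1 - (q.2 : ℝ)) +
    (q.2 : ℝ) * (max ‖c.emb q.1‖ δ)⁻¹) • c.emb q.1), by
      have : Continuous fun q : D × I => (max ‖c.emb q.1‖ δ)⁻¹ :=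
        .inv₀ (by fun_prop) fun q => (lt_max_of_lt_right hδ0).ne'
      fun_prop⟩
  have hG₂b : ∀ y ∈ c.bd, ∀ p, G₂ (y, p) = y := fun y hy p => by
    have hy' : ‖c.emb y‖ = 1 := hy
    simp only [G₂, ContinuousMap.coe_mk, hy', max_eq_left hδ1]
    norm_num
    exact c.ret_emb y
  have hG₂1 : ∀ y, δ ≤ ‖c.emb y‖ → G₂ (y, 1) ∈ c.bd := fun y hy => by
    show ‖c.emb (c.ret _)‖ = 1
    have hy0 : 0 < ‖c.emb y‖ := hδ0.trans_le hy
    rw [c.emb_ret, BallChart.norm_clamp, norm_smul]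
    simp only [Set.Icc.coe_one, sub_self, zero_add, one_mul, max_eq_left hy]
    rw [Real.norm_of_nonneg (inv_nonneg.2 hy0.le), inv_mul_cancel₀ hy0.ne', min_self]
  obtain ⟨g₂, hg₂c, hg₂A, hg₂Q⟩ := exists_glue_cell c hA Q hQb hQi hinj
    (fun q : Z × I => q.1) continuousOn_fst (Q.comp G₂)
    (fun y hy p => by simp [hG₂b y hy p])
  have hH₁ : ∀ s, H₁ (1, s) ∈ A ∪ range Q := fun s => by
    rcases hsplit s with h | ⟨y, hy⟩
    · left; simpa [H₁, hg₁A _ h] using h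
    · right; simp [H₁, hy, hg₁Q]
  let H₂ : C(I × K, Z) := ⟨fun q => g₂ (H₁ (1, q.2), q.1), hg₂c.comp_continuous (by fun_prop)
    fun q => ⟨hH₁ q.2, trivial⟩⟩
  have hH₁0 : ∀ s, H₁ (0, s) = u s := fun s => by
    rcases hsplit s with h | ⟨y, hy⟩
    · exact hg₁A _ h _
    · show g₁ (u s, (0, s)) = _
      rw [hy, hg₁Q]
      simp [G₁, c.ret_emb]
  have hH₂0 : ∀ s, H₂ (0, s) = H₁ (1, s) := fun s => by
    show g₂ (H₁ (1, s), 0) = _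
    rcases hH₁ s with h | ⟨y, hy⟩
    · exact hg₂A _ h _
    · rw [← hy, hg₂Q]
      simp [G₂, c.ret_emb]
  have hA₁ : ∀ s, u s ∈ A → ∀ t, H₁ (t, s) = u s := fun s hs t => hg₁A _ hs _
  have hA₂ : ∀ s, u s ∈ A → ∀ t, H₂ (t, s) = u s := fun s hs t => by
    show g₂ (H₁ (1, s), t) = _
    rw [hA₁ s hs, hg₂A _ hs]
  obtain ⟨H, h0, h1, h2⟩ := exists_homotopy_trans H₁ H₂ hH₂0
  refine ⟨H, fun s => (h0 s).trans (hH₁0 s), fun s => ?_,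
    fun s hs t => h2 s _ (hA₁ s hs) (hA₂ s hs) t⟩
  rw [h1 s]
  rcases hsplit s with h | ⟨y, hy⟩
  · rw [hA₂ s h]; exact h
  · show g₂ (g₁ (u s, (1, s)), 1) ∈ A
    rw [hy, hg₁Q]
    simp only [ContinuousMap.comp_apply]
    rw [hg₂Q]
    exact hQb _ (hG₂1 _ (hδ y s hy))

end Compression

/-! ### Pointed maps, pointed homotopies and reduced suspensions -/

@[ext]
lemma PtdMap.ext {X : PtdSpace.{u}} {Y : PtdSpace.{v}} {f g : PtdMap X Y}
    (h : ∀ x, f.toMap x = g.toMap x) : f = g := by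
  cases f; cases g; congr; exact ContinuousMap.ext h

/-- The identity map. -/
def PtdMap.id (X : PtdSpace.{u}) : PtdMap X X := ⟨ContinuousMap.id _, rfl⟩

/-- The composition of pointed maps. -/
def PtdMap.comp {X : PtdSpace.{u}} {Y : PtdSpace.{v}} {Z : PtdSpace.{w}} (g : PtdMap Y Z)
    (f : PtdMap X Y) : PtdMap X Z :=
  ⟨g.toMap.comp f.toMap, by simp [f.map_pt, g.map_pt]⟩

/-- Pointed homotopy of pointed maps. -/
def PtdMap.Htpy {X : PtdSpace.{u}} {Y : PtdSpace.{v}} (f g : PtdMap X Y) : Prop :=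
  ∃ H : C(I × X, Y), (∀ x, H (0, x) = f.toMap x) ∧ (∀ x, H (1, x) = g.toMap x) ∧
    ∀ t, H (t, X.pt) = Y.pt

namespace PtdMap

variable {X : PtdSpace.{u}} {Y : PtdSpace.{v}} {Z : PtdSpace.{w}}

lemma Htpy.refl (f : PtdMap X Y) : f.Htpy f :=
  ⟨⟨fun q => f.toMap q.2, by fun_prop⟩, fun _ => rfl, fun _ => rfl, fun _ => f.map_pt⟩

lemma Htpy.symm {f g : PtdMap X Y} (h : f.Htpy g) : g.Htpy f := by
  obtain ⟨H, h0, h1, h2⟩ := h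
  exact ⟨H.comp ⟨fun q => (σ q.1, q.2), by fun_prop⟩, fun x => by simp [h1], fun x => by simp [h0],
    fun t => h2 _⟩

lemma Htpy.trans {f g h : PtdMap X Y} (hfg : f.Htpy g) (hgh : g.Htpy h) : f.Htpy h := by
  obtain ⟨H, h0, h1, h2⟩ := hfg
  obtain ⟨H', h0', h1', h2'⟩ := hgh
  obtain ⟨G, g0, g1, g2⟩ := exists_homotopy_trans H H' fun s => by rw [h0', h1]
  exact ⟨G, fun x => by rw [g0, h0], fun x => by rw [g1, h1'], g2 _ _ h2 h2'⟩

lemma Htpy.comp_left {f g : PtdMap X Y} (k : PtdMap Y Z) (h : f.Htpy g) :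
    (k.comp f).Htpy (k.comp g) := by
  obtain ⟨H, h0, h1, h2⟩ := h
  exact ⟨k.toMap.comp H, fun x => by simp [h0, PtdMap.comp], fun x => by simp [h1, PtdMap.comp],
    fun t => by simp [h2, k.map_pt]⟩

lemma Htpy.comp_right {f g : PtdMap Y Z} (h : f.Htpy g) (k : PtdMap X Y) :
    (f.comp k).Htpy (g.comp k) := by
  obtain ⟨H, h0, h1, h2⟩ := h
  exact ⟨H.comp ⟨fun q => (q.1, k.toMap q.2), by fun_prop⟩, fun x => by simp [h0, PtdMap.comp],
    fun x => by simp [h1, PtdMap.comp], fun t => by simp [h2, k.map_pt]⟩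

end PtdMap

lemma isQuotientMap_suspMk (X : PtdSpace.{u}) : IsQuotientMap (suspMk X) :=
  isQuotientMap_quotient_mk'

lemma suspMk_surjective (X : PtdSpace.{u}) : Function.Surjective (suspMk X) :=
  (isQuotientMap_suspMk X).surjective

lemma suspMk_eq_iff (X : PtdSpace.{u}) {p q : X × I} :
    suspMk X p = suspMk X q ↔ p = q ∨ p ∈ suspBase X ∧ q ∈ suspBase X :=
  ⟨fun h => Quotient.exact (s := collapse (suspBase X)) h,
    fun h => Quotient.sound (s := collapse (suspBase X)) h⟩

lemma pt_mem_suspBase (X : PtdSpace.{u}) (t : I) : (X.pt, t) ∈ suspBase X := Or.inr (Or.inr rfl)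

lemma suspMk_eq_pt_iff (X : PtdSpace.{u}) {p : X × I} :
    suspMk X p = (susp X).pt ↔ p ∈ suspBase X := by
  refine ⟨fun h => ?_, suspMk_eq_pt X⟩
  rw [← suspMk_eq_pt X (pt_mem_suspBase X 0)] at h
  rcases (suspMk_eq_iff X).1 h with h | h
  · rw [h]; exact pt_mem_suspBase X 0
  · exact h.1

/-- The map of reduced suspensions induced by a pointed map. -/
def suspMap {X : PtdSpace.{u}} {Y : PtdSpace.{v}} (f : PtdMap X Y) :
    PtdMap (susp X) (susp Y) where
  toMap := ⟨Quotient.lift (s := collapse (suspBase X)) (fun p => suspMk Y (f.toMap p.1, p.2)) (by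
      have key : ∀ p ∈ suspBase X, (f.toMap p.1, p.2) ∈ suspBase Y := by
        rintro p (h | h | h)
        · exact Or.inl h
        · exact Or.inr (Or.inl h)
        · exact Or.inr (Or.inr (by rw [h]; exact f.map_pt))
      rintro p q (rfl | ⟨hp, hq⟩)
      · rfl
      · rw [suspMk_eq_pt Y (key p hp), suspMk_eq_pt Y (key q hq)]),
    Continuous.quotient_lift (by fun_prop) _⟩
  map_pt := by
    show suspMk Y (f.toMap X.pt, 0) = _
    exact suspMk_eq_pt Y (Or.inl rfl)

@[simp]
lemma suspMap_mk {X : PtdSpace.{u}} {Y : PtdSpace.{v}} (f : PtdMap X Y) (p : X × I) :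
    (suspMap f).toMap (suspMk X p) = suspMk Y (f.toMap p.1, p.2) := rfl

lemma suspMap_comp {X : PtdSpace.{u}} {Y : PtdSpace.{v}} {Z : PtdSpace.{w}} (g : PtdMap Y Z)
    (f : PtdMap X Y) : suspMap (g.comp f) = (suspMap g).comp (suspMap f) := by
  refine PtdMap.ext fun x => ?_
  obtain ⟨p, rfl⟩ := suspMk_surjective X x
  rfl

lemma suspMap_id (X : PtdSpace.{u}) : suspMap (PtdMap.id X) = PtdMap.id (susp X) := by
  refine PtdMap.ext fun x => ?_
  obtain ⟨p, rfl⟩ := suspMk_surjective X x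
  rfl

lemma PtdMap.Htpy.suspMap {X : PtdSpace.{u}} {Y : PtdSpace.{v}} {f g : PtdMap X Y}
    (h : f.Htpy g) : (suspMap f).Htpy (suspMap g) := by
  obtain ⟨H, h0, h1, h2⟩ := h
  let K : I → susp X → susp Y := fun t => (OneStep.suspMap
    (⟨H.comp ⟨fun x => (t, x), by fun_prop⟩, h2 t⟩ : PtdMap X Y)).toMap
  have hK : ∀ t p, K t (suspMk X p) = suspMk Y (H (t, p.1), p.2) := fun t p => rfl
  refine ⟨⟨fun q => K q.1 q.2, ?_⟩, fun x => ?_, fun x => ?_, fun t => ?_⟩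
  · refine (isQuotientMap_suspMk X).continuous_lift_prod_right ?_
    simp only [hK]
    fun_prop
  · obtain ⟨p, rfl⟩ := suspMk_surjective X x
    simp [hK, h0]
  · obtain ⟨p, rfl⟩ := suspMk_surjective X x
    simp [hK, h1]
  · exact (OneStep.suspMap (⟨H.comp ⟨fun x => (t, x), by fun_prop⟩, h2 t⟩ : PtdMap X Y)).map_pt

/-- The iterated suspension of a pointed map. -/
def iterSuspMap {X : PtdSpace.{u}} {Y : PtdSpace.{v}} (f : PtdMap X Y) :
    ∀ N, PtdMap (iterSusp X N) (iterSusp Y N)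
  | 0 => f
  | N + 1 => suspMap (iterSuspMap f N)

lemma iterSuspMap_comp {X : PtdSpace.{u}} {Y : PtdSpace.{v}} {Z : PtdSpace.{w}} (g : PtdMap Y Z)
    (f : PtdMap X Y) (N : ℕ) :
    iterSuspMap (g.comp f) N = (iterSuspMap g N).comp (iterSuspMap f N) := by
  induction N with
  | zero => rfl
  | succ N ih =>
    show suspMap _ = (suspMap _).comp (suspMap _)
    rw [ih, suspMap_comp]

lemma iterSuspMap_id (X : PtdSpace.{u}) (N : ℕ) :
    iterSuspMap (PtdMap.id X) N = PtdMap.id (iterSusp X N) := by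
  induction N with
  | zero => rfl
  | succ N ih =>
    show suspMap _ = _
    rw [ih, suspMap_id]; rfl

lemma PtdMap.Htpy.iterSuspMap {X : PtdSpace.{u}} {Y : PtdSpace.{v}} {f g : PtdMap X Y}
    (h : f.Htpy g) (N : ℕ) : (iterSuspMap f N).Htpy (iterSuspMap g N) := by
  induction N with
  | zero => exact h
  | succ N ih => exact ih.suspMap

/-- The canonical map from the product with a cube onto the iterated suspension. -/
def suspCube (X : PtdSpace.{u}) : ∀ N, C(X × (Fin N → I), iterSusp X N)
  | 0 => ⟨fun q => q.1, continuous_fst⟩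
  | N + 1 => (suspMk (iterSusp X N)).comp
      ⟨fun q => (suspCube X N (q.1, fun i => q.2 i.succ), q.2 0), by fun_prop⟩

lemma suspCube_succ (X : PtdSpace.{u}) (N : ℕ) (q : X × (Fin (N + 1) → I)) :
    suspCube X (N + 1) q = suspMk _ (suspCube X N (q.1, fun i => q.2 i.succ), q.2 0) := rfl

lemma iterSuspMap_suspCube {X : PtdSpace.{u}} {Y : PtdSpace.{v}} (f : PtdMap X Y) (N : ℕ)
    (q : X × (Fin N → I)) :
    (iterSuspMap f N).toMap (suspCube X N q) = suspCube Y N (f.toMap q.1, q.2) := by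
  induction N with
  | zero => rfl
  | succ N ih =>
    show suspMk _ ((iterSuspMap f N).toMap (suspCube X N _), _) = _
    rw [ih]; rfl

/-- The product of a quotient map with the identity of a locally compact space. -/
lemma isQuotientMap_prodMap_id {A B Y : Type*} [TopologicalSpace A] [TopologicalSpace B]
    [TopologicalSpace Y] [LocallyCompactSpace Y] {f : A → B} (hf : IsQuotientMap f) :
    IsQuotientMap (Prod.map f (_root_.id : Y → Y)) := by
  refine (isQuotientMap_iff _).2 ⟨isCoinducing_iff.2 fun s => ⟨fun hs => ?_, fun hs =>
    hs.preimage (hf.continuous.prodMap continuous_id)⟩,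
    hf.surjective.prodMap Function.surjective_id⟩
  rw [isOpen_iff_continuous_mem] at hs ⊢
  exact hf.continuous_lift_prod_left hs

/-- Splitting off the first coordinate of a cube. -/
def splitFirst (T : Type*) [TopologicalSpace T] (N : ℕ) :
    T × (Fin (N + 1) → I) ≃ₜ (T × (Fin N → I)) × I where
  toFun q := ((q.1, fun i => q.2 i.succ), q.2 0)
  invFun r := (r.1.1, Fin.cons r.2 r.1.2)
  left_inv q := by
    ext1
    · rfl
    · exact Fin.cons_self_tail q.2
  right_inv r := by simp
  continuous_toFun := by fun_prop
  continuous_invFun := by fun_prop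

lemma isQuotientMap_suspCube (X : PtdSpace.{u}) (N : ℕ) : IsQuotientMap (suspCube X N) := by
  induction N with
  | zero =>
    exact (Homeomorph.prodUnique X (Fin 0 → I)).isQuotientMap
  | succ N ih =>
    exact ((isQuotientMap_suspMk _).comp (isQuotientMap_prodMap_id (Y := I) ih)).comp
      (splitFirst X N).isQuotientMap

/-- The part of the product with a cube that is collapsed in the iterated suspension. -/
def cubeBase (X : PtdSpace.{u}) (N : ℕ) : Set (X × (Fin N → I)) :=
  {q | q.1 = X.pt ∨ q.2 ∈ Cube.boundary (Fin N)}

lemma mem_boundary_succ {N : ℕ} {s : Fin (N + 1) → I} :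
    s ∈ Cube.boundary (Fin (N + 1)) ↔ s 0 = 0 ∨ s 0 = 1 ∨ (fun i => s i.succ) ∈
      Cube.boundary (Fin N) := by
  constructor
  · rintro ⟨i, hi⟩
    induction i using Fin.cases with
    | zero => tauto
    | succ i => exact Or.inr (Or.inr ⟨i, hi⟩)
  · rintro (h | h | ⟨i, hi⟩)
    exacts [⟨0, Or.inl h⟩, ⟨0, Or.inr h⟩, ⟨i.succ, hi⟩]

lemma suspCube_eq_pt_iff (X : PtdSpace.{u}) {N : ℕ} {q : X × (Fin N → I)} :
    suspCube X N q = (iterSusp X N).pt ↔ q ∈ cubeBase X N := by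
  induction N with
  | zero =>
    refine ⟨fun h => Or.inl h, ?_⟩
    rintro (h | ⟨i, -⟩)
    exacts [h, i.elim0]
  | succ N ih =>
    rw [suspCube_succ]
    refine (suspMk_eq_pt_iff _).trans ?_
    show _ ∨ _ ∨ _ ↔ q.1 = X.pt ∨ q.2 ∈ _
    rw [ih, mem_boundary_succ]
    show _ ∨ _ ∨ (q.1 = X.pt ∨ _) ↔ _
    tauto

lemma suspCube_eq_iff (X : PtdSpace.{u}) {N : ℕ} {q q' : X × (Fin N → I)} :
    suspCube X N q = suspCube X N q' ↔ q = q' ∨ q ∈ cubeBase X N ∧ q' ∈ cubeBase X N := by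
  refine ⟨fun h => ?_, ?_⟩
  · by_cases hq : q ∈ cubeBase X N
    · exact Or.inr ⟨hq, (suspCube_eq_pt_iff X).1 (h ▸ (suspCube_eq_pt_iff X).2 hq)⟩
    left
    induction N with
    | zero => exact Prod.ext h (Subsingleton.elim _ _)
    | succ N ih =>
      rw [suspCube_succ, suspCube_succ] at h
      rcases (suspMk_eq_iff _).1 h with h' | h'
      · obtain ⟨h1, h2⟩ := Prod.mk.inj h'
        have hq' : (q.1, fun i => q.2 i.succ) ∉ cubeBase X N := by
          rintro (h | h)
          exacts [hq (Or.inl h), hq (Or.inr (mem_boundary_succ.2 (Or.inr (Or.inr h))))]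
        have h3 := ih h1 hq'
        obtain ⟨h4, h5⟩ := Prod.mk.inj h3
        refine Prod.ext h4 ?_
        rw [← Fin.cons_self_tail q.2, ← Fin.cons_self_tail q'.2, h2]
        exact congrArg _ h5
      · exfalso
        apply hq
        have := (suspMk_eq_pt_iff _).2 h'.1
        exact (suspCube_eq_pt_iff X (N := N + 1)).1 this
  · rintro (rfl | ⟨h1, h2⟩)
    · rfl
    · rw [(suspCube_eq_pt_iff X).2 h1, (suspCube_eq_pt_iff X).2 h2]

lemma suspCube_surjective (X : PtdSpace.{u}) (N : ℕ) : Function.Surjective (suspCube X N) :=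
  (isQuotientMap_suspCube X N).surjective

/-- A parametrized map out of the product with a cube that is constant on the collapsed part
descends to the iterated suspension. -/
lemma exists_desc_suspCube (X : PtdSpace.{u}) (N : ℕ) {P Z : Type*} [TopologicalSpace P]
    [LocallyCompactSpace P] [TopologicalSpace Z] (f : C(P × (X × (Fin N → I)), Z)) (z : P → Z)
    (hf : ∀ p, ∀ q ∈ cubeBase X N, f (p, q) = z p) :
    ∃ F : C(P × iterSusp X N, Z), (∀ p q, F (p, suspCube X N q) = f (p, q)) ∧
      ∀ p, F (p, (iterSusp X N).pt) = z p := by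
  let F : P × iterSusp X N → Z := fun r => f (r.1, Function.surjInv (suspCube_surjective X N) r.2)
  have hF : ∀ p q, F (p, suspCube X N q) = f (p, q) := fun p q => by
    have h := Function.surjInv_eq (suspCube_surjective X N) (suspCube X N q)
    rcases (suspCube_eq_iff X).1 h with h' | ⟨h1, h2⟩
    · simp only [F, h']
    · simp only [F]; rw [hf _ _ h1, hf _ _ h2]
  refine ⟨⟨F, (isQuotientMap_suspCube X N).continuous_lift_prod_right ?_⟩, hF, fun p => ?_⟩
  · simp only [hF]
    exact f.continuous
  · have : (X.pt, fun _ => 0) ∈ cubeBase X N := Or.inl rfl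
    rw [← hf p _ this, ← hF p, (suspCube_eq_pt_iff X).2 this]
    rfl

/-- A pointed map out of an iterated suspension from a map on the product with a cube. -/
lemma exists_ptdMap_of_cube (X : PtdSpace.{u}) (N : ℕ) (Y : PtdSpace.{v})
    (f : C(X × (Fin N → I), Y)) (hf : ∀ q ∈ cubeBase X N, f q = Y.pt) :
    ∃ F : PtdMap (iterSusp X N) Y, ∀ q, F.toMap (suspCube X N q) = f q := by
  obtain ⟨F, h1, h2⟩ := exists_desc_suspCube X N (P := Unit) (f.comp ⟨fun r => r.2, by fun_prop⟩)
    (fun _ => Y.pt) (fun _ q hq => hf q hq)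
  exact ⟨⟨F.comp ⟨fun x => ((), x), by fun_prop⟩, h2 ()⟩, h1 ()⟩

/-- Pointed homotopies of maps out of an iterated suspension, described on the product with a
cube. -/
lemma htpy_of_cube {X : PtdSpace.{u}} {N : ℕ} {Y : PtdSpace.{v}}
    {F G : PtdMap (iterSusp X N) Y} (H : C(I × (X × (Fin N → I)), Y))
    (h0 : ∀ q, H (0, q) = F.toMap (suspCube X N q))
    (h1 : ∀ q, H (1, q) = G.toMap (suspCube X N q))
    (hb : ∀ t, ∀ q ∈ cubeBase X N, H (t, q) = Y.pt) : F.Htpy G := by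
  obtain ⟨K, hK1, hK2⟩ := exists_desc_suspCube X N H (fun _ => Y.pt) hb
  refine ⟨K, fun x => ?_, fun x => ?_, hK2⟩
  · obtain ⟨q, rfl⟩ := suspCube_surjective X N x
    rw [hK1, h0]
  · obtain ⟨q, rfl⟩ := suspCube_surjective X N x
    rw [hK1, h1]

lemma isClosed_cubeBoundary (N : ℕ) : IsClosed (Cube.boundary (Fin N)) := by
  have : Cube.boundary (Fin N) = (BallChart.cube (Fin N)).bd := by
    ext t; exact BallChart.mem_bd_cube.symm
  rw [this]
  exact BallChart.isClosed_bd _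

lemma isClosed_suspBase (X : PtdSpace.{u}) (h : IsClosed ({X.pt} : Set X)) :
    IsClosed (suspBase X) :=
  (isClosed_eq continuous_snd continuous_const).union
    ((isClosed_eq continuous_snd continuous_const).union (h.preimage continuous_fst))

instance t2Space_susp (X : PtdSpace.{u}) [T2Space X] : T2Space (susp X) := by
  -- two points away from the base point are separated in the cylinder
  have hbase : IsClosed (suspBase X) := isClosed_suspBase X isClosed_singleton
  have hq := isQuotientMap_suspMk X
  have hsep : ∀ p q : X × I, p ∉ suspBase X → suspMk X p ≠ suspMk X q →
      ∃ U V : Set (susp X), IsOpen U ∧ IsOpen V ∧ suspMk X p ∈ U ∧ suspMk X q ∈ V ∧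
        Disjoint U V := by
    intro p q hp hpq
    -- an open subset of the cylinder away from the base gives an open set
    have hopen : ∀ O : Set (X × I), IsOpen O → Disjoint O (suspBase X) →
        IsOpen (suspMk X '' O) := by
      intro O hO hd
      rw [← hq.isOpen_preimage]
      convert hO using 1
      ext r
      constructor
      · rintro ⟨r', hr', h⟩
        rcases (suspMk_eq_iff X).1 h with rfl | ⟨h1, -⟩
        · exact hr'
        · exact (hd.le_bot ⟨hr', h1⟩).elim
      · exact fun hr => ⟨r, hr, rfl⟩
    by_cases hqb : q ∈ suspBase X
    · -- separate `p` from the whole base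
      have hp1 : p.1 ≠ X.pt := fun h => hp (Or.inr (Or.inr h))
      obtain ⟨U, V, hU, hV, hpU, hptV, hUV⟩ := t2_separation hp1
      obtain ⟨a, ha0, hap⟩ : ∃ a : ℝ, 0 < a ∧ a < p.2 := by
        refine exists_between (lt_of_le_of_ne p.2.2.1 fun h => hp (Or.inl (Subtype.ext h.symm)))
      obtain ⟨b, hpb, hb1⟩ : ∃ b : ℝ, (p.2 : ℝ) < b ∧ b < 1 := by
        refine exists_between (lt_of_le_of_ne p.2.2.2 fun h => hp (Or.inr (Or.inl (Subtype.ext h))))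
      let O : Set (X × I) := {r | r.1 ∈ U ∧ a < (r.2 : ℝ) ∧ (r.2 : ℝ) < b}
      let O' : Set (X × I) := {r | r.1 ∈ V ∨ (r.2 : ℝ) < a ∨ b < (r.2 : ℝ)}
      have hOO' : Disjoint O O' := by
        rw [Set.disjoint_left]
        rintro r ⟨h1, h2, h3⟩ (h | h | h)
        · exact hUV.le_bot ⟨h1, h⟩
        · linarith
        · linarith
      have hbO' : suspBase X ⊆ O' := by
        rintro r (h | h | h)
        · right; left; rw [h]; simpa using ha0
        · right; right; rw [h]; simpa using hb1
        · left; rw [h]; exact hptV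
      have hO : IsOpen O := (hU.preimage continuous_fst).inter
        ((isOpen_lt continuous_const (continuous_subtype_val.comp continuous_snd)).inter
          (isOpen_lt (continuous_subtype_val.comp continuous_snd) continuous_const))
      have hO' : IsOpen O' := (hV.preimage continuous_fst).union
        ((isOpen_lt (continuous_subtype_val.comp continuous_snd) continuous_const).union
          (isOpen_lt continuous_const (continuous_subtype_val.comp continuous_snd)))
      have hsat : suspMk X ⁻¹' (suspMk X '' O') = O' := by
        ext r
        constructor
        · rintro ⟨r', hr', h⟩
          rcases (suspMk_eq_iff X).1 h with rfl | ⟨-, h1⟩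
          exacts [hr', hbO' h1]
        · exact fun hr => ⟨r, hr, rfl⟩
      refine ⟨suspMk X '' O, suspMk X '' O', hopen O hO (hOO'.mono_right hbO'), ?_,
        mem_image_of_mem _ ⟨hpU, hap, hpb⟩, mem_image_of_mem _ (hbO' hqb), ?_⟩
      · rw [← hq.isOpen_preimage, hsat]; exact hO'
      · rw [Set.disjoint_left]
        rintro _ ⟨r, hr, rfl⟩ hr'
        have : r ∈ O' := by rw [← hsat]; exact hr'
        exact hOO'.le_bot ⟨hr, this⟩
    · have hne : p ≠ q := fun h => hpq (by rw [h])
      obtain ⟨U, V, hU, hV, hpU, hqV, hUV⟩ := t2_separation hne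
      have hU' : IsOpen (U ∩ (suspBase X)ᶜ) := hU.inter hbase.isOpen_compl
      have hV' : IsOpen (V ∩ (suspBase X)ᶜ) := hV.inter hbase.isOpen_compl
      refine ⟨suspMk X '' (U ∩ (suspBase X)ᶜ), suspMk X '' (V ∩ (suspBase X)ᶜ),
        hopen _ hU' (disjoint_compl_left.mono_left inter_subset_right),
        hopen _ hV' (disjoint_compl_left.mono_left inter_subset_right),
        mem_image_of_mem _ ⟨hpU, hp⟩, mem_image_of_mem _ ⟨hqV, hqb⟩, ?_⟩
      rw [Set.disjoint_left]
      rintro _ ⟨r, hr, rfl⟩ ⟨r', hr', h⟩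
      rcases (suspMk_eq_iff X).1 h with rfl | ⟨h1, -⟩
      · exact hUV.le_bot ⟨hr.1, hr'.1⟩
      · exact hr'.2 h1
  refine ⟨fun x y hxy => ?_⟩
  obtain ⟨p, rfl⟩ := suspMk_surjective X x
  obtain ⟨q, rfl⟩ := suspMk_surjective X y
  by_cases hp : p ∈ suspBase X
  · by_cases hqb : q ∈ suspBase X
    · exact (hxy (by rw [suspMk_eq_pt X hp, suspMk_eq_pt X hqb])).elim
    · obtain ⟨U, V, h1, h2, h3, h4, h5⟩ := hsep q p hqb hxy.symm
      exact ⟨V, U, h2, h1, h4, h3, h5.symm⟩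
  · exact hsep p q hp hxy

instance t2Space_iterSusp (X : PtdSpace.{u}) [T2Space X] (N : ℕ) : T2Space (iterSusp X N) := by
  induction N with
  | zero => assumption
  | succ N ih => exact t2Space_susp (iterSusp X N)

/-- The suspension preserves closed embeddings. -/
lemma isClosedEmbedding_suspMap {X Y : PtdSpace.{u}} (f : PtdMap X Y)
    (hf : IsClosedEmbedding f.toMap) (hY : IsClosed ({Y.pt} : Set Y)) :
    IsClosedEmbedding (suspMap f).toMap := by
  have hinj : ∀ p : X × I, (f.toMap p.1, p.2) ∈ suspBase Y ↔ p ∈ suspBase X := fun p => by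
    show _ ∨ _ ∨ f.toMap p.1 = Y.pt ↔ _ ∨ _ ∨ _
    rw [← f.map_pt, hf.injective.eq_iff]
  refine IsClosedEmbedding.of_continuous_injective_isClosedMap (suspMap f).toMap.continuous ?_ ?_
  · intro x y h
    obtain ⟨p, rfl⟩ := suspMk_surjective X x
    obtain ⟨q, rfl⟩ := suspMk_surjective X y
    rw [suspMap_mk, suspMap_mk, suspMk_eq_iff, hinj, hinj] at h
    refine (suspMk_eq_iff X).2 (h.imp_left fun h => ?_)
    exact Prod.ext (hf.injective (Prod.mk.inj h).1) (Prod.mk.inj h).2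
  · intro C hC
    rw [← (isQuotientMap_suspMk Y).isClosed_preimage]
    have hmap : IsClosedMap (Prod.map f.toMap (_root_.id : I → I)) :=
      (hf.isProperMap.prodMap isProperMap_id).isClosedMap
    have h1 : IsClosed (Prod.map f.toMap (_root_.id : I → I) '' (suspMk X ⁻¹' C)) :=
      hmap _ (hC.preimage (suspMk X).continuous)
    by_cases hpt : (susp X).pt ∈ C
    · convert h1.union (isClosed_suspBase Y hY) using 1
      ext r
      constructor
      · rintro ⟨x, hx, hxr⟩
        obtain ⟨p, rfl⟩ := suspMk_surjective X x
        rw [suspMap_mk, suspMk_eq_iff] at hxr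
        rcases hxr with h | h
        · exact Or.inl ⟨p, hx, h⟩
        · exact Or.inr h.2
      · rintro (⟨p, hp, rfl⟩ | h)
        · exact ⟨suspMk X p, hp, rfl⟩
        · exact ⟨_, hpt, ((suspMap f).map_pt).trans (suspMk_eq_pt Y h).symm⟩
    · convert h1 using 1
      ext r
      constructor
      · rintro ⟨x, hx, hxr⟩
        obtain ⟨p, rfl⟩ := suspMk_surjective X x
        rw [suspMap_mk, suspMk_eq_iff] at hxr
        rcases hxr with h | h
        · exact ⟨p, hx, h⟩
        · exact (hpt (suspMk_eq_pt X ((hinj p).1 h.1) ▸ hx)).elim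
      · rintro ⟨p, hp, rfl⟩
        exact ⟨suspMk X p, hp, rfl⟩

lemma isClosedEmbedding_iterSuspMap {X Y : PtdSpace.{u}} [T2Space Y] (f : PtdMap X Y)
    (hf : IsClosedEmbedding f.toMap) (N : ℕ) : IsClosedEmbedding (iterSuspMap f N).toMap := by
  induction N with
  | zero => exact hf
  | succ N ih => exact isClosedEmbedding_suspMap _ ih isClosed_singleton

/-! ### Compact subsets of suspended CW complexes -/

/-- A family of distinct points is locally finite if all sets of its members are closed. -/
lemma locallyFinite_singleton_of_isClosed {ι Z : Type*} [TopologicalSpace Z] (p : ι → Z)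
    (hp : Function.Injective p) (h : ∀ B : Set ι, IsClosed (p '' B)) :
    LocallyFinite fun i => ({p i} : Set Z) := by
  intro z
  refine ⟨(p '' {i | p i ≠ z})ᶜ, (h _).isOpen_compl.mem_nhds ?_, ?_⟩
  · rintro ⟨i, hi, rfl⟩
    exact hi rfl
  · refine Set.Subsingleton.finite ?_
    rintro i ⟨_, rfl, hi⟩ i' ⟨_, rfl, hi'⟩
    have h1 : p i = z := by
      by_contra hne
      exact hi ⟨i, hne, rfl⟩
    have h2 : p i' = z := by
      by_contra hne
      exact hi' ⟨i', hne, rfl⟩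
    exact hp (h1.trans h2.symm)

section Cyl

variable {Y : Type u} [TopologicalSpace Y]

/-- The iterated suspension of a subset, as a subset of the iterated suspension. -/
def cyl (y0 : Y) (N : ℕ) (S : Set Y) : Set (iterSusp ⟨Y, y0⟩ N) :=
  suspCube ⟨Y, y0⟩ N '' {q | q ∈ cubeBase ⟨Y, y0⟩ N ∨ q.1 ∈ S}

lemma suspCube_mem_cyl {y0 : Y} {N : ℕ} {S : Set Y} {q : Y × (Fin N → I)} :
    suspCube ⟨Y, y0⟩ N q ∈ cyl y0 N S ↔ q ∈ cubeBase ⟨Y, y0⟩ N ∨ q.1 ∈ S := by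
  constructor
  · rintro ⟨q', h, h'⟩
    rcases (suspCube_eq_iff _).1 h' with rfl | h1
    exacts [h, Or.inl h1.2]
  · exact fun h => ⟨q, h, rfl⟩

lemma pt_mem_cyl (y0 : Y) (N : ℕ) (S : Set Y) : (iterSusp ⟨Y, y0⟩ N).pt ∈ cyl y0 N S := by
  obtain ⟨q, hq⟩ := suspCube_surjective ⟨Y, y0⟩ N (iterSusp ⟨Y, y0⟩ N).pt
  rw [← hq]
  exact suspCube_mem_cyl.2 (Or.inl ((suspCube_eq_pt_iff _).1 hq))

lemma cyl_mono (y0 : Y) (N : ℕ) {S T : Set Y} (h : S ⊆ T) : cyl y0 N S ⊆ cyl y0 N T :=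
  image_mono fun _ hq => hq.imp_right fun hq => h hq

lemma isClosed_cubeBase (X : PtdSpace.{u}) (N : ℕ) (h : IsClosed ({X.pt} : Set X)) :
    IsClosed (cubeBase X N) :=
  (h.preimage continuous_fst).union ((isClosed_cubeBoundary N).preimage continuous_snd)

lemma isClosed_cyl [T2Space Y] (y0 : Y) (N : ℕ) {S : Set Y} (hS : IsClosed S) :
    IsClosed (cyl y0 N S) := by
  rw [← (isQuotientMap_suspCube _ N).isClosed_preimage]
  have : suspCube ⟨Y, y0⟩ N ⁻¹' cyl y0 N S = cubeBase ⟨Y, y0⟩ N ∪ Prod.fst ⁻¹' S := by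
    ext q
    exact suspCube_mem_cyl
  rw [this]
  exact (isClosed_cubeBase ⟨Y, y0⟩ N (isClosed_singleton (X := Y))).union
    (hS.preimage continuous_fst)

variable [T2Space Y] [CWComplex (Set.univ : Set Y)]

lemma openCell_unique {c c' : Σ n, Cell Y n} {x : Y} (h : x ∈ RelCWComplex.openCell c.1 c.2)
    (h' : x ∈ RelCWComplex.openCell c'.1 c'.2) : c = c' := by
  obtain ⟨y, hy, rfl⟩ := h
  obtain ⟨y', hy', h⟩ := h'
  exact chi_ball_inj hy hy' h.symm

lemma isClosed_image_of_mem_openCell {ι : Type*} (x : ι → Y) (c : ι → Σ n, Cell Y n)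
    (hc : Function.Injective c) (hx : ∀ i, x i ∈ RelCWComplex.openCell (c i).1 (c i).2)
    (B : Set ι) : IsClosed (x '' B) := by
  refine CWComplex.isClosed_of_isClosed_inter_openCell_or_isClosed_inter_closedCell
    (subset_univ _) fun n _ e => Or.inl ?_
  refine Set.Subsingleton.isClosed ?_
  rintro _ ⟨⟨i, -, rfl⟩, hi⟩ _ ⟨⟨i', -, rfl⟩, hi'⟩
  rw [hc ((openCell_unique (c' := ⟨n, e⟩) (hx i) hi).trans
    (openCell_unique (c' := ⟨n, e⟩) (hx i') hi').symm)]

/-- A compact subset of an iterated suspension of a CW complex meets, away from the base point,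
only finitely many open cells. -/
lemma finite_cells_of_isCompact (y0 : Y) (N : ℕ) {C : Set (iterSusp ⟨Y, y0⟩ N)}
    (hC : IsCompact C) : {c : Σ n, Cell Y n | ∃ q : Y × (Fin N → I), q ∉ cubeBase ⟨Y, y0⟩ N ∧
      suspCube ⟨Y, y0⟩ N q ∈ C ∧ q.1 ∈ RelCWComplex.openCell c.1 c.2}.Finite := by
  -- Points chosen in distinct open cells form a locally finite family, in the complex as well as
  -- in the suspension, and a compact set meets only finitely many of its members.
  set F := {c : Σ n, Cell Y n | ∃ q : Y × (Fin N → I), q ∉ cubeBase ⟨Y, y0⟩ N ∧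
      suspCube ⟨Y, y0⟩ N q ∈ C ∧ q.1 ∈ RelCWComplex.openCell c.1 c.2} with hF
  have hq : ∀ c : F, ∃ q : Y × (Fin N → I), q ∉ cubeBase ⟨Y, y0⟩ N ∧
      suspCube ⟨Y, y0⟩ N q ∈ C ∧ q.1 ∈ RelCWComplex.openCell c.1.1 c.1.2 := fun c => c.2
  choose q hq1 hq2 hq3 using hq
  have hfst : Function.Injective fun c => (q c).1 := by
    intro c c' h
    refine Subtype.ext (openCell_unique (hq3 c) ?_)
    have := hq3 c'
    simp only at h
    rwa [h]
  have h1 : LocallyFinite fun c => ({(q c).1} : Set Y) :=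
    locallyFinite_singleton_of_isClosed _ hfst
      (isClosed_image_of_mem_openCell _ _ Subtype.val_injective hq3)
  have h2 : LocallyFinite fun c => ({q c} : Set (Y × (Fin N → I))) :=
    (h1.preimage_continuous continuous_fst).subset fun c => by
      rintro _ rfl
      rfl
  have h3 : LocallyFinite fun c => ({suspCube ⟨Y, y0⟩ N (q c)} : Set (iterSusp ⟨Y, y0⟩ N)) := by
    have hinj : ∀ c r, suspCube ⟨Y, y0⟩ N (q c) = suspCube ⟨Y, y0⟩ N r → q c = r :=
      fun c r h => ((suspCube_eq_iff _).1 h).resolve_right fun h => hq1 c h.1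
    refine locallyFinite_singleton_of_isClosed _
      (fun c c' h => hfst (congrArg Prod.fst (hinj c _ h))) fun B => ?_
    rw [← (isQuotientMap_suspCube _ N).isClosed_preimage]
    have : suspCube ⟨Y, y0⟩ N ⁻¹' ((fun c => suspCube ⟨Y, y0⟩ N (q c)) '' B) =
        ⋃ c : B, {q c} := by
      ext r
      simp only [mem_preimage, mem_image, mem_iUnion, mem_singleton_iff]
      constructor
      · rintro ⟨c, hc, h⟩
        exact ⟨⟨c, hc⟩, (hinj c r h).symm⟩
      · rintro ⟨⟨c, hc⟩, h⟩
        exact ⟨c, hc, by rw [h]⟩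
    rw [this]
    exact (h2.comp_injective Subtype.val_injective).isClosed_iUnion fun c =>
      isClosed_singleton (X := Y × (Fin N → I))
  have h4 := h3.finite_nonempty_inter_compact hC
  have h5 : (univ : Set F).Finite := h4.subset fun c _ => ⟨_, rfl, hq2 c⟩
  exact Set.finite_coe_iff.1 (Set.finite_univ_iff.1 h5)


instance compactSpace_closedBall (n : ℕ) : CompactSpace (closedBall (0 : Fin n → ℝ) 1) :=
  isCompact_iff_compactSpace.1 (isCompact_closedBall _ _)

/-- A map from a complex of small dimension to the iterated suspension of a CW complex can be
pushed off a single cell. -/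
lemma compressible_cyl_cell (y0 : Y) (N : ℕ) {S : Set Y} (hS : IsClosed S) (h0 : y0 ∈ S) {n : ℕ}
    (e : Cell Y n) (hfr : ∀ y ∈ Metric.sphere (0 : Fin n → ℝ) 1, chi n e y ∈ S)
    (hint : ∀ y ∈ ball (0 : Fin n → ℝ) 1, chi n e y ∉ S) {d : ℕ} (hd : d < n + N) :
    Compressible (cyl y0 N S) (cyl y0 N (S ∪ RelCWComplex.closedCell n e)) d := by
  -- The product of the cell with the cube is a cell of dimension `n + N` of the suspension.
  let c := (BallChart.ball (Fin n → ℝ)).prod (BallChart.cube (Fin N))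
  let Q : C(closedBall (0 : Fin n → ℝ) 1 × (Fin N → I), iterSusp ⟨Y, y0⟩ N) :=
    (suspCube ⟨Y, y0⟩ N).comp ⟨fun q => (chi n e q.1, q.2),
      (((continuousOn_chi e).comp_continuous continuous_subtype_val
        fun y => y.2).comp continuous_fst).prodMk continuous_snd⟩
  have hQ : ∀ q, Q q = suspCube ⟨Y, y0⟩ N (chi n e q.1, q.2) := fun q => rfl
  have hbd : ∀ q, q ∉ c.bd → (q.1 : Fin n → ℝ) ∈ ball (0 : Fin n → ℝ) 1 ∧
      q.2 ∉ Cube.boundary (Fin N) := by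
    intro q hq
    rw [BallChart.mem_bd_prod, BallChart.mem_bd_ball, BallChart.mem_bd_cube, not_or] at hq
    refine ⟨?_, hq.2⟩
    have : (q.1 : Fin n → ℝ) ∈ Metric.sphere (0 : Fin n → ℝ) 1 ∪ ball 0 1 := by
      rw [sphere_union_ball]
      exact q.1.2
    exact this.resolve_left hq.1
  have hbase : ∀ q, q ∉ c.bd → ((chi n e q.1, q.2) : Y × (Fin N → I)) ∉ cubeBase ⟨Y, y0⟩ N := by
    intro q hq
    rintro (h | h)
    · refine hint _ (hbd q hq).1 ?_
      simp only at h
      rw [h]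
      exact h0
    · exact (hbd q hq).2 h
  have hrange : cyl y0 N (S ∪ RelCWComplex.closedCell n e) = cyl y0 N S ∪ range Q := by
    ext z
    constructor
    · rintro ⟨q, hq | hq | ⟨y, hy, hyq⟩, rfl⟩
      · exact Or.inl ⟨q, Or.inl hq, rfl⟩
      · exact Or.inl ⟨q, Or.inr hq, rfl⟩
      · exact Or.inr ⟨(⟨y, hy⟩, q.2), by rw [hQ]; exact congrArg _ (Prod.ext hyq rfl)⟩
    · rintro (h | ⟨q, rfl⟩)
      · exact cyl_mono y0 N subset_union_left h
      · exact suspCube_mem_cyl.2 (Or.inr (Or.inr ⟨q.1, q.1.2, rfl⟩))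
  rw [hrange]
  refine compressible_cell c (isClosed_cyl y0 N hS) Q ?_ ?_ ?_ (by simpa using hd)
  · intro q hq
    rw [BallChart.mem_bd_prod, BallChart.mem_bd_ball, BallChart.mem_bd_cube] at hq
    refine suspCube_mem_cyl.2 ?_
    rcases hq with hq | hq
    · exact Or.inr (hfr _ hq)
    · exact Or.inl (Or.inr hq)
  · intro q hq h
    rcases suspCube_mem_cyl.1 h with h | h
    · exact hbase q hq h
    · exact hint _ (hbd q hq).1 h
  · intro q q' hq hq' h
    rw [hQ, hQ] at h
    rcases (suspCube_eq_iff _).1 h with h | h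
    · obtain ⟨h1, h2⟩ := Prod.mk.inj h
      exact Prod.ext (Subtype.ext (chi_injOn e (hbd q hq).1 (hbd q' hq').1 h1)) h2
    · exact (hbase q hq h.1).elim

/-- A compact set in the suspension of `S` together with all `n`-cells lies in the suspension of
`S` and finitely many `n`-cells; this reduces a statement on compressions to finite stages. -/
lemma compressible_cyl_succ (y0 : Y) (N n : ℕ) (h0 : y0 ∈ skLT Y n) {d : ℕ} (hd : d < n + N) :
    Compressible (cyl y0 N (skLT Y n)) (cyl y0 N (skLT Y (n + 1))) d := by
  classical
  have hfin : ∀ F : Finset (Cell Y n), Compressible (cyl y0 N (skLT Y n))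
      (cyl y0 N (skLT Y n ∪ ⋃ e ∈ F, RelCWComplex.closedCell n e)) d := by
    intro F
    induction F using Finset.induction_on with
    | empty => simpa using Compressible.refl _ _
    | insert e F he ih =>
      refine ih.trans (cyl_mono y0 N subset_union_left) ?_
      have h1 := compressible_cyl_cell y0 N
        (S := skLT Y n ∪ ⋃ e ∈ F, RelCWComplex.closedCell n e)
        ((isClosed_skLT _).union (F.finite_toSet.isClosed_biUnion fun e _ =>
          RelCWComplex.isClosed_closedCell)) (Or.inl h0) e
        (fun y hy => Or.inl (chi_sphere_mem e hy)) (fun y hy => ?_) hd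
      · convert h1 using 2
        rw [Finset.set_biUnion_insert, union_assoc, union_comm (RelCWComplex.closedCell n e)]
      · rintro (h | h)
        · exact chi_ball_notMem e hy h
        · simp only [mem_iUnion] at h
          obtain ⟨e', he', y', hy', h⟩ := h
          rw [← sphere_union_ball] at hy'
          rcases hy' with hy' | hy'
          · exact chi_ball_notMem e hy (h ▸ chi_sphere_mem e' hy')
          · have := chi_ball_inj hy' hy h
            simp only [Sigma.mk.injEq, heq_eq_eq, true_and] at this
            exact he (this ▸ he')
  intro K _ _ k hk j hj u hu
  have hF := finite_cells_of_isCompact y0 N (isCompact_range u.continuous)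
  have hF' : {e : Cell Y n | (⟨n, e⟩ : Σ n, Cell Y n) ∈ {c : Σ n, Cell Y n |
      ∃ q : Y × (Fin N → I), q ∉ cubeBase ⟨Y, y0⟩ N ∧
      suspCube ⟨Y, y0⟩ N q ∈ range u ∧ q.1 ∈ RelCWComplex.openCell c.1 c.2}}.Finite :=
    hF.preimage (sigma_mk_injective.injOn)
  refine hfin hF'.toFinset K k hk j hj u fun s => ?_
  obtain ⟨q, hq, hqs⟩ := hu s
  rw [← hqs]
  refine suspCube_mem_cyl.2 ?_
  by_cases hqb : q ∈ cubeBase ⟨Y, y0⟩ N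
  · exact Or.inl hqb
  obtain ⟨m, hm, e, y, hy, hyq⟩ := exists_chi_of_mem_skLT (hq.resolve_left hqb)
  right
  have hm' : m < n + 1 := by exact_mod_cast hm
  rcases (Nat.lt_succ_iff.1 hm').eq_or_lt with rfl | hlt
  · right
    simp only [mem_iUnion]
    refine ⟨e, ?_, y, ball_subset_closedBall hy, hyq⟩
    simp only [Finite.mem_toFinset]
    exact ⟨q, hqb, ⟨s, hqs.symm⟩, y, hy, hyq⟩
  · left
    rw [← hyq]
    exact chi_mem_skLT_of_lt (by exact_mod_cast hlt) e (ball_subset_closedBall hy)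

/-- Maps of dimension less than `n + N` into the `N`-fold suspension of a CW complex can be
deformed into the suspension of the union of the cells of dimension less than `n`. -/
theorem compressible_cyl (y0 : Y) (N n : ℕ) (h0 : y0 ∈ skLT Y n) {d : ℕ} (hd : d < n + N) :
    Compressible (cyl y0 N (skLT Y n)) univ d := by
  have hfin : ∀ m : ℕ, Compressible (cyl y0 N (skLT Y n))
      (cyl y0 N (skLT Y ((n + m : ℕ) : ℕ∞))) d := by
    intro m
    induction m with
    | zero => exact Compressible.refl _ _
    | succ m ih =>
      have hsub : skLT Y n ⊆ skLT Y ((n + m : ℕ) : ℕ∞) :=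
        CWComplex.skeletonLT_mono (by exact_mod_cast Nat.le_add_right n m)
      refine ih.trans (cyl_mono y0 N hsub) ?_
      exact compressible_cyl_succ y0 N (n + m) (hsub h0) (by omega)
  intro K _ _ k hk j hj u _
  have hF := finite_cells_of_isCompact y0 N (isCompact_range u.continuous)
  obtain ⟨m, hm⟩ := (hF.image Sigma.fst).bddAbove
  refine hfin (m + 1) K k hk j hj u fun s => ?_
  obtain ⟨q, hqs⟩ := suspCube_surjective ⟨Y, y0⟩ N (u s)
  rw [← hqs]
  refine suspCube_mem_cyl.2 ?_
  by_cases hqb : q ∈ cubeBase ⟨Y, y0⟩ N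
  · exact Or.inl hqb
  right
  obtain ⟨l, e, y, hy, hyq⟩ := exists_chi q.1
  have hl : l ≤ m := hm ⟨⟨l, e⟩, ⟨q, hqb, ⟨s, hqs.symm⟩, y, hy, hyq⟩, rfl⟩
  rw [← hyq]
  exact chi_mem_skLT_of_lt (by exact_mod_cast (by omega : l < n + (m + 1))) e
    (ball_subset_closedBall hy)

end Cyl

/-! ### Cellular approximation in iterated suspensions -/

section Cellular

variable {X : Type u} [TopologicalSpace X] [T2Space X] [CWComplex (Set.univ : Set X)]
variable {Y : Type v} [TopologicalSpace Y] [T2Space Y] [CWComplex (Set.univ : Set Y)]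

/-- A family of maps from cubes to a suspended CW complex, parametrized by a skeleton, can be
deformed into the suspension of a skeleton of sufficiently large dimension, relative to the
boundary of the cubes and to the base point. -/
theorem exists_cellular_deformation (x0 : X) (hx0 : x0 ∈ skLT X 1) (y0 : Y) (N M m n0 : ℕ)
    (h0 : y0 ∈ skLT Y n0) (hdim : m + M < n0 + N + 1)
    (u : C(skLT X m × (Fin M → I), iterSusp ⟨Y, y0⟩ N))
    (hub : ∀ x, ∀ t ∈ Cube.boundary (Fin M), u (x, t) ∈ cyl y0 N (skLT Y n0))
    (hu0 : ∀ x : skLT X m, (x : X) = x0 → ∀ t, u (x, t) ∈ cyl y0 N (skLT Y n0)) :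
    ∃ G : C(I × (skLT X m × (Fin M → I)), iterSusp ⟨Y, y0⟩ N), (∀ q, G (0, q) = u q) ∧
      (∀ q, G (1, q) ∈ cyl y0 N (skLT Y n0)) ∧
      (∀ s x, ∀ t ∈ Cube.boundary (Fin M), G (s, (x, t)) = u (x, t)) ∧
      ∀ s, ∀ x : skLT X m, ∀ t, (x : X) = x0 → G (s, (x, t)) = u (x, t) := by
  classical
  set A := cyl y0 N (skLT Y n0)
  let Z := iterSusp ⟨Y, y0⟩ N
  -- The condition `R` describes the tracks of the points of the skeleton; the deformation is
  -- constructed over one cell after the other.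
  let R : X → (I × (Fin M → I) → Z) → Prop := fun x g => ∀ hx : x ∈ skLT X m,
    (∀ t, g (0, t) = u (⟨x, hx⟩, t)) ∧ (∀ t, g (1, t) ∈ A) ∧
    (∀ s, ∀ t ∈ Cube.boundary (Fin M), g (s, t) = u (⟨x, hx⟩, t)) ∧
    (x = x0 → ∀ s t, g (s, t) = u (⟨x, hx⟩, t))
  have hstart : ∀ x ∈ skLT X (0 : ℕ), R x fun _ => Z.pt := fun x hx => by
    obtain ⟨n, hn, -⟩ := exists_chi_of_mem_skLT hx
    simp at hn
  refine Exists.elim (exists_extension (X := X) (P := I × (Fin M → I)) (Z := Z) m R 0 (by simp)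
    (fun _ _ => Z.pt) continuousOn_const hstart ?_) ?_
  · intro n _ hn e b hb hbR
    have hmem : ∀ y ∈ closedBall (0 : Fin n → ℝ) 1, chi n e y ∈ skLT X m := fun y hy =>
      chi_mem_skLT_of_lt hn e hy
    have hn' : n < m := by exact_mod_cast hn
    let uc : C(closedBall (0 : Fin n → ℝ) 1 × (Fin M → I), Z) :=
      u.comp ⟨fun q => (⟨chi n e q.1, hmem _ q.1.2⟩, q.2), by
        refine Continuous.prodMk (Continuous.subtype_mk ?_ _) continuous_snd
        exact ((continuousOn_chi e).comp_continuous continuous_subtype_val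
          fun y => y.2).comp continuous_fst⟩
    have huc : ∀ q, uc q = u (⟨chi n e q.1, hmem _ q.1.2⟩, q.2) := fun q => rfl
    let pr : (Fin n → ℝ) → closedBall (0 : Fin n → ℝ) 1 :=
      (BallChart.ball (Fin n → ℝ)).ret
    have hprc : Continuous pr := (BallChart.ball (Fin n → ℝ)).ret.continuous
    have hpr : ∀ y (hy : y ∈ closedBall (0 : Fin n → ℝ) 1), pr y = ⟨y, hy⟩ := fun y hy =>
      (BallChart.ball (Fin n → ℝ)).ret_emb ⟨y, hy⟩
    by_cases hcase : ∃ y ∈ ball (0 : Fin n → ℝ) 1, chi n e y = x0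
    · -- the base point is a vertex, and on this cell the deformation is constant
      obtain ⟨y1, hy1, hy1'⟩ := hcase
      have hn0 : n = 0 := by
        by_contra hne
        refine chi_ball_notMem e hy1 (CWComplex.skeletonLT_mono ?_ (hy1' ▸ hx0))
        exact_mod_cast Nat.one_le_iff_ne_zero.2 hne
      subst hn0
      refine ⟨fun y p => uc (pr y, p.2), ?_, ?_, fun y hy hx => ?_⟩
      · exact (by fun_prop : Continuous fun q : (Fin 0 → ℝ) × (I × (Fin M → I)) =>
          uc (pr q.1, q.2.2)).continuousOn
      · intro y hy
        rw [mem_sphere_zero_iff_norm, Subsingleton.elim y 0, norm_zero] at hy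
        exact (zero_ne_one hy).elim
      · have hyx : chi 0 e y = x0 := by rw [Subsingleton.elim y y1, hy1']
        simp only [hpr y hy]
        exact ⟨fun t => rfl, fun t => hu0 _ hyx t, fun s t _ => rfl, fun _ s t => rfl⟩
    · have hnot : ∀ y ∈ ball (0 : Fin n → ℝ) 1, chi n e y ≠ x0 := fun y hy h =>
        hcase ⟨y, hy, h⟩
      let c := (BallChart.ball (Fin n → ℝ)).prod (BallChart.cube (Fin M))
      have hbd : ∀ q : closedBall (0 : Fin n → ℝ) 1 × (Fin M → I), q ∈ c.bd ↔
          (q.1 : Fin n → ℝ) ∈ Metric.sphere (0 : Fin n → ℝ) 1 ∨ q.2 ∈ Cube.boundary (Fin M) :=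
        fun q => by rw [BallChart.mem_bd_prod, BallChart.mem_bd_ball, BallChart.mem_bd_cube]
      -- The deformation is given over the boundary of the cell, and constant on the boundary of
      -- the cube. It extends, since the product of the cell and the cube has a dimension small
      -- enough for compressions into `A`.
      let k : I × (closedBall (0 : Fin n → ℝ) 1 × (Fin M → I)) → Z := fun r =>
        if (r.2.1 : Fin n → ℝ) ∈ Metric.sphere (0 : Fin n → ℝ) 1 then b r.2.1 (r.1, r.2.2)
        else uc r.2
      have hk1 : ∀ r, (r.2.1 : Fin n → ℝ) ∈ Metric.sphere (0 : Fin n → ℝ) 1 →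
          k r = b r.2.1 (r.1, r.2.2) := fun r hr => if_pos hr
      have hk2 : ∀ r, r.2.2 ∈ Cube.boundary (Fin M) → k r = uc r.2 := fun r hr => by
        by_cases h : (r.2.1 : Fin n → ℝ) ∈ Metric.sphere (0 : Fin n → ℝ) 1
        · rw [hk1 r h]
          exact (hbR _ h (hmem _ r.2.1.2)).2.2.1 _ _ hr
        · exact if_neg h
      refine Exists.elim (BallChart.exists_extension_of_compression c A uc k ?_ ?_ ?_ ?_) ?_
      · have h1 : ContinuousOn k {r | (r.2.1 : Fin n → ℝ) ∈ Metric.sphere (0 : Fin n → ℝ) 1} := by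
          refine ContinuousOn.congr ?_ fun r hr => hk1 r hr
          exact hb.comp (f := fun r : I × (closedBall (0 : Fin n → ℝ) 1 × (Fin M → I)) =>
            ((r.2.1 : Fin n → ℝ), (r.1, r.2.2))) (by fun_prop) fun r hr => ⟨hr, mem_univ _⟩
        have h2 : ContinuousOn k {r | r.2.2 ∈ Cube.boundary (Fin M)} := by
          refine ContinuousOn.congr ?_ fun r hr => hk2 r hr
          exact (by fun_prop : Continuous fun r : I × (closedBall (0 : Fin n → ℝ) 1 ×
            (Fin M → I)) => uc r.2).continuousOn
        refine (h1.union_of_isClosed h2 (isClosed_sphere.preimage (by fun_prop))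
          ((isClosed_cubeBoundary M).preimage (by fun_prop))).mono ?_
        rintro ⟨s, q⟩ ⟨-, hq⟩
        exact (hbd q).1 hq
      · intro y hy
        by_cases hys : (y.1 : Fin n → ℝ) ∈ Metric.sphere (0 : Fin n → ℝ) 1
        · rw [hk1 _ hys]
          exact (hbR _ hys (hmem _ y.1.2)).1 _
        · exact hk2 _ (((hbd y).1 hy).resolve_left hys)
      · intro y hy
        by_cases hys : (y.1 : Fin n → ℝ) ∈ Metric.sphere (0 : Fin n → ℝ) 1
        · rw [hk1 _ hys]
          exact (hbR _ hys (hmem _ y.1.2)).2.1 _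
        · have ht := ((hbd y).1 hy).resolve_left hys
          rw [hk2 _ ht]
          exact hub _ _ ht
      · intro w hw
        let j : C(closedBall (0 : Fin n → ℝ) 1 × (Fin M → I), Fin (n + M) → ℝ) :=
          ⟨fun q => Fin.append (q.1 : Fin n → ℝ) (fun i => (q.2 i : ℝ)), by
            refine continuous_pi fun i => ?_
            refine Fin.addCases (fun i => ?_) (fun i => ?_) i
            · simp only [Fin.append_left]
              exact (continuous_apply i).comp (continuous_subtype_val.comp continuous_fst)
            · simp only [Fin.append_right]; fun_prop⟩
        have hj : Function.Injective j := fun q q' h => by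
          refine Prod.ext (Subtype.ext (funext fun i => ?_)) (funext fun i => Subtype.ext ?_)
          · have := congrFun h (Fin.castAdd M i)
            simpa [j] using this
          · have := congrFun h (Fin.natAdd n i)
            simpa [j] using this
        obtain ⟨L, hL0, hL1, hL⟩ := compressible_cyl y0 N n0 h0 (d := n + M) (by omega) _
          (n + M) le_rfl j hj w fun _ => mem_univ _
        exact ⟨L, hL0, fun t y hy => hL y (hw y hy) t, hL1⟩
      · rintro G ⟨hG0, hGb, hG1⟩
        refine ⟨fun y p => G (p.1, (pr y, p.2)), ?_, fun y hy => ?_, fun y hy hx => ?_⟩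
        · exact (by fun_prop : Continuous fun q : (Fin n → ℝ) × (I × (Fin M → I)) =>
            G (q.2.1, (pr q.1, q.2.2))).continuousOn
        · ext1 p
          simp only [hpr y (sphere_subset_closedBall hy)]
          rw [hGb _ _ ((hbd _).2 (Or.inl hy)), hk1 _ hy]
        · simp only [hpr y hy]
          refine ⟨fun t => by rw [hG0]; rfl, fun t => hG1 _, fun s t ht => ?_, fun h s t => ?_⟩
          · rw [hGb _ _ ((hbd _).2 (Or.inr ht)), hk2 _ ht]
            rfl
          · have hys : y ∈ Metric.sphere (0 : Fin n → ℝ) 1 := by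
              rw [← sphere_union_ball] at hy
              exact hy.resolve_right fun hy => hnot y hy h
            rw [hGb _ _ ((hbd _).2 (Or.inl hys)), hk1 _ hys]
            exact (hbR y hys hx).2.2.2 h s t
  · rintro g ⟨hg, -, hgR⟩
    refine ⟨⟨fun q => g q.2.1 (q.1, q.2.2), ?_⟩, fun q => ?_, fun q => ?_, fun s x t ht => ?_,
      fun s x t hx => ?_⟩
    · exact hg.comp_continuous (f := fun q : I × (skLT X m × (Fin M → I)) =>
        ((q.2.1 : X), (q.1, q.2.2))) (by fun_prop) fun q => ⟨q.2.1.2, mem_univ _⟩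
    · exact (hgR _ q.1.2 q.1.2).1 q.2
    · exact (hgR _ q.1.2 q.1.2).2.1 q.2
    · exact (hgR _ x.2 x.2).2.2.1 s t ht
    · exact (hgR _ x.2 x.2).2.2.2 hx s t

/-- The `m`-skeleton of a CW complex, pointed at a vertex. -/
abbrev skPt (X : Type u) [TopologicalSpace X] [T2Space X] [CWComplex (Set.univ : Set X)] (x0 : X)
    (hx0 : x0 ∈ skLT X 1) (m : ℕ) : PtdSpace.{u} where
  carrier := ↥(CWComplex.skeleton (Set.univ : Set X) m : Set X)
  pt := ⟨x0, CWComplex.skeletonLT_mono (by norm_cast; omega) hx0⟩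

/-- The inclusion of the pointed `m`-skeleton in the whole complex. -/
def skPtIncl (X : Type u) [TopologicalSpace X] [T2Space X] [CWComplex (Set.univ : Set X)] (x0 : X)
    (hx0 : x0 ∈ skLT X 1) (m : ℕ) : PtdMap (skPt X x0 hx0 m) ⟨X, x0⟩ :=
  ⟨⟨Subtype.val, continuous_subtype_val⟩, rfl⟩

/-- The inclusion of the pointed `m`-skeleton in the pointed `(m + 1)`-skeleton. -/
def skPtStep (X : Type u) [TopologicalSpace X] [T2Space X] [CWComplex (Set.univ : Set X)] (x0 : X)
    (hx0 : x0 ∈ skLT X 1) (m : ℕ) : PtdMap (skPt X x0 hx0 m) (skPt X x0 hx0 (m + 1)) :=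
  ⟨⟨Set.inclusion (CWComplex.skeleton_mono (by norm_cast; omega)), continuous_inclusion _⟩, rfl⟩

lemma skPtIncl_comp_skPtStep (x0 : X) (hx0 : x0 ∈ skLT X 1) (m : ℕ) :
    (skPtIncl X x0 hx0 (m + 1)).comp (skPtStep X x0 hx0 m) = skPtIncl X x0 hx0 m := rfl

lemma range_iterSuspMap_skPtIncl (x0 : X) (hx0 : x0 ∈ skLT X 1) (m N : ℕ) :
    range (iterSuspMap (skPtIncl X x0 hx0 m) N).toMap = cyl x0 N (skLT X (m + 1)) := by
  ext z
  constructor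
  · rintro ⟨w, rfl⟩
    obtain ⟨q, rfl⟩ := suspCube_surjective _ N w
    rw [iterSuspMap_suspCube]
    exact suspCube_mem_cyl.2 (Or.inr q.1.2)
  · rintro ⟨q, hq | hq, rfl⟩
    · exact ⟨_, (PtdMap.map_pt _).trans ((suspCube_eq_pt_iff _).2 hq).symm⟩
    · exact ⟨suspCube (skPt X x0 hx0 m) N (⟨q.1, hq⟩, q.2), iterSuspMap_suspCube _ _ _⟩

lemma isClosedEmbedding_iterSuspMap_skPtIncl (x0 : X) (hx0 : x0 ∈ skLT X 1) (m N : ℕ) :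
    IsClosedEmbedding (iterSuspMap (skPtIncl X x0 hx0 m) N).toMap := by
  have : T2Space (⟨X, x0⟩ : PtdSpace.{u}) := ‹T2Space X›
  exact isClosedEmbedding_iterSuspMap _ (isClosed_skLT _).isClosedEmbedding_subtypeVal N

lemma exists_lift_of_isEmbedding {A B C : Type*} [TopologicalSpace A] [TopologicalSpace B]
    [TopologicalSpace C] (i : C(B, C)) (hi : IsEmbedding i) (f : C(A, C))
    (h : ∀ a, f a ∈ range i) : ∃ g : C(A, B), ∀ a, i (g a) = f a := by
  choose g hg using h
  exact ⟨⟨g, hi.isInducing.continuous_iff.2 (by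
    have : i ∘ g = f := funext hg
    rw [this]; exact f.continuous)⟩, hg⟩

/-- `exists_cellular_deformation` for the pointed `m`-skeleton. -/
lemma exists_cellular_deformation_skPt (x0 : X) (hx0 : x0 ∈ skLT X 1) (y0 : Y) (hy0 : y0 ∈ skLT Y 1)
    (N M m n : ℕ) (hdim : m + M < n + N + 1)
    (u : C(skPt X x0 hx0 m × (Fin M → I), iterSusp ⟨Y, y0⟩ N))
    (hub : ∀ q ∈ cubeBase (skPt X x0 hx0 m) M, u q ∈ cyl y0 N (skLT Y (n + 1))) :
    ∃ G : C(I × (skPt X x0 hx0 m × (Fin M → I)), iterSusp ⟨Y, y0⟩ N), (∀ q, G (0, q) = u q) ∧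
      (∀ q, G (1, q) ∈ cyl y0 N (skLT Y (n + 1))) ∧
      ∀ s, ∀ q ∈ cubeBase (skPt X x0 hx0 m) M, G (s, q) = u q := by
  obtain ⟨G, hG0, hG1, hGb, hGx⟩ := exists_cellular_deformation x0 hx0 y0 N M (m + 1) (n + 1)
    (CWComplex.skeletonLT_mono (by norm_cast; omega) hy0) (by omega) u
    (fun x t ht => hub (x, t) (Or.inr ht))
    (fun x hx t => hub (x, t) (Or.inl (Subtype.ext hx)))
  refine ⟨G, hG0, hG1, fun s q hq => ?_⟩
  rcases hq with hq | hq
  · exact hGx s q.1 q.2 (congrArg Subtype.val hq)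
  · exact hGb s q.1 q.2 hq

/-- Every map from the suspension of an `m`-skeleton to a suspended complex is homotopic to one with
values in the suspension of the `m`-skeleton. -/
theorem exists_htpy_skPtIncl_comp (x0 : X) (hx0 : x0 ∈ skLT X 1) (y0 : Y) (hy0 : y0 ∈ skLT Y 1)
    (N m : ℕ) (F : PtdMap (iterSusp (skPt X x0 hx0 m) N) (iterSusp ⟨Y, y0⟩ N)) :
    ∃ F' : PtdMap (iterSusp (skPt X x0 hx0 m) N) (iterSusp (skPt Y y0 hy0 m) N),
      F.Htpy ((iterSuspMap (skPtIncl Y y0 hy0 m) N).comp F') := by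
  have hbase : ∀ q ∈ cubeBase (skPt X x0 hx0 m) N, F.toMap (suspCube _ N q) =
      (iterSusp ⟨Y, y0⟩ N).pt := fun q hq => by
    rw [(suspCube_eq_pt_iff _).2 hq, F.map_pt]
  obtain ⟨G, hG0, hG1, hGb⟩ := exists_cellular_deformation_skPt x0 hx0 y0 hy0 N N m m (by omega)
    (F.toMap.comp (suspCube (skPt X x0 hx0 m) N))
    (fun q hq => by
      rw [ContinuousMap.comp_apply, hbase q hq]
      exact pt_mem_cyl _ _ _)
  have hGbase : ∀ s, ∀ q ∈ cubeBase (skPt X x0 hx0 m) N, G (s, q) = (iterSusp ⟨Y, y0⟩ N).pt :=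
    fun s q hq => (hGb s q hq).trans (hbase q hq)
  obtain ⟨H, hH, hHpt⟩ := exists_desc_suspCube (skPt X x0 hx0 m) N G _ hGbase
  have hemb := isClosedEmbedding_iterSuspMap_skPtIncl y0 hy0 m N
  obtain ⟨g, hg⟩ := exists_lift_of_isEmbedding _ hemb.isEmbedding
    (H.comp ⟨fun x => ((1 : I), x), by fun_prop⟩) (fun x => by
      rw [range_iterSuspMap_skPtIncl]
      obtain ⟨q, rfl⟩ := suspCube_surjective _ N x
      exact (hH 1 q) ▸ hG1 q)
  refine ⟨⟨g, hemb.injective ?_⟩, H, fun x => ?_, fun x => (hg x).symm, hHpt⟩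
  · rw [hg, (iterSuspMap (skPtIncl Y y0 hy0 m) N).map_pt]
    exact hHpt 1
  · obtain ⟨q, rfl⟩ := suspCube_surjective _ N x
    rw [hH, hG0]
    rfl

/-- Two maps between suspensions of `m`-skeleta that become homotopic in the whole suspended complex
become homotopic in the suspension of the `(m + 1)`-skeleton. -/
theorem htpy_skPtStep_comp (x0 : X) (hx0 : x0 ∈ skLT X 1) (y0 : Y) (hy0 : y0 ∈ skLT Y 1)
    (N m : ℕ) (F₀ F₁ : PtdMap (iterSusp (skPt X x0 hx0 m) N) (iterSusp (skPt Y y0 hy0 m) N))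
    (h : ((iterSuspMap (skPtIncl Y y0 hy0 m) N).comp F₀).Htpy
      ((iterSuspMap (skPtIncl Y y0 hy0 m) N).comp F₁)) :
    ((iterSuspMap (skPtStep Y y0 hy0 m) N).comp F₀).Htpy
      ((iterSuspMap (skPtStep Y y0 hy0 m) N).comp F₁) := by
  obtain ⟨H, hH0, hH1, hHpt⟩ := h
  let Z := iterSusp ⟨Y, y0⟩ N
  let S := suspCube (skPt X x0 hx0 m) N
  -- The homotopy is a family of maps from `(N + 1)`-cubes. Its deformation relative to the
  -- boundary of the cubes does not change its two ends.
  let u : C(skPt X x0 hx0 m × (Fin (N + 1) → I), Z) :=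
    H.comp ⟨fun q => (q.2 0, S (q.1, fun i => q.2 i.succ)), by fun_prop⟩
  have hu : ∀ x t, u (x, t) = H (t 0, S (x, fun i => t i.succ)) := fun x t => rfl
  have hS : ∀ q ∈ cubeBase (skPt X x0 hx0 m) N, S q = (iterSusp (skPt X x0 hx0 m) N).pt :=
    fun q hq => (suspCube_eq_pt_iff _).2 hq
  have hmem : ∀ w, (iterSuspMap (skPtIncl Y y0 hy0 m) N).toMap w ∈
      cyl y0 N (skLT Y ((m + 1 : ℕ) + 1)) := fun w => by
    refine cyl_mono y0 N (CWComplex.skeletonLT_mono ?_)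
      ((range_iterSuspMap_skPtIncl y0 hy0 m N).subset ⟨w, rfl⟩)
    norm_cast
    omega
  obtain ⟨G, -, hG1, hGb⟩ := exists_cellular_deformation_skPt x0 hx0 y0 hy0 N (N + 1) m (m + 1)
    (by omega) u
    (fun q hq => by
      show u (q.1, q.2) ∈ _
      rw [hu]
      rcases hq with h | h
      · rw [hS _ (Or.inl h), hHpt]; exact pt_mem_cyl _ _ _
      rcases mem_boundary_succ.1 h with h | h | h
      · rw [h, hH0]; exact hmem _
      · rw [h, hH1]; exact hmem _
      · rw [hS _ (Or.inr h), hHpt]; exact pt_mem_cyl _ _ _)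
  let K : C(I × (skPt X x0 hx0 m × (Fin N → I)), Z) :=
    G.comp ⟨fun q => (1, (q.2.1, Fin.cons q.1 q.2.2)), by fun_prop⟩
  have hKu : ∀ s q, (s = 0 ∨ s = 1 ∨ q ∈ cubeBase (skPt X x0 hx0 m) N) →
      K (s, q) = H (s, S q) := by
    rintro s ⟨x, t⟩ h
    have e : u (x, Fin.cons s t) = H (s, S (x, t)) := by
      rw [hu]
      simp
    rw [← e]
    have hbd : (s = 0 ∨ s = 1 ∨ t ∈ Cube.boundary (Fin N)) →
        (Fin.cons s t : Fin (N + 1) → I) ∈ Cube.boundary (Fin (N + 1)) := fun h => by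
      rw [mem_boundary_succ]
      simpa using h
    rcases h with h | h | h | h
    · exact hGb _ _ (Or.inr (hbd (Or.inl h)))
    · exact hGb _ _ (Or.inr (hbd (Or.inr (Or.inl h))))
    · exact hGb _ (x, _) (Or.inl h)
    · exact hGb _ _ (Or.inr (hbd (Or.inr (Or.inr h))))
  have hemb := isClosedEmbedding_iterSuspMap_skPtIncl y0 hy0 (m + 1) N
  obtain ⟨g, hg⟩ := exists_lift_of_isEmbedding _ hemb.isEmbedding K (fun q => by
    rw [range_iterSuspMap_skPtIncl]
    exact hG1 (q.2.1, Fin.cons q.1 q.2.2))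
  have hstep : ∀ w, (iterSuspMap (skPtIncl Y y0 hy0 (m + 1)) N).toMap
      ((iterSuspMap (skPtStep Y y0 hy0 m) N).toMap w) =
      (iterSuspMap (skPtIncl Y y0 hy0 m) N).toMap w := fun w => by
    have := iterSuspMap_comp (skPtIncl Y y0 hy0 (m + 1)) (skPtStep Y y0 hy0 m) N
    rw [skPtIncl_comp_skPtStep] at this
    rw [this]
    rfl
  refine htpy_of_cube g (fun q => hemb.injective ?_) (fun q => hemb.injective ?_)
    (fun t q hq => hemb.injective ?_)
  · rw [hg, hKu _ _ (Or.inl rfl), hH0]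
    exact (hstep _).symm
  · rw [hg, hKu _ _ (Or.inr (Or.inl rfl)), hH1]
    exact (hstep _).symm
  · rw [hg, hKu _ _ (Or.inr (Or.inr hq)), hS q hq, hHpt, PtdMap.map_pt]

end Cellular

/-! ### Iterated loop spaces of a spectrum -/

/-- A sequence of pointed spaces and maps. -/
structure Tower : Type (u + 1) where
  /-- the spaces -/
  space : ℕ → Type u
  /-- the topologies -/
  [top : ∀ i, TopologicalSpace (space i)]
  /-- the base points -/
  pt : ∀ i, space i
  /-- the maps -/
  step : ∀ i, C(space i, space (i + 1))
  step_pt : ∀ i, step i (pt i) = pt (i + 1)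

instance (T : Tower.{u}) (i : ℕ) : TopologicalSpace (T.space i) := T.top i

namespace Tower

/-- The composite of the maps of a tower from level `i` to level `j`. -/
def tr (T : Tower.{u}) {i j : ℕ} (h : i ≤ j) : C(T.space i, T.space j) :=
  Nat.leRec (motive := fun k _ => C(T.space i, T.space k)) (ContinuousMap.id _)
    (fun k _ f => (T.step k).comp f) h

@[simp]
lemma tr_self (T : Tower.{u}) {i : ℕ} (h : i ≤ i) (x : T.space i) : T.tr h x = x := by
  rw [tr, Nat.leRec_self]
  rfl

lemma tr_succ (T : Tower.{u}) {i j : ℕ} (h : i ≤ j) (h' : i ≤ j + 1) (x : T.space i) :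
    T.tr h' x = T.step j (T.tr h x) := by
  rw [tr, Nat.leRec_succ _ _ h]
  rfl

@[simp]
lemma tr_tr (T : Tower.{u}) {i j k : ℕ} (h : i ≤ j) (h' : j ≤ k) (x : T.space i) :
    T.tr h' (T.tr h x) = T.tr (h.trans h') x := by
  induction k, h' using Nat.le_induction with
  | base => simp
  | succ k hk ih => rw [tr_succ T hk, ih, tr_succ T (h.trans hk)]

@[simp]
lemma tr_pt (T : Tower.{u}) {i j : ℕ} (h : i ≤ j) : T.tr h (T.pt i) = T.pt j := by
  induction j, h using Nat.le_induction with
  | base => simp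
  | succ k hk ih => rw [tr_succ T hk, ih, T.step_pt]

/-- A map of towers. -/
structure Hom (T T' : Tower.{u}) where
  /-- the map in level `i` -/
  app : ∀ i, C(T.space i, T'.space i)
  app_pt : ∀ i, app i (T.pt i) = T'.pt i
  comm : ∀ i x, app (i + 1) (T.step i x) = T'.step i (app i x)

lemma Hom.app_tr {T T' : Tower.{u}} (f : Hom T T') {i j : ℕ} (h : i ≤ j) (x : T.space i) :
    f.app j (T.tr h x) = T'.tr h (f.app i x) := by
  induction j, h using Nat.le_induction with
  | base => simp
  | succ k hk ih => rw [tr_succ T hk, f.comm, ih, tr_succ T' hk]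

end Tower

/-- The identification of `I^K × I^i` with `I^(K + i)` that puts the coordinates of `I^i` in
front. -/
def cubeSplit (K : ℕ) : ∀ i : ℕ, (Fin K → I) × (Fin (0 + i) → I) ≃ₜ (Fin (K + i) → I)
  | 0 => Homeomorph.prodUnique (Fin K → I) (Fin 0 → I)
  | i + 1 => ((splitFirst (Fin K → I) (0 + i)).trans ((cubeSplit K i).prodCongr
      (Homeomorph.refl I))).trans
      { toFun := fun r => (Fin.cons r.2 r.1 : Fin (K + i + 1) → I)
        invFun := fun q => (fun k => q k.succ, q 0)
        left_inv := fun r => by simp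
        right_inv := fun q => Fin.cons_self_tail q
        continuous_toFun := by fun_prop
        continuous_invFun := by fun_prop }

lemma cubeSplit_succ (K i : ℕ) (s : Fin K → I) (t : Fin (0 + i + 1) → I) :
    cubeSplit K (i + 1) (s, t) = Fin.cons (t 0) (cubeSplit K i (s, fun k => t k.succ)) := rfl

lemma cubeSplit_mem_boundary {K i : ℕ} {s : Fin K → I} {t : Fin (0 + i) → I} :
    cubeSplit K i (s, t) ∈ Cube.boundary (Fin (K + i)) ↔
      s ∈ Cube.boundary (Fin K) ∨ t ∈ Cube.boundary (Fin (0 + i)) := by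
  induction i with
  | zero =>
    refine ⟨fun h => Or.inl h, ?_⟩
    rintro (h | ⟨i, -⟩)
    exacts [h, i.elim0]
  | succ i ih =>
    rw [cubeSplit_succ]
    refine mem_boundary_succ.trans ?_
    simp only [Fin.cons_zero, Fin.cons_succ]
    refine (or_congr_right (or_congr_right (ih (t := fun k => t k.succ)))).trans ?_
    refine Iff.trans ?_ (or_congr_right (mem_boundary_succ (N := 0 + i) (s := t)).symm)
    tauto

section Ev

variable {X : Type u} [TopologicalSpace X] {x : X}

/-- A loop of dimension `K + i` as a family of loops of dimension `i` parametrized by a cube of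
dimension `K`. -/
def ev (K i : ℕ) : C(GenLoop (Fin (K + i)) X x × (Fin K → I), GenLoop (Fin (0 + i)) X x) where
  toFun q := ⟨⟨fun r => q.1.1 (cubeSplit K i (q.2, r)), by fun_prop⟩, fun r hr =>
    q.1.2 _ (cubeSplit_mem_boundary.2 (Or.inr hr))⟩
  continuous_toFun := by
    refine Continuous.subtype_mk (ContinuousMap.continuous_of_continuous_uncurry _ ?_) _
    show Continuous fun r : (GenLoop (Fin (K + i)) X x × (Fin K → I)) × (Fin (0 + i) → I) =>
      r.1.1.1 (cubeSplit K i (r.1.2, r.2))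
    fun_prop

lemma ev_apply (K i : ℕ) (p : GenLoop (Fin (K + i)) X x) (s : Fin K → I) (r : Fin (0 + i) → I) :
    ev K i (p, s) r = p (cubeSplit K i (s, r)) := rfl

lemma ev_injective {K i : ℕ} {p q : GenLoop (Fin (K + i)) X x}
    (h : ∀ s, ev K i (p, s) = ev K i (q, s)) : p = q := by
  ext y
  obtain ⟨⟨s, r⟩, rfl⟩ := (cubeSplit K i).surjective y
  rw [← ev_apply, ← ev_apply, h]

lemma ev_boundary {K i : ℕ} (p : GenLoop (Fin (K + i)) X x) {s : Fin K → I}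
    (hs : s ∈ Cube.boundary (Fin K)) : ev K i (p, s) = GenLoop.const := by
  ext r
  exact p.2 _ (cubeSplit_mem_boundary.2 (Or.inl hs))

/-- The inverse construction to `ev`. -/
lemma exists_flat {P : Type*} [TopologicalSpace P] (K i : ℕ)
    (g : C(P × (Fin K → I), GenLoop (Fin (0 + i)) X x))
    (hg : ∀ p, ∀ s ∈ Cube.boundary (Fin K), g (p, s) = GenLoop.const) :
    ∃ G : C(P, GenLoop (Fin (K + i)) X x), ∀ p s, ev K i (G p, s) = g (p, s) := by
  refine ⟨⟨fun p => ⟨⟨fun y => (g (p, ((cubeSplit K i).symm y).1)).1 ((cubeSplit K i).symm y).2,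
    by fun_prop⟩, fun y hy => ?_⟩, ?_⟩, fun p s => ?_⟩
  · obtain ⟨⟨s, r⟩, rfl⟩ := (cubeSplit K i).surjective y
    simp only [ContinuousMap.coe_mk, Homeomorph.symm_apply_apply]
    rcases cubeSplit_mem_boundary.1 hy with h | h
    · rw [hg p s h]; rfl
    · exact (g (p, s)).2 r h
  · refine Continuous.subtype_mk (ContinuousMap.continuous_of_continuous_uncurry _ ?_) _
    show Continuous fun r : P × (Fin (K + i) → I) =>
      (g (r.1, ((cubeSplit K i).symm r.2).1)).1 ((cubeSplit K i).symm r.2).2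
    fun_prop
  · ext r
    rw [ev_apply]
    show (g (p, ((cubeSplit K i).symm (cubeSplit K i (s, r))).1)).1
      ((cubeSplit K i).symm (cubeSplit K i (s, r))).2 = _
    rw [Homeomorph.symm_apply_apply]
    rfl

/-- Homotopies of loops are paths in the loop space. -/
lemma joined_genLoop_iff {d : ℕ} {p q : GenLoop (Fin d) X x} :
    Joined p q ↔ GenLoop.Homotopic p q := by
  constructor
  · rintro ⟨γ⟩
    refine ⟨⟨⟨⟨fun r => (γ r.1).1 r.2, by fun_prop⟩, fun y => ?_, fun y => ?_⟩, fun t y hy => ?_⟩⟩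
    · simp
    · simp
    · exact ((γ t).2 y hy).trans (p.2 y hy).symm
  · rintro ⟨H⟩
    refine ⟨⟨⟨fun t => ⟨⟨fun y => H (t, y), by fun_prop⟩, fun y hy => ?_⟩, ?_⟩, ?_, ?_⟩⟩
    · exact (H.eq_fst t hy).trans (p.2 y hy)
    · exact Continuous.subtype_mk (ContinuousMap.continuous_of_continuous_uncurry _
        (show Continuous fun r : I × (Fin d → I) => H (r.1, r.2) from H.continuous)) _
    · ext y; exact H.apply_zero y
    · ext y; exact H.apply_one y

end Ev

namespace Spectrum

/-- The stabilization as a continuous map of loop spaces. -/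
def stabMap (E : Spectrum.{u}) (n d : ℕ) :
    C(GenLoop (Fin d) (E.space n) (E.space n).pt,
      GenLoop (Fin (d + 1)) (E.space (n + 1)) (E.space (n + 1)).pt) where
  toFun := E.stab
  continuous_toFun := by
    refine Continuous.subtype_mk (ContinuousMap.continuous_of_continuous_uncurry _ ?_) _
    show Continuous fun r : GenLoop (Fin d) (E.space n) (E.space n).pt × (Fin (d + 1) → I) =>
      (E.str n).toMap (suspMk (E.space n) (r.1.1 (fun i => r.2 i.succ), r.2 0))
    fun_prop

/-- The loop spaces `Ω^(K + i) E_(1 + i)`. -/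
def tower (E : Spectrum.{u}) (K : ℕ) : Tower.{u} where
  space i := GenLoop (Fin (K + i)) (E.space (1 + i)) (E.space (1 + i)).pt
  pt i := GenLoop.const
  step i := E.stabMap (1 + i) (K + i)
  step_pt i := by
    ext t
    have : ((E.space (1 + i)).pt, t 0) ∈ suspBase (E.space (1 + i)) := pt_mem_suspBase _ _
    exact (congrArg _ (suspMk_eq_pt _ this)).trans (E.str _).map_pt

/-- The map of loop spaces induced by a map of spectra. -/
def Hom.tower {E F : Spectrum.{u}} (f : Hom E F) (K : ℕ) : Tower.Hom (E.tower K) (F.tower K) where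
  app i := ⟨fun p => pushLoop (f.app (1 + i)) p, by
    refine Continuous.subtype_mk (ContinuousMap.continuous_of_continuous_uncurry _ ?_) _
    show Continuous fun r : GenLoop (Fin (K + i)) (E.space (1 + i)) (E.space (1 + i)).pt ×
      (Fin (K + i) → I) => (f.app (1 + i)).toMap (r.1.1 r.2)
    fun_prop⟩
  app_pt i := by
    apply GenLoop.ext
    intro t
    exact (f.app (1 + i)).map_pt
  comm i p := by
    apply GenLoop.ext
    intro t
    exact f.comm (1 + i) _ _

/-- The map `ev` for the loop spaces of a spectrum. -/
def ev (E : Spectrum.{u}) (K i : ℕ) :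
    C((E.tower K).space i × (Fin K → I), (E.tower 0).space i) := OneStep.ev K i

lemma ev_step (E : Spectrum.{u}) (K i : ℕ) (p : (E.tower K).space i) (s : Fin K → I) :
    (E.tower 0).step i (E.ev K i (p, s)) = E.ev K (i + 1) ((E.tower K).step i p, s) := rfl

lemma ev_tr (E : Spectrum.{u}) (K : ℕ) {i j : ℕ} (h : i ≤ j) (p : (E.tower K).space i)
    (s : Fin K → I) : (E.tower 0).tr h (E.ev K i (p, s)) = E.ev K j ((E.tower K).tr h p, s) := by
  induction j, h using Nat.le_induction with
  | base => simp
  | succ k hk ih => rw [Tower.tr_succ _ hk, ih, Tower.tr_succ _ hk, ev_step]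

lemma ev_app {E F : Spectrum.{u}} (f : Hom E F) (K i : ℕ) (p : (E.tower K).space i)
    (s : Fin K → I) :
    (f.tower 0).app i (E.ev K i (p, s)) = F.ev K i ((f.tower K).app i p, s) := rfl

lemma ev_pt (E : Spectrum.{u}) (K i : ℕ) (s : Fin K → I) :
    E.ev K i ((E.tower K).pt i, s) = (E.tower 0).pt i := rfl

lemma ev_boundary (E : Spectrum.{u}) {K i : ℕ} (p : (E.tower K).space i) {s : Fin K → I}
    (hs : s ∈ Cube.boundary (Fin K)) : E.ev K i (p, s) = (E.tower 0).pt i :=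
  OneStep.ev_boundary _ hs

lemma ev_injective (E : Spectrum.{u}) {K i : ℕ} {p q : (E.tower K).space i}
    (h : ∀ s, E.ev K i (p, s) = E.ev K i (q, s)) : p = q :=
  OneStep.ev_injective h

lemma exists_flat (E : Spectrum.{u}) {P : Type*} [TopologicalSpace P] (K i : ℕ)
    (g : C(P × (Fin K → I), (E.tower 0).space i))
    (hg : ∀ p, ∀ s ∈ Cube.boundary (Fin K), g (p, s) = (E.tower 0).pt i) :
    ∃ G : C(P, (E.tower K).space i), ∀ p s, E.ev K i (G p, s) = g (p, s) :=
  OneStep.exists_flat K i g hg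

/-! ### Stable equivalences on loop spaces -/

/-- The stabilization of a representative. -/
def Rep.st {E : Spectrum.{u}} {k : ℤ} (a : E.Rep k) : E.Rep k :=
  ⟨a.n + 1, a.d + 1, by have := a.deg; push_cast; omega, E.stab a.loop⟩

/-- Homotopy of representatives in the same level. -/
inductive Rep.Hty {E : Spectrum.{u}} {k : ℤ} : E.Rep k → E.Rep k → Prop
  | mk (n d : ℕ) (h : (d : ℤ) - n = k) (p q : GenLoop (Fin d) (E.space n) (E.space n).pt)
      (hpq : Joined p q) : Rep.Hty ⟨n, d, h, p⟩ ⟨n, d, h, q⟩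

lemma Rep.Hty.refl {E : Spectrum.{u}} {k : ℤ} (a : E.Rep k) : Rep.Hty a a :=
  Rep.Hty.mk a.n a.d a.deg _ _ (Joined.refl _)

lemma Rep.Hty.symm {E : Spectrum.{u}} {k : ℤ} {a b : E.Rep k} (h : Rep.Hty a b) :
    Rep.Hty b a := by
  obtain ⟨n, d, h, p, q, hpq⟩ := h
  exact .mk n d h q p hpq.symm

lemma Rep.Hty.trans {E : Spectrum.{u}} {k : ℤ} {a b c : E.Rep k} (h : Rep.Hty a b)
    (h' : Rep.Hty b c) : Rep.Hty a c := by
  obtain ⟨n, d, h, p, q, hpq⟩ := h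
  generalize hb : (⟨n, d, h, q⟩ : E.Rep k) = b at h'
  obtain ⟨n', d', h', p', q', hpq'⟩ := h'
  obtain ⟨rfl, rfl, h⟩ := Rep.mk.inj hb
  obtain rfl := eq_of_heq h
  exact .mk _ _ _ _ _ (hpq.trans hpq')

lemma Rep.Hty.st {E : Spectrum.{u}} {k : ℤ} {a b : E.Rep k} (h : Rep.Hty a b) :
    Rep.Hty a.st b.st := by
  obtain ⟨n, d, h, p, q, hpq⟩ := h
  exact .mk _ _ _ _ _ (hpq.map (E.stabMap n d).continuous)

lemma Rep.Hty.iterate_st {E : Spectrum.{u}} {k : ℤ} {a b : E.Rep k} (h : Rep.Hty a b) (M : ℕ) :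
    Rep.Hty (Rep.st^[M] a) (Rep.st^[M] b) := by
  induction M with
  | zero => exact h
  | succ M ih =>
    rw [Function.iterate_succ_apply', Function.iterate_succ_apply']
    exact ih.st

/-- Representatives of the same element of a homotopy group become homotopic after stabilization. -/
lemma exists_hty_of_mk_eq {E : Spectrum.{u}} {k : ℤ} {a b : E.Rep k}
    (h : (Quot.mk _ a : E.Pi k) = Quot.mk _ b) :
    ∃ M N, Rep.Hty (Rep.st^[M] a) (Rep.st^[N] b) := by
  have h' := Quot.eqvGen_exact h
  induction h' with
  | rel a b hab =>
    obtain ⟨n, d, h, p, q, hpq⟩ | ⟨n, d, h, h', p⟩ := hab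
    · exact ⟨0, 0, .mk _ _ _ p q (joined_genLoop_iff.2 hpq)⟩
    · exact ⟨1, 0, Rep.Hty.refl _⟩
  | refl a => exact ⟨0, 0, Rep.Hty.refl _⟩
  | symm a b _ ih =>
    obtain ⟨M, N, h⟩ := ih (Quot.eqvGen_sound ‹_›)
    exact ⟨N, M, h.symm⟩
  | trans a b c _ _ ih1 ih2 =>
    obtain ⟨M, N, h1⟩ := ih1 (Quot.eqvGen_sound ‹_›)
    obtain ⟨M', N', h2⟩ := ih2 (Quot.eqvGen_sound ‹_›)
    refine ⟨M' + M, N + N', ?_⟩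
    have h3 := h1.iterate_st M'
    have h4 := h2.iterate_st N
    rw [← Function.iterate_add_apply, ← Function.iterate_add_apply] at h3 h4
    rw [add_comm N M'] at h4
    exact h3.trans h4

/-- A point of a loop space as a representative of an element of a homotopy group. -/
def repOf (E : Spectrum.{u}) (K : ℕ) (i : ℕ) (p : (E.tower K).space i) : E.Rep ((K : ℤ) - 1) :=
  ⟨1 + i, K + i, by push_cast; omega, p⟩

lemma iterate_st_repOf (E : Spectrum.{u}) (K i M : ℕ) (p : (E.tower K).space i) :
    Rep.st^[M] (E.repOf K i p) = E.repOf K (i + M) ((E.tower K).tr (Nat.le_add_right i M) p) := by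
  induction M with
  | zero => simp
  | succ M ih =>
    rw [Function.iterate_succ_apply', ih, Tower.tr_succ _ (Nat.le_add_right i M)]
    rfl

lemma Rep.Hty.joined {E : Spectrum.{u}} {K i j : ℕ} {p : (E.tower K).space i}
    {q : (E.tower K).space j} (h : Rep.Hty (E.repOf K i p) (E.repOf K j q)) :
    ∃ hij : i = j, Joined ((E.tower K).tr hij.le p) q := by
  generalize ha : E.repOf K i p = a at h
  generalize hb : E.repOf K j q = b at h
  obtain ⟨n, d, h, p', q', hpq⟩ := h
  obtain ⟨rfl, rfl, h1⟩ := Rep.mk.inj ha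
  obtain ⟨h2, h3, h4⟩ := Rep.mk.inj hb
  obtain rfl : j = i := by omega
  obtain rfl := eq_of_heq h1
  obtain rfl := eq_of_heq h4
  exact ⟨rfl, by rw [Tower.tr_self]; exact hpq⟩

/-- Every representative is stably one of the form `repOf`. -/
lemma exists_st_eq_repOf (E : Spectrum.{u}) (K : ℕ) (a : E.Rep ((K : ℤ) - 1)) :
    ∃ i p, a.st = E.repOf K i p := by
  have hn : 1 ≤ a.st.n := Nat.le_add_left 1 a.n
  generalize a.st = b at hn
  obtain ⟨n, d, h, p⟩ := b
  obtain ⟨i, rfl⟩ := Nat.exists_eq_add_of_le hn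
  obtain rfl : d = K + i := by push_cast at h; omega
  exact ⟨i, p, rfl⟩

namespace Hom

variable {E F : Spectrum.{u}} {f : Hom E F}

lemma mapPi_repOf (f : Hom E F) (K i : ℕ) (p : (E.tower K).space i) :
    f.mapPi _ (Quot.mk _ (E.repOf K i p)) = Quot.mk _ (F.repOf K i ((f.tower K).app i p)) := rfl

lemma IsStableEquiv.exists_joined (hf : f.IsStableEquiv) {K i : ℕ} {p q : (E.tower K).space i}
    (h : Joined ((f.tower K).app i p) ((f.tower K).app i q)) :
    ∃ j, ∃ hij : i ≤ j, Joined ((E.tower K).tr hij p) ((E.tower K).tr hij q) := by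
  have h1 : (Quot.mk _ (E.repOf K i p) : E.Pi ((K : ℤ) - 1)) = Quot.mk _ (E.repOf K i q) := by
    refine (hf _).1 ?_
    rw [mapPi_repOf, mapPi_repOf]
    exact Quot.sound (.homotopic _ _ _ _ _ (joined_genLoop_iff.1 h))
  obtain ⟨M, N, hMN⟩ := exists_hty_of_mk_eq h1
  rw [iterate_st_repOf, iterate_st_repOf] at hMN
  obtain ⟨hij, hj⟩ := hMN.joined
  obtain rfl : M = N := by omega
  exact ⟨i + M, Nat.le_add_right _ _, by simpa using hj⟩

lemma IsStableEquiv.exists_app_joined (hf : f.IsStableEquiv) {K i : ℕ} (u : (F.tower K).space i) :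
    ∃ j, ∃ hij : i ≤ j, ∃ p : (E.tower K).space j,
      Joined ((f.tower K).app j p) ((F.tower K).tr hij u) := by
  obtain ⟨x, hx⟩ := (hf _).2 (Quot.mk _ (F.repOf K i u))
  obtain ⟨a, rfl⟩ := Quot.exists_rep x
  have ha : (Quot.mk _ a : E.Pi ((K : ℤ) - 1)) = Quot.mk _ a.st :=
    Quot.sound (.stab a.n a.d a.deg _ a.loop)
  obtain ⟨i', p, hp⟩ := exists_st_eq_repOf E K a
  rw [ha, hp, mapPi_repOf] at hx
  obtain ⟨M, N, hMN⟩ := exists_hty_of_mk_eq hx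
  rw [iterate_st_repOf, iterate_st_repOf] at hMN
  obtain ⟨hij, hj⟩ := hMN.joined
  refine ⟨i + N, Nat.le_add_right _ _, (E.tower K).tr (show i' ≤ i + N by omega) p, ?_⟩
  rw [Tower.Hom.app_tr]
  simpa using hj

end Hom

end Spectrum

namespace Spectrum.Hom

variable {E F : Spectrum.{u}} {f : Hom E F}

/-- Loops in the loop spaces of the target can stably be lifted along a stable equivalence, up to
homotopy. -/
lemma IsStableEquiv.exists_loop_lift (hf : f.IsStableEquiv) {K i : ℕ}
    (γ : C(I, (F.tower K).space i)) (h0 : γ 0 = (F.tower K).pt i) (h1 : γ 1 = (F.tower K).pt i) :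
    ∃ j, ∃ hij : i ≤ j, ∃ b : C(I, (E.tower K).space j),
      b 0 = (E.tower K).pt j ∧ b 1 = (E.tower K).pt j ∧
      ∃ L : C(I × I, (F.tower K).space j), (∀ t, L (0, t) = (f.tower K).app j (b t)) ∧
        (∀ t, L (1, t) = (F.tower K).tr hij (γ t)) ∧
        ∀ s, L (s, 0) = (F.tower K).pt j ∧ L (s, 1) = (F.tower K).pt j := by
  -- A loop of loops of dimension `K` is a point of the loop space of dimension `K + 1`, and
  -- stable equivalences are surjective on the path components of the latter.
  obtain ⟨G, hG⟩ := F.exists_flat (P := Unit) (K + 1) i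
    ((F.ev K i).comp ⟨fun q => (γ (q.2 0), fun k => q.2 k.succ), by fun_prop⟩) (fun _ s hs => by
      simp only [ContinuousMap.comp_apply, ContinuousMap.coe_mk]
      rcases mem_boundary_succ.1 hs with h | h | h
      · rw [h, h0, ev_pt]
      · rw [h, h1, ev_pt]
      · rw [ev_boundary _ _ h])
  have hG' : ∀ t (s : Fin K → I), F.ev (K + 1) i (G (), Fin.cons t s) = F.ev K i (γ t, s) :=
    fun t s => by rw [hG]; simp
  obtain ⟨j, hij, p, ⟨δ⟩⟩ := hf.exists_app_joined (G ())
  have hbd : ∀ t (s : Fin K → I), t = 0 ∨ t = 1 ∨ s ∈ Cube.boundary (Fin K) →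
      (Fin.cons t s : Fin (K + 1) → I) ∈ Cube.boundary (Fin (K + 1)) := fun t s h => by
    rw [mem_boundary_succ]
    simpa using h
  obtain ⟨b, hb⟩ := E.exists_flat (P := I) K j
    ((E.ev (K + 1) j).comp ⟨fun q => (p, Fin.cons q.1 q.2), by fun_prop⟩)
    (fun t s hs => ev_boundary _ _ (hbd _ _ (Or.inr (Or.inr hs))))
  obtain ⟨L, hL⟩ := F.exists_flat (P := I × I) K j
    ((F.ev (K + 1) j).comp ⟨fun q => (δ q.1.1, Fin.cons q.1.2 q.2), by fun_prop⟩)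
    (fun t s hs => ev_boundary _ _ (hbd _ _ (Or.inr (Or.inr hs))))
  simp only [ContinuousMap.comp_apply, ContinuousMap.coe_mk] at hb hL
  refine ⟨j, hij, b, ?_, ?_, L, fun t => ?_, fun t => ?_, fun s => ⟨?_, ?_⟩⟩
  · refine ev_injective _ fun s => ?_
    rw [hb, ev_boundary _ _ (hbd 0 s (Or.inl rfl)), ev_pt]
  · refine ev_injective _ fun s => ?_
    rw [hb, ev_boundary _ _ (hbd 1 s (Or.inr (Or.inl rfl))), ev_pt]
  · refine ev_injective _ fun s => ?_
    rw [hL, ← ev_app, hb, ev_app, δ.source]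
  · refine ev_injective _ fun s => ?_
    rw [hL, δ.target, ← ev_tr, ← ev_tr, hG']
  · refine ev_injective _ fun s => ?_
    rw [hL, ev_boundary _ _ (hbd 0 s (Or.inl rfl)), ev_pt]
  · refine ev_injective _ fun s => ?_
    rw [hL, ev_boundary _ _ (hbd 1 s (Or.inr (Or.inl rfl))), ev_pt]

/-- Lifting of paths with prescribed endpoints. The endpoints can be joined by some path since a
stable equivalence is injective on homotopy groups; by surjectivity in the next dimension this path
can be corrected by a loop. -/
lemma IsStableEquiv.exists_path_lift (hf : f.IsStableEquiv) {K i : ℕ} (x : (E.tower K).space i)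
    (γ : C(I, (F.tower K).space i)) (h0 : γ 0 = (F.tower K).pt i)
    (h1 : γ 1 = (f.tower K).app i x) :
    ∃ j, ∃ hij : i ≤ j, ∃ b : C(I, (E.tower K).space j),
      b 0 = (E.tower K).pt j ∧ b 1 = (E.tower K).tr hij x ∧
      ∃ L : C(I × I, (F.tower K).space j), (∀ t, L (0, t) = (F.tower K).tr hij (γ t)) ∧
        (∀ t, L (1, t) = (f.tower K).app j (b t)) ∧
        ∀ s, L (s, 0) = (F.tower K).pt j ∧
          L (s, 1) = (F.tower K).tr hij ((f.tower K).app i x) := by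
  -- The path `α` joins the endpoints; its image and `γ` differ by the loop `δ`, which lifts to
  -- `b`.
  obtain ⟨j, hij, hα⟩ := hf.exists_joined (K := K) (i := i) (p := (E.tower K).pt i) (q := x)
    ⟨⟨γ, by rw [Tower.Hom.app_pt]; exact h0, h1⟩⟩
  rw [Tower.tr_pt] at hα
  obtain ⟨α⟩ := hα
  let φ := (f.tower K).app
  let x₁ := (E.tower K).tr hij x
  let γ₁ : Path ((F.tower K).pt j) (φ j x₁) :=
    ⟨((F.tower K).tr hij).comp γ, by simp [h0], by simp [h1, φ, x₁, Tower.Hom.app_tr]⟩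
  let α₁ : Path ((F.tower K).pt j) (φ j x₁) :=
    ⟨(φ j).comp α.toContinuousMap, by simp [φ, Tower.Hom.app_pt], by simp [x₁]⟩
  let δ := γ₁.trans α₁.symm
  obtain ⟨k, hjk, b, hb0, hb1, L, hL0, hL1, hL⟩ := hf.exists_loop_lift δ.toContinuousMap
    δ.source δ.target
  let x₂ := (E.tower K).tr hjk x₁
  let β : Path ((E.tower K).pt k) ((E.tower K).pt k) := ⟨b, hb0, hb1⟩
  let α₂ : Path ((E.tower K).pt k) x₂ :=
    ⟨((E.tower K).tr hjk).comp α.toContinuousMap, by simp, by simp [x₂, x₁]⟩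
  let γ₂ : Path ((F.tower K).pt k) (φ k x₂) :=
    ⟨((F.tower K).tr hjk).comp γ₁.toContinuousMap, by simp, by
      simp [x₂, φ, Tower.Hom.app_tr]⟩
  let α₃ : Path ((F.tower K).pt k) (φ k x₂) :=
    ⟨(φ k).comp α₂.toContinuousMap, by simp [φ, Tower.Hom.app_pt], by simp⟩
  let β₁ : Path ((F.tower K).pt k) ((F.tower K).pt k) :=
    ⟨(φ k).comp b, by simp [φ, hb0, Tower.Hom.app_pt], by simp [φ, hb1, Tower.Hom.app_pt]⟩
  have e1 : β₁.Homotopic (γ₂.trans α₃.symm) := by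
    refine ⟨⟨⟨L, fun t => hL0 t, fun t => ?_⟩, ?_⟩⟩
    · refine (hL1 t).trans ?_
      show (F.tower K).tr hjk (δ t) = (γ₂.trans α₃.symm) t
      simp only [δ, Path.trans_apply]
      split_ifs
      · rfl
      · show (F.tower K).tr hjk (φ j (α _)) = φ k ((E.tower K).tr hjk (α _))
        rw [Tower.Hom.app_tr]
    · rintro s t (rfl | rfl)
      · exact (hL s).1.trans β₁.source.symm
      · exact (hL s).2.trans β₁.target.symm
  have e2 : γ₂.Homotopic (β₁.trans α₃) := by
    refine Path.Homotopic.Quotient.exact ?_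
    rw [← Path.Homotopic.Quotient.eq, Path.Homotopic.Quotient.mk_trans,
      Path.Homotopic.Quotient.mk_symm] at e1
    show Path.Homotopic.Quotient.mk _ = Path.Homotopic.Quotient.mk _
    rw [Path.Homotopic.Quotient.mk_trans, e1, Path.Homotopic.Quotient.trans_assoc,
      Path.Homotopic.Quotient.symm_trans, Path.Homotopic.Quotient.trans_refl]
  obtain ⟨H⟩ := e2
  refine ⟨k, hij.trans hjk, (β.trans α₂).toContinuousMap, (β.trans α₂).source, ?_,
    H.toContinuousMap, fun t => ?_, fun t => ?_, fun s => ⟨?_, ?_⟩⟩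
  · exact (β.trans α₂).target.trans (Tower.tr_tr _ _ _ _)
  · exact (H.apply_zero t).trans (Tower.tr_tr _ _ _ _)
  · refine (H.apply_one t).trans ?_
    show (β₁.trans α₃) t = φ k ((β.trans α₂) t)
    simp only [Path.trans_apply]
    split_ifs <;> rfl
  · exact H.source s
  · refine (H.target s).trans ?_
    simp only [φ, x₂, x₁, Tower.Hom.app_tr, Tower.tr_tr]

section Ball

variable {V S : Type*} [NormedAddCommGroup V] [NormedSpace ℝ V] [TopologicalSpace S]

/-- Lifting along a stable equivalence on a ball `I × S`, relative to a lift on the boundary that is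
trivial on the bottom. -/
lemma IsStableEquiv.exists_box_lift (hf : f.IsStableEquiv) (c : BallChart V S) {K i : ℕ}
    (h : S ≃ₜ (Fin K → I)) (hbd : ∀ s, s ∈ c.bd ↔ h s ∈ Cube.boundary (Fin K))
    (x : C(I × S, (F.tower 0).space i)) (y : I × S → (E.tower 0).space i)
    (hy : ContinuousOn y (BallChart.interval.prod c).bd) (hy0 : ∀ s, y (0, s) = (E.tower 0).pt i)
    (hxy : ∀ r ∈ (BallChart.interval.prod c).bd, x r = (f.tower 0).app i (y r)) :
    ∃ j, ∃ hij : i ≤ j, ∃ z : C(I × S, (E.tower 0).space j),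
      (∀ r ∈ (BallChart.interval.prod c).bd, z r = (E.tower 0).tr hij (y r)) ∧
      ∃ L : C(I × (I × S), (F.tower 0).space j), (∀ r, L (0, r) = (F.tower 0).tr hij (x r)) ∧
        (∀ t, ∀ r ∈ (BallChart.interval.prod c).bd, L (t, r) = (F.tower 0).tr hij (x r)) ∧
        ∀ r, L (1, r) = (f.tower 0).app j (z r) := by
  let B := BallChart.interval.prod c
  have hB : ∀ r : I × S, r ∈ B.bd ↔ r.1 = 0 ∨ r.1 = 1 ∨ r.2 ∈ c.bd := fun r => by
    rw [BallChart.mem_bd_prod, BallChart.mem_bd_interval, or_assoc]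
  have hbot : ∀ r : I × S, r.1 = 0 → y r = (E.tower 0).pt i := fun r hr => by
    rw [← hy0 r.2, ← hr]
  have hsq : ∀ r : I × S, r.1 = 0 ∨ r.2 ∈ c.bd → y (c.squeeze (1, r)) = (E.tower 0).pt i :=
    fun r hr => hbot _ (c.squeeze_one hr)
  have hsqx : ∀ r : I × S, r.1 = 0 ∨ r.2 ∈ c.bd → x (c.squeeze (1, r)) = (F.tower 0).pt i :=
    fun r hr => by
      rw [hxy _ ((hB _).2 (Or.inl (c.squeeze_one hr))), hsq r hr, Tower.Hom.app_pt]
  -- after squeezing, the problem is one about lifting a path of loops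
  have htop : ∀ s : S, c.squeeze (1, (1, s)) ∈ B.bd := fun s =>
    c.squeeze_mem_bd ((hB _).2 (Or.inr (Or.inl rfl)))
  obtain ⟨w, hw⟩ := E.exists_flat (P := Unit) K i
    ⟨fun q => y (c.squeeze (1, (1, h.symm q.2))), hy.comp_continuous (by fun_prop) fun q =>
      htop _⟩ (fun _ s hs => hsq _ (Or.inr ((hbd _).2 (by simpa using hs))))
  obtain ⟨γ, hγ⟩ := F.exists_flat (P := I) K i
    ⟨fun q => x (c.squeeze (1, (q.1, h.symm q.2))), by fun_prop⟩
    (fun _ s hs => hsqx _ (Or.inr ((hbd _).2 (by simpa using hs))))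
  simp only [ContinuousMap.coe_mk] at hw hγ
  obtain ⟨j, hij, b, hb0, hb1, L, hL0, hL1, hL⟩ := hf.exists_path_lift (w ()) γ
    (ev_injective _ fun s => by rw [hγ, hsqx _ (Or.inl rfl), ev_pt])
    (ev_injective _ fun s => by rw [hγ, ← ev_app, hw, hxy _ (htop _)])
  let z₀ : C(I × S, (E.tower 0).space j) := (E.ev K j).comp ⟨fun r => (b r.1, h r.2), by fun_prop⟩
  have hz₀ : ∀ r, z₀ r = E.ev K j (b r.1, h r.2) := fun r => rfl
  have hz₀b : ∀ r ∈ B.bd, z₀ r = (E.tower 0).tr hij (y (c.squeeze (1, r))) := by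
    rintro ⟨t, s⟩ hr
    rw [hz₀]
    rcases (hB _).1 hr with rfl | rfl | hs
    · rw [hb0, hsq _ (Or.inl rfl), ev_pt, Tower.tr_pt]
    · rw [hb1, ← ev_tr, hw]
      simp
    · rw [hsq _ (Or.inr hs), ev_boundary _ _ ((hbd s).1 hs), Tower.tr_pt]
  let Kh : C(I × (I × S), (F.tower 0).space j) :=
    (((F.tower 0).tr hij).comp x).comp c.squeeze
  have hKh : ∀ q, Kh q = (F.tower 0).tr hij (x (c.squeeze q)) := fun q => rfl
  let Lh : C(I × (I × S), (F.tower 0).space j) :=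
    (F.ev K j).comp ⟨fun q => (L (q.1, q.2.1), h q.2.2), by fun_prop⟩
  have hLh : ∀ q, Lh q = F.ev K j (L (q.1, q.2.1), h q.2.2) := fun q => rfl
  -- The squeezing, followed by the homotopy to the image of the lift `z₀`: on the boundary it
  -- moves along the squeezing only, which is undone by `exists_lift_rel`.
  obtain ⟨G, hG0, hGb, hG1⟩ := B.exists_concat_rel Kh Lh
    (fun r => by
      rw [hLh, hKh, hL0, ← ev_tr, hγ]
      simp)
    (fun t r hr => by
      obtain ⟨a, s⟩ := r
      rw [hLh, hKh]
      rcases (hB _).1 hr with rfl | rfl | hs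
      · rw [(hL t).1, hsqx _ (Or.inl rfl), ev_pt, Tower.tr_pt]
      · rw [(hL t).2, ← ev_tr, hxy _ (htop s), ← ev_app, hw]
        simp
      · rw [hsqx _ (Or.inr hs), ev_boundary _ _ ((hbd s).1 hs), Tower.tr_pt])
  have hscl : ∀ r ∈ B.bd, B.scl (2, r) = r := fun r hr => B.scl_of_mem_bd one_le_two hr
  obtain ⟨z, hz, L', hL'0, hL'b, hL'1⟩ := B.exists_lift_rel ((f.tower 0).app j)
    (((F.tower 0).tr hij).comp x) (fun q => (E.tower 0).tr hij (y (c.squeeze q)))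
    (by
      refine ((E.tower 0).tr hij).continuous.comp_continuousOn (hy.comp (by fun_prop) ?_)
      rintro ⟨t, r⟩ ⟨-, hr⟩
      exact c.squeeze_mem_bd hr)
    (z₀.comp ⟨fun r => B.scl (2, r), by fun_prop⟩)
    (fun r hr => by
      simp only [ContinuousMap.comp_apply, ContinuousMap.coe_mk]
      rw [hscl r hr, hz₀b r hr])
    G (fun r => by rw [hG0, hKh, c.squeeze_zero]; rfl)
    (fun t r hr => by rw [hGb t r hr, hKh, hxy _ (c.squeeze_mem_bd hr), Tower.Hom.app_tr])
    (fun r => by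
      rw [hG1, hLh, hL1, ← ev_app]
      rfl)
  refine ⟨j, hij, z, fun r hr => ?_, L', hL'0, hL'b, hL'1⟩
  rw [hz r hr, c.squeeze_zero]

/-- Lifting along a stable equivalence on a ball, relative to a lift on the boundary sphere. -/
theorem IsStableEquiv.exists_ball_lift (hf : f.IsStableEquiv) (c : BallChart V S) {K i : ℕ}
    (h : S ≃ₜ (Fin K → I)) (hbd : ∀ s, s ∈ c.bd ↔ h s ∈ Cube.boundary (Fin K))
    (x : C(S, (F.tower 1).space i)) (y : S → (E.tower 1).space i) (hy : ContinuousOn y c.bd)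
    (hxy : ∀ s ∈ c.bd, x s = (f.tower 1).app i (y s)) :
    ∃ j, ∃ hij : i ≤ j, ∃ z : C(S, (E.tower 1).space j),
      (∀ s ∈ c.bd, z s = (E.tower 1).tr hij (y s)) ∧
      ∃ L : C(I × S, (F.tower 1).space j), (∀ s, L (0, s) = (F.tower 1).tr hij (x s)) ∧
        (∀ t, ∀ s ∈ c.bd, L (t, s) = (F.tower 1).tr hij (x s)) ∧
        ∀ s, L (1, s) = (f.tower 1).app j (z s) := by
  classical
  have hB : ∀ r : I × S, r ∈ (BallChart.interval.prod c).bd ↔ r.1 = 0 ∨ r.1 = 1 ∨ r.2 ∈ c.bd :=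
    fun r => by rw [BallChart.mem_bd_prod, BallChart.mem_bd_interval, or_assoc]
  have hcb : ∀ t : I, (fun _ : Fin 1 => t) ∈ Cube.boundary (Fin 1) ↔ t = 0 ∨ t = 1 := fun t =>
    ⟨fun ⟨_, h⟩ => h, fun h => ⟨0, h⟩⟩
  have hone : ∀ s : Fin 1 → I, (fun _ => s 0) = s := fun s => funext fun k => by
    rw [Subsingleton.elim 0 k]
  -- By adjunction, a map from `S` to the loop spaces of `tower 1` is a map from `I × S` to those of
  -- `tower 0` that is trivial at both ends; in particular the lift is trivial on the bottom.
  let y₀ : I × S → (E.tower 0).space i := fun r =>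
    if r.2 ∈ c.bd then E.ev 1 i (y r.2, fun _ => r.1) else (E.tower 0).pt i
  have hy1 : ∀ r, r.2 ∈ c.bd → y₀ r = E.ev 1 i (y r.2, fun _ => r.1) := fun r hr => if_pos hr
  have hy2 : ∀ r, r.1 = 0 ∨ r.1 = 1 → y₀ r = (E.tower 0).pt i := fun r hr => by
    by_cases h : r.2 ∈ c.bd
    · rw [hy1 r h, ev_boundary _ _ ((hcb _).2 hr)]
    · exact if_neg h
  have hx2 : ∀ s t, t = 0 ∨ t = 1 → F.ev 1 i (x s, fun _ => t) = (F.tower 0).pt i :=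
    fun s t ht => ev_boundary _ _ ((hcb _).2 ht)
  obtain ⟨j, hij, z, hz, L, hL0, hLb, hL1⟩ := hf.exists_box_lift c h hbd
    ((F.ev 1 i).comp ⟨fun r => (x r.2, fun _ => r.1), by fun_prop⟩) y₀
    (by
      have c1 : ContinuousOn y₀ {r | r.2 ∈ c.bd} := by
        refine ContinuousOn.congr ?_ hy1
        refine (E.ev 1 i).continuous.comp_continuousOn (ContinuousOn.prodMk ?_ ?_)
        · exact hy.comp continuousOn_snd fun r hr => hr
        · exact (by fun_prop : Continuous fun r : I × S => fun _ : Fin 1 => r.1).continuousOn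
      have c2 : ContinuousOn y₀ {r | r.1 = 0 ∨ r.1 = 1} :=
        ContinuousOn.congr continuousOn_const hy2
      refine (c1.union_of_isClosed c2 (c.isClosed_bd.preimage continuous_snd)
        ((isClosed_eq continuous_fst continuous_const).union
          (isClosed_eq continuous_fst continuous_const))).mono fun r hr => ?_
      rcases (hB r).1 hr with h | h | h
      exacts [Or.inr (Or.inl h), Or.inr (Or.inr h), Or.inl h])
    (fun s => hy2 _ (Or.inl rfl))
    (fun r hr => by
      simp only [ContinuousMap.comp_apply, ContinuousMap.coe_mk]
      by_cases hs : r.2 ∈ c.bd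
      · rw [hy1 r hs, hxy _ hs, ev_app]
      · have ht : r.1 = 0 ∨ r.1 = 1 := by
          rcases (hB r).1 hr with h | h | h
          exacts [Or.inl h, Or.inr h, (hs h).elim]
        rw [hy2 r ht, hx2 _ _ ht, Tower.Hom.app_pt])
  simp only [ContinuousMap.comp_apply, ContinuousMap.coe_mk] at hL0 hLb
  have hz2 : ∀ t s, t = 0 ∨ t = 1 → z (t, s) = (E.tower 0).pt j := fun t s ht => by
    rw [hz _ ((hB _).2 (ht.imp_right Or.inl)), hy2 _ ht, Tower.tr_pt]
  obtain ⟨Z, hZ⟩ := E.exists_flat (P := S) 1 j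
    (z.comp ⟨fun q => (q.2 0, q.1), by fun_prop⟩) (fun s t ht => hz2 _ _ ((hcb _).1 (by
      rwa [hone])))
  obtain ⟨M, hM⟩ := F.exists_flat (P := I × S) 1 j
    (L.comp ⟨fun q => (q.1.1, (q.2 0, q.1.2)), by fun_prop⟩) (fun s t ht => by
      have ht' := (hcb (t 0)).1 (by rwa [hone])
      simp only [ContinuousMap.comp_apply, ContinuousMap.coe_mk]
      rw [hLb _ _ ((hB _).2 (ht'.imp_right Or.inl)), hx2 _ _ ht', Tower.tr_pt])
  simp only [ContinuousMap.comp_apply, ContinuousMap.coe_mk] at hZ hM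
  refine ⟨j, hij, Z, fun s hs => ?_, M, fun s => ?_, fun t s hs => ?_, fun s => ?_⟩
  · refine ev_injective _ fun a => ?_
    rw [hZ, hz _ ((hB _).2 (Or.inr (Or.inr hs))), hy1 _ hs, ← ev_tr, hone]
  · refine ev_injective _ fun a => ?_
    rw [hM, hL0, ← ev_tr, hone]
  · refine ev_injective _ fun a => ?_
    rw [hM, hLb _ _ ((hB _).2 (Or.inr (Or.inr hs))), ← ev_tr, hone]
  · refine ev_injective _ fun a => ?_
    rw [hM, hL1, ← ev_app, hZ]

end Ball

end Spectrum.Hom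

/-! ### Lifting maps of finite complexes along stable equivalences -/

/-- The closed ball for the maximum norm as a cube. -/
def ballCube (n : ℕ) : closedBall (0 : Fin n → ℝ) 1 ≃ₜ (Fin n → I) where
  toFun y := (BallChart.cube (Fin n)).ret y
  invFun s := ⟨(BallChart.cube (Fin n)).emb s, by
    rw [mem_closedBall_zero_iff]
    exact (BallChart.cube (Fin n)).norm_emb_le s⟩
  left_inv y := by
    refine Subtype.ext ?_
    have h := y.2
    rw [mem_closedBall_zero_iff] at h
    exact ((BallChart.cube (Fin n)).emb_ret y).trans (BallChart.clamp_eq_self h)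
  right_inv s := (BallChart.cube (Fin n)).ret_emb s
  continuous_toFun := by fun_prop
  continuous_invFun := by fun_prop

lemma ballCube_mem_boundary {n : ℕ} {y : closedBall (0 : Fin n → ℝ) 1} :
    ballCube n y ∈ Cube.boundary (Fin n) ↔ (y : Fin n → ℝ) ∈ Metric.sphere (0 : Fin n → ℝ) 1 := by
  obtain ⟨s, rfl⟩ := (ballCube n).symm.surjective y
  rw [Homeomorph.apply_symm_apply, ← BallChart.mem_bd_cube, mem_sphere_zero_iff_norm]
  rfl

lemma append_mem_boundary {n q : ℕ} {r : (Fin n → I) × (Fin q → I)} :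
    Fin.appendHomeomorph n q r ∈ Cube.boundary (Fin (n + q)) ↔
      r.1 ∈ Cube.boundary (Fin n) ∨ r.2 ∈ Cube.boundary (Fin q) := by
  constructor
  · rintro ⟨k, hk⟩
    revert hk
    refine Fin.addCases (fun k hk => ?_) (fun k hk => ?_) k
    · exact Or.inl ⟨k, by simpa using hk⟩
    · exact Or.inr ⟨k, by simpa using hk⟩
  · rintro (⟨k, hk⟩ | ⟨k, hk⟩)
    · exact ⟨Fin.castAdd q k, by simpa using hk⟩
    · exact ⟨Fin.natAdd n k, by simpa using hk⟩

namespace Spectrum.Hom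

section Cells

variable {E F : Spectrum.{u}} {f : Hom E F}
variable {A : Type u} [TopologicalSpace A] [T2Space A] [CWComplex (Set.univ : Set A)]

/-- The conditions on the restriction to `{a} × I^q` of a lift `z` of a family `x` and of
a homotopy `L` between them, where `y` prescribes the lift on the boundary of the cubes. -/
structure IsLiftAt (f : Hom E F) (a0 : A) {q i : ℕ} (x : A × (Fin q → I) → (F.tower 1).space i)
    (y : A × (Fin q → I) → (E.tower 1).space i) {j : ℕ} (hij : i ≤ j) (a : A)
    (z : (Fin q → I) → (E.tower 1).space j) (L : I × (Fin q → I) → (F.tower 1).space j) :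
    Prop where
  boundary : ∀ t ∈ Cube.boundary (Fin q), z t = (E.tower 1).tr hij (y (a, t))
  pt : a = a0 → ∀ t, z t = (E.tower 1).pt j
  zero : ∀ t, L (0, t) = (F.tower 1).tr hij (x (a, t))
  one : ∀ t, L (1, t) = (f.tower 1).app j (z t)
  htpy_pt : a = a0 → ∀ s t, L (s, t) = (F.tower 1).pt j
  htpy_boundary : ∀ s, ∀ t ∈ Cube.boundary (Fin q), L (s, t) = (F.tower 1).tr hij (x (a, t))

lemma IsLiftAt.tr {A : Type u} {a0 : A} {q i : ℕ} {x : A × (Fin q → I) → (F.tower 1).space i}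
    {y : A × (Fin q → I) → (E.tower 1).space i} {j k : ℕ} {hij : i ≤ j} {a : A}
    {z : (Fin q → I) → (E.tower 1).space j} {L : I × (Fin q → I) → (F.tower 1).space j}
    (h : IsLiftAt f a0 x y hij a z L) (hjk : j ≤ k) :
    IsLiftAt f a0 x y (hij.trans hjk) a (fun t => (E.tower 1).tr hjk (z t))
      (fun r => (F.tower 1).tr hjk (L r)) where
  boundary t ht := by rw [h.boundary t ht, Tower.tr_tr]
  pt ha t := by rw [h.pt ha, Tower.tr_pt]
  zero t := by rw [h.zero, Tower.tr_tr]
  one t := by rw [h.one, Tower.Hom.app_tr]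
  htpy_pt ha s t := by rw [h.htpy_pt ha, Tower.tr_pt]
  htpy_boundary s t ht := by rw [h.htpy_boundary s t ht, Tower.tr_tr]

variable {a0 : A} {q i : ℕ} {x : C(A × (Fin q → I), (F.tower 1).space i)}
  {y : A × (Fin q → I) → (E.tower 1).space i}

/-- Extension of a lift over a cell that contains the base point, which is a vertex. -/
lemma exists_cell_lift_pt (f : Hom E F) (ha0 : a0 ∈ skLT A 1)
    (hx0 : ∀ t, x (a0, t) = (F.tower 1).pt i)
    (hy0 : ∀ t ∈ Cube.boundary (Fin q), y (a0, t) = (E.tower 1).pt i) {j : ℕ} (hij : i ≤ j) {n : ℕ}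
    (e : Cell A n) (hcase : ∃ b ∈ ball (0 : Fin n → ℝ) 1, chi n e b = a0) :
    n = 0 ∧ ∀ b, IsLiftAt f a0 x y hij (chi n e b) (fun _ => (E.tower 1).pt j)
      (fun _ => (F.tower 1).pt j) := by
  obtain ⟨b1, hb1, hb1'⟩ := hcase
  have hn0 : n = 0 := by
    by_contra hne
    refine chi_ball_notMem e hb1 (CWComplex.skeletonLT_mono ?_ (hb1' ▸ ha0))
    exact_mod_cast Nat.one_le_iff_ne_zero.2 hne
  subst hn0
  refine ⟨rfl, fun b => ?_⟩
  have hb : chi 0 e b = a0 := by rw [Subsingleton.elim b b1, hb1']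
  rw [hb]
  exact ⟨fun t ht => by rw [hy0 t ht, Tower.tr_pt], fun _ _ => rfl,
    fun t => by rw [hx0, Tower.tr_pt], fun t => by rw [Tower.Hom.app_pt], fun _ _ _ => rfl,
    fun s t _ => by rw [hx0, Tower.tr_pt]⟩

/-- Extension of a lift, and of the homotopy that comes with it, over a cell. -/
lemma IsStableEquiv.exists_cell_lift (hf : f.IsStableEquiv)
    (hy : ContinuousOn y (univ ×ˢ Cube.boundary (Fin q)))
    (hxy : ∀ a, ∀ t ∈ Cube.boundary (Fin q), x (a, t) = (f.tower 1).app i (y (a, t)))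
    {j : ℕ} (hij : i ≤ j) {n : ℕ} (e : Cell A n)
    (hcase : ∀ b ∈ ball (0 : Fin n → ℝ) 1, chi n e b ≠ a0)
    (z : A → (Fin q → I) → (E.tower 1).space j) (L : A → I × (Fin q → I) → (F.tower 1).space j)
    (hz : ContinuousOn (fun r : A × (Fin q → I) => z r.1 r.2) (skLT A n ×ˢ univ))
    (hL : ContinuousOn (fun r : A × (I × (Fin q → I)) => L r.1 r.2) (skLT A n ×ˢ univ))
    (hzL : ∀ a ∈ skLT A n, IsLiftAt f a0 x y hij a (z a) (L a)) :
    ∃ k, ∃ hjk : j ≤ k, ∃ (Z : (Fin n → ℝ) → (Fin q → I) → (E.tower 1).space k)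
      (M : (Fin n → ℝ) → I × (Fin q → I) → (F.tower 1).space k),
      ContinuousOn (fun r : (Fin n → ℝ) × (Fin q → I) => Z r.1 r.2) (closedBall 0 1 ×ˢ univ) ∧
      ContinuousOn (fun r : (Fin n → ℝ) × (I × (Fin q → I)) => M r.1 r.2) (closedBall 0 1 ×ˢ univ) ∧
      (∀ b ∈ Metric.sphere (0 : Fin n → ℝ) 1, (∀ t, Z b t = (E.tower 1).tr hjk (z (chi n e b) t)) ∧
        ∀ r, M b r = (F.tower 1).tr hjk (L (chi n e b) r)) ∧
      ∀ b ∈ closedBall (0 : Fin n → ℝ) 1,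
        IsLiftAt f a0 x y (hij.trans hjk) (chi n e b) (Z b) (M b) := by
  classical
  let c := (BallChart.ball (Fin n → ℝ)).prod (BallChart.cube (Fin q))
  have hbd : ∀ r : (closedBall (0 : Fin n → ℝ) 1 × (Fin q → I)), r ∈ c.bd ↔
      (r.1 : Fin n → ℝ) ∈ Metric.sphere (0 : Fin n → ℝ) 1 ∨ r.2 ∈ Cube.boundary (Fin q) :=
    fun r => by rw [BallChart.mem_bd_prod, BallChart.mem_bd_ball, BallChart.mem_bd_cube]
  have hchi : Continuous fun r : (closedBall (0 : Fin n → ℝ) 1 × (Fin q → I)) => chi n e r.1 :=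
    ((continuousOn_chi e).comp_continuous continuous_subtype_val fun y => y.2).comp continuous_fst
  have hsk : ∀ r : (closedBall (0 : Fin n → ℝ) 1 × (Fin q → I)),
      (r.1 : Fin n → ℝ) ∈ Metric.sphere (0 : Fin n → ℝ) 1 →
      IsLiftAt f a0 x y hij (chi n e r.1) (z (chi n e r.1)) (L (chi n e r.1)) := fun r hr =>
    hzL _ (chi_sphere_mem e hr)
  -- the given homotopy on the boundary of the cell
  let x₁ : C(closedBall (0 : Fin n → ℝ) 1 × (Fin q → I), (F.tower 1).space j) :=
    (((F.tower 1).tr hij).comp x).comp ⟨fun r => (chi n e r.1, r.2), by fun_prop⟩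
  let k₁ : I × (closedBall (0 : Fin n → ℝ) 1 × (Fin q → I)) → (F.tower 1).space j := fun r =>
    if (r.2.1 : Fin n → ℝ) ∈ Metric.sphere (0 : Fin n → ℝ) 1 then L (chi n e r.2.1) (r.1, r.2.2)
    else x₁ r.2
  have hk1 : ∀ r, (r.2.1 : Fin n → ℝ) ∈ Metric.sphere (0 : Fin n → ℝ) 1 →
      k₁ r = L (chi n e r.2.1) (r.1, r.2.2) := fun r hr => if_pos hr
  have hk2 : ∀ r, r.2.2 ∈ Cube.boundary (Fin q) → k₁ r = x₁ r.2 := fun r hr => by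
    by_cases h : (r.2.1 : Fin n → ℝ) ∈ Metric.sphere (0 : Fin n → ℝ) 1
    · rw [hk1 r h]
      exact (hsk r.2 h).htpy_boundary _ _ hr
    · exact if_neg h
  have hk₁ : ContinuousOn k₁ (univ ×ˢ c.bd) := by
    have h1 : ContinuousOn k₁ {r | (r.2.1 : Fin n → ℝ) ∈ Metric.sphere (0 : Fin n → ℝ) 1} := by
      refine ContinuousOn.congr ?_ fun r hr => hk1 r hr
      exact hL.comp (f := fun r : I × (closedBall (0 : Fin n → ℝ) 1 × (Fin q → I)) =>
        (chi n e r.2.1, (r.1, r.2.2)))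
        ((hchi.comp continuous_snd).prodMk (by fun_prop)).continuousOn
        fun r hr => ⟨chi_sphere_mem e hr, mem_univ _⟩
    have h2 : ContinuousOn k₁ {r | r.2.2 ∈ Cube.boundary (Fin q)} := by
      refine ContinuousOn.congr ?_ fun r hr => hk2 r hr
      exact (by fun_prop : Continuous fun r : I × (closedBall (0 : Fin n → ℝ) 1 × (Fin q → I)) =>
        x₁ r.2).continuousOn
    refine (h1.union_of_isClosed h2 (isClosed_sphere.preimage (by fun_prop :
      Continuous fun r : I × (closedBall (0 : Fin n → ℝ) 1 × (Fin q → I)) => (r.2.1 : Fin n → ℝ)))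
      ((isClosed_cubeBoundary q).preimage
      (by fun_prop : Continuous fun r : I × (closedBall (0 : Fin n → ℝ) 1 × (Fin q → I)) =>
        r.2.2))).mono ?_
    rintro ⟨s, r⟩ ⟨-, hr⟩
    exact (hbd r).1 hr
  obtain ⟨K, hK0, hKb⟩ := c.exists_homotopy_extension' x₁ k₁ hk₁ (fun r hr => by
    rcases (hbd r).1 hr with h | h
    · rw [hk1 _ h]
      exact (hsk r h).zero _
    · exact hk2 _ h)
  -- the given lift on the boundary of the cell
  let y₁ : (closedBall (0 : Fin n → ℝ) 1 × (Fin q → I)) → (E.tower 1).space j := fun r =>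
    if (r.1 : Fin n → ℝ) ∈ Metric.sphere (0 : Fin n → ℝ) 1 then z (chi n e r.1) r.2
    else (E.tower 1).tr hij (y (chi n e r.1, r.2))
  have hy1 : ∀ r, (r.1 : Fin n → ℝ) ∈ Metric.sphere (0 : Fin n → ℝ) 1 →
      y₁ r = z (chi n e r.1) r.2 := fun r hr => if_pos hr
  have hy2 : ∀ r, r.2 ∈ Cube.boundary (Fin q) →
      y₁ r = (E.tower 1).tr hij (y (chi n e r.1, r.2)) := fun r hr => by
    by_cases h : (r.1 : Fin n → ℝ) ∈ Metric.sphere (0 : Fin n → ℝ) 1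
    · rw [hy1 r h]
      exact (hsk r h).boundary _ hr
    · exact if_neg h
  have hy₁ : ContinuousOn y₁ c.bd := by
    have h1 : ContinuousOn y₁ {r | (r.1 : Fin n → ℝ) ∈ Metric.sphere (0 : Fin n → ℝ) 1} := by
      refine ContinuousOn.congr ?_ fun r hr => hy1 r hr
      exact hz.comp (f := fun r : (closedBall (0 : Fin n → ℝ) 1 × (Fin q → I)) =>
        (chi n e r.1, r.2))
        (by fun_prop) fun r hr => ⟨chi_sphere_mem e hr, mem_univ _⟩
    have h2 : ContinuousOn y₁ {r | r.2 ∈ Cube.boundary (Fin q)} := by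
      refine ContinuousOn.congr ?_ fun r hr => hy2 r hr
      exact ((E.tower 1).tr hij).continuous.comp_continuousOn
        (hy.comp (f := fun r : (closedBall (0 : Fin n → ℝ) 1 × (Fin q → I)) =>
          (chi n e r.1, r.2)) (by fun_prop) fun r hr => ⟨mem_univ _, hr⟩)
    exact (h1.union_of_isClosed h2 (isClosed_sphere.preimage (by fun_prop :
      Continuous fun r : (closedBall (0 : Fin n → ℝ) 1 × (Fin q → I)) => (r.1 : Fin n → ℝ)))
      ((isClosed_cubeBoundary q).preimage
      (by fun_prop : Continuous fun r : (closedBall (0 : Fin n → ℝ) 1 × (Fin q → I)) =>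
        r.2))).mono fun r hr => (hbd r).1 hr
  have hKy : ∀ r ∈ c.bd, K (1, r) = (f.tower 1).app j (y₁ r) := fun r hr => by
    rw [hKb _ r hr]
    by_cases h : (r.1 : Fin n → ℝ) ∈ Metric.sphere (0 : Fin n → ℝ) 1
    · rw [hk1 _ h, hy1 _ h]
      exact (hsk r h).one _
    · have ht := ((hbd r).1 hr).resolve_left h
      rw [hk2 _ ht, hy2 _ ht, Tower.Hom.app_tr, ← hxy _ _ ht]
      rfl
  obtain ⟨k, hjk, Z, hZb, M, hM0, hMb, hM1⟩ := hf.exists_ball_lift c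
    (((ballCube n).prodCongr (Homeomorph.refl _)).trans (Fin.appendHomeomorph n q))
    (fun r => by
      rw [hbd, ← ballCube_mem_boundary]
      exact (append_mem_boundary (r := (ballCube n r.1, r.2))).symm)
    (K.comp ⟨fun r => ((1 : I), r), by fun_prop⟩) y₁ hy₁ hKy
  -- The homotopy over the cell is the extended one, followed by the homotopy to the image of `Z`.
  obtain ⟨G, hG0, hGb, hG1⟩ := c.exists_concat_rel (((F.tower 1).tr hjk).comp K) M hM0 hMb
  have hscl : ∀ r ∈ c.bd, c.scl (2, r) = r := fun r hr => c.scl_of_mem_bd one_le_two hr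
  let pr : (Fin n → ℝ) → closedBall (0 : Fin n → ℝ) 1 := (BallChart.ball (Fin n → ℝ)).ret
  have hprc : Continuous pr := (BallChart.ball (Fin n → ℝ)).ret.continuous
  have hpr : ∀ y (hy : y ∈ closedBall (0 : Fin n → ℝ) 1), pr y = ⟨y, hy⟩ := fun y hy =>
    (BallChart.ball (Fin n → ℝ)).ret_emb ⟨y, hy⟩
  refine ⟨k, hjk, fun b t => Z (c.scl (2, (pr b, t))), fun b r => G (r.1, (pr b, r.2)), ?_, ?_,
    fun b hb => ?_, fun b hb => ?_⟩
  · exact (by fun_prop : Continuous fun r : (Fin n → ℝ) × (Fin q → I) =>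
      Z (c.scl (2, (pr r.1, r.2)))).continuousOn
  · exact (by fun_prop : Continuous fun r : (Fin n → ℝ) × (I × (Fin q → I)) =>
      G (r.2.1, (pr r.1, r.2.2))).continuousOn
  · simp only [hpr b (sphere_subset_closedBall hb)]
    constructor
    · intro t
      have h := (hbd (⟨b, sphere_subset_closedBall hb⟩, t)).2 (Or.inl hb)
      rw [hscl _ h, hZb _ h, hy1 _ hb]
    · intro r
      have h := (hbd (⟨b, sphere_subset_closedBall hb⟩, r.2)).2 (Or.inl hb)
      rw [hGb _ _ h, ContinuousMap.comp_apply, hKb _ _ h, hk1 _ hb]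
  · have hsph : chi n e b = a0 → b ∈ Metric.sphere (0 : Fin n → ℝ) 1 := fun h => by
      rw [← sphere_union_ball] at hb
      exact hb.resolve_right fun hb => hcase b hb h
    simp only [hpr b hb]
    refine ⟨fun t ht => ?_, fun h t => ?_, fun t => ?_, fun t => ?_, fun h s t => ?_,
      fun s t ht => ?_⟩
    · have h := (hbd (⟨b, hb⟩, t)).2 (Or.inr ht)
      rw [hscl _ h, hZb _ h, hy2 _ ht, Tower.tr_tr]
    · have h' := (hbd (⟨b, hb⟩, t)).2 (Or.inl (hsph h))
      rw [hscl _ h', hZb _ h', hy1 _ (hsph h), (hsk (⟨b, hb⟩, t) (hsph h)).pt h, Tower.tr_pt]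
    · rw [hG0, ContinuousMap.comp_apply, hK0]
      exact Tower.tr_tr _ _ _ _
    · rw [hG1, hM1]
    · have h' := (hbd (⟨b, hb⟩, t)).2 (Or.inl (hsph h))
      rw [hGb _ _ h', ContinuousMap.comp_apply, hKb _ _ h', hk1 _ (hsph h),
        (hsk (⟨b, hb⟩, t) (hsph h)).htpy_pt h, Tower.tr_pt]
    · have h := (hbd (⟨b, hb⟩, t)).2 (Or.inr ht)
      rw [hGb _ _ h, ContinuousMap.comp_apply, hKb _ _ h, hk2 _ ht]
      exact Tower.tr_tr _ _ _ _

/-- Lifting of a family of maps of a finite complex along a stable equivalence, relative to a lift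
on the boundary of the parameter cube. -/
theorem IsStableEquiv.exists_finite_lift (hf : f.IsStableEquiv)
    [RelCWComplex.Finite (Set.univ : Set A)] (ha0 : a0 ∈ skLT A 1)
    (hx0 : ∀ t, x (a0, t) = (F.tower 1).pt i)
    (hy : ContinuousOn y (univ ×ˢ Cube.boundary (Fin q)))
    (hy0 : ∀ t ∈ Cube.boundary (Fin q), y (a0, t) = (E.tower 1).pt i)
    (hxy : ∀ a, ∀ t ∈ Cube.boundary (Fin q), x (a, t) = (f.tower 1).app i (y (a, t))) :
    ∃ j, ∃ hij : i ≤ j, ∃ (z : C(A × (Fin q → I), (E.tower 1).space j))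
      (L : C(A × (I × (Fin q → I)), (F.tower 1).space j)),
      ∀ a, IsLiftAt f a0 x y hij a (fun t => z (a, t)) (fun r => L (a, r)) := by
  have main : ∀ n : ℕ, ∃ j, ∃ hij : i ≤ j, ∃ (z : A → (Fin q → I) → (E.tower 1).space j)
      (L : A → I × (Fin q → I) → (F.tower 1).space j),
      ContinuousOn (fun r : A × (Fin q → I) => z r.1 r.2) (skLT A n ×ˢ univ) ∧
      ContinuousOn (fun r : A × (I × (Fin q → I)) => L r.1 r.2) (skLT A n ×ˢ univ) ∧
      ∀ a ∈ skLT A n, IsLiftAt f a0 x y hij a (z a) (L a) := by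
    intro n
    induction n with
    | zero =>
      refine ⟨i, le_rfl, fun _ _ => (E.tower 1).pt i, fun _ _ => (F.tower 1).pt i,
        continuousOn_const, continuousOn_const, fun a ha => ?_⟩
      obtain ⟨m, hm, -⟩ := exists_chi_of_mem_skLT ha
      simp at hm
    | succ n ih =>
      obtain ⟨j, hij, z, L, hz, hL, hzL⟩ := ih
      have hcell : ∀ e : Cell A n, ∃ k, ∃ hjk : j ≤ k,
          ∃ (Z : (Fin n → ℝ) → (Fin q → I) → (E.tower 1).space k)
          (M : (Fin n → ℝ) → I × (Fin q → I) → (F.tower 1).space k),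
          ContinuousOn (fun r : (Fin n → ℝ) × (Fin q → I) => Z r.1 r.2) (closedBall 0 1 ×ˢ univ) ∧
          ContinuousOn (fun r : (Fin n → ℝ) × (I × (Fin q → I)) => M r.1 r.2)
            (closedBall 0 1 ×ˢ univ) ∧
          (∀ b ∈ Metric.sphere (0 : Fin n → ℝ) 1,
            (∀ t, Z b t = (E.tower 1).tr hjk (z (chi n e b) t)) ∧
            ∀ r, M b r = (F.tower 1).tr hjk (L (chi n e b) r)) ∧
          ∀ b ∈ closedBall (0 : Fin n → ℝ) 1,
            IsLiftAt f a0 x y (hij.trans hjk) (chi n e b) (Z b) (M b) := by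
        intro e
        by_cases hcase : ∃ b ∈ ball (0 : Fin n → ℝ) 1, chi n e b = a0
        · obtain ⟨rfl, h⟩ := exists_cell_lift_pt f ha0 hx0 hy0 hij e hcase
          refine ⟨j, le_rfl, _, _, continuousOn_const, continuousOn_const, fun b hb => ?_,
            fun b _ => h b⟩
          rw [mem_sphere_zero_iff_norm, Subsingleton.elim b 0, norm_zero] at hb
          exact (zero_ne_one hb).elim
        · exact hf.exists_cell_lift hy hxy hij e (fun b hb h => hcase ⟨b, hb, h⟩) z L hz hL hzL
      choose k hjk Z M hZ hM hZM hlift using hcell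
      -- The lifts over the finitely many cells live in a common level.
      have hfin : Finite (Cell A n) := RelCWComplex.FiniteType.finite_cell (C := (univ : Set A)) n
      obtain ⟨l, hl⟩ := (Set.finite_range k).bddAbove
      have hl' : ∀ e, k e ≤ max j l := fun e => (hl ⟨e, rfl⟩).trans (le_max_right _ _)
      obtain ⟨z', hz', hz'1, hz'2⟩ := exists_extension_step n
        (fun a t => (E.tower 1).tr (le_max_left j l) (z a t))
        (((E.tower 1).tr (le_max_left j l)).continuous.comp_continuousOn hz)
        (fun e b t => (E.tower 1).tr (hl' e) (Z e b t))
        (fun e => ((E.tower 1).tr (hl' e)).continuous.comp_continuousOn (hZ e))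
        (fun e b hb => funext fun t => by rw [(hZM e b hb).1, Tower.tr_tr])
      obtain ⟨L', hL', hL'1, hL'2⟩ := exists_extension_step n
        (fun a t => (F.tower 1).tr (le_max_left j l) (L a t))
        (((F.tower 1).tr (le_max_left j l)).continuous.comp_continuousOn hL)
        (fun e b t => (F.tower 1).tr (hl' e) (M e b t))
        (fun e => ((F.tower 1).tr (hl' e)).continuous.comp_continuousOn (hM e))
        (fun e b hb => funext fun t => by rw [(hZM e b hb).2, Tower.tr_tr])
      refine ⟨max j l, hij.trans (le_max_left _ _), z', L', ?_, ?_, fun a ha => ?_⟩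
      · exact_mod_cast hz'
      · exact_mod_cast hL'
      · obtain ⟨m, hm, e, b, hb, rfl⟩ := exists_chi_of_mem_skLT ha
        have hm' : m < n + 1 := by exact_mod_cast hm
        rcases (Nat.lt_succ_iff.1 hm').eq_or_lt with rfl | hlt
        · rw [hz'2 e b (ball_subset_closedBall hb), hL'2 e b (ball_subset_closedBall hb)]
          exact (hlift e b (ball_subset_closedBall hb)).tr (hl' e)
        · have hmem := chi_mem_skLT_of_lt (X := A) (N := n) (by exact_mod_cast hlt) e
            (ball_subset_closedBall hb)
          rw [hz'1 _ hmem, hL'1 _ hmem]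
          exact (hzL _ hmem).tr _
  obtain ⟨n, hn⟩ := Filter.eventually_atTop.1
    (RelCWComplex.FiniteDimensional.eventually_isEmpty_cell (X := A) (C := (univ : Set A)) (D := ∅))
  have huniv : ∀ a : A, a ∈ skLT A n := fun a => by
    obtain ⟨m, e, b, hb, rfl⟩ := exists_chi a
    refine chi_mem_skLT_of_lt ?_ e (ball_subset_closedBall hb)
    by_contra h
    have h' : n ≤ m := by exact_mod_cast not_lt.1 h
    exact (hn m h').false e
  obtain ⟨j, hij, z, L, hz, hL, hzL⟩ := main n
  exact ⟨j, hij, ⟨fun r => z r.1 r.2, hz.comp_continuous continuous_id fun r =>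
    ⟨huniv _, mem_univ _⟩⟩, ⟨fun r => L r.1 r.2, hL.comp_continuous continuous_id fun r =>
    ⟨huniv _, mem_univ _⟩⟩, fun a => hzL a (huniv a)⟩

end Cells

end Spectrum.Hom

/-! ### Stable maps -/

namespace Spectrum

variable {A B : PtdSpace.{u}} {E F : Spectrum.{u}}

/-- A representative in level `n` of a stable map of degree zero from a space to a spectrum. -/
abbrev Map (A : PtdSpace.{u}) (E : Spectrum.{u}) (n : ℕ) : Type u :=
  PtdMap (iterSusp A n) (E.space n)

/-- The suspension of a representative of a stable map. -/
def Map.st {n : ℕ} (p : Map A E n) : Map A E (n + 1) := (E.str n).comp (suspMap p)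

/-- The iterated suspension of a representative of a stable map. -/
def Map.stTo {n m : ℕ} (h : n ≤ m) (p : Map A E n) : Map A E m :=
  Nat.leRec (motive := fun k _ => Map A E k) p (fun _ _ q => q.st) h

@[simp]
lemma Map.stTo_self {n : ℕ} (h : n ≤ n) (p : Map A E n) : p.stTo h = p := by
  rw [stTo, Nat.leRec_self]

lemma Map.stTo_succ {n m : ℕ} (h : n ≤ m) (h' : n ≤ m + 1) (p : Map A E n) :
    p.stTo h' = (p.stTo h).st := by
  rw [stTo, Nat.leRec_succ _ _ h]
  rfl

@[simp]
lemma Map.stTo_stTo {n m k : ℕ} (h : n ≤ m) (h' : m ≤ k) (p : Map A E n) :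
    (p.stTo h).stTo h' = p.stTo (h.trans h') := by
  induction k, h' using Nat.le_induction with
  | base => simp
  | succ k hk ih => rw [stTo_succ hk, ih, stTo_succ (h.trans hk)]

lemma Map.st_comp {n : ℕ} (p : Map A E n) (g : Map B (suspensionSpectrum A) n) :
    Map.st (E := E) (p.comp g) = p.st.comp g.st := by
  exact congrArg (E.str n).comp (suspMap_comp p g)

lemma Map.stTo_comp {n m : ℕ} (h : n ≤ m) (p : Map A E n) (g : Map B (suspensionSpectrum A) n) :
    Map.stTo (E := E) h (p.comp g) = (p.stTo h).comp (g.stTo h) := by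
  induction m, h using Nat.le_induction with
  | base => simp
  | succ k hk ih => rw [stTo_succ hk, ih, st_comp, ← stTo_succ hk, ← stTo_succ hk]

lemma Map.stTo_iterSuspMap {n m : ℕ} (h : n ≤ m) (g : PtdMap B A) :
    Map.stTo (E := suspensionSpectrum A) h (iterSuspMap g n) = iterSuspMap g m := by
  induction m, h using Nat.le_induction with
  | base => exact Map.stTo_self (E := suspensionSpectrum A) _ _
  | succ k hk ih =>
    exact (Map.stTo_succ (E := suspensionSpectrum A) hk _ _).trans
      (congrArg (Map.st (E := suspensionSpectrum A)) ih)

lemma Map.st_htpy {n : ℕ} {p q : Map A E n} (h : p.Htpy q) : p.st.Htpy q.st :=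
  h.suspMap.comp_left _

lemma Map.stTo_htpy {n m : ℕ} (h : n ≤ m) {p q : Map A E n} (hpq : p.Htpy q) :
    (p.stTo h).Htpy (q.stTo h) := by
  induction m, h using Nat.le_induction with
  | base => simpa using hpq
  | succ k hk ih =>
    rw [stTo_succ hk, stTo_succ hk]
    exact st_htpy ih

/-- The image of a stable map under a map of spectra. -/
def Hom.push (f : Hom E F) {n : ℕ} (p : Map A E n) : Map A F n := (f.app n).comp p

lemma Hom.push_st (f : Hom E F) {n : ℕ} (p : Map A E n) : f.push p.st = (f.push p).st := by
  refine PtdMap.ext fun x => ?_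
  obtain ⟨⟨y, t⟩, rfl⟩ := suspMk_surjective (iterSusp A n) x
  exact f.comm n _ _

lemma Hom.push_stTo (f : Hom E F) {n m : ℕ} (h : n ≤ m) (p : Map A E n) :
    f.push (p.stTo h) = (f.push p).stTo h := by
  induction m, h using Nat.le_induction with
  | base => simp
  | succ k hk ih => rw [Map.stTo_succ hk, push_st, ih, Map.stTo_succ hk]

/-- Two representatives, possibly in different levels, represent the same stable map. -/
def Map.SEq {n m : ℕ} (p : Map A E n) (q : Map A E m) : Prop :=
  ∃ k, ∃ (h : n ≤ k) (h' : m ≤ k), (p.stTo h).Htpy (q.stTo h')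

lemma Map.SEq.symm {n m : ℕ} {p : Map A E n} {q : Map A E m} (h : p.SEq q) : q.SEq p := by
  obtain ⟨k, h, h', H⟩ := h
  exact ⟨k, h', h, H.symm⟩

lemma Map.SEq.trans {n m l : ℕ} {p : Map A E n} {q : Map A E m} {r : Map A E l} (h : p.SEq q)
    (h' : q.SEq r) : p.SEq r := by
  obtain ⟨k, h1, h2, H⟩ := h
  obtain ⟨k', h1', h2', H'⟩ := h'
  have e := stTo_htpy (le_max_left k k') H
  have e' := stTo_htpy (le_max_right k k') H'
  rw [stTo_stTo, stTo_stTo] at e e'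
  exact ⟨max k k', _, _, e.trans e'⟩

lemma Map.SEq.of_htpy {n : ℕ} {p q : Map A E n} (h : p.Htpy q) : p.SEq q :=
  ⟨n, le_rfl, le_rfl, by simpa using h⟩

lemma Map.sEq_stTo {n m : ℕ} (h : n ≤ m) (p : Map A E n) : p.SEq (p.stTo h) :=
  ⟨m, h, le_rfl, by rw [stTo_self]; exact .refl _⟩

lemma Map.SEq.push (f : Hom E F) {n m : ℕ} {p : Map A E n} {q : Map A E m} (h : p.SEq q) :
    (f.push p).SEq (f.push q) := by
  obtain ⟨k, h1, h2, H⟩ := h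
  refine ⟨k, h1, h2, ?_⟩
  rw [← Hom.push_stTo, ← Hom.push_stTo]
  exact H.comp_left _

/-! ### Stable maps of finite complexes and stable equivalences -/

/-- The adjoint of a representative of a stable map. -/
def Map.adj {i : ℕ} (p : Map A E (1 + i)) : C(A, (E.tower 1).space i) where
  toFun a := ⟨⟨fun t => p.toMap (suspCube A (1 + i) (a, t)), p.toMap.continuous.comp (by fun_prop)⟩,
      fun t ht => by
    have : ((a, t) : A × (Fin (1 + i) → I)) ∈ cubeBase A (1 + i) := Or.inr ht
    exact (congrArg p.toMap ((suspCube_eq_pt_iff A).2 this)).trans p.map_pt⟩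
  continuous_toFun := by
    refine Continuous.subtype_mk (ContinuousMap.continuous_of_continuous_uncurry _ ?_) _
    show Continuous fun r : A × (Fin (1 + i) → I) => p.toMap (suspCube A (1 + i) (r.1, r.2))
    exact p.toMap.continuous.comp (suspCube A (1 + i)).continuous

lemma Map.adj_pt {i : ℕ} (p : Map A E (1 + i)) : p.adj A.pt = (E.tower 1).pt i := by
  apply GenLoop.ext
  intro t
  have : ((A.pt, t) : A × (Fin (1 + i) → I)) ∈ cubeBase A (1 + i) := Or.inl rfl
  exact (congrArg p.toMap ((suspCube_eq_pt_iff A).2 this)).trans p.map_pt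

lemma Map.adj_st {i : ℕ} (p : Map A E (1 + i)) (a : A) :
    Map.adj (i := i + 1) p.st a = (E.tower 1).step i (p.adj a) := rfl

lemma Map.adj_stTo {i j : ℕ} (h : i ≤ j) (h' : 1 + i ≤ 1 + j) (p : Map A E (1 + i)) (a : A) :
    (p.stTo h').adj a = (E.tower 1).tr h (p.adj a) := by
  induction j, h using Nat.le_induction with
  | base => simp
  | succ k hk ih =>
    rw [Tower.tr_succ _ hk, ← ih (by omega), ← adj_st]
    exact congrArg (fun q : Map A E (1 + (k + 1)) => q.adj a) (stTo_succ (m := 1 + k) _ _ p)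

lemma Map.push_adj (f : Hom E F) {i : ℕ} (p : Map A E (1 + i)) (a : A) :
    (f.push p).adj a = (f.tower 1).app i (p.adj a) := rfl

lemma Map.exists_adj_eq {i : ℕ} (g : C(A, (E.tower 1).space i)) (hg : g A.pt = (E.tower 1).pt i) :
    ∃ p : Map A E (1 + i), ∀ a, p.adj a = g a := by
  have hc : Continuous fun r : A × (Fin (1 + i) → I) => (g r.1).1 r.2 := by
    let g' : C(A, GenLoop (Fin (1 + i)) (E.space (1 + i)) (E.space (1 + i)).pt) := g
    show Continuous fun r : A × (Fin (1 + i) → I) => (g' r.1).1 r.2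
    fun_prop
  obtain ⟨p, hp⟩ := exists_ptdMap_of_cube A (1 + i) (E.space (1 + i)) ⟨_, hc⟩ (by
    rintro ⟨a, t⟩ (rfl | ht)
    · show (g A.pt).1 t = _
      rw [hg]
      rfl
    · exact (g a).2 t ht)
  refine ⟨p, fun a => ?_⟩
  apply GenLoop.ext
  intro t
  exact hp (a, t)

/-- Homotopies of adjoints give homotopies of stable maps. -/
lemma Map.htpy_of_adj {i : ℕ} {p q : Map A E (1 + i)} (H : C(A × I, (E.tower 1).space i))
    (h0 : ∀ a, H (a, 0) = p.adj a) (h1 : ∀ a, H (a, 1) = q.adj a)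
    (hpt : ∀ s, H (A.pt, s) = (E.tower 1).pt i) : p.Htpy q := by
  have hc : Continuous fun r : I × (A × (Fin (1 + i) → I)) => (H (r.2.1, r.1)).1 r.2.2 := by
    let H' : C(A × I, GenLoop (Fin (1 + i)) (E.space (1 + i)) (E.space (1 + i)).pt) := H
    show Continuous fun r : I × (A × (Fin (1 + i) → I)) => (H' (r.2.1, r.1)).1 r.2.2
    fun_prop
  refine htpy_of_cube ⟨_, hc⟩ (fun r => ?_) (fun r => ?_) fun s r hr => ?_
  · show (H (r.1, 0)).1 r.2 = _
    rw [h0]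
    rfl
  · show (H (r.1, 1)).1 r.2 = _
    rw [h1]
    rfl
  · rcases hr with hr | hr
    · show (H (r.1, s)).1 r.2 = _
      rw [hr, hpt]
      rfl
    · exact (H (r.1, s)).2 r.2 hr

/-- Homotopies of stable maps give homotopies of adjoints, parametrized by the cube `I^1`. -/
lemma Map.exists_adj_htpy {i : ℕ} {p q : Map A E (1 + i)} (h : p.Htpy q) :
    ∃ H : C(A × (Fin 1 → I), (E.tower 1).space i), (∀ a t, t 0 = 0 → H (a, t) = p.adj a) ∧
      (∀ a t, t 0 = 1 → H (a, t) = q.adj a) ∧ ∀ t, H (A.pt, t) = (E.tower 1).pt i := by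
  obtain ⟨H, h0, h1, hpt⟩ := h
  refine ⟨⟨fun r => ⟨⟨fun s => H (r.2 0, suspCube A (1 + i) (r.1, s)), by fun_prop⟩,
    fun s hs => ?_⟩,
    ?_⟩, fun a t ht => ?_, fun a t ht => ?_, fun t => ?_⟩
  · have : ((r.1, s) : A × (Fin (1 + i) → I)) ∈ cubeBase A (1 + i) := Or.inr hs
    show H (r.2 0, suspCube A (1 + i) (r.1, s)) = _
    rw [(suspCube_eq_pt_iff A).2 this, hpt]
  · refine Continuous.subtype_mk (ContinuousMap.continuous_of_continuous_uncurry _ ?_) _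
    show Continuous fun r : (A × (Fin 1 → I)) × (Fin (1 + i) → I) =>
      H (r.1.2 0, suspCube A (1 + i) (r.1.1, r.2))
    fun_prop
  · apply GenLoop.ext
    intro s
    show H (t 0, suspCube A (1 + i) (a, s)) = _
    rw [ht, h0]
    rfl
  · apply GenLoop.ext
    intro s
    show H (t 0, suspCube A (1 + i) (a, s)) = _
    rw [ht, h1]
    rfl
  · apply GenLoop.ext
    intro s
    have : ((A.pt, s) : A × (Fin (1 + i) → I)) ∈ cubeBase A (1 + i) := Or.inl rfl
    show H (t 0, suspCube A (1 + i) (A.pt, s)) = _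
    rw [(suspCube_eq_pt_iff A).2 this, hpt]
    rfl

end Spectrum

/-- A pointed space is a finite CW complex, with a vertex as base point. -/
def PtdSpace.IsFiniteCW (A : PtdSpace.{u}) : Prop :=
  ∃ (_ : T2Space A) (_ : CWComplex (Set.univ : Set A)),
    RelCWComplex.Finite (Set.univ : Set A) ∧ A.pt ∈ skLT A 1

namespace Spectrum

variable {A B : PtdSpace.{u}} {E F : Spectrum.{u}}

/-- A stable equivalence is surjective on stable maps of finite complexes. -/
theorem Hom.IsStableEquiv.exists_push_htpy {f : Hom E F} (hf : f.IsStableEquiv) (hA : A.IsFiniteCW)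
    {n : ℕ} (u : Map A F n) : ∃ m, ∃ h : n ≤ m, ∃ v : Map A E m, (f.push v).Htpy (u.stTo h) := by
  obtain ⟨_, _, _, hA0⟩ := hA
  have key : ∀ n, 1 ≤ n → ∀ u : Map A F n,
      ∃ m, ∃ h : n ≤ m, ∃ v : Map A E m, (f.push v).Htpy (u.stTo h) := by
    intro n hn u
    obtain ⟨i, rfl⟩ := Nat.exists_eq_add_of_le hn
    have hbd : ∀ t : Fin 0 → I, t ∉ Cube.boundary (Fin 0) := fun t ⟨k, _⟩ => k.elim0
    obtain ⟨j, hij, z, L, h⟩ := hf.exists_finite_lift (q := 0) (a0 := A.pt)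
      (x := u.adj.comp ⟨fun r => r.1, by fun_prop⟩) (y := fun _ => (E.tower 1).pt i) hA0
      (fun t => u.adj_pt) continuousOn_const (fun _ _ => rfl) fun a t ht => (hbd t ht).elim
    obtain ⟨v, hv⟩ := Map.exists_adj_eq (z.comp ⟨fun a => (a, Fin.elim0), by fun_prop⟩)
      ((h A.pt).pt rfl _)
    refine ⟨1 + j, by omega, v, PtdMap.Htpy.symm ?_⟩
    refine Map.htpy_of_adj (L.comp ⟨fun r => (r.1, (r.2, Fin.elim0)), by fun_prop⟩)
      (fun a => ?_) (fun a => ?_) (fun s => (h A.pt).htpy_pt rfl s _)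
    · rw [Map.adj_stTo hij]
      exact (h a).zero _
    · rw [Map.push_adj, hv]
      exact (h a).one _
  obtain ⟨m, h, v, hv⟩ := key (n + 1) (by omega) u.st
  refine ⟨m, (Nat.le_succ n).trans h, v, ?_⟩
  rw [← Map.stTo_stTo (Nat.le_succ n) h, Map.stTo_succ le_rfl, Map.stTo_self]
  exact hv

/-- A stable equivalence is injective on stable maps of finite complexes. -/
theorem Hom.IsStableEquiv.sEq_of_push (hA : A.IsFiniteCW) {f : Hom E F} (hf : f.IsStableEquiv)
    {n m : ℕ} {u : Map A E n} {v : Map A E m} (h : (f.push u).SEq (f.push v)) : u.SEq v := by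
  obtain ⟨_, _, _, hA0⟩ := hA
  have key : ∀ n, 1 ≤ n → ∀ u v : Map A E n, (f.push u).Htpy (f.push v) → u.SEq v := by
    intro n hn u v huv
    obtain ⟨i, rfl⟩ := Nat.exists_eq_add_of_le hn
    obtain ⟨H, H0, H1, Hpt⟩ := Map.exists_adj_htpy huv
    have hbd : ∀ t : Fin 1 → I, t ∈ Cube.boundary (Fin 1) → t 0 = 0 ∨ t 0 = 1 := by
      rintro t ⟨k, hk⟩
      rwa [Subsingleton.elim 0 k]
    -- A homotopy of the images is lifted to a homotopy of the maps, relative to its two ends.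
    let y : A × (Fin 1 → I) → (E.tower 1).space i := fun r =>
      if r.2 0 = 0 then u.adj r.1 else v.adj r.1
    have hy0 : ∀ r, r.2 0 = 0 → y r = u.adj r.1 := fun r hr => if_pos hr
    have hy1 : ∀ r, r.2 0 = 1 → y r = v.adj r.1 := fun r hr => if_neg (by simp [hr])
    obtain ⟨j, hij, z, L, h⟩ := hf.exists_finite_lift (q := 1) (a0 := A.pt)
      (x := H) (y := y) hA0 Hpt
      (by
        have c0 : ContinuousOn y {r | r.2 0 = 0} := ContinuousOn.congr
          (by fun_prop : Continuous fun r : A × (Fin 1 → I) => u.adj r.1).continuousOn hy0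
        have c1 : ContinuousOn y {r | r.2 0 = 1} := ContinuousOn.congr
          (by fun_prop : Continuous fun r : A × (Fin 1 → I) => v.adj r.1).continuousOn hy1
        exact (c0.union_of_isClosed c1 (isClosed_eq (by fun_prop) continuous_const)
          (isClosed_eq (by fun_prop) continuous_const)).mono fun r hr => hbd _ hr.2)
      (fun t ht => by
        rcases hbd t ht with h | h
        · rw [hy0 _ h, Map.adj_pt]
        · rw [hy1 _ h, Map.adj_pt])
      (fun a t ht => by
        rcases hbd t ht with h | h
        · rw [hy0 _ h, H0 _ _ h, Map.push_adj]
        · rw [hy1 _ h, H1 _ _ h, Map.push_adj])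
    refine ⟨1 + j, by omega, by omega, Map.htpy_of_adj (z.comp ⟨fun r => (r.1, fun _ => r.2),
      by fun_prop⟩) (fun a => ?_) (fun a => ?_) fun s => (h A.pt).pt rfl _⟩
    · rw [Map.adj_stTo hij]
      exact ((h a).boundary _ ⟨0, Or.inl rfl⟩).trans (by rw [hy0 _ rfl])
    · rw [Map.adj_stTo hij]
      exact ((h a).boundary _ ⟨0, Or.inr rfl⟩).trans (by rw [hy1 _ rfl])
  obtain ⟨k, h1, h2, H⟩ := h
  rw [← push_stTo, ← push_stTo] at H
  have H' := Map.st_htpy H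
  rw [← push_st, ← push_st] at H'
  have := key (k + 1) (by omega) _ _ H'
  rw [← Map.stTo_succ, ← Map.stTo_succ] at this
  · exact ((Map.sEq_stTo _ u).trans this).trans (Map.sEq_stTo _ v).symm
  all_goals omega

/-! ### Stable maps and zigzags of stable equivalences -/

/-- A correspondence between the stable maps to `E` and those to `F` that is natural, and bijective
on stable maps of finite complexes. -/
structure Correspondence (E F : Spectrum.{u}) where
  /-- the relation -/
  rel : ∀ (A : PtdSpace.{u}) (n : ℕ), Map A E n → Map A F n → Prop
  st : ∀ {A n u w}, rel A n u w → rel A (n + 1) u.st w.st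
  comp : ∀ {A B n u w}, rel A n u w → ∀ g : Map B (suspensionSpectrum A) n,
    rel B n (u.comp g) (w.comp g)
  total : ∀ {A n}, A.IsFiniteCW → ∀ u : Map A E n, ∃ m, ∃ h : n ≤ m, ∃ w : Map A F m,
    rel A m (u.stTo h) w
  total' : ∀ {A n}, A.IsFiniteCW → ∀ w : Map A F n, ∃ m, ∃ h : n ≤ m, ∃ u : Map A E m,
    rel A m u (w.stTo h)
  unique : ∀ {A n m}, A.IsFiniteCW → ∀ {u : Map A E n} {u' : Map A E m} {w : Map A F n}
    {w' : Map A F m}, rel A n u w → rel A m u' w' → u.SEq u' → w.SEq w'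
  unique' : ∀ {A n m}, A.IsFiniteCW → ∀ {u : Map A E n} {u' : Map A E m} {w : Map A F n}
    {w' : Map A F m}, rel A n u w → rel A m u' w' → w.SEq w' → u.SEq u'

namespace Correspondence

lemma stTo (R : Correspondence E F) {n m : ℕ} (h : n ≤ m) {u : Map A E n} {w : Map A F n}
    (hR : R.rel A n u w) : R.rel A m (u.stTo h) (w.stTo h) := by
  induction m, h using Nat.le_induction with
  | base => simpa using hR
  | succ k hk ih =>
    rw [Map.stTo_succ hk, Map.stTo_succ hk]
    exact R.st ih

/-- The correspondence given by a stable equivalence. -/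
def ofHom (f : Hom E F) (hf : f.IsStableEquiv) : Correspondence E F where
  rel A n u w := (f.push u).Htpy w
  st h := by
    rw [Hom.push_st]
    exact Map.st_htpy h
  comp h g := h.comp_right g
  total {A n} _ u := ⟨n, le_rfl, f.push u, by rw [Map.stTo_self]; exact .refl _⟩
  total' hA w := hf.exists_push_htpy hA w
  unique {_ _ _} _ {_ _ _ _} h h' := fun hu =>
    ((Map.SEq.of_htpy h).symm.trans (hu.push f)).trans (Map.SEq.of_htpy h')
  unique' {_ _ _} hA {_ _ _ _} h h' := fun hw => hf.sEq_of_push hA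
    (((Map.SEq.of_htpy h).trans hw).trans (Map.SEq.of_htpy h').symm)

/-- The identical correspondence. -/
def refl (E : Spectrum.{u}) : Correspondence E E where
  rel A n u w := u = w
  st := by rintro _ _ _ _ rfl; rfl
  comp := by rintro _ _ _ _ _ rfl g; rfl
  total {A n} _ u := ⟨n, le_rfl, u, by simp⟩
  total' {A n} _ u := ⟨n, le_rfl, u, by simp⟩
  unique := by rintro _ _ _ _ _ _ _ _ rfl rfl h; exact h
  unique' := by rintro _ _ _ _ _ _ _ _ rfl rfl h; exact h

/-- The reversed correspondence. -/
def symm (R : Correspondence E F) : Correspondence F E where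
  rel A n u w := R.rel A n w u
  st h := R.st h
  comp h g := R.comp h g
  total hA u := R.total' hA u
  total' hA u := R.total hA u
  unique {_ _ _} hA {_ _ _ _} h h' := R.unique' hA h h'
  unique' {_ _ _} hA {_ _ _ _} h h' := R.unique hA h h'

/-- The composition of correspondences. -/
def trans {G : Spectrum.{u}} (R : Correspondence E F) (R' : Correspondence F G) :
    Correspondence E G where
  rel A n u w := ∃ k, ∃ h : n ≤ k, ∃ x : Map A F k, R.rel A k (u.stTo h) x ∧
    R'.rel A k x (w.stTo h)
  st := by
    rintro A n u w ⟨k, h, x, h1, h2⟩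
    refine ⟨k + 1, by omega, x.st, ?_, ?_⟩
    · have := R.st h1
      rwa [← Map.stTo_succ h (by omega), ← Map.stTo_stTo (Nat.le_succ n) (by omega),
        Map.stTo_succ le_rfl, Map.stTo_self] at this
    · have := R'.st h2
      rwa [← Map.stTo_succ h (by omega), ← Map.stTo_stTo (Nat.le_succ n) (by omega),
        Map.stTo_succ le_rfl, Map.stTo_self] at this
  comp := by
    rintro A B n u w ⟨k, h, x, h1, h2⟩ g
    refine ⟨k, h, x.comp (g.stTo h), ?_, ?_⟩
    · rw [Map.stTo_comp]
      exact R.comp h1 _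
    · rw [Map.stTo_comp]
      exact R'.comp h2 _
  total {A n} hA u := by
    obtain ⟨m, h, x, hx⟩ := R.total hA u
    obtain ⟨k, h', w, hw⟩ := R'.total hA x
    refine ⟨k, h.trans h', w, k, le_rfl, x.stTo h', ?_, ?_⟩
    · rw [Map.stTo_self, ← Map.stTo_stTo h h']
      exact R.stTo h' hx
    · rwa [Map.stTo_self]
  total' {A n} hA w := by
    obtain ⟨m, h, x, hx⟩ := R'.total' hA w
    obtain ⟨k, h', u, hu⟩ := R.total' hA x
    refine ⟨k, h.trans h', u, k, le_rfl, x.stTo h', ?_, ?_⟩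
    · rwa [Map.stTo_self]
    · rw [Map.stTo_self, ← Map.stTo_stTo h h']
      exact R'.stTo h' hx
  unique := by
    rintro A n m hA u u' w w' ⟨k, h, x, h1, h2⟩ ⟨k', h', x', h1', h2'⟩ hu
    have hx := R.unique hA h1 h1' (((Map.sEq_stTo h u).symm.trans hu).trans (Map.sEq_stTo h' u'))
    exact ((Map.sEq_stTo h w).trans (R'.unique hA h2 h2' hx)).trans (Map.sEq_stTo h' w').symm
  unique' := by
    rintro A n m hA u u' w w' ⟨k, h, x, h1, h2⟩ ⟨k', h', x', h1', h2'⟩ hw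
    have hx := R'.unique' hA h2 h2' (((Map.sEq_stTo h w).symm.trans hw).trans (Map.sEq_stTo h' w'))
    exact ((Map.sEq_stTo h u).trans (R.unique' hA h1 h1' hx)).trans (Map.sEq_stTo h' u').symm

end Correspondence

lemma Equivalent.nonempty_correspondence (h : E.Equivalent F) : Nonempty (Correspondence E F) := by
  induction h with
  | rel E F h => exact ⟨.ofHom h.choose h.choose_spec⟩
  | refl E => exact ⟨.refl E⟩
  | symm E F _ ih => exact ih.map Correspondence.symm
  | trans E F G _ _ ih1 ih2 => exact ih1.map2 Correspondence.trans ih2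

end Spectrum

/-! ### Holonomy along paths in the 1-skeleton -/

instance contractibleSpace_unitInterval : ContractibleSpace I :=
  (convex_Icc (0 : ℝ) 1).contractibleSpace ⟨0, by simp⟩

/-- A homomorphism from the fundamental groupoid of a space to a group, as a function on paths. -/
structure Holonomy (Γ : Type v) [Group Γ] (X : Type u) [TopologicalSpace X] where
  /-- the value on a path -/
  val : ∀ {x y : X}, Path x y → Γ
  val_trans : ∀ {x y z : X} (p : Path x y) (q : Path y z), val (p.trans q) = val p * val q
  val_eq : ∀ {x y : X} {p q : Path x y}, p.Homotopic q → val p = val q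

namespace Holonomy

variable {Γ : Type v} [Group Γ] {X : Type u} [TopologicalSpace X] (M : Holonomy Γ X)

lemma val_refl (x : X) : M.val (Path.refl x) = 1 := by
  have h := M.val_trans (Path.refl x) (Path.refl x)
  rw [M.val_eq ⟨Path.Homotopy.reflTrans (Path.refl x)⟩] at h
  exact left_eq_mul.1 h

lemma val_symm {x y : X} (p : Path x y) : M.val p.symm = (M.val p)⁻¹ := by
  rw [eq_inv_iff_mul_eq_one, ← val_trans, ← M.val_refl y]
  exact (M.val_eq ⟨Path.Homotopy.reflSymmTrans p⟩).symm

lemma val_congr {x y x' y' : X} (p : Path x y) (q : Path x' y') (h : ∀ t, p t = q t) :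
    M.val p = M.val q := by
  obtain rfl : x = x' := by rw [← p.source, h, q.source]
  obtain rfl : y = y' := by rw [← p.target, h, q.target]
  obtain rfl : p = q := by ext t; exact h t
  rfl

lemma val_const {x y : X} (p : Path x y) (h : ∀ t, p t = x) : M.val p = 1 :=
  (M.val_congr p (Path.refl x) h).trans (M.val_refl x)

/-- The pullback along a continuous map. -/
def comap {A : Type w} [TopologicalSpace A] (f : C(A, X)) : Holonomy Γ A where
  val p := M.val (p.map f.continuous)
  val_trans p q := by rw [Path.map_trans, val_trans]
  val_eq h := M.val_eq (h.map f)

lemma comap_val {A : Type w} [TopologicalSpace A] (f : C(A, X)) {a b : A} (p : Path a b) :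
    (M.comap f).val p = M.val (p.map f.continuous) := rfl

lemma val_eq_of_simplyConnected {D : Type w} [TopologicalSpace D] [SimplyConnectedSpace D]
    (M : Holonomy Γ D) {x y : D} (p q : Path x y) : M.val p = M.val q :=
  M.val_eq (SimplyConnectedSpace.paths_homotopic p q)

lemma val_loop_of_simplyConnected {D : Type w} [TopologicalSpace D] [SimplyConnectedSpace D]
    (M : Holonomy Γ D) {x : D} (p : Path x x) : M.val p = 1 :=
  (M.val_eq_of_simplyConnected p (Path.refl x)).trans (M.val_refl x)

/-- The holonomy around a square is trivial. -/
lemma val_square (F : C(I × I, X)) {a b c d : X} (p : Path a b) (q : Path c d) (r : Path a c)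
    (s : Path b d) (hp : ∀ t, p t = F (t, 0)) (hq : ∀ t, q t = F (t, 1))
    (hr : ∀ t, r t = F (0, t)) (hs : ∀ t, s t = F (1, t)) :
    M.val p * M.val s = M.val r * M.val q := by
  let P : Path ((0 : I), (0 : I)) (1, 0) := ⟨⟨fun t => (t, 0), by fun_prop⟩, rfl, rfl⟩
  let Q : Path ((0 : I), (1 : I)) (1, 1) := ⟨⟨fun t => (t, 1), by fun_prop⟩, rfl, rfl⟩
  let R : Path ((0 : I), (0 : I)) (0, 1) := ⟨⟨fun t => (0, t), by fun_prop⟩, rfl, rfl⟩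
  let S : Path ((1 : I), (0 : I)) (1, 1) := ⟨⟨fun t => (1, t), by fun_prop⟩, rfl, rfl⟩
  have e := (M.comap F).val_eq_of_simplyConnected (P.trans S) (R.trans Q)
  rw [val_trans, val_trans, comap_val, comap_val, comap_val, comap_val] at e
  rw [M.val_congr p (P.map F.continuous) hp, M.val_congr q (Q.map F.continuous) hq,
    M.val_congr r (R.map F.continuous) hr, M.val_congr s (S.map F.continuous) hs, e]

end Holonomy

instance contractibleSpace_closedBall (n : ℕ) :
    ContractibleSpace (closedBall (0 : Fin n → ℝ) 1) :=
  (convex_closedBall 0 1).contractibleSpace ⟨0, by simp⟩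

section Skeleton

variable {X : Type u} [TopologicalSpace X] [T2Space X] [CWComplex (Set.univ : Set X)]

/-- The characteristic map of a cell, as a continuous map from the closed ball to a skeleton. -/
def cellMap {n : ℕ} {N : ℕ∞} (h : (n : ℕ∞) < N) (e : Cell X n) :
    C(closedBall (0 : Fin n → ℝ) 1, skLT X N) where
  toFun y := ⟨chi n e y, chi_mem_skLT_of_lt h e y.2⟩
  continuous_toFun := ((continuousOn_chi e).comp_continuous continuous_subtype_val
    fun y => y.2).subtype_mk _

/-- The points of the ball of dimension one on its boundary. -/
def ballEnd (s : ℝ) (hs : |s| ≤ 1) : closedBall (0 : Fin 1 → ℝ) 1 :=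
  ⟨fun _ => s, by simpa [pi_norm_const] using hs⟩

/-- The vertices of a CW complex form a discrete set. -/
lemma continuousOn_skLT_one {T : Type*} [TopologicalSpace T] (f : X → T) :
    ContinuousOn f (skLT X 1) := by
  refine continuousOn_skLT_of_cells f 1 fun n hn e => ?_
  obtain rfl : n = 0 := by
    have : n < 1 := by exact_mod_cast hn
    omega
  exact (continuous_of_const fun a b => by rw [Subsingleton.elim a b]).continuousOn

lemma path_eq_of_mem_skLT_one {x y : X} (p : Path x y) (h : ∀ t, p t ∈ skLT X 1) (t : I) :
    p t = x := by
  classical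
  have hc : Continuous fun t => (if p t = x then true else false : Bool) :=
    (continuousOn_skLT_one (fun z => (if z = x then true else false : Bool))).comp_continuous
      p.continuous h
  have := PreconnectedSpace.constant inferInstance hc (x := t) (y := 0)
  simpa using this

/-- Radial expansion from a point `c` in each edge of the 1-skeleton, and the distance `g` from
this point, cut off at `1 / 2`. The factor 16 at the end of the expansion suffices to move all
points with `1 / 8 < g` to the vertices. -/
lemma exists_edge_expansion (c : Fin 1 → ℝ) (hc : ‖c‖ ≤ 1 / 2) :
    ∃ (ρ : C(skLT X 2 × I, skLT X 2)) (g : C(skLT X 2, ℝ)),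
      (∀ x : skLT X 2, (x : X) ∈ skLT X 1 → (∀ t, ρ (x, t) = x) ∧ g x = 1 / 2) ∧
      ∀ (e : Cell X 1) (y : closedBall (0 : Fin 1 → ℝ) 1),
        g (cellMap (by norm_num) e y) = min ‖y.1 - c‖ (1 / 2) ∧
        ∀ t, ρ (cellMap (by norm_num) e y, t) = cellMap (by norm_num) e
          ((BallChart.ball (Fin 1 → ℝ)).ret (c + (1 + 15 * (t : ℝ)) • (y.1 - c))) := by
  -- The expansion from `c` fixes the ends of the edge, as the radial retraction undoes it there.
  have key : ∀ y ∈ Metric.sphere (0 : Fin 1 → ℝ) 1, ∀ L : ℝ, 0 ≤ L →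
      (BallChart.ball (Fin 1 → ℝ)).emb
        ((BallChart.ball (Fin 1 → ℝ)).ret (c + (1 + L) • (y - c))) = y := by
    intro y hy L hL
    have hy1 : ‖y‖ = 1 := by simpa using hy
    have hy2 : y 0 * y 0 = 1 := by
      have : ‖y‖ = |y 0| := by simp [Pi.norm_def]
      rw [← abs_mul_abs_self, ← this, hy1, mul_one]
    have hc1 : |c 0| ≤ 1 / 2 := (norm_le_pi_norm c 0).trans hc
    have hμ : 0 ≤ 1 - y 0 * c 0 := by
      have : |y 0 * c 0| ≤ 1 / 2 := by
        have : |y 0| ≤ 1 := (norm_le_pi_norm y 0).trans hy1.le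
        rw [abs_mul]
        nlinarith [abs_nonneg (c 0)]
      linarith [le_abs_self (y 0 * c 0)]
    have e : c + (1 + L) • (y - c) = (1 + L * (1 - y 0 * c 0)) • y := by
      ext i
      rw [Subsingleton.elim i 0]
      simp only [Pi.add_apply, Pi.smul_apply, Pi.sub_apply, smul_eq_mul]
      linear_combination (L * c 0) * hy2
    have h1 : 1 ≤ 1 + L * (1 - y 0 * c 0) := by nlinarith [mul_nonneg hL hμ]
    rw [BallChart.emb_ret, e, norm_smul, hy1, Real.norm_of_nonneg (by linarith), mul_one,
      max_eq_right h1, smul_smul, inv_mul_cancel₀ (by linarith), one_smul]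
  obtain ⟨ρ, hρc, hρ0, hρ1⟩ := exists_extension_step (P := I) (Z := X) 1 (fun x _ => x)
    (by fun_prop)
    (fun e y t => chi 1 e ((BallChart.ball (Fin 1 → ℝ)).ret (c + (1 + 15 * (t : ℝ)) • (y - c))).1)
    (fun e => Continuous.continuousOn <| (continuousOn_chi e).comp_continuous
      (continuous_subtype_val.comp ((BallChart.ball _).ret.continuous.comp (by fun_prop)))
      fun q => Subtype.coe_prop _)
    (fun e y hy => funext fun t => congrArg (chi 1 e) (key y hy _ (by have := t.2.1; positivity)))
  obtain ⟨g, hgc, hg0, hg1⟩ := exists_extension_step (X := X) (P := Unit) (Z := ℝ) 1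
    (fun _ _ => 1 / 2) (by fun_prop) (fun e y _ => min ‖y - c‖ (1 / 2)) (by fun_prop)
    (fun e y hy => funext fun _ => min_eq_right (by
      have hy1 : ‖y‖ = 1 := by simpa using hy
      linarith [norm_sub_norm_le y c]))
  have hmem : ∀ q : skLT X 2 × I, ρ q.1 q.2 ∈ skLT X 2 := by
    rintro ⟨⟨x, hx⟩, t⟩
    obtain ⟨n, hn, e, y, hy, rfl⟩ := exists_chi_of_mem_skLT hx
    have hn' : n < 2 := by exact_mod_cast hn
    interval_cases n
    · have : chi 0 e y ∈ skLT X (1 : ℕ) := chi_mem_skLT_of_lt (by norm_num) e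
        (ball_subset_closedBall hy)
      rw [hρ0 _ this]
      exact hx
    · rw [hρ1 e y (ball_subset_closedBall hy)]
      exact chi_mem_skLT_of_lt hn e (Subtype.coe_prop _)
  have h12 : ((1 : ℕ) : ℕ∞) + 1 = 2 := by norm_num
  rw [h12] at hρc hgc
  refine ⟨⟨fun q => ⟨ρ q.1 q.2, hmem q⟩, ?_⟩, ⟨fun x => g x (), ?_⟩, fun x hx => ⟨fun t => ?_, ?_⟩,
    fun e y => ⟨?_, fun t => ?_⟩⟩
  · exact (hρc.comp_continuous (f := fun q : skLT X 2 × I => ((q.1 : X), q.2)) (by fun_prop)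
      fun q => ⟨q.1.2, trivial⟩).subtype_mk _
  · exact hgc.comp_continuous (f := fun x : skLT X 2 => ((x : X), ())) (by fun_prop)
      fun x => ⟨x.2, trivial⟩
  · exact Subtype.ext (congrFun (hρ0 x (by exact_mod_cast hx)) t)
  · exact congrFun (hg0 x (by exact_mod_cast hx)) ()
  · exact congrFun (hg1 e y y.2) ()
  · exact Subtype.ext (congrFun (hρ1 e y y.2) t)

/-- Two holonomies on the 1-skeleton that agree along all edges are conjugate. -/
theorem exists_conj_of_edges {Γ : Type w} [Group Γ] (M₁ M₂ : Holonomy Γ (skLT X 2))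
    (hedge : ∀ (e : Cell X 1) (p : Path (ballEnd (-1) (by simp)) (ballEnd 1 (by simp))),
      M₂.val (p.map (cellMap (N := 2) (by norm_num) e).continuous) =
        M₁.val (p.map (cellMap (N := 2) (by norm_num) e).continuous)) :
    ∃ c : skLT X 2 → Γ, (∀ x : skLT X 2, (x : X) ∈ skLT X 1 → c x = 1) ∧
      ∀ (x y : skLT X 2) (p : Path x y), M₂.val p = (c x)⁻¹ * M₁.val p * c y := by
  classical
  have h1 : ((1 : ℕ) : ℕ∞) < 2 := by norm_num
  let E (e : Cell X 1) : C(closedBall (0 : Fin 1 → ℝ) 1, skLT X 2) := cellMap h1 e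
  -- On an edge, `c` compares the holonomies of the part of the edge before the point in question.
  let sp (y : closedBall (0 : Fin 1 → ℝ) 1) : Path (ballEnd (-1) (by simp)) y :=
    PathConnectedSpace.somePath _ _
  let w (e : Cell X 1) (y : closedBall (0 : Fin 1 → ℝ) 1) : Γ :=
    ((M₁.comap (E e)).val (sp y))⁻¹ * (M₂.comap (E e)).val (sp y)
  let P (x : skLT X 2) : Prop := ∃ r : Cell X 1 × closedBall (0 : Fin 1 → ℝ) 1,
    r.2.1 ∈ ball (0 : Fin 1 → ℝ) 1 ∧ E r.1 r.2 = x
  let c (x : skLT X 2) : Γ := if h : P x then w h.choose.1 h.choose.2 else 1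
  have hc0 : ∀ x : skLT X 2, (x : X) ∈ skLT X 1 → c x = 1 := by
    intro x hx
    refine dif_neg ?_
    rintro ⟨⟨e, y⟩, hy, rfl⟩
    exact chi_ball_notMem e hy (by exact_mod_cast hx)
  have hbd : ∀ (e : Cell X 1) (y : closedBall (0 : Fin 1 → ℝ) 1), ‖y.1‖ = 1 →
      (E e y : X) ∈ skLT X 1 := fun e y hy => by
    exact_mod_cast chi_sphere_mem e (by simpa using hy)
  have hc1 : ∀ e y, c (E e y) = w e y := by
    intro e y
    by_cases hy : ‖y.1‖ < 1
    · have h : P (E e y) := ⟨(e, y), by simpa using hy, rfl⟩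
      have hyb : y.1 ∈ ball (0 : Fin 1 → ℝ) 1 := by simpa using hy
      have h2 : chi 1 h.choose.1 h.choose.2 = chi 1 e y := congrArg Subtype.val h.choose_spec.2
      have h3 : c (E e y) = w h.choose.1 h.choose.2 := dif_pos h
      have h4 : h.choose = (e, y) := by
        refine Prod.ext ?_ ?_
        · exact eq_of_heq (Sigma.mk.inj (chi_ball_inj h.choose_spec.1 hyb h2)).2
        · have h5 : h.choose.1 = e :=
            eq_of_heq (Sigma.mk.inj (chi_ball_inj h.choose_spec.1 hyb h2)).2
          rw [h5] at h2
          exact Subtype.ext (chi_injOn e h.choose_spec.1 hyb h2)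
      rw [h3, h4]
    · have hy1 : ‖y.1‖ = 1 := le_antisymm (mem_closedBall_zero_iff.1 y.2) (not_lt.1 hy)
      rw [hc0 _ (hbd e y hy1)]
      have hy0 : |y.1 0| = 1 := by
        refine Eq.trans ?_ hy1
        simp [Pi.norm_def]
      rcases eq_or_eq_neg_of_abs_eq hy0 with h | h
      · obtain rfl : y = ballEnd 1 (by simp) := Subtype.ext (funext fun i => by
          rw [Subsingleton.elim i 0, h]; rfl)
        show 1 = (M₁.val _)⁻¹ * M₂.val _
        rw [hedge e (sp _), inv_mul_cancel]
      · obtain rfl : y = ballEnd (-1) (by simp) := Subtype.ext (funext fun i => by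
          rw [Subsingleton.elim i 0, h]; rfl)
        show 1 = (Holonomy.val _ _)⁻¹ * Holonomy.val _ _
        rw [Holonomy.val_loop_of_simplyConnected, Holonomy.val_loop_of_simplyConnected]
        simp
  have hcell : ∀ (e : Cell X 1) (d : C(I, closedBall (0 : Fin 1 → ℝ) 1)) (x x' : skLT X 2)
      (p : Path x x'), (∀ t, p t = E e (d t)) → M₂.val p = (c x)⁻¹ * M₁.val p * c x' := by
    intro e d x x' p hp
    obtain rfl : x = E e (d 0) := by rw [← p.source, hp]
    obtain rfl : x' = E e (d 1) := by rw [← p.target, hp]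
    let d' : Path (d 0) (d 1) := ⟨d, rfl, rfl⟩
    have hv : ∀ M : Holonomy Γ (skLT X 2), M.val p = ((M.comap (E e)).val (sp (d 0)))⁻¹ *
        (M.comap (E e)).val (sp (d 1)) := fun M => by
      rw [← Holonomy.val_symm, ← Holonomy.val_trans,
        Holonomy.val_eq_of_simplyConnected _ _ d', Holonomy.comap_val]
      exact M.val_congr _ _ hp
    rw [hv, hv, hc1, hc1]
    simp only [w]
    group
  refine ⟨c, hc0, ?_⟩
  -- A path may run through infinitely many edges. By connectedness of the interval it suffices to
  -- prove the formula locally, near a time `s`.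
  have main : ∀ (q : C(I, skLT X 2)) (s t : I), ∀ τ : Path s t,
      (M₂.comap q).val τ = (c (q s))⁻¹ * (M₁.comap q).val τ * c (q t) := by
    intro q
    have : Std.Symm fun s t : I => ∀ τ : Path s t,
        (M₂.comap q).val τ = (c (q s))⁻¹ * (M₁.comap q).val τ * c (q t) := ⟨fun s t h τ => by
      have := h τ.symm
      rw [Holonomy.val_symm, Holonomy.val_symm] at this
      rw [← inv_inj, this]
      group⟩
    refine PreconnectedSpace.induction₂ _ ?_ ?_
    · intro s
      have hK : ∀ x : skLT X 2, (x : X) ∈ skLT X 1 ∨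
          ∃ (e : Cell X 1) (y : closedBall (0 : Fin 1 → ℝ) 1), x = E e y := by
        rintro ⟨x, hx⟩
        obtain ⟨n, hn, e, y, hy, rfl⟩ := exists_chi_of_mem_skLT hx
        have hn' : n < 2 := by exact_mod_cast hn
        interval_cases n
        · exact Or.inl (chi_mem_skLT_of_lt (by norm_num) e (ball_subset_closedBall hy))
        · exact Or.inr ⟨e, ⟨y, ball_subset_closedBall hy⟩, rfl⟩
      -- expand the edges from a point different from the given one
      obtain ⟨c0, hc0', hc0s⟩ : ∃ c0 : Fin 1 → ℝ, ‖c0‖ ≤ 1 / 2 ∧ ((q s : X) ∈ skLT X 1 ∨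
          ∃ (e : Cell X 1) (y : closedBall (0 : Fin 1 → ℝ) 1), q s = E e y ∧
            1 / 8 < ‖y.1 - c0‖) := by
        rcases hK (q s) with h | ⟨e, y, h⟩
        · exact ⟨0, by simp, Or.inl h⟩
        · rcases le_total (1 / 4) ‖y.1‖ with hy | hy
          · exact ⟨0, by simp, Or.inr ⟨e, y, h, by rw [sub_zero]; linarith⟩⟩
          · have hn : ‖(fun _ => 1 / 2 : Fin 1 → ℝ)‖ = 1 / 2 := by
              rw [pi_norm_const]; norm_num
            refine ⟨fun _ => 1 / 2, hn.le, Or.inr ⟨e, y, h, ?_⟩⟩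
            have := norm_sub_norm_le (fun _ => 1 / 2 : Fin 1 → ℝ) y.1
            rw [hn, norm_sub_rev] at this
            linarith
      obtain ⟨ρ, g, hv, hρ⟩ := exists_edge_expansion (X := X) c0 hc0'
      have hρ0 : ∀ x, ρ (x, 0) = x := by
        intro x
        rcases hK x with h | ⟨e, y, rfl⟩
        · exact (hv x h).1 0
        · refine ((hρ e y).2 0).trans (congrArg (E e) ?_)
          refine Eq.trans (congrArg _ ?_) ((BallChart.ball (Fin 1 → ℝ)).ret_emb y)
          show _ = y.1
          simp
      have hρ1 : ∀ x, 1 / 8 < g x → (ρ (x, 1) : X) ∈ skLT X 1 := by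
        intro x hx
        rcases hK x with h | ⟨e, y, rfl⟩
        · rw [(hv x h).1]
          exact h
        · have hg : 1 / 8 < ‖y.1 - c0‖ := by
            have := (hρ e y).1
            exact (lt_min_iff.1 (hx.trans_eq this)).1
          have := (hρ e y).2 1
          refine (congrArg Subtype.val this).symm ▸ hbd e _ ?_
          refine (congrArg norm ((BallChart.ball (Fin 1 → ℝ)).emb_ret _)).trans ?_
          rw [BallChart.norm_clamp, min_eq_left]
          have h3 := norm_sub_norm_le ((1 + 15 * ((1 : I) : ℝ)) • (y.1 - c0)) (-c0)
          rw [norm_smul, norm_neg, sub_neg_eq_add, add_comm _ c0] at h3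
          norm_num at h3
          norm_num
          linarith
      have htr : ∀ x (p : Path x (ρ (x, 1))), (∀ t, p t = ρ (x, t)) →
          M₂.val p = (c x)⁻¹ * M₁.val p * c (ρ (x, 1)) := by
        intro x p hp
        rcases hK x with h | ⟨e, y, rfl⟩
        · have hp' : ∀ t, p t = x := fun t => (hp t).trans ((hv x h).1 t)
          rw [M₁.val_const p hp', M₂.val_const p hp', (hv x h).1, hc0 x h]
          simp
        · refine hcell e ⟨fun t => (BallChart.ball (Fin 1 → ℝ)).ret
            (c0 + (1 + 15 * (t : ℝ)) • (y.1 - c0)), ?_⟩ _ _ p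
            fun t => (hp t).trans ((hρ e y).2 t)
          exact (BallChart.ball _).ret.continuous.comp (by fun_prop)
      have hgs : 1 / 8 < g (q s) := by
        rcases hc0s with h | ⟨e, y, h, hy⟩
        · rw [(hv _ h).2]
          norm_num
        · rw [h]
          exact (lt_min hy (by norm_num)).trans_eq (hρ e y).1.symm
      obtain ⟨ε, hε, hball⟩ := Metric.mem_nhds_iff.1
        ((isOpen_lt continuous_const (by fun_prop : Continuous fun t => g (q t))).mem_nhds hgs)
      refine Filter.mem_of_superset (Metric.ball_mem_nhds s hε) fun t ht τ => ?_
      let l : Path s t := ⟨⟨fun r => ⟨(1 - r : ℝ) • (s : ℝ) + (r : ℝ) • (t : ℝ),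
        (convex_Icc (0 : ℝ) 1) s.2 t.2 (sub_nonneg.2 r.2.2) r.2.1 (by ring)⟩, by fun_prop⟩,
        Subtype.ext (by simp), Subtype.ext (by simp)⟩
      have hl : ∀ r, 1 / 8 < g (q (l r)) := fun r => hball (by
        have e1 : dist (l r) s = r * dist t s := by
          show |((1 - r : ℝ) • (s : ℝ) + (r : ℝ) • (t : ℝ)) - s| = r * |(t : ℝ) - s|
          rw [← abs_of_nonneg r.2.1, ← abs_mul, abs_of_nonneg r.2.1]
          congr 1
          simp only [smul_eq_mul]
          ring
        have e2 := Metric.mem_ball.1 ht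
        rw [Metric.mem_ball, e1]
        exact (mul_le_of_le_one_left dist_nonneg r.2.2).trans_lt e2)
      rw [Holonomy.val_eq_of_simplyConnected _ τ l, Holonomy.val_eq_of_simplyConnected _ τ l]
      let F : C(I × I, skLT X 2) := ⟨fun r => ρ (q (l r.1), r.2), by fun_prop⟩
      let R (t : I) : Path (q t) (ρ (q t, 1)) := ⟨⟨fun r => ρ (q t, r), by fun_prop⟩, hρ0 _, rfl⟩
      let B : Path (ρ (q s, 1)) (ρ (q t, 1)) :=
        ⟨⟨fun r => ρ (q (l r), 1), by fun_prop⟩, by simp, by simp⟩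
      have hR := fun t => htr (q t) (R t) fun _ => rfl
      have sq : ∀ M : Holonomy Γ (skLT X 2), (M.comap q).val l = M.val (R s) * (M.val (R t))⁻¹ := by
        intro M
        have := M.val_square F (l.map q.continuous) B (R s) (R t) (fun r => (hρ0 _).symm)
          (fun r => rfl) (fun r => by show ρ (q s, r) = ρ (q (l 0), r); simp)
          (fun r => by show ρ (q t, r) = ρ (q (l 1), r); simp)
        -- The expanded path consists of vertices and is therefore constant.
        have hB : M.val B = 1 := M.val_const B fun r => by
          let p : Path (ρ (q s, 1) : X) (ρ (q t, 1)) := B.map continuous_subtype_val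
          exact Subtype.ext (path_eq_of_mem_skLT_one p (fun r => hρ1 _ (hl r)) r)
        rw [hB, mul_one] at this
        rw [← this, Holonomy.comap_val, mul_inv_cancel_right]
      have hs1 : c (ρ (q s, 1)) = 1 := hc0 _ (hρ1 _ hgs)
      have ht1 : c (ρ (q t, 1)) = 1 := hc0 _ (hρ1 _ (by simpa using hl 1))
      rw [sq, sq, hR, hR, hs1, ht1]
      group
    · refine ⟨fun s t r h h' τ => ?_⟩
      rw [Holonomy.val_eq_of_simplyConnected _ τ ((PathConnectedSpace.somePath s t).trans
        (PathConnectedSpace.somePath t r)), Holonomy.val_eq_of_simplyConnected _ τ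
        ((PathConnectedSpace.somePath s t).trans (PathConnectedSpace.somePath t r)),
        Holonomy.val_trans, Holonomy.val_trans, h, h']
      group
  intro x y p
  have e := main p.toContinuousMap 0 1 ⟨ContinuousMap.id I, rfl, rfl⟩
  have e' : ∀ M : Holonomy Γ (skLT X 2), (M.comap p.toContinuousMap).val
      (⟨ContinuousMap.id I, rfl, rfl⟩ : Path (0 : I) 1) = M.val p :=
    fun M => M.val_congr _ _ fun t => rfl
  have hx : p.toContinuousMap 0 = x := p.source
  have hy : p.toContinuousMap 1 = y := p.target
  rwa [e', e', hx, hy] at e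

end Skeleton

section

/-! ### Maps to Eilenberg-MacLane spaces -/

namespace BallChart

variable {V B B' Z : Type*} [NormedAddCommGroup V] [NormedSpace ℝ V] [TopologicalSpace B]
  [TopologicalSpace B'] [TopologicalSpace Z]

lemma emb_ret_emb (c : BallChart V B) (d : BallChart V B') (b : B) :
    d.emb (d.ret (c.emb b)) = c.emb b := by
  rw [emb_ret, clamp_eq_self (c.norm_emb_le b)]

lemma ret_emb_mem_bd (c : BallChart V B) (d : BallChart V B') {b : B} :
    d.ret (c.emb b) ∈ d.bd ↔ b ∈ c.bd := by
  simp only [bd, mem_ofPred_eq, emb_ret_emb]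

lemma ret_emb_ret_emb (c : BallChart V B) (d : BallChart V B') (b : B) :
    c.ret (d.emb (d.ret (c.emb b))) = b := by
  rw [emb_ret_emb, ret_emb]

/-- A homotopy followed by a homotopy relative to the boundary sphere can be replaced by a homotopy
with the same end that has the same track on the boundary as the first one. -/
lemma exists_homotopy_of_rel (c : BallChart V B) (K L : C(I × B, Z)) (h : ∀ y, L (0, y) = K (1, y))
    (hL : ∀ t, ∀ y ∈ c.bd, L (t, y) = K (1, y)) :
    ∃ G : C(I × B, Z), (∀ y, G (0, y) = K (0, y)) ∧ (∀ t, ∀ y ∈ c.bd, G (t, y) = K (t, y)) ∧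
      ∀ y, G (1, y) = L (1, y) := by
  classical
  -- The homotopy `G` ends with `L` up to a rescaling by the factor 2. The homotopy extension
  -- property on the cylinder changes its end by a homotopy that undoes the rescaling.
  obtain ⟨G, hG0, hGb, hG1⟩ := c.exists_concat_rel K L h hL
  let k : I × (I × B) → Z := fun q =>
    if q.2.1 = 1 then L (1, c.scl (2 - q.1, q.2.2)) else G q.2
  have k1 : ∀ q : I × (I × B), q.2.1 = 1 → k q = L (1, c.scl (2 - q.1, q.2.2)) :=
    fun q hq => if_pos hq
  have k2 : ∀ q : I × (I × B), q.2.1 = 0 ∨ q.2.2 ∈ c.bd → k q = G q.2 := by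
    rintro ⟨s, t, y⟩ hq
    by_cases ht : t = 1
    · subst ht
      have hy : y ∈ c.bd := by simpa using hq
      rw [k1 _ rfl]
      show L (1, c.scl (2 - (s : ℝ), y)) = G (1, y)
      rw [scl_of_mem_bd _ (by linarith [s.2.2]) hy, hL _ _ hy, hGb _ _ hy]
    · exact if_neg ht
  have hk : ContinuousOn k (univ ×ˢ (interval.prod c).bd) := by
    have c1 : ContinuousOn k {q | q.2.1 = 1} := ContinuousOn.congr
      (by fun_prop : Continuous fun q : I × (I × B) =>
        L (1, c.scl (2 - q.1, q.2.2))).continuousOn k1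
    have c2 : ContinuousOn k {q | q.2.1 = 0 ∨ q.2.2 ∈ c.bd} := ContinuousOn.congr
      (by fun_prop : Continuous fun q : I × (I × B) => G q.2).continuousOn k2
    refine (c1.union_of_isClosed c2 (isClosed_eq (by fun_prop) continuous_const)
      ((isClosed_eq (by fun_prop) continuous_const).union
        (c.isClosed_bd.preimage (by fun_prop)))).mono ?_
    rintro ⟨s, t, y⟩ ⟨-, hq⟩
    rcases mem_bd_prod.1 hq with hq | hq
    · rcases mem_bd_interval.1 hq with hq | hq
      · exact Or.inr (Or.inl hq)
      · exact Or.inl hq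
    · exact Or.inr (Or.inr hq)
  obtain ⟨K', hK0, hKb⟩ := (interval.prod c).exists_homotopy_extension' G k hk (by
    rintro ⟨t, y⟩ hq
    rcases mem_bd_prod.1 hq with hq | hq
    · rcases mem_bd_interval.1 hq with rfl | rfl
      · exact k2 _ (Or.inl rfl)
      · rw [k1 _ rfl, hG1]
        simp
    · exact k2 _ (Or.inr hq))
  refine ⟨K'.comp ⟨fun q => (1, q), by fun_prop⟩, fun y => ?_, fun t y hy => ?_, fun y => ?_⟩
  · show K' (1, (0, y)) = _
    rw [hKb _ _ (mem_bd_prod.2 (Or.inl (mem_bd_interval.2 (Or.inl rfl)))), k2 _ (Or.inl rfl), hG0]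
  · show K' (1, (t, y)) = _
    rw [hKb _ _ (mem_bd_prod.2 (Or.inr hy)), k2 _ (Or.inr hy), hGb _ _ hy]
  · show K' (1, (1, y)) = _
    rw [hKb _ _ (mem_bd_prod.2 (Or.inl (mem_bd_interval.2 (Or.inr rfl)))), k1 _ rfl]
    show L (1, c.scl (2 - ((1 : I) : ℝ), y)) = _
    have : (2 : ℝ) - ((1 : I) : ℝ) = 1 := by norm_num
    rw [this, scl_one]

end BallChart

variable {Γ : Type v} [Group Γ] {Y : Type u} [TopologicalSpace Y]

/-- A holonomy that identifies all sets of homotopy classes of paths with given ends with the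
group. -/
structure Holonomy.IsBijective (M : Holonomy Γ Y) : Prop where
  homotopic : ∀ {x y : Y} {p q : Path x y}, M.val p = M.val q → p.Homotopic q
  exists_path : ∀ (x y : Y) (g : Γ), ∃ p : Path x y, M.val p = g

/-- A classifying space of a group has a bijective holonomy: connect all points to a fixed one. -/
lemma IsClassifyingSpace.exists_holonomy (hY : IsClassifyingSpace Γ Y) :
    ∃ M : Holonomy Γ Y, M.IsBijective := by
  have := hY.pathConnected
  obtain ⟨x0⟩ : Nonempty Y := inferInstance
  obtain ⟨φ⟩ := hY.fundamentalGroup x0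
  let A (x : Y) : FundamentalGroupoid.mk x0 ⟶ FundamentalGroupoid.mk x :=
    Path.Homotopic.Quotient.mk (PathConnectedSpace.somePath x0 x)
  let P {x y : Y} (p : Path x y) : FundamentalGroupoid.mk x ⟶ FundamentalGroupoid.mk y :=
    Path.Homotopic.Quotient.mk p
  let L {x y : Y} (p : Path x y) : FundamentalGroup Y x0 := A x ≫ P p ≫ Groupoid.inv (A y)
  refine ⟨⟨fun p => (φ (L p))⁻¹, fun {x y z} p q => ?_, fun {x y p q} h => ?_⟩,
    fun {x y p q} h => ?_, fun x y g => ?_⟩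
  · rw [← mul_inv_rev, ← map_mul]
    congr 2
    have : P (p.trans q) = P p ≫ P q := rfl
    show A x ≫ P (p.trans q) ≫ Groupoid.inv (A z) =
      (A x ≫ P p ≫ Groupoid.inv (A y)) ≫ (A y ≫ P q ≫ Groupoid.inv (A z))
    rw [this]
    simp
  · have : P p = P q := Path.Homotopic.Quotient.eq.2 h
    simp only [L, this]
  · have h1 : L p = L q := φ.injective (inv_injective h)
    have h2 : P p = P q := by
      have := congrArg (fun l : FundamentalGroupoid.mk x0 ⟶ FundamentalGroupoid.mk x0 =>
        Groupoid.inv (A x) ≫ l ≫ A y) h1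
      simpa [L] using this
    exact Path.Homotopic.Quotient.eq.1 h2
  · obtain ⟨l, hl⟩ := φ.surjective g⁻¹
    obtain ⟨p, hp⟩ := Path.Homotopic.Quotient.mk_surjective
      (Groupoid.inv (A x) ≫ (l : FundamentalGroupoid.mk x0 ⟶ FundamentalGroupoid.mk x0) ≫ A y)
    refine ⟨p, ?_⟩
    have : L p = l := by
      have hp' : P p = Groupoid.inv (A x) ≫
        (l : FundamentalGroupoid.mk x0 ⟶ FundamentalGroupoid.mk x0) ≫ A y := hp
      show A x ≫ P p ≫ Groupoid.inv (A y) = l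
      rw [hp']
      simp
    show (φ (L p))⁻¹ = g
    rw [this, hl, inv_inv]

/-- A map from the boundary of a cube to a classifying space extends if the dimension is at least
three, or if its holonomy is trivial. -/
lemma IsClassifyingSpace.exists_extension_cube (hY : IsClassifyingSpace Γ Y) {M : Holonomy Γ Y}
    (hM : M.IsBijective) {n : ℕ} (hn : 1 ≤ n) (v : I × (Fin n → I) → Y)
    (hv : ContinuousOn v (BallChart.interval.prod (BallChart.cube (Fin n))).bd)
    (hloop : n = 1 → ∀ r : C(I, I × (Fin n → I)),
      (∀ t, r t ∈ (BallChart.interval.prod (BallChart.cube (Fin n))).bd) → r 0 = r 1 →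
      ∀ (y : Y) (p : Path y y), (∀ t, p t = v (r t)) → M.val p = 1) :
    ∃ v' : C(I × (Fin n → I), Y),
      ∀ x ∈ (BallChart.interval.prod (BallChart.cube (Fin n))).bd, v' x = v x := by
  refine BallChart.exists_extension_of_null _ v hv fun r x0 hx0 hr hrb => ?_
  let p : GenLoop (Fin n) Y (v x0) := ⟨⟨fun s => v (r s), hv.comp_continuous (by fun_prop) hr⟩,
    fun s hs => congrArg v (hrb s (BallChart.mem_bd_cube.2 hs))⟩
  suffices h : GenLoop.Homotopic (GenLoop.const : GenLoop (Fin n) Y (v x0)) p by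
    obtain ⟨H⟩ := h
    exact ⟨H.toContinuousMap, fun s => H.apply_zero s, fun s => H.apply_one s,
      fun t s hs => H.eq_fst t (BallChart.mem_bd_cube.1 hs)⟩
  -- In dimension at least two the higher homotopy groups vanish; a loop is null-homotopic since
  -- its holonomy is trivial.
  obtain hn | hn := hn.lt_or_eq
  · have : Subsingleton (Quotient (GenLoop.Homotopic.setoid (Fin n) (v x0))) :=
      hY.aspherical n hn (v x0)
    exact Quotient.exact (Subsingleton.elim
      (Quotient.mk (GenLoop.Homotopic.setoid _ _) (GenLoop.const : GenLoop (Fin n) Y (v x0)))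
      (Quotient.mk (GenLoop.Homotopic.setoid _ _) p))
  · subst hn
    let r' : C(I, I × (Fin 1 → I)) := ⟨fun t => r fun _ => t, by fun_prop⟩
    have h0 : r' 0 = x0 := hrb _ (BallChart.mem_bd_cube.2 ⟨0, Or.inl rfl⟩)
    have h1 : r' 1 = x0 := hrb _ (BallChart.mem_bd_cube.2 ⟨0, Or.inr rfl⟩)
    let q : Path (v x0) (v x0) := ⟨⟨fun t => p fun _ => t, by fun_prop⟩,
      congrArg v h0, congrArg v h1⟩
    have hq : M.val (Path.refl (v x0)) = M.val q := by
      rw [M.val_refl, hloop rfl r' (fun t => hr _) (h0.trans h1.symm) _ q fun t => rfl]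
    obtain ⟨H⟩ := hM.homotopic hq
    refine ⟨⟨⟨⟨fun z => H (z.1, z.2 0), by fun_prop⟩, fun s => H.apply_zero _, fun s => ?_⟩, ?_⟩⟩
    · refine (H.apply_one _).trans (congrArg p ?_)
      ext i
      rw [Subsingleton.elim i 0]
    · rintro t s ⟨i, hi⟩
      rw [Subsingleton.elim i 0] at hi
      exact H.eq_fst t hi

/-- `IsClassifyingSpace.exists_extension_cube` for a ball. -/
lemma IsClassifyingSpace.exists_extension_ball (hY : IsClassifyingSpace Γ Y) {M : Holonomy Γ Y}
    (hM : M.IsBijective) {n : ℕ} (hn : 1 ≤ n) (b : (Fin (n + 1) → ℝ) → Y)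
    (hb : ContinuousOn b (Metric.sphere 0 1))
    (hloop : n = 1 → ∀ r : C(I, Fin (n + 1) → ℝ), (∀ t, r t ∈ Metric.sphere 0 1) → r 0 = r 1 →
      ∀ (y : Y) (p : Path y y), (∀ t, p t = b (r t)) → M.val p = 1) :
    ∃ G : (Fin (n + 1) → ℝ) → Y, ContinuousOn G (closedBall 0 1) ∧
      ∀ y ∈ Metric.sphere (0 : Fin (n + 1) → ℝ) 1, G y = b y := by
  let c := BallChart.cube (Fin (n + 1))
  let s : I × (Fin n → I) → (Fin (n + 1) → ℝ) := fun q => c.emb (Fin.cons q.1 q.2)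
  have hs : Continuous s := c.emb.continuous.comp (by fun_prop)
  have hsb : ∀ q ∈ (BallChart.interval.prod (BallChart.cube (Fin n))).bd,
      s q ∈ Metric.sphere 0 1 := by
    rintro ⟨t, q⟩ hq
    have : (Fin.cons t q : Fin (n + 1) → I) ∈ c.bd := by
      refine BallChart.mem_bd_cube.2 ?_
      rcases BallChart.mem_bd_prod.1 hq with hq | hq
      · exact ⟨0, BallChart.mem_bd_interval.1 hq⟩
      · obtain ⟨i, hi⟩ := BallChart.mem_bd_cube.1 hq
        exact ⟨i.succ, by simpa using hi⟩
    exact mem_sphere_zero_iff_norm.2 this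
  obtain ⟨v', hv'⟩ := hY.exists_extension_cube hM hn (fun q => b (s q))
    (hb.comp hs.continuousOn hsb)
    (fun h1 r hr h01 y p hp => hloop h1 ⟨fun t => s (r t), hs.comp r.continuous⟩
      (fun t => hsb _ (hr t)) (congrArg s h01) y p hp)
  refine ⟨fun y => v' (c.ret y 0, Fin.tail (c.ret y)),
    Continuous.continuousOn (v'.continuous.comp ?_), fun y hy => ?_⟩
  · exact ((continuous_apply 0).comp c.ret.continuous).prodMk
      (continuous_pi fun i => (continuous_apply i.succ).comp c.ret.continuous)
  · have hy1 : ‖y‖ = 1 := mem_sphere_zero_iff_norm.1 hy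
    have he : c.emb (c.ret y) = y := by rw [BallChart.emb_ret, BallChart.clamp_eq_self hy1.le]
    have hbd : c.ret y ∈ c.bd := by
      show ‖c.emb (c.ret y)‖ = 1
      rw [he, hy1]
    have hbd' : (c.ret y 0, Fin.tail (c.ret y)) ∈
        (BallChart.interval.prod (BallChart.cube (Fin n))).bd := by
      obtain ⟨i, hi⟩ := BallChart.mem_bd_cube.1 hbd
      refine BallChart.mem_bd_prod.2 ?_
      induction i using Fin.cases with
      | zero => exact Or.inl (BallChart.mem_bd_interval.2 hi)
      | succ i => exact Or.inr (BallChart.mem_bd_cube.2 ⟨i, hi⟩)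
    refine (hv' _ hbd').trans (congrArg b ?_)
    show c.emb (Fin.cons (c.ret y 0) (Fin.tail (c.ret y))) = y
    rw [Fin.cons_self_tail, he]

/-- `IsClassifyingSpace.exists_extension_cube` for the cylinder over a ball. -/
lemma IsClassifyingSpace.exists_extension_cylinder (hY : IsClassifyingSpace Γ Y) {M : Holonomy Γ Y}
    (hM : M.IsBijective) {n : ℕ} (hn : 2 ≤ n) (v : I × closedBall (0 : Fin n → ℝ) 1 → Y)
    (hv : ContinuousOn v (BallChart.interval.prod (BallChart.ball (Fin n → ℝ))).bd) :
    ∃ v' : C(I × closedBall (0 : Fin n → ℝ) 1, Y),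
      ∀ x ∈ (BallChart.interval.prod (BallChart.ball (Fin n → ℝ))).bd, v' x = v x := by
  generalize hd : BallChart.ball (Fin n → ℝ) = d at hv ⊢
  have hcont : Continuous fun q : I × (Fin n → I) =>
      ((q.1, d.ret ((BallChart.cube (Fin n)).emb q.2)) : I × closedBall (0 : Fin n → ℝ) 1) := by
    fun_prop
  obtain ⟨v', hv'⟩ := hY.exists_extension_cube hM (by omega)
    (fun q => v (q.1, d.ret ((BallChart.cube (Fin n)).emb q.2)))
    (hv.comp hcont.continuousOn fun q hq => BallChart.mem_bd_prod.2
      ((BallChart.mem_bd_prod.1 hq).imp_right (BallChart.ret_emb_mem_bd _ d).2))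
    (fun h => absurd h (by omega))
  refine ⟨v'.comp ⟨fun q => (q.1, (BallChart.cube (Fin n)).ret (d.emb q.2)), by fun_prop⟩,
    fun x hx => ?_⟩
  refine (hv' _ (BallChart.mem_bd_prod.2 ((BallChart.mem_bd_prod.1 hx).imp_right
          (BallChart.ret_emb_mem_bd d _).2))).trans ?_
  show v (x.1, d.ret ((BallChart.cube (Fin n)).emb
    ((BallChart.cube (Fin n)).ret (d.emb x.2)))) = v x
  rw [BallChart.ret_emb_ret_emb]

section Maps

variable {X : Type w} [TopologicalSpace X] [T2Space X] [CWComplex (Set.univ : Set X)]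

/-- The interval `[-1, 1]` as a path. -/
def ballPath : Path (ballEnd (-1) (by simp)) (ballEnd 1 (by simp)) where
  toFun t := ballEnd (2 * t - 1) (abs_le.2 ⟨by linarith [t.2.1], by linarith [t.2.2]⟩)
  continuous_toFun := Continuous.subtype_mk (by fun_prop) _
  source' := Subtype.ext (by ext; simp [ballEnd])
  target' := Subtype.ext (by ext; simp [ballEnd]; norm_num)

/-- The affine identification of `[-1, 1]` with the unit interval. -/
def ballTime : C(Fin 1 → ℝ, I) where
  toFun y := Set.projIcc 0 1 zero_le_one ((1 + y 0) / 2)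

lemma ballTime_ballPath (t : I) : ballTime (ballPath t).1 = t := by
  show Set.projIcc (0 : ℝ) 1 zero_le_one ((1 + (2 * t - 1)) / 2) = t
  rw [show (1 + (2 * (t : ℝ) - 1)) / 2 = t by ring, projIcc_val]

lemma ballPath_ballTime (y : closedBall (0 : Fin 1 → ℝ) 1) : ballPath (ballTime y.1) = y := by
  have h : |y.1 0| ≤ 1 := (norm_le_pi_norm y.1 0).trans (mem_closedBall_zero_iff.1 y.2)
  have h' := abs_le.1 h
  refine Subtype.ext (funext fun i => ?_)
  rw [Subsingleton.elim i 0]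
  show 2 * (Set.projIcc (0 : ℝ) 1 zero_le_one ((1 + y.1 0) / 2) : ℝ) - 1 = y.1 0
  rw [projIcc_of_mem zero_le_one (⟨by linarith, by linarith⟩ : (1 + y.1 0) / 2 ∈ Set.Icc (0 : ℝ) 1)]
  ring

lemma ballTime_of_mem_sphere {y : Fin 1 → ℝ} (hy : y ∈ Metric.sphere (0 : Fin 1 → ℝ) 1) :
    ballTime y = 0 ∨ ballTime y = 1 := by
  have h : |y 0| = 1 := by
    refine Eq.trans ?_ (mem_sphere_zero_iff_norm.1 hy)
    simp [Pi.norm_def]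
  rcases eq_or_eq_neg_of_abs_eq h with h | h
  · refine Or.inr ?_
    show Set.projIcc (0 : ℝ) 1 zero_le_one ((1 + y 0) / 2) = 1
    rw [h]
    exact projIcc_of_right_le _ (by norm_num)
  · refine Or.inl ?_
    show Set.projIcc (0 : ℝ) 1 zero_le_one ((1 + y 0) / 2) = 0
    rw [h]
    exact projIcc_of_le_left _ (by norm_num)

/-- An edge of a CW complex as a path. -/
def edgePath (e : Cell X 1) : Path (chi 1 e (ballEnd (-1) (by simp)).1)
    (chi 1 e (ballEnd 1 (by simp)).1) :=
  (ballPath.map (cellMap (N := 2) (by norm_num) e).continuous).map continuous_subtype_val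

end Maps

end

section

/-! ### Uniqueness of Eilenberg-MacLane complexes -/

variable {Γ : Type v} [Group Γ] {Y : Type u} [TopologicalSpace Y]
variable {X : Type w} [TopologicalSpace X] [T2Space X] [CWComplex (Set.univ : Set X)]

lemma skLT_one_subset_two : skLT X 1 ⊆ skLT X 2 := CWComplex.skeletonLT_mono (by norm_num)

/-- A point of a closed cell of dimension at least `k` that lies in the union of the cells of
dimension less than `k` lies on the boundary of the cell. -/
lemma mem_sphere_of_chi_mem {n k : ℕ} (h : k ≤ n) (e : Cell X n) {y : Fin n → ℝ}
    (hy : y ∈ closedBall (0 : Fin n → ℝ) 1) (hx : chi n e y ∈ skLT X k) :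
    y ∈ Metric.sphere (0 : Fin n → ℝ) 1 := by
  by_contra hs
  refine chi_ball_notMem e (y := y) ?_ (CWComplex.skeletonLT_mono (by exact_mod_cast h) hx)
  rw [mem_ball_zero_iff]
  rw [mem_sphere_zero_iff_norm] at hs
  exact lt_of_le_of_ne (mem_closedBall_zero_iff.1 hy) hs

/-- A homotopy over an edge with given tracks of the endpoints. It exists if these tracks have
trivial holonomy and the images of the edge have the same holonomy. -/
lemma Holonomy.IsBijective.exists_edge_homotopy {M : Holonomy Γ Y} (hM : M.IsBijective)
    (e : Cell X 1) (f₀ f₁ : C(X, Y))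
    (hf : M.val ((edgePath e).map f₀.continuous) = M.val ((edgePath e).map f₁.continuous))
    (b : (Fin 1 → ℝ) → I → Y)
    (hb : ContinuousOn (fun q : (Fin 1 → ℝ) × I => b q.1 q.2) (Metric.sphere 0 1 ×ˢ univ))
    (hb0 : ∀ y ∈ Metric.sphere (0 : Fin 1 → ℝ) 1, b y 0 = f₀ (chi 1 e y) ∧ b y 1 = f₁ (chi 1 e y) ∧
      ∀ (z z' : Y) (p : Path z z'), (∀ t, p t = b y t) → M.val p = 1) :
    ∃ G : C(I × closedBall (0 : Fin 1 → ℝ) 1, Y), (∀ y, G (0, y) = f₀ (chi 1 e y)) ∧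
      (∀ y, G (1, y) = f₁ (chi 1 e y)) ∧
      ∀ y : closedBall (0 : Fin 1 → ℝ) 1, y.1 ∈ Metric.sphere 0 1 → ∀ t, G (t, y) = b y t := by
  let c := BallChart.ball (Fin 1 → ℝ)
  let E := cellMap (N := 2) (by norm_num) e
  have hbd : ∀ y : closedBall (0 : Fin 1 → ℝ) 1, y ∈ c.bd ↔ y.1 ∈ Metric.sphere 0 1 :=
    fun y => BallChart.mem_bd_ball
  obtain ⟨K, hK0, hKb⟩ := c.exists_homotopy_extension'
    ((f₀.comp ⟨Subtype.val, continuous_subtype_val⟩).comp E) (fun q => b q.2 q.1)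
    (hb.comp (f := fun q : I × closedBall (0 : Fin 1 → ℝ) 1 => ((q.2 : Fin 1 → ℝ), q.1))
      (by fun_prop) fun q hq => ⟨(hbd _).1 hq.2, trivial⟩)
    (fun y hy => (hb0 _ ((hbd y).1 hy)).1)
  have hend : ∀ s : ℝ, |s| = 1 → ∀ hs : |s| ≤ 1, (ballEnd s hs).1 ∈
      Metric.sphere (0 : Fin 1 → ℝ) 1 := fun s h hs => by
    rw [mem_sphere_zero_iff_norm]
    show ‖fun _ : Fin 1 => s‖ = 1
    rw [pi_norm_const, Real.norm_eq_abs, h]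
  -- the end of the homotopy `K`, as a path with the same ends as the image of the edge under `f₁`
  have hK1 : ∀ y : closedBall (0 : Fin 1 → ℝ) 1, y.1 ∈ Metric.sphere 0 1 →
      K (1, y) = f₁ (chi 1 e y) := fun y hy => (hKb 1 y ((hbd y).2 hy)).trans (hb0 _ hy).2.1
  let q : Path (f₁ (chi 1 e (ballEnd (-1) (by simp)).1)) (f₁ (chi 1 e (ballEnd 1 (by simp)).1)) :=
    ⟨⟨fun t => K (1, ballPath t), by fun_prop⟩,
      (congrArg (fun y => K (1, y)) ballPath.source).trans (hK1 _ (hend _ (by simp) _)),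
      (congrArg (fun y => K (1, y)) ballPath.target).trans (hK1 _ (hend _ (by simp) _))⟩
  have side : ∀ s hs, |s| = 1 → M.val (⟨⟨fun t => K (t, ballEnd s hs), by fun_prop⟩, rfl, rfl⟩ :
      Path (K (0, ballEnd s hs)) (K (1, ballEnd s hs))) = 1 := fun s hs h =>
    (hb0 _ (hend s h hs)).2.2 _ _ _ fun t => hKb t _ ((hbd _).2 (hend s h hs))
  have hq : M.val q = M.val ((edgePath e).map f₁.continuous) := by
    let F : C(I × I, Y) := ⟨fun r => K (r.2, ballPath r.1), by fun_prop⟩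
    let q₀ : Path (K (0, ballEnd (-1) (by simp))) (K (0, ballEnd 1 (by simp))) :=
      ⟨⟨fun t => K (0, ballPath t), by fun_prop⟩, by simp, by simp⟩
    let q₁ : Path (K (1, ballEnd (-1) (by simp))) (K (1, ballEnd 1 (by simp))) :=
      ⟨⟨fun t => K (1, ballPath t), by fun_prop⟩, by simp, by simp⟩
    have sq := M.val_square F q₀ q₁
      ⟨⟨fun t => K (t, ballEnd (-1) (by simp)), by fun_prop⟩, rfl, rfl⟩
      ⟨⟨fun t => K (t, ballEnd 1 (by simp)), by fun_prop⟩, rfl, rfl⟩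
      (fun t => rfl) (fun t => rfl)
      (fun t => congrArg (fun y => K (t, y)) ballPath.source.symm)
      (fun t => congrArg (fun y => K (t, y)) ballPath.target.symm)
    rw [side _ _ (by simp), side _ _ (by simp), one_mul, mul_one] at sq
    rw [← hf, M.val_congr q q₁ fun t => rfl, ← sq]
    exact M.val_congr _ _ fun t => hK0 _
  obtain ⟨H⟩ := hM.homotopic hq
  obtain ⟨G, hG0, hGb, hG1⟩ := c.exists_homotopy_of_rel K
    ⟨fun r => H (r.1, ballTime r.2.1), by fun_prop⟩
    (fun y => (H.apply_zero _).trans (congrArg (fun y => K (1, y)) (ballPath_ballTime y)))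
    (fun t y hy => by
      have h := ballTime_of_mem_sphere ((hbd y).1 hy)
      refine (H.eq_fst t h).trans (congrArg (fun y => K (1, y)) (ballPath_ballTime y)))
  refine ⟨G, fun y => (hG0 y).trans (hK0 y), fun y => (hG1 y).trans ?_, fun y hy t =>
    (hGb t y ((hbd y).2 hy)).trans (hKb t y ((hbd y).2 hy))⟩
  refine (H.apply_one _).trans ?_
  show f₁ (chi 1 e (ballPath (ballTime y.1)).1) = _
  rw [ballPath_ballTime]

/-- Two maps to a classifying space with the same holonomy along the edges are homotopic. -/
theorem IsClassifyingSpace.exists_homotopy (hY : IsClassifyingSpace Γ Y) {M : Holonomy Γ Y}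
    (hM : M.IsBijective) (x0 : X) (f₀ f₁ : C(X, Y)) (h0 : f₀ x0 = f₁ x0)
    (hf : ∀ e : Cell X 1,
      M.val ((edgePath e).map f₀.continuous) = M.val ((edgePath e).map f₁.continuous))
    (hx0 : x0 ∈ skLT X 1) :
    ∃ H : C(I × X, Y), (∀ x, H (0, x) = f₀ x) ∧ (∀ x, H (1, x) = f₁ x) ∧
      ∀ t, H (t, x0) = f₀ x0 := by
  classical
  -- Tracks of trivial holonomy for the vertices, constant for the base point.
  have hpath : ∀ x : X, ∃ p : C(I, Y), p 0 = f₀ x ∧ p 1 = f₁ x ∧ (x = x0 → ∀ t, p t = f₀ x0) ∧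
      ∀ (z z' : Y) (q : Path z z'), (∀ t, q t = p t) → M.val q = 1 := by
    intro x
    by_cases hx : x = x0
    · subst hx
      exact ⟨.const _ (f₀ x), rfl, h0, fun _ _ => rfl, fun z z' q hq =>
        M.val_const q fun t => (hq t).trans ((hq 0).symm.trans q.source)⟩
    · obtain ⟨p, hp⟩ := hM.exists_path (f₀ x) (f₁ x) 1
      exact ⟨p.toContinuousMap, p.source, p.target, fun h => absurd h hx, fun z z' q hq =>
        (M.val_congr q p hq).trans hp⟩
  choose P hP0 hP1 hPx hPM using hpath
  have hPc : ContinuousOn (fun q : X × I => P q.1 q.2) (skLT X (1 : ℕ) ×ˢ univ) := by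
    refine continuousOn_skLT_prod (fun x t => P x t) _ fun n hn e => ?_
    obtain rfl : n = 0 := by
      have : n < 1 := by exact_mod_cast hn
      omega
    refine Continuous.continuousOn ?_
    have : (fun q : (Fin 0 → ℝ) × I => P (chi 0 e q.1) q.2) = fun q => P (chi 0 e 0) q.2 := by
      ext q
      rw [Subsingleton.elim q.1 0]
    rw [this]
    fun_prop
  obtain ⟨H, hHc, hHP, hHR⟩ := exists_extension (X := X) (P := I) (Z := Y) ⊤
    (fun x h => h 0 = f₀ x ∧ h 1 = f₁ x ∧ (x ∈ skLT X 1 → h = P x)) 1 le_top (fun x t => P x t)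
    hPc
    (fun x hx => ⟨hP0 x, hP1 x, fun _ => rfl⟩) (by
      intro n hn _ e b hb hR
      suffices h : ∃ G : C(I × closedBall (0 : Fin n → ℝ) 1, Y), (∀ y, G (0, y) = f₀ (chi n e y)) ∧
          (∀ y, G (1, y) = f₁ (chi n e y)) ∧
          ∀ y : closedBall (0 : Fin n → ℝ) 1, y.1 ∈ Metric.sphere 0 1 → ∀ t, G (t, y) = b y t by
        obtain ⟨G, hG0, hG1, hGb⟩ := h
        let G' : (Fin n → ℝ) → I → Y := fun y t => G (t, (BallChart.ball _).ret y)
        have hG' : ∀ y (hy : y ∈ closedBall (0 : Fin n → ℝ) 1), ∀ t, G' y t = G (t, ⟨y, hy⟩) :=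
          fun y hy t => congrArg (fun z => G (t, z)) ((BallChart.ball _).ret_emb ⟨y, hy⟩)
        have hGs : ∀ y ∈ Metric.sphere (0 : Fin n → ℝ) 1, G' y = b y := fun y hy => funext fun t =>
          (hG' y (sphere_subset_closedBall hy) t).trans (hGb ⟨y, sphere_subset_closedBall hy⟩ hy t)
        refine ⟨G', Continuous.continuousOn ?_, hGs, fun y hy => ⟨?_, ?_, fun hx => ?_⟩⟩
        · exact G.continuous.comp (continuous_snd.prodMk
            ((BallChart.ball _).ret.continuous.comp continuous_fst))
        · rw [hG' y hy, hG0]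
        · rw [hG' y hy, hG1]
        · have hys := mem_sphere_of_chi_mem hn e hy (by exact_mod_cast hx)
          rw [hGs y hys]
          exact (hR y hys).2.2 hx
      -- In dimension at least two there is no obstruction; over an edge the obstruction is a
      -- holonomy.
      obtain hn2 | rfl := hn.lt_or_eq
      · obtain ⟨M', hM'⟩ : ∃ v : I × closedBall (0 : Fin n → ℝ) 1 → Y,
            v = fun q => if q.2.1 ∈ Metric.sphere (0 : Fin n → ℝ) 1 then b q.2.1 q.1 else
              if q.1 = 0 then f₀ (chi n e q.2.1) else f₁ (chi n e q.2.1) := ⟨_, rfl⟩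
        have ms : ∀ q : I × closedBall (0 : Fin n → ℝ) 1, q.2.1 ∈ Metric.sphere (0 : Fin n → ℝ) 1 →
            M' q = b q.2.1 q.1 := fun q hq => by rw [hM']; exact if_pos hq
        have m0 : ∀ q : I × closedBall (0 : Fin n → ℝ) 1, q.1 = 0 → M' q = f₀ (chi n e q.2.1) := by
          intro q hq
          by_cases hs : q.2.1 ∈ Metric.sphere (0 : Fin n → ℝ) 1
          · rw [ms q hs, hq, (hR _ hs).1]
          · rw [hM']
            exact (if_neg hs).trans (if_pos hq)
        have m1 : ∀ q : I × closedBall (0 : Fin n → ℝ) 1, q.1 = 1 → M' q = f₁ (chi n e q.2.1) := by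
          intro q hq
          by_cases hs : q.2.1 ∈ Metric.sphere (0 : Fin n → ℝ) 1
          · rw [ms q hs, hq, (hR _ hs).2.1]
          · rw [hM']
            exact (if_neg hs).trans (if_neg (by rw [hq]; exact one_ne_zero))
        have hE : Continuous fun q : I × closedBall (0 : Fin n → ℝ) 1 => chi n e q.2.1 :=
          (continuousOn_chi e).comp_continuous (by fun_prop) fun q => q.2.2
        have cs : ContinuousOn M' {q | q.2.1 ∈ Metric.sphere (0 : Fin n → ℝ) 1} :=
          ContinuousOn.congr (hb.comp (f := fun q : I × closedBall (0 : Fin n → ℝ) 1 =>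
            ((q.2 : Fin n → ℝ), q.1)) (by fun_prop) fun q hq => ⟨hq, trivial⟩) ms
        have c0 : ContinuousOn M' {q | q.1 = 0} :=
          ContinuousOn.congr (f₀.continuous.comp hE).continuousOn m0
        have c1 : ContinuousOn M' {q | q.1 = 1} :=
          ContinuousOn.congr (f₁.continuous.comp hE).continuousOn m1
        obtain ⟨G, hG⟩ := hY.exists_extension_cylinder hM hn2 M' (by
          refine ((c0.union_of_isClosed c1 (isClosed_eq (by fun_prop) continuous_const)
            (isClosed_eq (by fun_prop) continuous_const)).union_of_isClosed cs
            ((isClosed_eq (by fun_prop) continuous_const).union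
              (isClosed_eq (by fun_prop) continuous_const))
            (isClosed_sphere.preimage (by fun_prop))).mono ?_
          intro q hq
          rcases BallChart.mem_bd_prod.1 hq with hq | hq
          · exact Or.inl (BallChart.mem_bd_interval.1 hq)
          · exact Or.inr (BallChart.mem_bd_ball.1 hq))
        exact ⟨G, fun y => (hG _ (BallChart.mem_bd_prod.2 (Or.inl
            (BallChart.mem_bd_interval.2 (Or.inl rfl))))).trans (m0 _ rfl),
          fun y => (hG _ (BallChart.mem_bd_prod.2 (Or.inl
            (BallChart.mem_bd_interval.2 (Or.inr rfl))))).trans (m1 _ rfl),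
          fun y hy t => (hG _ (BallChart.mem_bd_prod.2 (Or.inr
            (BallChart.mem_bd_ball.2 hy)))).trans (ms _ hy)⟩
      · refine hM.exists_edge_homotopy e f₀ f₁ (hf e) b hb fun y hy => ⟨(hR y hy).1, (hR y hy).2.1,
          fun z z' p hp => hPM (chi 1 e y) z z' p fun t => ?_⟩
        rw [hp t, (hR y hy).2.2 (by exact_mod_cast chi_sphere_mem e hy)])
  have htop : ∀ x : X, x ∈ skLT X ⊤ := fun x => by
    rw [skLT, CWComplex.skeletonLT_top]
    trivial
  refine ⟨⟨fun q => H q.2 q.1, hHc.comp_continuous (f := fun q : I × X => (q.2, q.1))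
    (by fun_prop) fun q => ⟨htop _, trivial⟩⟩, fun x => (hHR x (htop x)).1,
    fun x => (hHR x (htop x)).2.1, fun t => ?_⟩
  exact (congrFun ((hHR x0 (htop x0)).2.2 hx0) t).trans (hPx x0 rfl t)

/-- For every holonomy on a CW complex there is a map to a classifying space that induces it. -/
theorem IsClassifyingSpace.exists_map (hY : IsClassifyingSpace Γ Y) {M' : Holonomy Γ Y}
    (hM' : M'.IsBijective) (M : Holonomy Γ X) (y0 : Y) (S : Set Y) (hy0 : y0 ∈ S)
    (hS : ∀ g : Γ, ∃ p : Path y0 y0, M'.val p = g ∧ ∀ t, p t ∈ S) :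
    ∃ f : C(X, Y), (∀ x ∈ skLT X 1, f x = y0) ∧ (∀ x ∈ skLT X 2, f x ∈ S) ∧
      ∀ (x y : X) (p : Path x y), x ∈ skLT X 1 → y ∈ skLT X 1 → (∀ t, p t ∈ skLT X 2) →
        M'.val (p.map f.continuous) = M.val p := by
  choose l hlM hlS using hS
  have h12 : ((1 : ℕ) : ℕ∞) + 1 = 2 := by norm_num
  have h22 : ((2 : ℕ) : ℕ∞) = 2 := by norm_num
  -- All vertices are mapped to `y0`, and every edge to a loop with the holonomy of the edge.
  obtain ⟨f₁, hf₁c, hf₁v, hf₁e⟩ := exists_extension_step (X := X) (P := Unit) (Z := Y) 1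
    (fun _ _ => y0) (by fun_prop) (fun e y _ => l (M.val (edgePath e)) (ballTime y))
    (fun e => by fun_prop) (fun e y hy => funext fun _ => by
      rcases ballTime_of_mem_sphere hy with h | h <;> simp [h])
  rw [h12] at hf₁c
  let incl : C(skLT X 2, X) := ⟨Subtype.val, continuous_subtype_val⟩
  let F : C(skLT X 2, Y) := ⟨fun x => f₁ x (), hf₁c.comp_continuous
    (f := fun x : skLT X 2 => ((x : X), ())) (by fun_prop) fun x => ⟨x.2, trivial⟩⟩
  have hFE : ∀ (e : Cell X 1) (y : closedBall (0 : Fin 1 → ℝ) 1),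
      F (cellMap (by norm_num) e y) = l (M.val (edgePath e)) (ballTime y.1) :=
    fun e y => congrFun (hf₁e e y y.2) ()
  have hFS : ∀ x, F x ∈ S := by
    rintro ⟨x, hx⟩
    obtain ⟨n, hn, e, y, hy, rfl⟩ := exists_chi_of_mem_skLT hx
    have hn' : n < 2 := by exact_mod_cast hn
    interval_cases n
    · have : F ⟨chi 0 e y, hx⟩ = y0 := congrFun (hf₁v _ (chi_mem_skLT_of_lt (by norm_num) e
        (ball_subset_closedBall hy))) ()
      rw [this]
      exact hy0
    · exact (hFE e ⟨y, ball_subset_closedBall hy⟩).symm ▸ hlS _ _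
  -- Then the holonomies agree, up to conjugation, on the whole 1-skeleton.
  obtain ⟨c, hc1, hc⟩ := exists_conj_of_edges (M.comap incl) (M'.comap F) (by
    intro e p
    rw [← Holonomy.comap_val, ← Holonomy.comap_val, Holonomy.val_eq_of_simplyConnected _ p ballPath,
      Holonomy.val_eq_of_simplyConnected _ p ballPath]
    refine Eq.trans ?_ (hlM (M.val (edgePath e)))
    refine M'.val_congr _ _ fun t => ?_
    refine (hFE e (ballPath t)).trans ?_
    rw [ballTime_ballPath])
  -- The boundary of a 2-cell has trivial holonomy in the complex, hence in the target, so that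
  -- the map extends to all cells of dimension two; in higher dimensions there is no obstruction.
  obtain ⟨f, hfc, hf₁, hfR⟩ := exists_extension (X := X) (P := Unit) (Z := Y) ⊤
    (fun x h => ∀ hx : x ∈ skLT X 2, h () = F ⟨x, hx⟩) 2 le_top f₁ (by rw [h22]; exact hf₁c)
    (fun x _ _ => rfl) (by
      intro n hn _ e b hb hR
      obtain ⟨k, rfl⟩ : ∃ k, n = k + 1 := ⟨n - 1, by omega⟩
      obtain ⟨G, hGc, hGb⟩ := hY.exists_extension_ball hM' (n := k) (by omega) (fun y => b y ())
        (hb.comp (f := fun y : Fin (k + 1) → ℝ => (y, ())) (by fun_prop) fun y hy => ⟨hy, trivial⟩)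
        (by
          rintro rfl r hr h01 y p hp
          have hmem : ∀ t, chi 2 e (r t) ∈ skLT X 2 := fun t => by
            exact_mod_cast chi_sphere_mem e (hr t)
          let ℓ : C(I, closedBall (0 : Fin 2 → ℝ) 1) :=
            ⟨fun t => ⟨r t, sphere_subset_closedBall (hr t)⟩, by fun_prop⟩
          have hrc : Continuous fun t => chi 2 e (r t) :=
            (continuousOn_chi e).comp_continuous r.continuous fun t => (ℓ t).2
          let q : Path (⟨_, hmem 0⟩ : skLT X 2) ⟨_, hmem 0⟩ :=
            ⟨⟨fun t => ⟨_, hmem t⟩, hrc.subtype_mk _⟩, rfl, Subtype.ext (by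
              show chi 2 e (r 1) = chi 2 e (r 0)
              rw [h01])⟩
          have h1 : (M.comap incl).val q = 1 := by
            let d : Path (ℓ 0) (ℓ 0) := ⟨ℓ, rfl, Subtype.ext h01.symm⟩
            let E : C(closedBall (0 : Fin 2 → ℝ) 1, X) :=
              (⟨Subtype.val, continuous_subtype_val⟩ : C(skLT X 3, X)).comp
                (cellMap (by norm_num) e)
            exact (M.val_congr _ _ fun t => rfl).trans
              ((M.comap E).val_loop_of_simplyConnected d)
          have h2 := hc _ _ q
          rw [h1, mul_one, inv_mul_cancel] at h2
          refine Eq.trans (M'.val_congr _ _ fun t => ?_) h2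
          exact (hp t).trans (hR _ (hr t) (hmem t)))
      refine ⟨fun y _ => G y, hGc.comp continuousOn_fst fun q hq => hq.1, fun y hy =>
        funext fun _ =>
        hGb y hy, fun y hy hx => ?_⟩
      have hys := mem_sphere_of_chi_mem hn e hy (by rw [h22]; exact hx)
      exact (hGb y hys).trans (hR y hys hx))
  have htop : ∀ x : X, x ∈ skLT X ⊤ := fun x => by
    rw [skLT, CWComplex.skeletonLT_top]
    trivial
  refine ⟨⟨fun x => f x (), hfc.comp_continuous (f := fun x : X => (x, ())) (by fun_prop)
    fun x => ⟨htop x, trivial⟩⟩, fun x hx => ?_, fun x hx => ?_, fun x y p hx hy hp => ?_⟩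
  · exact (hfR x (htop x) (skLT_one_subset_two hx)).trans
      (congrFun (hf₁v x (by exact_mod_cast hx)) ())
  · show f x () ∈ S
    rw [hfR x (htop x) hx]
    exact hFS _
  · let q : Path (⟨x, skLT_one_subset_two hx⟩ : skLT X 2) ⟨y, skLT_one_subset_two hy⟩ :=
      ⟨⟨fun t => ⟨p t, hp t⟩, by fun_prop⟩, Subtype.ext p.source, Subtype.ext p.target⟩
    have := hc _ _ q
    rw [hc1 _ hx, hc1 _ hy, inv_one, one_mul, mul_one] at this
    refine (M'.val_congr _ _ fun t => ?_).trans (this.trans (M.val_congr _ _ fun t => rfl))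
    exact hfR _ (htop _) (hp t)

/-- Every loop at a vertex can be deformed into the 1-skeleton. -/
lemma exists_loop_skLT_two {x0 : X} (hx0 : x0 ∈ skLT X 1) (p : Path x0 x0) :
    ∃ q : Path x0 x0, (∀ t, q t ∈ skLT X 2) ∧ p.Homotopic q := by
  have hcyl : ∀ x : X, (x : iterSusp ⟨X, x0⟩ 0) ∈ cyl x0 0 (skLT X 2) ↔ x ∈ skLT X 2 := by
    intro x
    refine (suspCube_mem_cyl (y0 := x0) (N := 0) (q := (x, Fin.elim0))).trans ⟨?_, Or.inr⟩
    rintro ((h | ⟨i, -⟩) | h)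
    · have h' : x = x0 := h
      rw [h']
      exact skLT_one_subset_two hx0
    · exact i.elim0
    · exact h
  obtain ⟨H, H0, H1, Hr⟩ := compressible_cyl x0 0 2 (skLT_one_subset_two hx0) (d := 1) (by norm_num)
    I 1 le_rfl ⟨fun t _ => (t : ℝ), by fun_prop⟩
    (fun s t h => Subtype.ext (congrFun h 0)) p.toContinuousMap fun _ => trivial
  have hend : ∀ t s : I, t = 0 ∨ t = 1 → H (s, t) = p t := fun t s ht =>
    Hr t ((hcyl _).2 (by
      have : p t = x0 := by rcases ht with rfl | rfl <;> simp
      show p t ∈ skLT X 2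
      rw [this]
      exact skLT_one_subset_two hx0)) s
  let q : Path x0 x0 := ⟨H.comp ⟨fun t => (1, t), by fun_prop⟩,
    (hend 0 1 (Or.inl rfl)).trans p.source, (hend 1 1 (Or.inr rfl)).trans p.target⟩
  refine ⟨q, fun t => (hcyl _).1 (H1 t), ⟨⟨⟨⟨H, H.continuous⟩, H0, fun t => rfl⟩, ?_⟩⟩⟩
  exact fun s t ht => hend t s ht

/-- Every holonomy of a classifying complex is realized by a loop in the 1-skeleton. -/
lemma Holonomy.IsBijective.exists_loop_skLT_two {M : Holonomy Γ X} (hM : M.IsBijective) {x0 : X}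
    (hx0 : x0 ∈ skLT X 1) (g : Γ) : ∃ p : Path x0 x0, M.val p = g ∧ ∀ t, p t ∈ skLT X 2 := by
  obtain ⟨p, hp⟩ := hM.exists_path x0 x0 g
  obtain ⟨q, hq, hpq⟩ := OneStep.exists_loop_skLT_two hx0 p
  exact ⟨q, by rw [← M.val_eq hpq, hp], hq⟩

/-- Classifying complexes of a group, pointed at vertices, are homotopy equivalent. -/
theorem IsClassifyingSpace.exists_htpy_id {X Y : Type u} [TopologicalSpace X] [T2Space X]
    [CWComplex (Set.univ : Set X)] [TopologicalSpace Y] [T2Space Y] [CWComplex (Set.univ : Set Y)]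
    (hX : IsClassifyingSpace Γ X) (hY : IsClassifyingSpace Γ Y) {x0 : X} (hx0 : x0 ∈ skLT X 1)
    {y0 : Y} (hy0 : y0 ∈ skLT Y 1) :
    ∃ (f : PtdMap ⟨X, x0⟩ ⟨Y, y0⟩) (g : PtdMap ⟨Y, y0⟩ ⟨X, x0⟩),
      (g.comp f).Htpy (PtdMap.id ⟨X, x0⟩) := by
  obtain ⟨M, hM⟩ := hX.exists_holonomy
  obtain ⟨M', hM'⟩ := hY.exists_holonomy
  -- Maps in both directions that preserve the holonomies; their composition has the same holonomy
  -- along the edges as the identity.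
  obtain ⟨f, hf0, hfS, hf⟩ := hY.exists_map hM' M y0 (skLT Y 2) (skLT_one_subset_two hy0)
    (hM'.exists_loop_skLT_two hy0)
  obtain ⟨g, hg0, -, hg⟩ := hX.exists_map hM M' x0 (skLT X 2) (skLT_one_subset_two hx0)
    (hM.exists_loop_skLT_two hx0)
  have hend : ∀ (e : Cell X 1) (s : ℝ) (hs : |s| ≤ 1), |s| = 1 →
      chi 1 e (ballEnd s hs).1 ∈ skLT X 1 := fun e s hs h => by
    have hs' : (ballEnd s hs).1 ∈ Metric.sphere (0 : Fin 1 → ℝ) 1 := by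
      rw [mem_sphere_zero_iff_norm]
      show ‖fun _ : Fin 1 => s‖ = 1
      rw [pi_norm_const, Real.norm_eq_abs, h]
    exact_mod_cast chi_sphere_mem e hs'
  obtain ⟨H, H0, H1, Hx⟩ := hX.exists_homotopy hM x0 (g.comp f) (ContinuousMap.id X)
    (by
      show g (f x0) = x0
      rw [hf0 x0 hx0, hg0 y0 hy0])
    (fun e => by
      have h0 := hend e (-1) (by simp) (by simp)
      have h1 := hend e 1 (by simp) (by simp)
      have hs : ∀ t, edgePath e t ∈ skLT X 2 := fun t =>
        chi_mem_skLT_of_lt (by norm_num) e (ballPath t).2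
      have e1 := hf _ _ (edgePath e) h0 h1 hs
      have e2 := hg _ _ ((edgePath e).map f.continuous) (by rw [hf0 _ h0]; exact hy0)
        (by rw [hf0 _ h1]; exact hy0) (fun t => hfS _ (hs t))
      refine Eq.trans (M.val_congr _ _ fun t => rfl) ((e2.trans e1).trans ?_)
      exact M.val_congr _ _ fun t => rfl)
    hx0
  refine ⟨⟨f, hf0 x0 hx0⟩, ⟨g, hg0 y0 hy0⟩, H, H0, H1, fun t => (Hx t).trans ?_⟩
  show g (f x0) = x0
  rw [hf0 x0 hx0, hg0 y0 hy0]

end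

/-! ### Wedges of spheres as CW complexes -/

instance fact_finrank_euclideanSpace (n : ℕ) :
    Fact (Module.finrank ℝ (EuclideanSpace ℝ (Fin (n + 1))) = n + 1) :=
  ⟨finrank_euclideanSpace_fin⟩

/-- The stereographic projection from the base point of the sphere. -/
def sphereChart (n : ℕ) : OpenPartialHomeomorph (sphere n) (EuclideanSpace ℝ (Fin n)) :=
  stereographic' n ((sphere n).pt : Metric.sphere (0 : EuclideanSpace ℝ (Fin (n + 1))) 1)

lemma sphereChart_source (n : ℕ) : (sphereChart n).source = {(sphere n).pt}ᶜ :=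
  stereographic'_source _

lemma sphereChart_target (n : ℕ) : (sphereChart n).target = univ := stereographic'_target _

/-- The characteristic map of the top cell of the sphere: on the open ball, a radial homeomorphism
onto the Euclidean space, followed by the inverse of the stereographic projection from the base
point. -/
def sphereCell (n : ℕ) (y : Fin n → ℝ) : sphere n :=
  open Classical in if ‖y‖ < 1 then
    (sphereChart n).symm (WithLp.toLp 2 ((1 - ‖y‖)⁻¹ • y)) else (sphere n).pt

/-- The inverse of `sphereCell` on the complement of the base point. -/
def sphereCellInv (n : ℕ) (z : sphere n) : Fin n → ℝ :=
  (1 + ‖WithLp.ofLp (sphereChart n z)‖)⁻¹ •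
    WithLp.ofLp (sphereChart n z)

lemma sphereCell_of_lt {n : ℕ} {y : Fin n → ℝ} (hy : ‖y‖ < 1) : sphereCell n y =
    (sphereChart n).symm (WithLp.toLp 2 ((1 - ‖y‖)⁻¹ • y)) := if_pos hy

lemma sphereCell_of_le {n : ℕ} {y : Fin n → ℝ} (hy : 1 ≤ ‖y‖) : sphereCell n y = (sphere n).pt :=
  if_neg (not_lt.2 hy)

lemma sphereCell_ne {n : ℕ} {y : Fin n → ℝ} (hy : ‖y‖ < 1) : sphereCell n y ≠ (sphere n).pt := by
  rw [sphereCell_of_lt hy]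
  have := (sphereChart n).map_target
    (x := WithLp.toLp 2 ((1 - ‖y‖)⁻¹ • y)) (by rw [sphereChart_target]; trivial)
  rw [sphereChart_source] at this
  exact this

lemma sphereCellInv_sphereCell {n : ℕ} {y : Fin n → ℝ} (hy : ‖y‖ < 1) :
    sphereCellInv n (sphereCell n y) = y := by
  have h : 0 < 1 - ‖y‖ := by linarith
  rw [sphereCellInv, sphereCell_of_lt hy,
    (sphereChart n).right_inv (by rw [sphereChart_target]; trivial)]
  show (1 + ‖(1 - ‖y‖)⁻¹ • y‖)⁻¹ • ((1 - ‖y‖)⁻¹ • y) = y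
  rw [norm_smul, Real.norm_of_nonneg (inv_nonneg.2 h.le), smul_smul, ← mul_inv]
  have : (1 + (1 - ‖y‖)⁻¹ * ‖y‖) * (1 - ‖y‖) = 1 := by
    field_simp
    ring
  rw [this, inv_one, one_smul]

lemma norm_sphereCellInv_lt {n : ℕ} (z : sphere n) : ‖sphereCellInv n z‖ < 1 := by
  rw [sphereCellInv, norm_smul, Real.norm_of_nonneg (by positivity),
    inv_mul_lt_iff₀ (by positivity)]
  linarith

lemma sphereCell_sphereCellInv {n : ℕ} {z : sphere n} (hz : z ≠ (sphere n).pt) :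
    sphereCell n (sphereCellInv n z) = z := by
  rw [sphereCell_of_lt (norm_sphereCellInv_lt z)]
  have : WithLp.toLp 2 ((1 - ‖sphereCellInv n z‖)⁻¹ • sphereCellInv n z) =
      sphereChart n z := by
    refine (congrArg (WithLp.toLp 2) ?_).trans (WithLp.toLp_ofLp 2 _)
    generalize hw : WithLp.ofLp (sphereChart n z) = w
    have hpos : 0 < 1 + ‖w‖ := by positivity
    rw [sphereCellInv, hw, norm_smul, Real.norm_of_nonneg (inv_nonneg.2 hpos.le), smul_smul,
      ← mul_inv]
    have : (1 - (1 + ‖w‖)⁻¹ * ‖w‖) * (1 + ‖w‖) = 1 := by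
      field_simp
      ring
    rw [this, inv_one, one_smul]
  rw [this]
  exact (sphereChart n).left_inv (by rw [sphereChart_source]; exact hz)

lemma continuousOn_sphereCellInv (n : ℕ) : ContinuousOn (sphereCellInv n) {(sphere n).pt}ᶜ := by
  have h : ContinuousOn (sphereChart n) {(sphere n).pt}ᶜ := by
    have := (sphereChart n).continuousOn
    rwa [sphereChart_source] at this
  have h2 : Continuous fun w : EuclideanSpace ℝ (Fin n) =>
      (1 + ‖WithLp.ofLp w‖)⁻¹ • WithLp.ofLp w := by
    have hc : Continuous fun w : EuclideanSpace ℝ (Fin n) => WithLp.ofLp w :=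
      PiLp.continuous_ofLp 2 _
    exact ((continuous_const.add hc.norm).inv₀ fun w => (by positivity :
      (0 : ℝ) < 1 + ‖WithLp.ofLp w‖).ne').smul hc
  exact h2.comp_continuousOn h

/-- The explicit formula `g` for the stereographic parametrization, multiplied through by the
denominator, is continuous up to the boundary sphere. -/
lemma continuousOn_sphereCell (n : ℕ) : ContinuousOn (sphereCell n) (closedBall 0 1) := by
  let v : Metric.sphere (0 : EuclideanSpace ℝ (Fin (n + 1))) 1 := (sphere n).pt
  let U := (OrthonormalBasis.fromOrthogonalSpanSingleton (𝕜 := ℝ) n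
    (ne_zero_of_mem_unit_sphere v)).repr
  let u (y : Fin n → ℝ) : EuclideanSpace ℝ (Fin (n + 1)) := U.symm (WithLp.toLp 2 y)
  have hu : Continuous u := continuous_subtype_val.comp
    (U.symm.continuous.comp (PiLp.continuous_toLp 2 _))
  have hsmul : ∀ (a : ℝ) y, u (a • y) = a • u y := fun a y => by simp [u]
  have hu0 : ∀ y, u y = 0 → y = 0 := by
    intro y hy
    have h1 : U.symm (WithLp.toLp 2 y) = 0 := Subtype.ext hy
    have h2 : WithLp.toLp 2 y = (0 : EuclideanSpace ℝ (Fin n)) := by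
      simpa using h1
    simpa using congrArg WithLp.ofLp h2
  let D (y : Fin n → ℝ) : ℝ := ‖u y‖ ^ 2 + 4 * (1 - ‖y‖) ^ 2
  have hD : ∀ y, D y ≠ 0 := by
    intro y hy
    have h1 : ‖u y‖ ^ 2 = 0 := by nlinarith [sq_nonneg (1 - ‖y‖), sq_nonneg ‖u y‖]
    have h2 := hu0 y (by simpa using h1)
    rw [h2] at h1
    simp only [D, h2, h1] at hy
    norm_num at hy
  let g (y : Fin n → ℝ) : EuclideanSpace ℝ (Fin (n + 1)) :=
    (D y)⁻¹ • ((4 * (1 - ‖y‖)) • u y + (‖u y‖ ^ 2 - 4 * (1 - ‖y‖) ^ 2) • (v : EuclideanSpace ℝ _))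
  have hg : Continuous g := by
    have : Continuous fun y => (D y)⁻¹ := Continuous.inv₀ (by fun_prop) hD
    fun_prop
  have key : ∀ y ∈ closedBall (0 : Fin n → ℝ) 1, (sphereCell n y).1 = g y := by
    intro y hy
    rcases (mem_closedBall_zero_iff.1 hy).lt_or_eq with hy | hy
    · have hr : (1 - ‖y‖) ≠ 0 := by linarith
      rw [sphereCell_of_lt hy]
      refine (stereographic'_symm_apply v _).trans ?_
      show (‖u ((1 - ‖y‖)⁻¹ • y)‖ ^ 2 + 4)⁻¹ • (4 : ℝ) • u ((1 - ‖y‖)⁻¹ • y) +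
        (‖u ((1 - ‖y‖)⁻¹ • y)‖ ^ 2 + 4)⁻¹ • (‖u ((1 - ‖y‖)⁻¹ • y)‖ ^ 2 - 4) • v.1 = g y
      have e : ‖u ((1 - ‖y‖)⁻¹ • y)‖ ^ 2 = ‖u y‖ ^ 2 / (1 - ‖y‖) ^ 2 := by
        rw [hsmul, norm_smul, norm_inv, mul_pow, inv_pow, Real.norm_eq_abs, sq_abs]
        field_simp
      have e2 : (‖u ((1 - ‖y‖)⁻¹ • y)‖ ^ 2 + 4)⁻¹ = (D y)⁻¹ * (1 - ‖y‖) ^ 2 := by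
        rw [e, inv_eq_iff_eq_inv, mul_inv, inv_inv]
        simp only [D]
        field_simp
      rw [e2, e, hsmul]
      simp only [g, smul_add, smul_smul]
      congr 2
      · field_simp
      · field_simp
    · rw [sphereCell_of_le hy.ge]
      have h1 : D y = ‖u y‖ ^ 2 := by simp [D, hy]
      have h2 := hD y
      simp only [g, hy, sub_self, mul_zero, zero_smul, zero_add, ne_eq, OfNat.ofNat_ne_zero,
        not_false_eq_true, zero_pow, sub_zero, smul_smul]
      rw [h1] at h2 ⊢
      rw [inv_mul_cancel₀ h2, one_smul]
  exact (Topology.IsInducing.subtypeVal.continuousOn_iff).2 (hg.continuousOn.congr key)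

section Wedge

variable {J : Type u} {X : J → PtdSpace.{v}}

/-- The inclusion of a summand in a wedge. -/
def wedgeIn (X : J → PtdSpace.{v}) (j : J) : PtdMap (X j) (wedge X) where
  toMap := ⟨fun x => Quotient.mk _ (Sum.inr ⟨j, x⟩), continuous_quotient_mk'.comp
    (continuous_inr.comp continuous_sigmaMk)⟩
  map_pt := Quotient.sound (Or.inr ⟨Or.inr ⟨j, rfl⟩, Or.inl rfl⟩)

lemma wedge_cases (z : wedge X) :
    z = (wedge X).pt ∨ ∃ j x, x ≠ (X j).pt ∧ z = (wedgeIn X j).toMap x := by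
  induction z using Quotient.inductionOn with
  | h z =>
    rcases z with ⟨⟩ | ⟨j, x⟩
    · exact Or.inl rfl
    · by_cases hx : x = (X j).pt
      · subst hx
        exact Or.inl (wedgeIn X j).map_pt
      · exact Or.inr ⟨j, x, hx, rfl⟩

/-- The map out of a wedge given by pointed maps on the summands. -/
def wedgeDesc {Z : PtdSpace.{w}} (f : ∀ j, PtdMap (X j) Z) : PtdMap (wedge X) Z where
  toMap := ⟨Quotient.lift (Sum.elim (fun _ => Z.pt) fun z => (f z.1).toMap z.2) (by
    have key : ∀ z : PUnit.{1} ⊕ (Σ j, X j), (z = Sum.inl PUnit.unit ∨ ∃ j, z = Sum.inr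
        ⟨j, (X j).pt⟩) → Sum.elim (fun _ => Z.pt) (fun z => (f z.1).toMap z.2) z = Z.pt := by
      rintro _ (rfl | ⟨j, rfl⟩)
      · rfl
      · exact (f j).map_pt
    rintro a b (rfl | ⟨ha, hb⟩)
    · rfl
    · rw [key a ha, key b hb]),
    Continuous.quotient_lift (continuous_const.sumElim
      (continuous_sigma fun j => (f j).toMap.continuous)) _⟩
  map_pt := rfl

lemma wedgeDesc_wedgeIn {Z : PtdSpace.{w}} (f : ∀ j, PtdMap (X j) Z) (j : J) (x : X j) :
    (wedgeDesc f).toMap ((wedgeIn X j).toMap x) = (f j).toMap x := rfl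

/-- The projection of a wedge onto a summand. -/
def wedgeProj (X : J → PtdSpace.{v}) (j : J) : PtdMap (wedge X) (X j) :=
  open Classical in wedgeDesc fun k =>
    if h : k = j then h ▸ PtdMap.id (X k) else ⟨.const _ (X j).pt, rfl⟩

lemma wedgeProj_wedgeIn (j : J) (x : X j) : (wedgeProj X j).toMap ((wedgeIn X j).toMap x) = x := by
  classical
  refine (wedgeDesc_wedgeIn _ _ _).trans ?_
  rw [dif_pos rfl]
  rfl

lemma wedgeProj_wedgeIn_of_ne {j k : J} (h : k ≠ j) (x : X k) :
    (wedgeProj X j).toMap ((wedgeIn X k).toMap x) = (X j).pt := by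
  classical
  refine (wedgeDesc_wedgeIn _ _ _).trans ?_
  rw [dif_neg h]
  rfl

lemma wedgeIn_wedgeProj {j : J} {z : wedge X} (h : (wedgeProj X j).toMap z ≠ (X j).pt) :
    (wedgeIn X j).toMap ((wedgeProj X j).toMap z) = z := by
  rcases wedge_cases z with rfl | ⟨k, x, hx, rfl⟩
  · exact absurd (wedgeProj X j).map_pt h
  · by_cases hk : k = j
    · subst hk
      rw [wedgeProj_wedgeIn]
    · exact absurd (wedgeProj_wedgeIn_of_ne hk x) h

lemma wedge_ext {z z' : wedge X}
    (h : ∀ j, (wedgeProj X j).toMap z = (wedgeProj X j).toMap z') : z = z' := by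
  have key : ∀ z z' : wedge X, (∀ j, (wedgeProj X j).toMap z = (wedgeProj X j).toMap z') →
      z ≠ (wedge X).pt → z = z' := by
    intro z z' h hz
    rcases wedge_cases z with rfl | ⟨j, x, hx, rfl⟩
    · exact absurd rfl hz
    · have hj := h j
      rw [wedgeProj_wedgeIn] at hj
      rw [hj] at hx ⊢
      exact wedgeIn_wedgeProj hx
  by_cases hz : z = (wedge X).pt
  · by_cases hz' : z' = (wedge X).pt
    · rw [hz, hz']
    · exact (key z' z (fun j => (h j).symm) hz').symm
  · exact key z z' h hz

instance wedge_t2Space [∀ j, T2Space (X j)] : T2Space (wedge X) :=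
  T2Space.of_injective_continuous (f := fun z j => (wedgeProj X j).toMap z)
    (fun _ _ h => wedge_ext (congrFun h)) (by fun_prop)

lemma isClosed_wedge_iff {A : Set (wedge X)} :
    IsClosed A ↔ ∀ j, IsClosed ((wedgeIn X j).toMap ⁻¹' A) := by
  refine ⟨fun h j => h.preimage (wedgeIn X j).toMap.continuous, fun h => ?_⟩
  refine isQuotientMap_quotient_mk'.isClosed_preimage.1 (isClosed_sum_iff.2 ⟨?_, ?_⟩)
  · exact isClosed_discrete _
  · exact isClosed_sigma_iff.2 h

end Wedge

section WedgeOfSpheres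

instance sphere_t2Space (n : ℕ) : T2Space (sphere n) :=
  inferInstanceAs (T2Space (Metric.sphere (0 : EuclideanSpace ℝ (Fin (n + 1))) 1))

variable {J : Type u} (d : J → ℕ)

/-- A wedge of spheres. -/
abbrev sphereWedge : PtdSpace.{u} := wedge fun j => sphere (d j)

/-- The cells of a wedge of spheres: the base point, and one cell for each sphere. -/
abbrev WedgeCell (k : ℕ) : Type u := {j : J // d j = k} ⊕ {_x : PUnit.{u + 1} // k = 0}

/-- The inclusion of a sphere of the wedge, of known dimension. -/
def sphereIn {k : ℕ} (j : {j : J // d j = k}) : PtdMap (sphere k) (sphereWedge d) :=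
  j.2 ▸ wedgeIn (fun j => sphere (d j)) j.1

/-- The projection onto a sphere of the wedge, of known dimension. -/
def sphereProj {k : ℕ} (j : {j : J // d j = k}) : PtdMap (sphereWedge d) (sphere k) :=
  j.2 ▸ wedgeProj (fun j => sphere (d j)) j.1

variable {d}

lemma sphereProj_sphereIn {k : ℕ} (j : {j : J // d j = k}) (x : sphere k) :
    (sphereProj d j).toMap ((sphereIn d j).toMap x) = x := by
  obtain ⟨j, rfl⟩ := j
  exact wedgeProj_wedgeIn (X := fun j => sphere (d j)) j x

lemma sphereProj_sphereIn_of_ne {k l : ℕ} {i : {j : J // d j = k}} {j : {j : J // d j = l}}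
    (h : i.1 ≠ j.1) (x : sphere k) :
    (sphereProj d j).toMap ((sphereIn d i).toMap x) = (sphere l).pt := by
  obtain ⟨i, rfl⟩ := i
  obtain ⟨j, rfl⟩ := j
  exact wedgeProj_wedgeIn_of_ne (X := fun j => sphere (d j)) h x

lemma sphereIn_sphereProj {k : ℕ} {j : {j : J // d j = k}} {z : sphereWedge d}
    (h : (sphereProj d j).toMap z ≠ (sphere k).pt) :
    (sphereIn d j).toMap ((sphereProj d j).toMap z) = z := by
  obtain ⟨j, rfl⟩ := j
  exact wedgeIn_wedgeProj h

lemma sphereWedge_cases (z : sphereWedge d) :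
    z = (sphereWedge d).pt ∨ ∃ k, ∃ j : {j : J // d j = k}, ∃ x, x ≠ (sphere k).pt ∧
      z = (sphereIn d j).toMap x := by
  rcases wedge_cases z with h | ⟨j, x, hx, h⟩
  · exact Or.inl h
  · exact Or.inr ⟨d j, ⟨j, rfl⟩, x, hx, h⟩

variable (d)

/-- The characteristic maps of a wedge of spheres. -/
def wedgeCellMap (k : ℕ) : WedgeCell d k → PartialEquiv (Fin k → ℝ) (sphereWedge d)
  | Sum.inl j =>
    { toFun := fun y => (sphereIn d j).toMap (sphereCell k y)
      invFun := fun z => sphereCellInv k ((sphereProj d j).toMap z)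
      source := ball 0 1
      target := {z | (sphereProj d j).toMap z ≠ (sphere k).pt}
      map_source' := fun y hy => by
        show (sphereProj d j).toMap _ ≠ _
        rw [sphereProj_sphereIn]
        exact sphereCell_ne (mem_ball_zero_iff.1 hy)
      map_target' := fun z _ => mem_ball_zero_iff.2 (norm_sphereCellInv_lt _)
      left_inv' := fun y hy => by
        rw [sphereProj_sphereIn, sphereCellInv_sphereCell (mem_ball_zero_iff.1 hy)]
      right_inv' := fun z hz => by
        rw [sphereCell_sphereCellInv hz, sphereIn_sphereProj hz] }
  | Sum.inr h =>
    { toFun := fun _ => (sphereWedge d).pt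
      invFun := fun _ => 0
      source := ball 0 1
      target := {(sphereWedge d).pt}
      map_source' := fun _ _ => rfl
      map_target' := fun _ _ => by simp
      left_inv' := fun y _ => by
        obtain ⟨-, rfl⟩ := h
        exact Subsingleton.elim _ _
      right_inv' := fun z hz => hz.symm }

lemma wedgeCellMap_inl {k : ℕ} (j : {j : J // d j = k}) (y : Fin k → ℝ) :
    wedgeCellMap d k (Sum.inl j) y = (sphereIn d j).toMap (sphereCell k y) := rfl

lemma wedgeCellMap_inr {k : ℕ} (h) (y : Fin k → ℝ) :
    wedgeCellMap d k (Sum.inr h) y = (sphereWedge d).pt := rfl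

lemma mem_wedgeCellMap_closedBall {k : ℕ} (j : {j : J // d j = k}) {x : sphere k}
    (hx : x ≠ (sphere k).pt) :
    (sphereIn d j).toMap x ∈ wedgeCellMap d k (Sum.inl j) '' closedBall 0 1 :=
  ⟨sphereCellInv k x, mem_closedBall_zero_iff.2 (norm_sphereCellInv_lt x).le, by
    rw [wedgeCellMap_inl, sphereCell_sphereCellInv hx]⟩

lemma pt_mem_wedgeCellMap_closedBall :
    (sphereWedge d).pt ∈ wedgeCellMap d 0 (Sum.inr ⟨PUnit.unit, rfl⟩) '' closedBall 0 1 :=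
  ⟨0, by simp, rfl⟩

/-- A wedge of spheres as a CW complex, with the base point as its only vertex apart from the
second points of the 0-spheres. -/
instance sphereWedge_cwComplex : CWComplex (Set.univ : Set (sphereWedge d)) where
  cell := WedgeCell d
  map := wedgeCellMap d
  source_eq k c := by rcases c with j | h <;> rfl
  continuousOn k c := by
    rcases c with j | h
    · exact (sphereIn d j).toMap.continuous.comp_continuousOn (continuousOn_sphereCell k)
    · exact continuousOn_const
  continuousOn_symm k c := by
    rcases c with j | h
    · exact (continuousOn_sphereCellInv k).comp (sphereProj d j).toMap.continuous.continuousOn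
        fun z hz => hz
    · exact continuousOn_const
  pairwiseDisjoint' := by
    rintro ⟨k, c⟩ - ⟨k', c'⟩ - hne
    refine Set.disjoint_left.2 ?_
    rintro _ ⟨y, hy, rfl⟩ ⟨y', hy', h⟩
    have hy1 := sphereCell_ne (mem_ball_zero_iff.1 hy)
    have hy1' := sphereCell_ne (mem_ball_zero_iff.1 hy')
    rcases c with j | ⟨p, rfl⟩ <;> rcases c' with j' | ⟨p', rfl⟩
    · by_cases hj : j.1 = j'.1
      · refine hne ?_
        obtain ⟨j, rfl⟩ := j
        obtain ⟨j', rfl⟩ := j'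
        obtain rfl : j = j' := hj
        rfl
      · have h' := congrArg (sphereProj d j).toMap h
        simp only [wedgeCellMap_inl] at h'
        rw [sphereProj_sphereIn, sphereProj_sphereIn_of_ne (Ne.symm hj)] at h'
        exact hy1 h'.symm
    · have h' := congrArg (sphereProj d j).toMap h
      simp only [wedgeCellMap_inl, wedgeCellMap_inr] at h'
      rw [sphereProj_sphereIn, (sphereProj d j).map_pt] at h'
      exact hy1 h'.symm
    · have h' := congrArg (sphereProj d j').toMap h
      simp only [wedgeCellMap_inl, wedgeCellMap_inr] at h'
      rw [sphereProj_sphereIn, (sphereProj d j').map_pt] at h'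
      exact hy1' h'
    · exact hne rfl
  mapsTo' k c := by
    classical
    refine ⟨fun m => if h : m = 0 then {Sum.inr ⟨PUnit.unit, h⟩} else ∅, fun y hy => ?_⟩
    have hy1 := mem_sphere_zero_iff_norm.1 hy
    have hk : 0 < k := by
      rcases Nat.eq_zero_or_pos k with rfl | hk
      · rw [Subsingleton.elim y 0, norm_zero] at hy1
        exact absurd hy1 (by norm_num)
      · exact hk
    refine mem_iUnion₂.2 ⟨0, hk, mem_iUnion₂.2 ⟨Sum.inr ⟨PUnit.unit, rfl⟩, by simp, ?_⟩⟩
    have : wedgeCellMap d k c y = (sphereWedge d).pt := by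
      rcases c with j | h
      · rw [wedgeCellMap_inl, sphereCell_of_le hy1.ge, (sphereIn d j).map_pt]
      · rfl
    rw [this]
    exact pt_mem_wedgeCellMap_closedBall d
  closed' A _ hA := by
    refine isClosed_wedge_iff.2 fun j => ?_
    have h1 := (hA (d j) (Sum.inl ⟨j, rfl⟩)).preimage (wedgeIn _ j).toMap.continuous
    have h2 := (hA 0 (Sum.inr ⟨PUnit.unit, rfl⟩)).preimage
      (wedgeIn (fun j => sphere (d j)) j).toMap.continuous
    convert h1.union h2 using 1
    ext x
    refine ⟨fun hx => ?_, fun hx => hx.elim (fun h => h.1) fun h => h.1⟩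
    by_cases hpt : x = (sphere (d j)).pt
    · refine Or.inr ⟨hx, ?_⟩
      rw [hpt, (wedgeIn (fun j => sphere (d j)) j).map_pt]
      exact pt_mem_wedgeCellMap_closedBall d
    · exact Or.inl ⟨hx, mem_wedgeCellMap_closedBall d ⟨j, rfl⟩ hpt⟩
  union' := by
    refine eq_univ_of_forall fun z => mem_iUnion₂.2 ?_
    rcases sphereWedge_cases z with rfl | ⟨k, j, x, hx, rfl⟩
    · exact ⟨0, _, pt_mem_wedgeCellMap_closedBall d⟩
    · exact ⟨k, _, mem_wedgeCellMap_closedBall d j hx⟩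

lemma sphereWedge_pt_mem_skLT {N : ℕ∞} (h : ((0 : ℕ) : ℕ∞) < N) :
    (sphereWedge d).pt ∈ skLT (sphereWedge d) N :=
  chi_mem_skLT_of_lt (X := sphereWedge d) h (Sum.inr ⟨PUnit.unit, rfl⟩) (y := 0) (by simp)

lemma sphereIn_mem_skLT {k : ℕ} {N : ℕ∞} (h : (k : ℕ∞) < N) (j : {j : J // d j = k})
    (x : sphere k) : (sphereIn d j).toMap x ∈ skLT (sphereWedge d) N := by
  by_cases hx : x = (sphere k).pt
  · rw [hx, (sphereIn d j).map_pt]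
    exact sphereWedge_pt_mem_skLT d (lt_of_le_of_lt (by exact_mod_cast Nat.zero_le k) h)
  · obtain ⟨y, hy, h'⟩ := mem_wedgeCellMap_closedBall d j hx
    rw [← h']
    exact chi_mem_skLT_of_lt (X := sphereWedge d) h (Sum.inl j) hy

/-- A finite wedge of spheres is a finite CW complex. -/
lemma sphereWedge_isFiniteCW [Finite J] : (sphereWedge d).IsFiniteCW := by
  refine ⟨inferInstance, sphereWedge_cwComplex d, ?_, sphereWedge_pt_mem_skLT d (by norm_num)⟩
  have h1 : RelCWComplex.FiniteDimensional (Set.univ : Set (sphereWedge d)) := ⟨by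
    obtain ⟨N, hN⟩ := (Set.finite_range d).bddAbove
    filter_upwards [Filter.eventually_gt_atTop N] with k hk
    refine ⟨fun c => ?_⟩
    rcases (c : WedgeCell d k) with ⟨j, rfl⟩ | ⟨-, rfl⟩
    · exact absurd (hN ⟨j, rfl⟩) (not_le.2 hk)
    · omega⟩
  have h2 : RelCWComplex.FiniteType (Set.univ : Set (sphereWedge d)) :=
    ⟨fun k => inferInstanceAs (Finite (WedgeCell d k))⟩
  exact { }

/-- The skeleta of a wedge of spheres are retracts: collapse the spheres of larger dimension. -/
lemma exists_retraction_skPt (h : (sphereWedge d).pt ∈ skLT (sphereWedge d) 1) (m : ℕ) :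
    ∃ r : PtdMap (sphereWedge d) (skPt (sphereWedge d) (sphereWedge d).pt h m),
      r.comp (skPtIncl (sphereWedge d) (sphereWedge d).pt h m) = PtdMap.id _ := by
  classical
  let f : PtdMap (sphereWedge d) (sphereWedge d) := wedgeDesc fun j =>
    if d j ≤ m then wedgeIn (fun j => sphere (d j)) j else ⟨.const _ (sphereWedge d).pt, rfl⟩
  have hf1 : ∀ j (x : sphere (d j)), d j ≤ m →
      f.toMap ((wedgeIn (fun j => sphere (d j)) j).toMap x) =
        (wedgeIn (fun j => sphere (d j)) j).toMap x := by
    intro j x hj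
    refine (wedgeDesc_wedgeIn _ _ _).trans ?_
    rw [if_pos hj]
  have hf2 : ∀ j (x : sphere (d j)), ¬ d j ≤ m →
      f.toMap ((wedgeIn (fun j => sphere (d j)) j).toMap x) = (sphereWedge d).pt := by
    intro j x hj
    refine (wedgeDesc_wedgeIn _ _ _).trans ?_
    rw [if_neg hj]
    rfl
  have hmem : ∀ z, f.toMap z ∈ skLT (sphereWedge d) (m + 1) := by
    intro z
    have h0 : (sphereWedge d).pt ∈ skLT (sphereWedge d) (m + 1) :=
      sphereWedge_pt_mem_skLT d (by exact_mod_cast Nat.succ_pos m)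
    rcases wedge_cases z with rfl | ⟨j, x, -, rfl⟩
    · rw [f.map_pt]
      exact h0
    · by_cases hj : d j ≤ m
      · rw [hf1 j x hj]
        exact sphereIn_mem_skLT d (by exact_mod_cast Nat.lt_succ_of_le hj) ⟨j, rfl⟩ x
      · rw [hf2 j x hj]
        exact h0
  refine ⟨⟨⟨fun z => ⟨f.toMap z, hmem z⟩, by fun_prop⟩, Subtype.ext f.map_pt⟩, ?_⟩
  refine PtdMap.ext fun z => Subtype.ext ?_
  show f.toMap z.1 = z.1
  obtain ⟨k, hk, c, y, hy, hz⟩ := exists_chi_of_mem_skLT (X := sphereWedge d) z.2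
  rw [← hz]
  rcases (c : WedgeCell d k) with ⟨j, rfl⟩ | h
  · exact hf1 j _ (by
      have : d j < m + 1 := by exact_mod_cast hk
      omega)
  · exact f.map_pt

/-- A map from a compact space to the suspension of a wedge of spheres factors through the
suspension of a finite wedge. -/
lemma exists_factor_finite_wedge {A : PtdSpace.{u}} {N : ℕ} [CompactSpace A]
    (f : PtdMap A (iterSusp (sphereWedge d) N)) :
    ∃ (s : Set J) (_ : Finite s) (i : PtdMap (sphereWedge fun j : s => d j) (sphereWedge d))
      (g : PtdMap A (iterSusp (sphereWedge fun j : s => d j) N)),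
      (iterSuspMap i N).comp g = f := by
  classical
  have hC : IsCompact (range f.toMap) := isCompact_range f.toMap.continuous
  have hfin := finite_cells_of_isCompact (sphereWedge d).pt N hC
  let cell (j : J) : Σ n, Cell (sphereWedge d) n := ⟨d j, Sum.inl ⟨j, rfl⟩⟩
  have hcell : Function.Injective cell := by
    intro j j' h
    have := congrArg (fun c : Σ k, WedgeCell d k =>
      Sum.elim (fun j => some j.1) (fun _ => none) c.2) h
    exact Option.some.inj this
  let s : Set J := cell ⁻¹' {c : Σ n, Cell (sphereWedge d) n | ∃ q : sphereWedge d × (Fin N → I),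
    q ∉ cubeBase (sphereWedge d) N ∧ suspCube (sphereWedge d) N q ∈ range f.toMap ∧
      q.1 ∈ RelCWComplex.openCell c.1 c.2}
  let i : PtdMap (sphereWedge fun j : s => d j) (sphereWedge d) :=
    wedgeDesc fun j => wedgeIn (fun j => sphere (d j)) j.1
  -- Collapsing the spheres that the map does not meet is inverse to the inclusion on its image.
  let r : PtdMap (sphereWedge d) (sphereWedge fun j : s => d j) :=
    wedgeDesc fun j => if h : j ∈ s then wedgeIn (fun j : s => sphere (d j)) ⟨j, h⟩ else
      ⟨.const _ (sphereWedge fun j : s => d j).pt, rfl⟩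
  refine ⟨s, (hfin.preimage hcell.injOn).to_subtype, i, (iterSuspMap r N).comp f,
    PtdMap.ext fun a => ?_⟩
  show (iterSuspMap i N).toMap ((iterSuspMap r N).toMap (f.toMap a)) = f.toMap a
  obtain ⟨q, hq⟩ := suspCube_surjective _ N (f.toMap a)
  by_cases hb : q ∈ cubeBase (sphereWedge d) N
  · have h : f.toMap a = (iterSusp (sphereWedge d) N).pt :=
      hq.symm.trans ((suspCube_eq_pt_iff _).2 hb)
    rw [h, (iterSuspMap r N).map_pt, (iterSuspMap i N).map_pt]
  · rw [← hq, iterSuspMap_suspCube, iterSuspMap_suspCube]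
    refine congrArg (fun w => suspCube (sphereWedge d) N (w, q.2)) ?_
    rcases wedge_cases q.1 with h | ⟨j, x, hx, h⟩
    · exact absurd (Or.inl h) hb
    · have hj : j ∈ s := by
        refine ⟨q, hb, ⟨a, hq.symm⟩, sphereCellInv (d j) x,
          mem_ball_zero_iff.2 (norm_sphereCellInv_lt x), ?_⟩
        rw [h]
        exact congrArg (wedgeIn (fun j => sphere (d j)) j).toMap (sphereCell_sphereCellInv hx)
      have hr : r.toMap q.1 = (wedgeIn (fun j : s => sphere (d j)) ⟨j, hj⟩).toMap x := by
        rw [h]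
        refine (wedgeDesc_wedgeIn _ _ _).trans ?_
        rw [dif_pos hj]
      rw [hr, h]
      rfl

end WedgeOfSpheres

/-! ### Homology of spaces and of pairs of a space and a subset -/

section
variable (h : TopPair.HomologyPretheory.{u} AddCommGrpCat.{w} (ComplexShape.down ℤ))

/-- The homology group `h_k X` of a space. -/
abbrev Grp (k : ℤ) (X : Type u) [TopologicalSpace X] : Type w := (h.H k).obj (TopCat.of X)

/-- The homology group `h_k (X, A)` of a pair. -/
abbrev RelGrp (k : ℤ) {X : Type u} [TopologicalSpace X] (A : Set X) : Type w :=
  (h.Hₚ k).obj (TopPair.ofSubset (X := TopCat.of X) A)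

variable {X Y : Type u} [TopologicalSpace X] [TopologicalSpace Y] {A : Set X} {B : Set Y}

/-- The map of pairs `(X, A) → (Y, B)` given by a continuous map. -/
def pairHom (f : C(X, Y)) (hf : MapsTo f A B) :
    TopPair.ofSubset (X := TopCat.of X) A ⟶ TopPair.ofSubset (X := TopCat.of Y) B :=
  TopPair.ofHom (TopCat.ofHom f) (TopCat.ofHom ⟨hf.restrict f A B, by fun_prop⟩)

/-- The homomorphism `h_k X → h_k Y` induced by a continuous map. -/
def mapH (k : ℤ) (f : C(X, Y)) : Grp h k X →+ Grp h k Y := ((h.H k).map (TopCat.ofHom f)).hom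

/-- The homomorphism `h_k (X, A) → h_k (Y, B)` induced by a map of pairs. -/
def relMap (k : ℤ) (f : C(X, Y)) (hf : MapsTo f A B) : RelGrp h k A →+ RelGrp h k B :=
  ((h.Hₚ k).map (pairHom f hf)).hom

/-- The homomorphism `h_k X → h_k (X, A)`. -/
def toRel (k : ℤ) (A : Set X) : Grp h k X →+ RelGrp h k A :=
  ((h.iso k).hom.app (TopCat.of X) ≫
    (h.Hₚ k).map (TopPair.j (TopPair.ofSubset (X := TopCat.of X) A))).hom

/-- The boundary homomorphism `h_(k+1) (X, A) → h_k A`. -/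
def bdry (k : ℤ) (A : Set X) : RelGrp h (k + 1) A →+ Grp h k A :=
  ((h.δ (k + 1) k).app (TopPair.ofSubset (X := TopCat.of X) A)).hom

end

section Functoriality

variable {h : TopPair.HomologyPretheory.{u} AddCommGrpCat.{w} (ComplexShape.down ℤ)}
  {X Y Z : Type u} [TopologicalSpace X] [TopologicalSpace Y] [TopologicalSpace Z]
  {A : Set X} {B : Set Y} {C : Set Z}

lemma mapH_comp (k : ℤ) (f : C(X, Y)) (g : C(Y, Z)) (x : Grp h k X) :
    mapH h k (g.comp f) x = mapH h k g (mapH h k f x) := by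
  simp only [mapH, TopCat.ofHom_comp, Functor.map_comp, AddCommGrpCat.hom_comp,
    AddMonoidHom.comp_apply]

lemma mapH_id (k : ℤ) (x : Grp h k X) : mapH h k (ContinuousMap.id X) x = x :=
  congrArg (fun φ => φ.hom x) ((h.H k).map_id (TopCat.of X))

lemma mapH_const_comp (k : ℤ) (f : C(X, Y)) (z : Z) (x : Grp h k X) :
    mapH h k (ContinuousMap.const Y z) (mapH h k f x) = mapH h k (ContinuousMap.const X z) x :=
  (mapH_comp k f (ContinuousMap.const Y z) x).symm

lemma mapH_comp_const (k : ℤ) (f : C(Y, Z)) (y : Y) (x : Grp h k X) :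
    mapH h k f (mapH h k (ContinuousMap.const X y) x) =
      mapH h k (ContinuousMap.const X (f y)) x :=
  (mapH_comp k (ContinuousMap.const X y) f x).symm

lemma relMap_comp (k : ℤ) (f : C(X, Y)) (g : C(Y, Z)) (hf : MapsTo f A B) (hg : MapsTo g B C)
    (hgf : MapsTo (g.comp f) A C) (x : RelGrp h k A) :
    relMap h k (g.comp f) hgf x = relMap h k g hg (relMap h k f hf x) := by
  have : pairHom (g.comp f) hgf = pairHom f hf ≫ pairHom g hg := rfl
  simp only [relMap, this, Functor.map_comp, AddCommGrpCat.hom_comp, AddMonoidHom.comp_apply]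

lemma relMap_id (k : ℤ) (hf : MapsTo (ContinuousMap.id X) A A) (x : RelGrp h k A) :
    relMap h k (ContinuousMap.id X) hf x = x :=
  congrArg (fun φ => φ.hom x) ((h.Hₚ k).map_id (TopPair.ofSubset (X := TopCat.of X) A))

lemma relMap_toRel (k : ℤ) (f : C(X, Y)) (hf : MapsTo f A B) (x : Grp h k X) :
    relMap h k f hf (toRel h k A x) = toRel h k B (mapH h k f x) := by
  have e1 : TopPair.j (TopPair.ofSubset (X := TopCat.of X) A) ≫ pairHom f hf =
      TopPair.incl.map (TopCat.ofHom f) ≫ TopPair.j (TopPair.ofSubset (X := TopCat.of Y) B) := by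
    refine MorphismProperty.Arrow.Hom.ext ?_ rfl
    exact TopCat.isInitialPEmpty.hom_ext _ _
  have e2 := (h.iso k).hom.naturality (TopCat.ofHom f)
  have e3 := congrArg (fun φ => φ.hom (((h.iso k).hom.app (TopCat.of X)).hom x))
    (((h.Hₚ k).map_comp _ _).symm.trans
      ((congrArg (h.Hₚ k).map e1).trans ((h.Hₚ k).map_comp _ _)))
  have e4 := congrArg (fun φ => ((h.Hₚ k).map
    (TopPair.j (TopPair.ofSubset (X := TopCat.of Y) B))).hom (φ.hom x)) e2
  exact e3.trans e4.symm

lemma bdry_relMap (k : ℤ) (f : C(X, Y)) (hf : MapsTo f A B) (x : RelGrp h (k + 1) A) :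
    bdry h k B (relMap h (k + 1) f hf x) =
      mapH h k ⟨hf.restrict f A B, by fun_prop⟩ (bdry h k A x) :=
  congrArg (fun φ => φ.hom x) ((h.δ (k + 1) k).naturality (pairHom f hf))

lemma toRel_eq_zero_iff (hh : IsGeneralizedHomologyTheory h) (k : ℤ) (x : Grp h k X) :
    toRel h k A x = 0 ↔
      ∃ y : Grp h k A, mapH h k ⟨Subtype.val, continuous_subtype_val⟩ y = x :=
  (hh.exact_fst (TopPair.ofSubset (X := TopCat.of X) A) k) x

lemma bdry_eq_zero_iff (hh : IsGeneralizedHomologyTheory h) (k : ℤ) (x : RelGrp h (k + 1) A) :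
    bdry h k A x = 0 ↔ ∃ y : Grp h (k + 1) X, toRel h (k + 1) A y = x :=
  (hh.exact_pair (TopPair.ofSubset (X := TopCat.of X) A) k) x

lemma mapH_val_eq_zero_iff (hh : IsGeneralizedHomologyTheory h) (k : ℤ) (x : Grp h k A) :
    mapH h k ⟨Subtype.val, continuous_subtype_val⟩ x = 0 ↔
      ∃ y : RelGrp h (k + 1) A, bdry h k A y = x :=
  (hh.exact_snd (TopPair.ofSubset (X := TopCat.of X) A) k) x

lemma bijective_relMap_val (hh : IsGeneralizedHomologyTheory h) (k : ℤ) (U : Set X)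
    (hU : closure U ⊆ interior A) :
    Function.Bijective (relMap h k (A := (Subtype.val ⁻¹' A : Set ↥Uᶜ)) (B := A)
      ⟨Subtype.val, continuous_subtype_val⟩ fun _ hx => hx) := by
  have := hh.excision (TopCat.of X) A U hU k
  exact (ConcreteCategory.isIso_iff_bijective
    ((h.Hₚ k).map (excisionMap (TopCat.of X) A U))).1 this

lemma relMap_eq_of_homotopy (hh : IsGeneralizedHomologyTheory h) (k : ℤ) (H : C(I × X, Y))
    (hH : ∀ s, ∀ x ∈ A, H (s, x) ∈ B) (f g : C(X, Y)) (h0 : ∀ x, H (0, x) = f x)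
    (h1 : ∀ x, H (1, x) = g x) (hf : MapsTo f A B) (hg : MapsTo g A B) :
    relMap h k f hf = relMap h k g hg := by
  have := hh.homotopy
  let F : TopPair.Homotopy (pairHom f hf) (pairHom g hg) :=
    { fst := { toContinuousMap := H, map_zero_left := h0, map_one_left := h1 }
      snd :=
        { toContinuousMap := ⟨fun q => ⟨H (q.1, q.2.1), hH q.1 _ q.2.2⟩, by fun_prop⟩
          map_zero_left := fun x => Subtype.ext (h0 x.1)
          map_one_left := fun x => Subtype.ext (h1 x.1) }
      w := by rfl }
  exact congrArg AddCommGrpCat.Hom.hom (TopPair.HomologyPretheory.map_eq_of_homotopy h F k)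

lemma mapH_eq_of_homotopy (hh : IsGeneralizedHomologyTheory h) (k : ℤ) (H : C(I × X, Y))
    (f g : C(X, Y)) (h0 : ∀ x, H (0, x) = f x) (h1 : ∀ x, H (1, x) = g x) :
    mapH h k f = mapH h k g := by
  have := hh.homotopy
  let F : TopPair.Homotopy (TopPair.incl.map (TopCat.ofHom f))
      (TopPair.incl.map (TopCat.ofHom g)) :=
    { fst := { toContinuousMap := H, map_zero_left := h0, map_one_left := h1 }
      snd :=
        { toContinuousMap := ⟨fun q => q.2, by fun_prop⟩
          map_zero_left := fun x => rfl
          map_one_left := fun x => rfl }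
      w := by ext x; exact x.1.elim }
  have e := TopPair.HomologyPretheory.map_eq_of_homotopy h F k
  -- homotopy invariance is an axiom for pairs; the absolute groups are those of `(X, ∅)`
  have e2 : (h.H k).map (TopCat.ofHom f) = (h.H k).map (TopCat.ofHom g) := by
    rw [← cancel_mono ((h.iso k).hom.app (TopCat.of Y))]
    have n1 := (h.iso k).hom.naturality (TopCat.ofHom f)
    have n2 := (h.iso k).hom.naturality (TopCat.ofHom g)
    exact n1.trans ((congrArg (fun φ => (h.iso k).hom.app (TopCat.of X) ≫ φ) e).trans n2.symm)
  exact congrArg AddCommGrpCat.Hom.hom e2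

end Functoriality

/-! ### The suspension of homology classes -/

section
variable (h : TopPair.HomologyPretheory.{u} AddCommGrpCat.{w} (ComplexShape.down ℤ))

/-- The map of homology groups induced by a pointed map. -/
abbrev ptMap (k : ℤ) {Z W : PtdSpace.{u}} (f : PtdMap Z W) : Grp h k Z →+ Grp h k W :=
  mapH h k f.toMap

/-- A homology class of a pointed space is reduced if the constant map to the base point kills
it. -/
def IsReduced {k : ℤ} {Z : PtdSpace.{u}} (a : Grp h k Z) : Prop :=
  mapH h k (ContinuousMap.const Z Z.pt) a = 0

/-- The end `{t} × Z` of the cylinder, for `t = 0` or `t = 1`, as a map to `suspBase Z`. -/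
def cylEnd (Z : PtdSpace.{u}) (t : I) (ht : t = 0 ∨ t = 1) : C(Z, ↥(suspBase Z)) :=
  ⟨fun z => ⟨(z, t), ht.imp_right Or.inl⟩, by fun_prop⟩

lemma mapsTo_suspMk (Z : PtdSpace.{u}) :
    MapsTo (suspMk Z) (suspBase Z) ({(susp Z).pt} : Set (susp Z)) :=
  fun _ hp => suspMk_eq_pt Z hp

lemma PtdMap.mapsTo_pt {Z W : PtdSpace.{u}} (f : PtdMap Z W) :
    MapsTo f.toMap ({Z.pt} : Set Z) {W.pt} := by
  rintro x rfl
  exact f.map_pt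

/-- The map of cylinders given by a pointed map. -/
def cylMap {Z W : PtdSpace.{u}} (f : PtdMap Z W) : C(Z × I, W × I) :=
  ⟨fun p => (f.toMap p.1, p.2), by fun_prop⟩

lemma mapsTo_cylMap {Z W : PtdSpace.{u}} (f : PtdMap Z W) :
    MapsTo (cylMap f) (suspBase Z) (suspBase W) := by
  intro p hp
  rcases hp with hp | hp | hp
  · exact Or.inl hp
  · exact Or.inr (Or.inl hp)
  · exact Or.inr (Or.inr ((congrArg f.toMap hp).trans f.map_pt))

/-- A class of a pointed space and a class of its suspension that correspond to each other under
the suspension isomorphism: the second is reduced, and there is a class of the cylinder relative to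
`suspBase Z` whose boundary is the difference of the two copies of the first class at the ends of
the cylinder and whose image in the suspension is the second class. -/
def SuspRel {k : ℤ} {Z : PtdSpace.{u}} (a : Grp h k Z) (c : Grp h (k + 1) (susp Z)) : Prop :=
  IsReduced h c ∧ ∃ b : RelGrp h (k + 1) (suspBase Z),
    bdry h k (suspBase Z) b =
      mapH h k (cylEnd Z 1 (.inr rfl)) a - mapH h k (cylEnd Z 0 (.inl rfl)) a ∧
    relMap h (k + 1) (suspMk Z) (mapsTo_suspMk Z) b =
      toRel h (k + 1) {(susp Z).pt} c

end

section Suspension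

variable {h : TopPair.HomologyPretheory.{u} AddCommGrpCat.{w} (ComplexShape.down ℤ)}

lemma IsReduced.map {k : ℤ} {Z W : PtdSpace.{u}} {a : Grp h k Z} (ha : IsReduced h a)
    (f : PtdMap Z W) : IsReduced h (ptMap h k f a) := by
  have h1 := mapH_const_comp k f.toMap W.pt a
  have h2 := mapH_comp_const k f.toMap Z.pt a
  rw [f.map_pt] at h2
  rw [IsReduced, h1, ← h2, ha, map_zero]

/-- Every class of a space has a suspension. -/
lemma exists_suspRel (hh : IsGeneralizedHomologyTheory h) {k : ℤ} {Z : PtdSpace.{u}}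
    (a : Grp h k Z) : ∃ c, SuspRel h a c := by
  have h1 : mapH h k ⟨Subtype.val, continuous_subtype_val⟩
      (mapH h k (cylEnd Z 1 (.inr rfl)) a - mapH h k (cylEnd Z 0 (.inl rfl)) a) = 0 := by
    rw [map_sub, ← mapH_comp, ← mapH_comp, sub_eq_zero]
    refine congrArg (fun φ => φ a) (mapH_eq_of_homotopy hh k (X := Z) (Y := Z × I)
      ⟨fun p => (p.2, σ p.1), by fun_prop⟩ _ _ ?_ ?_)
    · intro x; simp [cylEnd]
    · intro x; simp [cylEnd]
  obtain ⟨b, hb⟩ := (mapH_val_eq_zero_iff hh k _).1 h1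
  have h2 : bdry h k {(susp Z).pt} (relMap h (k + 1) (suspMk Z) (mapsTo_suspMk Z) b) = 0 := by
    rw [bdry_relMap, hb, map_sub, ← mapH_comp, ← mapH_comp, sub_eq_zero]
    congr 1
    refine congrArg _ (ContinuousMap.ext fun x => ?_)
    exact Subsingleton.elim (α := ({(susp Z).pt} : Set (susp Z))) _ _
  obtain ⟨c, hc⟩ := (bdry_eq_zero_iff hh k _).1 h2
  refine ⟨c - mapH h (k + 1) (ContinuousMap.const _ (susp Z).pt) c, ?_, b, hb, ?_⟩
  · rw [IsReduced, map_sub, mapH_const_comp, sub_self]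
  · rw [map_sub, hc]
    refine (sub_eq_self.2 ?_).symm
    refine (toRel_eq_zero_iff hh _ _).2
      ⟨mapH h (k + 1) (ContinuousMap.const _ ⟨(susp Z).pt, rfl⟩) c, ?_⟩
    exact mapH_comp_const _ _ _ _

/-- The suspension of homology classes is natural. -/
lemma SuspRel.map {k : ℤ} {Z W : PtdSpace.{u}} {a : Grp h k Z} {c : Grp h (k + 1) (susp Z)}
    (hac : SuspRel h a c) (f : PtdMap Z W) :
    SuspRel h (ptMap h k f a) (ptMap h (k + 1) (suspMap f) c) := by
  obtain ⟨hc, b, hb, hbc⟩ := hac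
  have hm : MapsTo ((suspMk W).comp (cylMap f)) (suspBase Z) {(susp W).pt} :=
    (mapsTo_suspMk W).comp (mapsTo_cylMap f)
  refine ⟨hc.map _, relMap h (k + 1) (cylMap f) (mapsTo_cylMap f) b, ?_, ?_⟩
  · rw [bdry_relMap, hb, map_sub, ← mapH_comp, ← mapH_comp, ← mapH_comp, ← mapH_comp]
    rfl
  · rw [← relMap_toRel _ _ (suspMap f).mapsTo_pt, ← hbc,
      ← relMap_comp _ _ _ _ _ hm]
    exact relMap_comp _ (suspMk Z) (suspMap f).toMap (mapsTo_suspMk Z) (suspMap f).mapsTo_pt hm b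

lemma mapH_suspMk (hh : IsGeneralizedHomologyTheory h) (k : ℤ) (Z : PtdSpace.{u}) :
    mapH h k (suspMk Z) = mapH h k (ContinuousMap.const _ (susp Z).pt) := by
  refine mapH_eq_of_homotopy hh k (X := Z × I) (Y := susp Z)
    ((suspMk Z).comp ⟨fun p => (p.2.1, p.2.2 * σ p.1), by fun_prop⟩) _ _ ?_ ?_
  · intro x; simp
  · intro x
    exact suspMk_eq_pt Z (Or.inl (by simp))

/-- The suspension of the zero class is zero. -/
lemma SuspRel.eq_zero (hh : IsGeneralizedHomologyTheory h) {k : ℤ} {Z : PtdSpace.{u}}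
    {c : Grp h (k + 1) (susp Z)} (hc : SuspRel h (0 : Grp h k Z) c) : c = 0 := by
  obtain ⟨hc, b, hb, hbc⟩ := hc
  rw [map_zero, map_zero, sub_zero] at hb
  obtain ⟨y, rfl⟩ := (bdry_eq_zero_iff hh k b).1 hb
  rw [relMap_toRel, mapH_suspMk hh, ← sub_eq_zero, ← map_sub, toRel_eq_zero_iff hh] at hbc
  obtain ⟨p, hp⟩ := hbc
  have h1 : mapH h (k + 1) (ContinuousMap.const _ (susp Z).pt)
      (mapH h (k + 1)
        (⟨Subtype.val, continuous_subtype_val⟩ : C(({(susp Z).pt} : Set (susp Z)), susp Z)) p) =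
      mapH h (k + 1) ⟨Subtype.val, continuous_subtype_val⟩ p := by
    rw [mapH_const_comp]
    congr 1
    exact congrArg _ (ContinuousMap.ext fun x => x.2.symm)
  rw [hp, map_sub, hc, mapH_const_comp, sub_zero] at h1
  rw [← sub_eq_zero.2 h1, sub_sub_cancel]

/-- A pointed space whose base point is closed and has a neighbourhood `{u < 1}` that can be
contracted to it by a deformation of the whole space. -/
structure PtdSpace.IsWellPointed (Z : PtdSpace.{u}) : Prop where
  isClosed_pt : IsClosed ({Z.pt} : Set Z)
  exists_contraction : ∃ (u : C(Z, I)) (H : C(I × Z, Z)), (∀ z, H (0, z) = z) ∧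
    (∀ s, H (s, Z.pt) = Z.pt) ∧ u Z.pt = 0 ∧ ∀ z, u z < 1 → H (1, z) = Z.pt

/-- The deformation of the unit interval that stretches its middle third to the whole interval. -/
def stretch : C(I × I, I) :=
  ⟨fun p => projIcc 0 1 zero_le_one ((1 + 2 * (p.1 : ℝ)) * p.2 - p.1), by fun_prop⟩

lemma stretch_zero_left (t : I) : stretch (0, t) = t := by
  simp [stretch]

lemma stretch_zero_right (s : I) : stretch (s, 0) = 0 := by
  simp [stretch, projIcc_of_le_left _ (neg_nonpos.2 s.2.1)]

lemma stretch_one_right (s : I) : stretch (s, 1) = 1 := by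
  have : (1 : ℝ) ≤ (1 + 2 * (s : ℝ)) * ((1 : I) : ℝ) - s := by
    have := s.2.1
    simp only [Icc.coe_one]
    linarith
  exact projIcc_of_right_le zero_le_one this

lemma stretch_eq_zero {t : I} (ht : (t : ℝ) < 1 / 3) : stretch (1, t) = 0 := by
  have : (1 + 2 * ((1 : I) : ℝ)) * t - ((1 : I) : ℝ) ≤ 0 := by
    simp only [Icc.coe_one]
    linarith
  exact projIcc_of_le_left zero_le_one this

lemma stretch_eq_one {t : I} (ht : 2 / 3 < (t : ℝ)) : stretch (1, t) = 1 := by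
  have : 1 ≤ (1 + 2 * ((1 : I) : ℝ)) * t - ((1 : I) : ℝ) := by
    simp only [Icc.coe_one]
    linarith
  exact projIcc_of_right_le zero_le_one this

/-- A neighbourhood of `suspBase Z` in the cylinder, and a deformation of the cylinder that pushes
it into `suspBase Z`. -/
lemma PtdSpace.IsWellPointed.exists_cylinder {Z : PtdSpace.{u}} (hZ : Z.IsWellPointed) :
    ∃ (v : C(Z × I, I)) (D : C(I × (Z × I), Z × I)), (∀ p, D (0, p) = p) ∧
      (∀ s, ∀ p ∈ suspBase Z, D (s, p) ∈ suspBase Z) ∧ (∀ p ∈ suspBase Z, v p = 0) ∧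
      ∀ p, v p < 1 → D (1, p) ∈ suspBase Z := by
  obtain ⟨-, u, H, h0, hpt, hu, hH⟩ := hZ
  refine ⟨⟨fun p => u p.1 ⊓ (projIcc 0 1 zero_le_one (3 * (p.2 : ℝ)) ⊓
      projIcc 0 1 zero_le_one (3 * (1 - (p.2 : ℝ)))), by fun_prop⟩,
    ⟨fun q => (H (q.1, q.2.1), stretch (q.1, q.2.2)), by fun_prop⟩, ?_, ?_, ?_, ?_⟩
  · rintro ⟨z, t⟩
    exact Prod.ext (h0 z) (stretch_zero_left t)
  · rintro s ⟨z, t⟩ (hp | hp | hp)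
    · exact Or.inl ((congrArg (fun t => stretch (s, t)) hp).trans (stretch_zero_right s))
    · exact Or.inr (Or.inl ((congrArg (fun t => stretch (s, t)) hp).trans (stretch_one_right s)))
    · exact Or.inr (Or.inr ((congrArg (fun z => H (s, z)) hp).trans (hpt s)))
  · rintro ⟨z, t⟩ (hp | hp | hp)
    · have : t = 0 := hp
      simp [this]
    · have : t = 1 := hp
      simp [this]
    · have : z = Z.pt := hp
      simp [this, hu]
  · rintro ⟨z, t⟩ hp
    have hp : u z ⊓ (projIcc 0 1 zero_le_one (3 * (t : ℝ)) ⊓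
      projIcc 0 1 zero_le_one (3 * (1 - (t : ℝ)))) < 1 := hp
    rcases inf_lt_iff.1 hp with hp | hp
    · exact Or.inr (Or.inr (hH z hp))
    rcases inf_lt_iff.1 hp with hp | hp
    · refine Or.inl (stretch_eq_zero ?_)
      by_contra hc
      exact hp.ne (projIcc_of_right_le _ (by linarith))
    · refine Or.inr (Or.inl (stretch_eq_one ?_))
      by_contra hc
      exact hp.ne (projIcc_of_right_le _ (by linarith))

/-- The deformation of the cylinder descends to the suspension. -/
lemma PtdSpace.IsWellPointed.susp {Z : PtdSpace.{u}} (hZ : Z.IsWellPointed) :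
    (susp Z).IsWellPointed := by
  obtain ⟨v, D, hD0, hDS, hv, hD1⟩ := hZ.exists_cylinder
  have hq := isQuotientMap_suspMk Z
  refine ⟨?_, ?_⟩
  · rw [← hq.isClosed_preimage]
    convert isClosed_suspBase Z hZ.isClosed_pt using 1
    ext p
    exact suspMk_eq_pt_iff Z
  let v' : OneStep.susp Z → I := Quotient.lift (s := collapse (suspBase Z)) v (by
    rintro p q (rfl | ⟨hp, hq⟩)
    · rfl
    · rw [hv p hp, hv q hq])
  let D' : I → OneStep.susp Z → OneStep.susp Z := fun s =>
    Quotient.lift (s := collapse (suspBase Z)) (fun p => suspMk Z (D (s, p))) (by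
      rintro p q (rfl | ⟨hp, hq⟩)
      · rfl
      · exact (suspMk_eq_pt Z (hDS s p hp)).trans (suspMk_eq_pt Z (hDS s q hq)).symm)
  have hvc : Continuous v' := v.continuous.quotient_lift _
  have hDq : ∀ s p, D' s (suspMk Z p) = suspMk Z (D (s, p)) := fun _ _ => rfl
  have hDc : Continuous fun q : I × OneStep.susp Z => D' q.1 q.2 := by
    refine hq.continuous_lift_prod_right ?_
    simp only [hDq]
    exact (suspMk Z).continuous.comp (D.continuous.comp (by fun_prop))
  have hpt : (OneStep.susp Z).pt = suspMk Z (Z.pt, 0) := rfl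
  refine ⟨⟨v', hvc⟩, ⟨_, hDc⟩, fun z => ?_, fun s => ?_, ?_, fun z hz => ?_⟩
  · obtain ⟨p, rfl⟩ := suspMk_surjective Z z
    exact congrArg (suspMk Z) (hD0 p)
  · exact suspMk_eq_pt Z (hDS s _ (pt_mem_suspBase Z 0))
  · exact hv _ (pt_mem_suspBase Z 0)
  · obtain ⟨p, rfl⟩ := suspMk_surjective Z z
    exact suspMk_eq_pt Z (hD1 p hz)

/-- The homology of the cylinder relative to `suspBase Z` injects into the homology of the
suspension relative to the base point, if `Z` is well-pointed. -/
lemma PtdSpace.IsWellPointed.relMap_suspMk_eq_zero (hh : IsGeneralizedHomologyTheory h) {k : ℤ}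
    {Z : PtdSpace.{u}} (hZ : Z.IsWellPointed) {b : RelGrp h k (suspBase Z)}
    (hb : relMap h k (suspMk Z) (mapsTo_suspMk Z) b = 0) : b = 0 := by
  obtain ⟨v, D, hD0, hDS, hv, hD1⟩ := hZ.exists_cylinder
  have hS : IsClosed (suspBase Z) := isClosed_suspBase Z hZ.isClosed_pt
  have hq := isQuotientMap_suspMk Z
  let N : Set (Z × I) := {p | v p < 1}
  have hNo : IsOpen N := isOpen_lt v.continuous continuous_const
  have hSN : suspBase Z ⊆ N := fun p hp => by
    show v p < 1
    rw [hv p hp]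
    exact zero_lt_one
  have hpc : IsClosed ({(OneStep.susp Z).pt} : Set (OneStep.susp Z)) := hZ.susp.isClosed_pt
  let N' : Set (OneStep.susp Z) := suspMk Z '' N
  have hN' : suspMk Z ⁻¹' N' = N := by
    refine Subset.antisymm ?_ (subset_preimage_image _ _)
    rintro p ⟨p', hp', hpp⟩
    rcases (suspMk_eq_iff Z).1 hpp with rfl | ⟨-, h2⟩
    exacts [hp', hSN h2]
  have hNo' : IsOpen N' := by rw [← hq.isOpen_preimage, hN']; exact hNo
  have hptN' : {(OneStep.susp Z).pt} ⊆ N' := by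
    rintro _ rfl
    exact ⟨(Z.pt, 0), hSN (pt_mem_suspBase Z 0), rfl⟩
  have hqN : MapsTo (suspMk Z) N N' := mapsTo_image _ _
  -- the class vanishes as soon as it vanishes relative to the neighbourhood
  have hSN' : MapsTo (ContinuousMap.id (Z × I)) (suspBase Z) N := hSN
  let D1 : C(Z × I, Z × I) := D.comp ⟨fun p => (1, p), by fun_prop⟩
  have hinj : relMap h k (ContinuousMap.id (Z × I)) hSN' b = 0 → b = 0 := fun h0 => by
    have h1 := relMap_comp k (ContinuousMap.id (Z × I)) D1 hSN' (C := suspBase Z)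
      (fun p hp => hD1 p hp) (fun p hp => hDS 1 p hp) b
    rw [h0, map_zero] at h1
    rw [← relMap_id k (mapsTo_id _) b, ← h1]
    exact congrArg (fun φ => φ b) (relMap_eq_of_homotopy hh k D hDS (ContinuousMap.id _) D1 hD0
      (fun p => rfl) _ _)
  refine hinj ?_
  obtain ⟨b1, hb1⟩ := (bijective_relMap_val hh k (A := N) (suspBase Z)
    (by rw [hS.closure_eq, hNo.interior_eq]; exact hSN)).2 (relMap h k (ContinuousMap.id _) hSN' b)
  have hex := (bijective_relMap_val hh k (A := N') {(OneStep.susp Z).pt}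
    (by rw [hpc.closure_eq, hNo'.interior_eq]; exact hptN')).1
  -- away from the base point the quotient map is a homeomorphism
  have hqm : ∀ p : ↥(suspBase Z)ᶜ, suspMk Z p ∈ ({(OneStep.susp Z).pt} : Set _)ᶜ :=
    fun p hp => p.2 ((suspMk_eq_pt_iff Z).1 hp)
  let q' : C(↥(suspBase Z)ᶜ, ↥({(OneStep.susp Z).pt} : Set (OneStep.susp Z))ᶜ) :=
    ⟨fun p => ⟨suspMk Z p, hqm p⟩, by fun_prop⟩
  have hq'inj : Function.Injective q' := fun p p' hpp => by
    rcases (suspMk_eq_iff Z).1 (congrArg Subtype.val hpp) with h | h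
    · exact Subtype.ext h
    · exact absurd h.1 p.2
  have hq'surj : Function.Surjective q' := by
    rintro ⟨z, hz⟩
    obtain ⟨p, rfl⟩ := suspMk_surjective Z z
    exact ⟨⟨p, fun hp => hz (suspMk_eq_pt Z hp)⟩, rfl⟩
  have hq'open : IsOpenMap q' := by
    intro V hV
    refine isOpen_induced_iff.2 ⟨suspMk Z '' (Subtype.val '' V), ?_, ?_⟩
    · rw [← hq.isOpen_preimage]
      convert hS.isOpen_compl.isOpenMap_subtype_val V hV using 1
      refine Subset.antisymm ?_ (subset_preimage_image _ _)
      rintro p ⟨p', ⟨x, hx, rfl⟩, hpp⟩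
      rcases (suspMk_eq_iff Z).1 hpp with rfl | h
      · exact ⟨x, hx, rfl⟩
      · exact absurd h.1 x.2
    · ext z
      constructor
      · rintro ⟨_, ⟨x, hx, rfl⟩, hxz⟩
        exact ⟨x, hx, Subtype.ext hxz⟩
      · rintro ⟨x, hx, rfl⟩
        exact ⟨_, ⟨x, hx, rfl⟩, rfl⟩
  let e : ↥(suspBase Z)ᶜ ≃ₜ ↥({(OneStep.susp Z).pt} : Set (OneStep.susp Z))ᶜ :=
    (Equiv.ofBijective q' ⟨hq'inj, hq'surj⟩).toHomeomorphOfContinuousOpen q'.continuous hq'open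
  let g : C(↥({(OneStep.susp Z).pt} : Set (OneStep.susp Z))ᶜ, ↥(suspBase Z)ᶜ) :=
    ⟨e.symm, e.symm.continuous⟩
  have hgq : g.comp q' = ContinuousMap.id _ := ContinuousMap.ext fun p => e.symm_apply_apply p
  have hqg : ∀ z, suspMk Z (g z) = z := fun z => congrArg Subtype.val (e.apply_symm_apply z)
  have hq'N : MapsTo q' (Subtype.val ⁻¹' N) (Subtype.val ⁻¹' N') := fun p hp => hqN hp
  have hgN : MapsTo g (Subtype.val ⁻¹' N') (Subtype.val ⁻¹' N) := fun z hz => by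
    show (g z : Z × I) ∈ N
    rw [← hN', mem_preimage, hqg]
    exact hz
  have hb2 : relMap h k q' hq'N b1 = 0 := by
    refine hex ?_
    have h0 := relMap_comp k q' ⟨Subtype.val, continuous_subtype_val⟩ hq'N
      (C := N') (fun z hz => hz) (fun p hp => hqN hp) b1
    refine (h0.symm.trans ?_).trans (map_zero _).symm
    have h1 := relMap_comp k ⟨Subtype.val, continuous_subtype_val⟩ (suspMk Z)
      (A := (Subtype.val ⁻¹' N : Set ↥(suspBase Z)ᶜ)) (fun x hx => hx) hqN
      (fun p hp => hqN hp) b1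
    refine h1.trans ?_
    rw [hb1, ← relMap_comp k (ContinuousMap.id _) (suspMk Z) hSN' hqN (fun p hp => hqN (hSN hp))]
    have h2 := relMap_comp k (suspMk Z) (ContinuousMap.id _) (mapsTo_suspMk Z)
      (C := N') (fun z hz => hptN' hz) (fun p hp => hqN (hSN hp)) b
    rw [hb, map_zero] at h2
    exact h2
  have hb3 : b1 = 0 := by
    rw [← relMap_id k (mapsTo_id _) b1, ← map_zero (relMap h k g hgN), ← hb2,
      ← relMap_comp k q' g hq'N hgN (hgN.comp hq'N)]
    congr 1
    congr 1
    exact hgq.symm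
  rw [← hb1, hb3, map_zero]

/-- A reduced class of a well-pointed space is zero if its suspension is. -/
lemma SuspRel.eq_zero_of_isReduced (hh : IsGeneralizedHomologyTheory h) {k : ℤ}
    {Z : PtdSpace.{u}} (hZ : Z.IsWellPointed) {a : Grp h k Z} (ha : IsReduced h a)
    (hac : SuspRel h a (0 : Grp h (k + 1) (OneStep.susp Z))) : a = 0 := by
  classical
  obtain ⟨-, b, hb, hbc⟩ := hac
  rw [map_zero] at hbc
  rw [hZ.relMap_suspMk_eq_zero hh hbc, map_zero] at hb
  -- the retraction of the base of the cylinder onto the top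
  let ρ : ↥(suspBase Z) → Z := fun p => if p.1.2 = 1 then p.1.1 else Z.pt
  have hρ0 : ∀ p : ↥(suspBase Z), (p.1.2 = 0 ∨ p.1.1 = Z.pt) → ρ p = Z.pt := by
    rintro ⟨⟨z, t⟩, hp⟩ (rfl | rfl)
    · exact if_neg (by simp)
    · exact ite_eq_right_iff.2 fun _ => rfl
  have hρ1 : ∀ p : ↥(suspBase Z), p.1.2 = 1 → ρ p = p.1.1 := fun p hp => if_pos hp
  have hρc : Continuous ρ := by
    have hA : IsClosed {p : ↥(suspBase Z) | p.1.2 = 1} := isClosed_eq (by fun_prop) (by fun_prop)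
    have hB : IsClosed {p : ↥(suspBase Z) | p.1.2 = 0 ∨ p.1.1 = Z.pt} :=
      (isClosed_eq (by fun_prop) (by fun_prop)).union
        (hZ.isClosed_pt.preimage (f := fun p : ↥(suspBase Z) => p.1.1) (by fun_prop))
    rw [← continuousOn_univ]
    have hU : (univ : Set ↥(suspBase Z)) ⊆
        {p : ↥(suspBase Z) | p.1.2 = 1} ∪ {p : ↥(suspBase Z) | p.1.2 = 0 ∨ p.1.1 = Z.pt} := by
      rintro ⟨p, hp⟩ -
      rcases hp with hp | hp | hp
      exacts [Or.inr (Or.inl hp), Or.inl hp, Or.inr (Or.inr hp)]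
    refine ContinuousOn.mono (ContinuousOn.union_of_isClosed ?_ ?_ hA hB) hU
    · exact ContinuousOn.congr (f := fun p : ↥(suspBase Z) => p.1.1) (by fun_prop) hρ1
    · exact ContinuousOn.congr (f := fun _ : ↥(suspBase Z) => Z.pt) (by fun_prop) hρ0
  have h1 := congrArg (mapH h k ⟨ρ, hρc⟩) hb
  rw [map_zero, map_sub, ← mapH_comp, ← mapH_comp] at h1
  have e1 : (⟨ρ, hρc⟩ : C(_, Z)).comp (cylEnd Z 1 (.inr rfl)) = ContinuousMap.id Z :=
    ContinuousMap.ext fun z => hρ1 _ rfl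
  have e0 : (⟨ρ, hρc⟩ : C(_, Z)).comp (cylEnd Z 0 (.inl rfl)) = ContinuousMap.const Z Z.pt :=
    ContinuousMap.ext fun z => hρ0 _ (Or.inl rfl)
  rw [e1, e0, mapH_id, ha, sub_zero] at h1
  exact h1.symm

end Suspension

/-! ### Skeleta are well-pointed -/

/-- Skeleta of CW complexes are well-pointed at the vertices of the complex. -/
theorem isWellPointed_skPt {X : Type u} [TopologicalSpace X] [T2Space X]
    [CWComplex (Set.univ : Set X)] (x0 : X) (hx0 : x0 ∈ skLT X 1) (m' : ℕ) :
    (skPt X x0 hx0 m').IsWellPointed := by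
  classical
  refine ⟨isClosed_singleton, ?_⟩
  obtain ⟨m, hm⟩ : ∃ m : ℕ, m = m' + 1 := ⟨_, rfl⟩
  have hm0 : x0 ∈ skLT X m := CWComplex.skeletonLT_mono (by rw [hm]; norm_cast; omega) hx0
  suffices ∃ (u : C(skLT X m, I)) (H : C(I × skLT X m, skLT X m)), (∀ z, H (0, z) = z) ∧
      (∀ s, H (s, ⟨x0, hm0⟩) = ⟨x0, hm0⟩) ∧ u ⟨x0, hm0⟩ = 0 ∧
      ∀ z, u z < 1 → H (1, z) = ⟨x0, hm0⟩ by
    subst hm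
    exact this
  let Z := skLT X m × I
  let z0 : skLT X m := ⟨x0, hm0⟩
  -- the deformation is constructed together with a function on its track, which starts as the
  -- constant function 1 and ends as the function that cuts out the neighbourhood
  let R : X → (I → Z) → Prop := fun x g => ∀ hx : x ∈ skLT X m,
    g 0 = (⟨x, hx⟩, 1) ∧ ((g 1).2 < 1 → (g 1).1 = z0) ∧ (x = x0 → ∀ s, g s = (z0, σ s))
  have hstart : ∀ x ∈ skLT X (0 : ℕ), R x fun _ => (z0, 1) := fun x hx => by
    obtain ⟨n, hn, -⟩ := exists_chi_of_mem_skLT hx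
    simp at hn
  refine Exists.elim (exists_extension (X := X) (P := I) (Z := Z) m R 0 (by simp)
    (fun _ _ => (z0, 1)) continuousOn_const hstart ?_) ?_
  · intro n _ hn e b hb hbR
    have hmem : ∀ y ∈ closedBall (0 : Fin n → ℝ) 1, chi n e y ∈ skLT X m := fun y hy =>
      chi_mem_skLT_of_lt hn e hy
    by_cases hcase : ∃ y ∈ ball (0 : Fin n → ℝ) 1, chi n e y = x0
    · -- the cell is the base point
      obtain ⟨y1, hy1, hy1'⟩ := hcase
      have hn0 : n = 0 := by
        by_contra hne
        refine chi_ball_notMem e hy1 (CWComplex.skeletonLT_mono ?_ (hy1' ▸ hx0))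
        exact_mod_cast Nat.one_le_iff_ne_zero.2 hne
      subst hn0
      refine ⟨fun y s => (z0, σ s), ?_, ?_, fun y hy hx => ?_⟩
      · exact (by fun_prop : Continuous fun q : (Fin 0 → ℝ) × I => (z0, σ q.2)).continuousOn
      · intro y hy
        rw [mem_sphere_zero_iff_norm, Subsingleton.elim y 0, norm_zero] at hy
        exact (zero_ne_one hy).elim
      · have hyx : chi 0 e y = x0 := by rw [Subsingleton.elim y y1, hy1']
        exact ⟨Prod.ext (Subtype.ext hyx.symm) (by simp), fun _ => rfl, fun _ s => rfl⟩
    · have hnot : ∀ y ∈ ball (0 : Fin n → ℝ) 1, chi n e y ≠ x0 := fun y hy h =>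
        hcase ⟨y, hy, h⟩
      obtain ⟨c, hc⟩ : ∃ c : BallChart (Fin n → ℝ) (closedBall (0 : Fin n → ℝ) 1),
        c = BallChart.ball (Fin n → ℝ) := ⟨_, rfl⟩
      have hbd : ∀ y : closedBall (0 : Fin n → ℝ) 1, y ∈ c.bd ↔
          (y : Fin n → ℝ) ∈ Metric.sphere (0 : Fin n → ℝ) 1 := fun y => by
        rw [hc, BallChart.mem_bd_ball]
      have hemb : ∀ y, c.emb y = (y : Fin n → ℝ) := fun y => by rw [hc]; rfl
      have hret : ∀ y (hy : y ∈ closedBall (0 : Fin n → ℝ) 1), c.ret y = ⟨y, hy⟩ := fun y hy => by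
        rw [← c.ret_emb ⟨y, hy⟩, hemb]
      let uc : C(closedBall (0 : Fin n → ℝ) 1, Z) :=
        ⟨fun y => (⟨chi n e y, hmem _ y.2⟩, 1), by
          refine Continuous.prodMk (Continuous.subtype_mk ?_ _) continuous_const
          exact (continuousOn_chi e).comp_continuous continuous_subtype_val fun y => y.2⟩
      refine Exists.elim (c.exists_homotopy_extension' uc (fun r => b r.2 r.1) ?_ ?_) ?_
      · exact hb.comp (f := fun r : I × closedBall (0 : Fin n → ℝ) 1 =>
          ((r.2 : Fin n → ℝ), r.1)) (by fun_prop) fun r hr => ⟨(hbd _).1 hr.2, mem_univ _⟩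
      · intro y hy
        exact (hbR _ ((hbd _).1 hy) (hmem _ y.2)).1
      rintro K ⟨hK0, hKb⟩
      -- the deformation runs until a collar of the boundary is mapped like the boundary itself
      obtain ⟨G, hG0, hGb, hG1⟩ := c.exists_concat_rel K (K.comp ⟨fun r => (1, r.2), by fun_prop⟩)
        (fun y => rfl) (fun t y hy => rfl)
      let cc : (Fin n → ℝ) → I := fun y => projIcc 0 1 zero_le_one (2 - 2 * ‖y‖)
      have hcc : Continuous cc := by fun_prop
      refine ⟨fun y s => ((G (s, c.ret y)).1, (G (s, c.ret y)).2 ⊔ cc y), ?_, fun y hy => ?_,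
        fun y hy hx => ?_⟩
      · have hGc : Continuous fun q : (Fin n → ℝ) × I => (G (q.2, c.ret q.1) : skLT X m × I) :=
          G.continuous.comp (by fun_prop)
        exact (hGc.fst.prodMk (hGc.snd.sup (hcc.comp continuous_fst))).continuousOn
      · ext1 s
        have hcy : cc y = 0 := projIcc_of_le_left zero_le_one (by
          rw [mem_sphere_zero_iff_norm.1 hy]; norm_num)
        simp only [hret y (sphere_subset_closedBall hy), hcy]
        rw [hGb _ _ ((hbd _).2 hy), hKb _ _ ((hbd _).2 hy)]
        exact Prod.ext rfl (max_eq_left unitInterval.nonneg')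
      · simp only [hret y hy]
        refine ⟨?_, fun h1 => ?_, fun h s => ?_⟩
        · rw [hG0, hK0]
          exact Prod.ext rfl (max_eq_left unitInterval.le_one')
        · have h2 : cc y < 1 := (max_lt_iff.1 h1).2
          have h3 : (G (1, ⟨y, hy⟩)).2 < 1 := (max_lt_iff.1 h1).1
          have hy2 : 1 ≤ 2 * ‖c.emb ⟨y, hy⟩‖ := by
            by_contra hlt
            rw [hemb] at hlt
            exact h2.ne (projIcc_of_right_le zero_le_one (by linarith))
          have hs : c.scl (2, ⟨y, hy⟩) ∈ c.bd := c.scl_mem_bd (by norm_num) hy2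
          have h4 : G (1, ⟨y, hy⟩) = b (c.scl (2, ⟨y, hy⟩) : Fin n → ℝ) 1 :=
            (hG1 _).trans (hKb 1 _ hs)
          rw [h4] at h3 ⊢
          exact (hbR _ ((hbd _).1 hs) (hmem _ (c.scl (2, ⟨y, hy⟩)).2)).2.1 h3
        · have hys : y ∈ Metric.sphere (0 : Fin n → ℝ) 1 := by
            rw [← sphere_union_ball] at hy
            exact hy.resolve_right fun hy => hnot y hy h
          have hcy : cc y = 0 := projIcc_of_le_left zero_le_one (by
            rw [mem_sphere_zero_iff_norm.1 hys]; norm_num)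
          have h5 := (hbR y hys hx).2.2 h s
          rw [hGb _ _ ((hbd _).2 hys), hKb _ _ ((hbd _).2 hys), hcy, h5]
          exact Prod.ext rfl (max_eq_left unitInterval.nonneg')
  · rintro g ⟨hg, -, hgR⟩
    have hgc : Continuous fun q : I × skLT X m => g q.2 q.1 :=
      hg.comp_continuous (f := fun q : I × skLT X m => ((q.2 : X), q.1)) (by fun_prop)
        fun q => ⟨q.2.2, mem_univ _⟩
    refine ⟨⟨fun z => (g z 1).2, ?_⟩, ⟨fun q => (g q.2 q.1).1, hgc.fst⟩, fun z => ?_, fun s => ?_,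
      ?_, fun z hz => ?_⟩
    · exact (hgc.comp (f := fun z : skLT X m => ((1 : I), z)) (by fun_prop)).snd
    · exact congrArg Prod.fst (hgR z z.2 z.2).1
    · exact congrArg Prod.fst ((hgR x0 hm0 hm0).2.2 rfl s)
    · exact (congrArg Prod.snd ((hgR x0 hm0 hm0).2.2 rfl 1)).trans (by simp)
    · exact (hgR z z.2 z.2).2.1 hz

section

/-! ### Detecting homology classes after suspension -/

variable {h : TopPair.HomologyPretheory.{u} AddCommGrpCat.{w} (ComplexShape.down ℤ)}

lemma ptMap_eq_of_htpy (hh : IsGeneralizedHomologyTheory h) (k : ℤ) {Z W : PtdSpace.{u}}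
    {f g : PtdMap Z W} (hfg : f.Htpy g) : ptMap h k f = ptMap h k g := by
  obtain ⟨H, h0, h1, -⟩ := hfg
  exact mapH_eq_of_homotopy hh k H _ _ h0 h1

lemma ptMap_comp (k : ℤ) {Z W V : PtdSpace.{u}} (g : PtdMap W V) (f : PtdMap Z W) (a : Grp h k Z) :
    ptMap h k (g.comp f) a = ptMap h k g (ptMap h k f a) :=
  mapH_comp k f.toMap g.toMap a

lemma PtdSpace.IsWellPointed.iterSusp {Z : PtdSpace.{u}} (hZ : Z.IsWellPointed) (n : ℕ) :
    (iterSusp Z n).IsWellPointed := by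
  induction n with
  | zero => exact hZ
  | succ n ih => exact ih.susp

/-- A reduced class has an iterated suspension, which detects whether the class is killed by a
pointed map. -/
lemma exists_iterSusp_class (hh : IsGeneralizedHomologyTheory h) {k : ℤ} {Z : PtdSpace.{u}}
    {a : Grp h k Z} (ha : IsReduced h a) (n : ℕ) :
    ∃ (l : ℤ) (c : Grp h l (iterSusp Z n)), IsReduced h c ∧
      (∀ (W : PtdSpace.{u}) (f : PtdMap Z W), ptMap h k f a = 0 →
        ptMap h l (iterSuspMap f n) c = 0) ∧
      ∀ (W : PtdSpace.{u}) (f : PtdMap Z W), W.IsWellPointed →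
        ptMap h l (iterSuspMap f n) c = 0 → ptMap h k f a = 0 := by
  induction n with
  | zero => exact ⟨k, a, ha, fun _ _ h => h, fun _ _ _ h => h⟩
  | succ n ih =>
    obtain ⟨l, c, hc, h1, h2⟩ := ih
    obtain ⟨c', hc'⟩ := exists_suspRel hh c
    refine ⟨l + 1, c', hc'.1, fun W f hf => ?_, fun W f hW hf => h2 W f hW ?_⟩
    · have := hc'.map (iterSuspMap f n)
      rw [h1 W f hf] at this
      exact this.eq_zero hh
    · have h3 := hc'.map (iterSuspMap f n)
      have h4 : ptMap h (l + 1) (suspMap (iterSuspMap f n)) c' = 0 := hf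
      rw [h4] at h3
      exact h3.eq_zero_of_isReduced hh (hW.iterSusp n) (hc.map _)

/-! ### Factorizations through wedges of spheres -/

/-- If a stable map of a finite complex corresponds to a map that factors through a finite complex,
then it factors through this complex stably. -/
lemma Spectrum.Correspondence.exists_factorization {E F : Spectrum.{u}} (R : Correspondence E F)
    {A V : PtdSpace.{u}} (hA : A.IsFiniteCW) (hV : V.IsFiniteCW) {n m : ℕ} (hm : n ≤ m)
    {u : Map A E n} {i : Map V F m} {g : Map A (suspensionSpectrum V) m}
    (hR : R.rel A m (u.stTo hm) (i.comp g)) :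
    ∃ l, ∃ hl : n ≤ l, ∃ (ψ : Map V E l) (g' : Map A (suspensionSpectrum V) l),
      PtdMap.Htpy (ψ.comp g') (u.stTo hl) := by
  obtain ⟨m', hm', ψ, hψ⟩ := R.total' hV i
  have h1 := R.comp hψ (g.stTo hm')
  have h2 := Map.sEq_stTo (E := F) hm' (i.comp g)
  rw [Map.stTo_comp] at h2
  obtain ⟨l, hl, hl', H⟩ := R.unique' hA h1 hR h2.symm
  rw [Map.stTo_comp, Map.stTo_stTo hm hl' u] at H
  exact ⟨l, _, _, _, H⟩

/-- A map from a finite complex to a space that is stably a wedge of spheres factors, after some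
suspensions, through a wedge of spheres. -/
lemma exists_stable_factorization {A B : PtdSpace.{u}} (hA : A.IsFiniteCW)
    [∀ n, CompactSpace (iterSusp A n)] (hB : HasStableTypeOfWedgeOfSpheres B) (b : PtdMap A B) :
    ∃ (K : Type u) (d : K → ℕ) (l : ℕ) (φ : PtdMap (iterSusp A l) (iterSusp (sphereWedge d) l))
      (ψ : PtdMap (iterSusp (sphereWedge d) l) (iterSusp B l)),
      (ψ.comp φ).Htpy (iterSuspMap b l) := by
  obtain ⟨J, n, hJ⟩ := hB
  obtain ⟨R⟩ := hJ.nonempty_correspondence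
  obtain ⟨m, hm, φ, hφ⟩ := R.total (n := 0) hA b
  -- Only finite wedges are finite complexes, to which the correspondence applies.
  obtain ⟨s, hs, i, g, rfl⟩ := exists_factor_finite_wedge n (A := iterSusp A m) (N := m) φ
  obtain ⟨l, hl, ψ, g', H⟩ :=
    R.exists_factorization hA (sphereWedge_isFiniteCW fun j : s => n j) hm hφ
  have e1 : Spectrum.Map.stTo (E := suspensionSpectrum B) hl b = iterSuspMap b l :=
    Spectrum.Map.stTo_iterSuspMap (Nat.zero_le l) b
  rw [e1] at H
  exact ⟨s, fun j => n j, l, g', ψ, H⟩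

/-- If a suspension of a CW complex is a homotopy retract of the suspension of a wedge of spheres,
then the inclusion of the `m`-skeleton in the `(m + 1)`-skeleton factors, after suspension, through
the whole complex up to homotopy. -/
lemma exists_iterSuspMap_skPtStep_factorization {X : Type u} [TopologicalSpace X] [T2Space X]
    [CWComplex (Set.univ : Set X)] (x0 : X) (hx0 : x0 ∈ skLT X 1) {K : Type u} (d : K → ℕ) (l : ℕ)
    (φ : PtdMap (iterSusp ⟨X, x0⟩ l) (iterSusp (sphereWedge d) l))
    (ψ : PtdMap (iterSusp (sphereWedge d) l) (iterSusp ⟨X, x0⟩ l))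
    (hψφ : (ψ.comp φ).Htpy (PtdMap.id _)) (m : ℕ) :
    ∃ r : PtdMap (iterSusp ⟨X, x0⟩ l) (iterSusp (skPt X x0 hx0 m) l),
      (iterSuspMap (skPtStep X x0 hx0 m) l).Htpy
        (((iterSuspMap (skPtStep X x0 hx0 m) l).comp r).comp
          (iterSuspMap (skPtIncl X x0 hx0 m) l)) := by
  have hv := sphereWedge_pt_mem_skLT d (N := 1) (by norm_num)
  let i := iterSuspMap (skPtIncl X x0 hx0 m) l
  let ι := iterSuspMap (skPtIncl (sphereWedge d) (sphereWedge d).pt hv m) l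
  obtain ⟨e, he⟩ := exists_retraction_skPt d hv m
  obtain ⟨g, hg⟩ := exists_htpy_skPtIncl_comp x0 hx0 (sphereWedge d).pt hv l m (φ.comp i)
  obtain ⟨χ, hχ⟩ := exists_htpy_skPtIncl_comp (sphereWedge d).pt hv x0 hx0 l m (ψ.comp ι)
  have he' : (iterSuspMap e l).comp ι = PtdMap.id _ :=
    (iterSuspMap_comp e _ l).symm.trans ((congrArg (iterSuspMap · l) he).trans (iterSuspMap_id _ l))
  let r := χ.comp ((iterSuspMap e l).comp φ)
  refine ⟨r, htpy_skPtStep_comp x0 hx0 x0 hx0 l m (PtdMap.id _) (r.comp i) (PtdMap.Htpy.symm ?_)⟩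
  -- `i r i = i χ e φ i ≃ i χ e ι g = i χ g ≃ ψ ι g ≃ ψ φ i ≃ i`
  have h1 : (i.comp (r.comp i)).Htpy (((i.comp χ).comp (iterSuspMap e l)).comp (ι.comp g)) :=
    hg.comp_left ((i.comp χ).comp (iterSuspMap e l))
  have h2 : ((i.comp χ).comp (iterSuspMap e l)).comp (ι.comp g) = (i.comp χ).comp g :=
    congrArg (fun f : PtdMap _ _ => (i.comp χ).comp (f.comp g)) he'
  rw [h2] at h1
  have h3 : ((i.comp χ).comp g).Htpy ((ψ.comp ι).comp g) := hχ.symm.comp_right g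
  have h4 : ((ψ.comp ι).comp g).Htpy (ψ.comp (φ.comp i)) := hg.symm.comp_left ψ
  have h5 : (ψ.comp (φ.comp i)).Htpy (i.comp (PtdMap.id _)) := hψφ.comp_right i
  exact ((h1.trans h3).trans h4).trans h5

/-- The kernels agree as soon as the inclusion of the `m`-skeleton in the `(m + 1)`-skeleton
factors, after suspension, through the whole complex. -/
lemma ker_skelStep_eq_ker_skelIncl (hh : IsGeneralizedHomologyTheory h) {X : Type u}
    [TopologicalSpace X] [T2Space X] [CWComplex (Set.univ : Set X)] (x0 : X)
    (hx0 : x0 ∈ skLT X 1) {m l : ℕ} (k : ℤ)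
    (r : PtdMap (iterSusp ⟨X, x0⟩ l) (iterSusp (skPt X x0 hx0 m) l))
    (hr : (iterSuspMap (skPtStep X x0 hx0 m) l).Htpy
      (((iterSuspMap (skPtStep X x0 hx0 m) l).comp r).comp (iterSuspMap (skPtIncl X x0 hx0 m) l))) :
    ((h.H k).map (skelStep X m)).hom.ker = ((h.H k).map (skelIncl X m)).hom.ker := by
  refine le_antisymm (fun a ha => ?_) fun a ha => ?_
  · have h1 := ptMap_comp k (skPtIncl X x0 hx0 (m + 1)) (skPtStep X x0 hx0 m) a
    have ha : ptMap h k (skPtStep X x0 hx0 m) a = 0 := ha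
    rw [ha, map_zero] at h1
    exact h1
  · have ha : ptMap h k (skPtIncl X x0 hx0 m) a = 0 := ha
    have hred : IsReduced h (Z := skPt X x0 hx0 m) a := by
      have h1 := mapH_const_comp k (skPtIncl X x0 hx0 m).toMap (skPt X x0 hx0 m).pt a
      rw [ha, map_zero] at h1
      exact h1.symm
    obtain ⟨n, c, -, h1, h2⟩ := exists_iterSusp_class hh hred l
    refine h2 _ (skPtStep X x0 hx0 m) (isWellPointed_skPt x0 hx0 _) ?_
    rw [ptMap_eq_of_htpy hh n hr, ptMap_comp, h1 _ _ ha, map_zero]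

lemma exists_mem_skLT_one (X : Type u) [TopologicalSpace X] [T2Space X]
    [CWComplex (Set.univ : Set X)] [Nonempty X] : ∃ x : X, x ∈ skLT X 1 := by
  classical
  have hex : ∃ n, Nonempty (Cell X n) := by
    obtain ⟨x⟩ := ‹Nonempty X›
    obtain ⟨n, e, -⟩ := exists_chi x
    exact ⟨n, ⟨e⟩⟩
  obtain ⟨e⟩ := Nat.find_spec hex
  rcases Nat.eq_zero_or_pos (Nat.find hex) with h0 | h0
  · refine ⟨_, chi_mem_skLT_of_lt (N := 1) ?_ e (mem_closedBall_self zero_le_one)⟩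
    rw [h0]
    norm_num
  · -- the boundary of a cell of minimal dimension lies in the union of cells of lower dimension
    have : Nonempty (Fin (Nat.find hex)) := ⟨⟨0, h0⟩⟩
    obtain ⟨y, hy⟩ := (NormedSpace.sphere_nonempty (E := Fin (Nat.find hex) → ℝ)
      (x := 0) (r := 1)).2 zero_le_one
    obtain ⟨n, hn, e', -⟩ := exists_chi_of_mem_skLT (chi_sphere_mem e hy)
    exact absurd ⟨e'⟩ (Nat.find_min hex (by exact_mod_cast hn))

lemma compactSpace_of_finite (X : Type u) [TopologicalSpace X] [T2Space X]
    [CWComplex (Set.univ : Set X)] [RelCWComplex.Finite (Set.univ : Set X)] : CompactSpace X := by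
  have := RelCWComplex.finite_cells_of_finite (C := (Set.univ : Set X))
  refine ⟨(isCompact_iUnion fun c : Σ n, Cell X n =>
    RelCWComplex.isCompact_closedCell (n := c.1) (i := c.2)).of_isClosed_subset isClosed_univ
      fun x _ => ?_⟩
  obtain ⟨n, e, y, hy, rfl⟩ := exists_chi x
  exact mem_iUnion.2 ⟨⟨n, e⟩, mem_image_of_mem _ (ball_subset_closedBall hy)⟩

lemma compactSpace_iterSusp (A : PtdSpace.{u}) [CompactSpace A] (n : ℕ) :
    CompactSpace (iterSusp A n) := by
  induction n with
  | zero => assumption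
  | succ n ih => exact Quotient.compactSpace

end

end OneStep

end

theorem mainTheorem7 (Γ : Type v) [Group Γ]
    (hfin : OneStep.GeometricallyFinite.{u, v} Γ)
    (hstar : OneStep.StableWedgeProperty.{u, v} Γ)
    (h : TopPair.HomologyPretheory.{u} AddCommGrpCat.{w} (ComplexShape.down ℤ))
    (hh : OneStep.IsGeneralizedHomologyTheory h) :
    OneStep.GroupOneStepStabilization h Γ := by
  open OneStep in
  intro X _ _ _ hX m k
  obtain ⟨X0, _, _, _, hX0f, hX0⟩ := hfin
  obtain ⟨X1, _, _, _, x1, hX1, hx1, hw⟩ := hstar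
  have := hX.pathConnected.nonempty
  have := hX0.pathConnected.nonempty
  obtain ⟨x, hx⟩ := exists_mem_skLT_one X
  obtain ⟨x0, hx0⟩ := exists_mem_skLT_one X0
  have hx1' : x1 ∈ skLT X1 1 := by
    have h1 : x1 ∈ skLT X1 (0 + 1) := hx1
    rwa [zero_add] at h1
  have hA : PtdSpace.IsFiniteCW ⟨X0, x0⟩ := ⟨‹_›, ‹_›, hX0f, hx0⟩
  have hc : CompactSpace X0 := compactSpace_of_finite X0
  have hc' : ∀ n, CompactSpace (iterSusp ⟨X0, x0⟩ n) := fun n =>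
    have : CompactSpace (⟨X0, x0⟩ : PtdSpace.{u}) := hc
    compactSpace_iterSusp _ n
  -- `X` is a homotopy retract of the finite complex `X0`, and the map from `X0` to `X1` factors
  -- stably through a wedge of spheres
  obtain ⟨a, a', ha⟩ := hX.exists_htpy_id hX0 hx hx0
  obtain ⟨b, b', hb⟩ := hX0.exists_htpy_id hX1 hx0 hx1'
  obtain ⟨K, d, l, φ, ψ, hφψ⟩ := exists_stable_factorization hA hw b
  obtain ⟨r, hr⟩ := exists_iterSuspMap_skPtStep_factorization x hx d l
    (φ.comp (iterSuspMap a l)) ((iterSuspMap (a'.comp b') l).comp ψ) (by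
      have h1 : ((iterSuspMap (a'.comp b') l).comp (ψ.comp φ)).Htpy
        ((iterSuspMap (a'.comp b') l).comp (iterSuspMap b l)) := hφψ.comp_left _
      have h2 : ((a'.comp (b'.comp b)).comp a).Htpy (PtdMap.id _) :=
        ((hb.comp_left a').comp_right a).trans ha
      have h3 := h2.iterSuspMap l
      rw [iterSuspMap_id, iterSuspMap_comp] at h3
      have h4 := h1.comp_right (iterSuspMap a l)
      rw [← iterSuspMap_comp] at h4
      exact h4.trans h3) m
  exact ker_skelStep_eq_ker_skelIncl hh x hx k r hr
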